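/- **Theorem (Existence of the minimizer).** Let $d\ge 1$, $\mathbb T=\mathbb R/\mathbb Z$ and $\Omega_d=\mathbb R\times\mathbb T^{d-1}$, with points $w=(x,y)$. Let $H:\mathbb R^d\to\mathbb R$ be positive and continuous on $\mathbb R^d\setminus\{0\}$, even, and homogeneous of degree $-(d+1)$, i.e. $H(az)=a^{-d-1}H(z)$ for $z\ne0$, $a>0$. Put $K(x,y)=\sum_{j\in\mathbb Z^{d-1}}H(x,y+j)$ and $$(\mathcal L u)(w)=\mathrm{P.V.}\int_{\Omega_d}(u(w)-u(w'))\,K(w-w')\,dw' .$$ Let $\gamma\in C^2(\mathbb R)$ be a double-well potential: $\gamma\ge 0$ on $\mathbb R$, $\gamma>0$ on $(-1,1)$, $\gamma(\pm1)=0$, $\gamma''(\pm1)>0$. Let $\eta\in C^\infty(\mathbb R)$ with $\eta=1$ on $[1,\infty)$ and $\eta=-1$ on $(-\infty,-1]$, and write $\eta(x,y)=\eta(x)$. For $s>0$ let $H^s(\Omega_d)=\{v\in L^2(\Omega_d):|\nu|^s\hat v(\nu)\in L^2(\mathbb R\times\mathbb Z^{d-1})\}$, where $\hat v$ is the Fourier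 transform in $x$ and Fourier series in $y$. Let $\mathcal A=\{u:\Omega_d\to\mathbb R : u-\eta\in H^{1/2}(\Omega_d)\}$ and $$F(u)=\frac14\int_{\Omega_d}\int_{\Omega_d}\big(|u(w)-u(w')|^2-|\eta(w)-\eta(w')|^2\big)K(w-w')\,dw\,dw'+\int_{\Omega_d}\gamma(u)\,dw .$$ For every $u\in\mathcal A$ the double integral converges absolutely, so that $F(u)\in(-\infty,+\infty]$ is well defined. Moreover there exists $u^*\in\mathcal A$ such that: 1. (existence) $F(u^*)=\min_{u\in\mathcal A}F(u)$, and $u^*$ is a weak solution of $\mathcal L u+\gamma'(u)=0$ in $\Omega_d$, i.e. for every $\varphi\in C_c^\infty(\Omega_d)$, $$\frac12\int_{\Omega_d}\int_{\Omega_d}(u^*(w)-u^*(w'))(\varphi(w)-\varphi(w'))K(w-w')\,dw\,dw'+\int_{\Omega_d}\gamma'(u^*)\varphi\,dw=0,$$ both integrals being absolutely convergent; 2. (regularity) $u^*-\eta\in H^2(\Omega_d)$; $u^*$ solves the equation in the $L^2$ sense, i.e. $\gamma'(u^*)\in L^2(\Omega_d)$ and, for almost every $w$, the principal value $(\mathcal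 Lu^*)(w)$ exists and equals $-\gamma'(u^*(w))$; and $u^*(x,y)\to\pm1$ as $x\to\pm\infty$, uniformly in $y$; 3. (monotonicity) $\partial_x u^*(x,y)>0$ for every $(x,y)\in\Omega_d$, so $u^*$ is strictly increasing in $x$; 4. (symmetry) $u^*(x,y)=u^*(x)$ depends on $x$ only, so $\nabla_y u^*\equiv 0$. -/

import Mathlib

open MeasureTheory Filter Topology
open scoped FourierTransform ENNReal ContDiff

noncomputable section

namespace PeierlsNabarro

/-- The partially periodic domain `Ω_d = ℝ × 𝕋^{d-1}` of dimension `d = n + 1`,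
with `𝕋 = ℝ/ℤ`; it carries the product of Lebesgue measure on `ℝ` and of the Haar probability
measure on the torus. -/
abbrev Cyl (n : ℕ) : Type := ℝ × UnitAddTorus (Fin n)

/-- Assumptions on the kernel `H : ℝ^d → ℝ`, `d = n + 1`, away from the origin: positive,
continuous, homogeneous of degree `-(d+1)`, and even. -/
structure IsKernel {n : ℕ} (H : ℝ × (Fin n → ℝ) → ℝ) : Prop where
  pos : ∀ z, z ≠ 0 → 0 < H z
  cont : ContinuousOn H {0}ᶜ
  homog : ∀ z, z ≠ 0 → ∀ a : ℝ, 0 < a → H (a • z) = (a ^ (n + 2))⁻¹ * H z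
  symm : ∀ z, H (-z) = H z

/-- The double-well condition on a `C²` potential: `γ ≥ 0`, `γ > 0` in `(-1,1)`, and `±1` are
nondegenerate zeros. -/
structure IsDoubleWell (γ : ℝ → ℝ) : Prop where
  contDiff : ContDiff ℝ 2 γ
  nonneg : ∀ s, 0 ≤ γ s
  pos : ∀ s, -1 < s → s < 1 → 0 < γ s
  zero_one : γ 1 = 0
  zero_neg_one : γ (-1) = 0
  second_one : 0 < deriv (deriv γ) 1
  second_neg_one : 0 < deriv (deriv γ) (-1)

/-- A smooth transition profile from `-1` to `1`. -/
structure IsProfile (η : ℝ → ℝ) : Prop where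
  smooth : ContDiff ℝ ∞ η
  eq_one : ∀ x, 1 ≤ x → η x = 1
  eq_neg_one : ∀ x, x ≤ -1 → η x = -1

/-- The representative in `[0,1)` of a point of `ℝ/ℤ`. -/
def rep (t : UnitAddCircle) : ℝ := (AddCircle.equivIco (1 : ℝ) 0 t : ℝ)

/-- The periodized kernel `K(x,y) = ∑_{j ∈ ℤ^{d-1}} H(x, y + j)` on `Ω_d`. -/
def kernel {n : ℕ} (H : ℝ × (Fin n → ℝ) → ℝ) (w : Cyl n) : ℝ :=
  ∑' j : Fin n → ℤ, H (w.1, fun i => rep (w.2 i) + (j i : ℝ))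

/-- The periodized kernel can be computed from any representative of the torus variable. -/
theorem kernel_coe {n : ℕ} (H : ℝ × (Fin n → ℝ) → ℝ) (x : ℝ) (y : Fin n → ℝ) :
    kernel H (x, fun i => (y i : UnitAddCircle)) =
      ∑' j : Fin n → ℤ, H (x, fun i => y i + (j i : ℝ)) := by
  have hrep : ∀ t : ℝ, ∃ m : ℤ, rep (t : UnitAddCircle) = t + m := by
    intro t
    refine ⟨-toIcoDiv (zero_lt_one' ℝ) 0 t, ?_⟩
    have h : rep (t : UnitAddCircle) = toIcoMod (zero_lt_one' ℝ) 0 t := rfl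
    rw [h, toIcoMod]
    simp [sub_eq_add_neg]
  choose m hm using hrep
  unfold kernel
  rw [← (Equiv.addLeft (fun i => m (y i))).tsum_eq
    (fun j : Fin n → ℤ => H (x, fun i => y i + (j i : ℝ)))]
  refine tsum_congr fun j => ?_
  simp only [hm, Equiv.coe_addLeft, Pi.add_apply, Int.cast_add, add_assoc]

/-- The `k`-th Fourier coefficient in the periodic variable,
`x ↦ ∫_{𝕋^{d-1}} e^{-2πi k·y} v(x,y) dy`. -/
def fourierMode {n : ℕ} (v : Cyl n → ℝ) (k : Fin n → ℤ) (x : ℝ) : ℂ :=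
  ∫ y : UnitAddTorus (Fin n), UnitAddTorus.mFourier (-k) y * (v (x, y) : ℂ)

/-- The Sobolev space `H^s(Ω_d)`, `s > 0`, defined on the Fourier side:
`v ∈ L²` and `|ν|^s v̂(ν) ∈ L²(ℝ × ℤ^{d-1})`, where `ν = (ξ,k)` and
`v̂(·,k)` is the (`L²`-) Fourier transform of the `k`-th Fourier coefficient of `v`. The existence
of `h` holds for every `v ∈ L²`; it only serves to speak of that transform. -/
def MemHs {n : ℕ} (s : ℝ) (v : Cyl n → ℝ) : Prop :=
  MemLp v 2 volume ∧
  ∃ h : ∀ k : Fin n → ℤ, MemLp (fourierMode v k) 2 (volume : Measure ℝ),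
    ∑' k : Fin n → ℤ, ∫⁻ ξ : ℝ,
      ENNReal.ofReal ((ξ ^ 2 + ∑ i, (k i : ℝ) ^ 2) ^ s * ‖(𝓕 ((h k).toLp) : Lp ℂ 2 (volume : Measure ℝ)) ξ‖ ^ 2) < ⊤

/-- The class `𝒜` of `H^{1/2}` perturbations of the profile `η`. -/
def admissible {n : ℕ} (η : ℝ → ℝ) : Set (Cyl n → ℝ) :=
  {u | MemHs (1 / 2) (fun w => u w - η w.1)}

/-- The renormalized interaction density
`(|u(w) - u(w')|² - |η(w) - η(w')|²) K(w - w')`. -/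
def density {n : ℕ} (H : ℝ × (Fin n → ℝ) → ℝ) (η : ℝ → ℝ) (u : Cyl n → ℝ)
    (p : Cyl n × Cyl n) : ℝ :=
  ((u p.1 - u p.2) ^ 2 - (η p.1.1 - η p.2.1) ^ 2) * kernel H (p.1 - p.2)

/-- The energy, with values in `(-∞, +∞]`: the potential term of the nonnegative `γ` is a Lebesgue
integral in `[0, +∞]`. The constant `1/4` makes `𝓛u + γ'(u) = 0` the Euler–Lagrange equation. -/
def energy {n : ℕ} (H : ℝ × (Fin n → ℝ) → ℝ) (γ η : ℝ → ℝ) (u : Cyl n → ℝ) : EReal :=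
  ((1 / 4 * ∫ p : Cyl n × Cyl n, density H η u p : ℝ) : EReal) +
    ((∫⁻ w : Cyl n, ENNReal.ofReal (γ (u w)) : ℝ≥0∞) : EReal)

/-- The square of the Euclidean (flat) distance on `ℝ × 𝕋^{d-1}`. -/
def sqDist {n : ℕ} (w w' : Cyl n) : ℝ :=
  (w.1 - w'.1) ^ 2 + ∑ i, ‖w.2 i - w'.2 i‖ ^ 2

/-- `(𝓛u)(w)` exists as a principal value integral and equals `ℓ`, where
`(𝓛u)(w) = P.V. ∫ (u(w) - u(w')) K(w - w') dw'`. -/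
def HasPVAt {n : ℕ} (H : ℝ × (Fin n → ℝ) → ℝ) (u : Cyl n → ℝ) (w : Cyl n) (ℓ : ℝ) : Prop :=
  (∀ ε : ℝ, 0 < ε →
    IntegrableOn (fun w' => (u w - u w') * kernel H (w - w')) {w' | ε ^ 2 < sqDist w w'}) ∧
  Tendsto (fun ε : ℝ => ∫ w' in {w' | ε ^ 2 < sqDist w w'}, (u w - u w') * kernel H (w - w'))
    (𝓝[>] 0) (𝓝 ℓ)

/-- Test functions on `Ω_d`: smooth (as functions that are `1`-periodic in `y`) with compact
support. -/
structure IsTest {n : ℕ} (φ : Cyl n → ℝ) : Prop where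
  smooth : ContDiff ℝ ∞ (fun z : ℝ × (Fin n → ℝ) => φ (z.1, fun i => (z.2 i : UnitAddCircle)))
  compact : HasCompactSupport φ

/-- Weak solutions of `𝓛u + γ'(u) = 0`: for every test function `φ`,
`½ ∬ (u(w)-u(w'))(φ(w)-φ(w')) K(w-w') + ∫ γ'(u) φ = 0`, both integrals being
absolutely convergent. -/
def IsWeakSolution {n : ℕ} (H : ℝ × (Fin n → ℝ) → ℝ) (γ : ℝ → ℝ) (u : Cyl n → ℝ) : Prop :=
  ∀ φ : Cyl n → ℝ, IsTest φ →
    Integrable (fun p : Cyl n × Cyl n =>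
      (u p.1 - u p.2) * (φ p.1 - φ p.2) * kernel H (p.1 - p.2)) ∧
    Integrable (fun w => deriv γ (u w) * φ w) ∧
    1 / 2 * (∫ p : Cyl n × Cyl n, (u p.1 - u p.2) * (φ p.1 - φ p.2) * kernel H (p.1 - p.2)) +
      ∫ w, deriv γ (u w) * φ w = 0

/-- `𝓛u + γ'(u) = 0` in the `L²` sense: `γ'(u) ∈ L²`, and `𝓛u` exists and equals `-γ'(u)`
almost everywhere. -/
def IsL2Solution {n : ℕ} (H : ℝ × (Fin n → ℝ) → ℝ) (γ : ℝ → ℝ) (u : Cyl n → ℝ) : Prop :=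
  MemLp (fun w => deriv γ (u w)) 2 volume ∧ ∀ᵐ w, HasPVAt H u w (-deriv γ (u w))

end PeierlsNabarro

end

noncomputable section

namespace PeierlsNabarro

/-! ### Kernel measures on the cover, on the cylinder and on the line -/

section

variable {n : ℕ}

/-! In the variables (w, z) with z = w - w' the interaction energy is the integral over z, against
K(z)dz, of ‖u - u(·-z)‖² - ‖η - η(·-z)‖². So the energy sees u only through the squared norms of its
increments (`shiftSq`) and through the distribution of its values. Writing u = η + v turns the
interaction into the Gagliardo energy of v plus a linear term, 4 times the pairing of v with Lη; Lη
is O(1/|x|), hence in L², so everything converges for v in L² of finite Gagliardo energy (`GAdm`).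
This class contains 𝒜 by Plancherel, because the symbol of K is at most C|ν| (`symbol_bound`,
`gag_lt_top_of_memHs`). Minimization is carried out in it, and regularity returns the minimizer to
𝒜.

Symmetry comes from rearrangement. Replace u by the increasing function of x whose sublevel sets are
half cylinders of the same renormalized volume, translated so that the sign changes at x = 0. Values
strictly between the wells keep their distribution, values ±1 cost nothing, so the potential term
does not grow. A layer-cake formula reduces the comparison of increments to the volume of {u(w-z) ≤
s < t < u(w)}, which is at least z₁ - |{s < u ≤ t}| for any u, and equals the positive part of this
number for a layer (`shiftSq_rearr_le`). Hence it suffices to minimize among monotone φ(x). There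
the fixed sign on each side of 0 removes the translations and makes the potential control (φ - η)²;
Helly selection and Fatou then give a minimizer (`exists_minimizer`).

The first variation (`euler_lagrange`) is taken along bounded perturbations. For functions of x
alone only the marginal of K matters, and by homogeneity it is c/x² (`IsKernel.map_fst`), whose
Fourier symbol is λ|ξ| with λ > 0. The equation becomes λ|ξ|v̂ = ĝ with g = -(γ'(φ) + Lη) in L²
(`symb_mul_ft_eq`). It is used twice: g in L² gives v in H¹, then γ'(φ) and Lη have L² increments of
size O(h), so g is in H¹ and v in H² (`IsMinimizer.lintegral_ft_lt_top`). Since (1+|ξ|)v̂ is then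
integrable, Fourier inversion provides a differentiable representative with the limits ±1.

For strict monotonicity, δ = φ(·+t) - φ is nonnegative and (M + L)δ = f ≥ 0, where M is a Lipschitz
constant of γ' on [-1,1]. Duhamel's formula for the positive Poisson semigroup gives δ ≥ e^{-M}
times a Poisson average of δ (`poisson_le_of_supersolution`). As φ rises from -1 to 1, the integral
of δ over a fixed interval is at least t/2, so δ(x) ≥ κt with κ > 0 independent of t, and φ'(x) ≥ κ.

Finally, K is even, so the truncated integrals in the principal value are half the integrals of
second differences, which Fourier inversion evaluates (`hasPVAt_lift`,
`integral_second_difference`). -/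

instance : (volume : Measure (UnitAddTorus (Fin n))).IsAddHaarMeasure :=
  inferInstanceAs ((Measure.pi fun _ : Fin n => (volume : Measure UnitAddCircle)).IsAddHaarMeasure)

instance : (volume : Measure (Fin n → ℝ)).IsAddHaarMeasure :=
  inferInstanceAs ((Measure.pi fun _ : Fin n => (volume : Measure ℝ)).IsAddHaarMeasure)

instance : (volume : Measure (ℝ × (Fin n → ℝ))).IsAddHaarMeasure :=
  inferInstanceAs ((volume.prod volume : Measure (ℝ × (Fin n → ℝ))).IsAddHaarMeasure)

instance : (volume : Measure (Cyl n)).IsAddHaarMeasure :=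
  inferInstanceAs ((volume.prod volume : Measure (ℝ × UnitAddTorus (Fin n))).IsAddHaarMeasure)

instance : (volume : Measure (Cyl n)).IsAddRightInvariant := inferInstance

instance : IsProbabilityMeasure (volume : Measure UnitAddCircle) :=
  ⟨by simp [AddCircle.measure_univ]⟩

instance : IsProbabilityMeasure (volume : Measure (UnitAddTorus (Fin n))) :=
  inferInstanceAs (IsProbabilityMeasure (Measure.pi fun _ : Fin n => (volume : Measure UnitAddCircle)))

instance : (volume : Measure UnitAddCircle).IsNegInvariant := inferInstance

instance : (volume : Measure (UnitAddTorus (Fin n))).IsNegInvariant :=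
  Measure.pi.isNegInvariant _

instance : (volume : Measure (Cyl n)).IsNegInvariant := by
  have h1 : MeasurePreserving (fun t : UnitAddTorus (Fin n) => -t) := Measure.measurePreserving_neg _
  have h2 : MeasurePreserving (fun w : ℝ × UnitAddTorus (Fin n) => (-w.1, -w.2))
    (volume.prod volume) (volume.prod volume) := (Measure.measurePreserving_neg volume).prod h1
  exact ⟨h2.map_eq⟩

/-- The covering map `ℝ × ℝⁿ → ℝ × 𝕋ⁿ`. -/
def proj (z : ℝ × (Fin n → ℝ)) : Cyl n := (z.1, fun i => (z.2 i : UnitAddCircle))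

lemma measurable_proj : Measurable (proj : ℝ × (Fin n → ℝ) → Cyl n) := by
  unfold proj
  refine measurable_fst.prodMk (measurable_pi_lambda _ fun i => ?_)
  exact AddCircle.measurable_mk'.comp ((measurable_pi_apply i).comp measurable_snd)

lemma measurable_rep : Measurable rep :=
  measurable_subtype_coe.comp (AddCircle.measurableEquivIco 1 0).measurable

lemma coe_rep (t : UnitAddCircle) : (rep t : UnitAddCircle) = t :=
  (AddCircle.equivIco (1 : ℝ) 0).symm_apply_apply t

/-- The measure `H(z) dz` on `ℝ × ℝⁿ`. -/
def kerMeas (H : ℝ × (Fin n → ℝ) → ℝ) : Measure (ℝ × (Fin n → ℝ)) :=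
  volume.withDensity fun z => ENNReal.ofReal (H z)

/-- The measure `K(w) dw` on the cylinder. -/
def cylMeas (H : ℝ × (Fin n → ℝ) → ℝ) : Measure (Cyl n) :=
  volume.withDensity fun w => ENNReal.ofReal (kernel H w)

/-- The measure `c x⁻² dx` on the line. -/
def lineMeas (c : ℝ) : Measure ℝ := volume.withDensity fun x => ENNReal.ofReal (c / x ^ 2)

/-- The mass `∫ H(1,y) dy`. -/
def kerConst (H : ℝ × (Fin n → ℝ) → ℝ) : ℝ := (∫⁻ y, ENNReal.ofReal (H (1, y))).toReal

instance (H : ℝ × (Fin n → ℝ) → ℝ) : SigmaFinite (cylMeas H) := SigmaFinite.withDensity_ofReal _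
instance (c : ℝ) : SigmaFinite (lineMeas c) := SigmaFinite.withDensity_ofReal _

namespace IsKernel

variable {H : ℝ × (Fin n → ℝ) → ℝ}

lemma measurable (hH : IsKernel H) : Measurable H := by
  refine measurable_of_measurable_on_compl_singleton 0 ?_
  exact (continuousOn_iff_continuous_domRestrict.1 hH.cont).measurable

/-- By homogeneity it is enough to bound H on the unit sphere, which is compact and avoids the
origin. The exponent n + 2 is d + 1. -/
lemma exists_bound (hH : IsKernel H) : ∃ C : ℝ, 0 < C ∧ ∀ z, z ≠ 0 → H z ≤ C * (‖z‖ ^ (n + 2))⁻¹ := by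
  have hc : IsCompact (Metric.sphere (0 : ℝ × (Fin n → ℝ)) 1) := isCompact_sphere _ _
  obtain ⟨C, hC⟩ := hc.bddAbove_image (hH.cont.mono (fun z hz => by
    simp only [Set.mem_compl_iff, Set.mem_singleton_iff]
    rintro rfl
    simp at hz))
  refine ⟨max C 1, by positivity, fun z hz => ?_⟩
  have hz' : 0 < ‖z‖ := norm_pos_iff.2 hz
  have h1 := hH.homog (‖z‖⁻¹ • z) (by simp [hz]) ‖z‖ hz'
  rw [smul_smul, mul_inv_cancel₀ hz'.ne', one_smul] at h1
  rw [h1, mul_comm]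
  gcongr
  refine le_trans (hC ⟨_, ?_, rfl⟩) (le_max_left _ _)
  simp [norm_smul, hz'.ne']

/-- The Lévy condition, on which the later integrability rests. In polar coordinates in dimension n
+ 1 the radial integrand is at most a multiple of min(1, r²)/r²: bounded near 0 and r⁻² at infinity.
-/
lemma lintegral_min_lt_top (hH : IsKernel H) :
    ∫⁻ z, ENNReal.ofReal (min 1 (‖z‖ ^ 2)) ∂kerMeas H < ⊤ := by
  obtain ⟨C, hC, hb⟩ := hH.exists_bound
  rw [kerMeas, lintegral_withDensity_eq_lintegral_mul _ hH.measurable.ennreal_ofReal (by fun_prop)]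
  have hint : Integrable (fun z : ℝ × (Fin n → ℝ) => min 1 (‖z‖ ^ 2) * (C * (‖z‖ ^ (n + 2))⁻¹)) := by
    have hd : Module.finrank ℝ (ℝ × (Fin n → ℝ)) = n + 1 := by simp [add_comm]
    rw [integrable_fun_norm_addHaar (volume : Measure (ℝ × (Fin n → ℝ)))
      (f := fun r : ℝ => min 1 (r ^ 2) * (C * (r ^ (n + 2))⁻¹)), hd]
    simp only [add_tsub_cancel_right, smul_eq_mul]
    have hpos : ∀ y : ℝ, 0 < y →
        y ^ n * (min 1 (y ^ 2) * (C * (y ^ (n + 2))⁻¹)) = min 1 (y ^ 2) * C * (y ^ 2)⁻¹ := by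
      intro y hy
      field_simp
      ring
    rw [← Set.Ioc_union_Ioi_eq_Ioi (zero_le_one' ℝ), integrableOn_union]
    constructor
    · refine Measure.integrableOn_of_bounded (M := C) (by simp) (by fun_prop) ?_
      filter_upwards [ae_restrict_mem measurableSet_Ioc] with y hy
      rw [hpos y hy.1, min_eq_right (by nlinarith [hy.1, hy.2])]
      have := hy.1
      rw [Real.norm_of_nonneg (by positivity)]
      field_simp
      rfl
    · have h2 : IntegrableOn (fun y : ℝ => C * y ^ (-2 : ℝ)) (Set.Ioi 1) :=
        (integrableOn_Ioi_rpow_of_lt (by norm_num) one_pos).const_mul C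
      refine h2.congr_fun (fun y hy => ?_) measurableSet_Ioi
      have hy' : (1 : ℝ) < y := hy
      simp only
      rw [hpos y (by linarith), min_eq_left (by nlinarith),
        Real.rpow_neg (by linarith)]
      norm_num
  refine lt_of_le_of_lt (lintegral_mono_ae ?_) hint.lintegral_lt_top
  have h0 : ∀ᵐ z : ℝ × (Fin n → ℝ), z ≠ 0 := by
    have : (volume : Measure (ℝ × (Fin n → ℝ))) {0} = 0 := by
      rw [show ({0} : Set (ℝ × (Fin n → ℝ))) = {0} ×ˢ {0} by ext; simp [Prod.ext_iff], Measure.volume_eq_prod,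
        Measure.prod_prod]
      simp
    exact compl_mem_ae_iff.2 this
  filter_upwards [h0] with z hz
  simp only [Pi.mul_apply]
  rw [← ENNReal.ofReal_mul (hH.pos z hz).le, mul_comm]
  exact ENNReal.ofReal_le_ofReal (mul_le_mul_of_nonneg_left (hb z hz) (by positivity))

lemma kernel_neg (hH : IsKernel H) (w : Cyl n) : kernel H (-w) = kernel H w := by
  obtain ⟨x, y⟩ := w
  have hy : y = fun i => ((rep (y i) : ℝ) : UnitAddCircle) := by ext i; exact (coe_rep _).symm
  set r : Fin n → ℝ := fun i => rep (y i)
  have hny : -y = fun i => ((-r i : ℝ) : UnitAddCircle) := by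
    rw [hy]; ext i; simp [r]
  rw [show -(x, y) = (-x, -y) from rfl, hny, kernel_coe, hy, kernel_coe]
  rw [← (Equiv.neg (Fin n → ℤ)).tsum_eq]
  refine tsum_congr fun j => ?_
  rw [← hH.symm]
  congr 1
  ext i
  · simp
  · simp; ring

end IsKernel

/-- The cubes are indexed by ⌈y⌉ - 1 and not by ⌊y⌋ because the fundamental domain of the torus in
use is (0,1]ⁿ. -/
lemma tsum_lintegral_floor_fiber (f : (Fin n → ℝ) → ℝ≥0∞) (hf : Measurable f) :
    ∫⁻ y, f y = ∑' j : Fin n → ℤ, 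
      ∫⁻ y in {y : Fin n → ℝ | ∀ i, y i ∈ Set.Ioc (0 : ℝ) (0 + 1)}, f (fun i => y i + (j i : ℝ)) := by
  have hm : Measurable (fun y : Fin n → ℝ => fun i => ⌈y i⌉ - 1) := by fun_prop
  have hd : (volume : Measure (Fin n → ℝ)) = Measure.sum fun j : Fin n → ℤ =>
      volume.restrict ((fun y : Fin n → ℝ => fun i => ⌈y i⌉ - 1) ⁻¹' {j}) := by
    rw [← Measure.restrict_iUnion]
    · rw [← Set.preimage_iUnion, Set.iUnion_of_singleton, Set.preimage_univ, Measure.restrict_univ]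
    · intro a b hab
      refine Disjoint.preimage _ ?_
      simpa using hab
    · exact fun j => hm (measurableSet_singleton _)
  conv_lhs => rw [hd]
  rw [lintegral_sum_measure]
  refine tsum_congr fun j => ?_
  have hmp : MeasurePreserving (fun y : Fin n → ℝ => y + fun i => (j i : ℝ)) volume volume :=
    measurePreserving_add_right _ _
  rw [← hmp.setLIntegral_comp_preimage (hm (measurableSet_singleton _)) hf]
  refine congrArg (fun s : Set (Fin n → ℝ) => ∫⁻ y in s, f (fun i => y i + (j i : ℝ))) (Set.ext fun y => ?_)
  simp only [Set.mem_preimage, Set.mem_singleton_iff, funext_iff, Pi.add_apply, Set.mem_ofPred_eq,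
    Set.mem_Ioc]
  refine forall_congr' fun i => ?_
  rw [sub_eq_iff_eq_add, Int.ceil_eq_iff]
  push_cast
  constructor <;> rintro ⟨h1, h2⟩ <;> constructor <;> linarith

lemma lintegral_torus (f : UnitAddTorus (Fin n) → ℝ≥0∞) :
    ∫⁻ y, f y = ∫⁻ y in {y : Fin n → ℝ | ∀ i, y i ∈ Set.Ioc (0 : ℝ) (0 + 1)}, f (fun i => y i) := by
  have h := UnitAddTorus.lintegral_preimage f (0 : Fin n → ℝ)
  simp only [Pi.zero_apply] at h
  rw [← h]
  congr 1
  have : (volume : Measure UnitAddCircle) = AddCircle.haarAddCircle := by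
    rw [AddCircle.volume_eq_smul_haarAddCircle]; simp
  exact congrArg (fun μ => Measure.pi fun _ : Fin n => μ) this

/-- The periodized kernel as an extended nonnegative function. -/
def kernelE (H : ℝ × (Fin n → ℝ) → ℝ) (w : Cyl n) : ℝ≥0∞ :=
  ∑' j : Fin n → ℤ, ENNReal.ofReal (H (w.1, fun i => rep (w.2 i) + (j i : ℝ)))

lemma IsKernel.measurable_kernelE {H : ℝ × (Fin n → ℝ) → ℝ} (hH : IsKernel H) :
    Measurable (kernelE H) := by
  unfold kernelE
  refine Measurable.tsum fun j => ENNReal.measurable_ofReal.comp (hH.measurable.comp ?_)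
  refine measurable_fst.prodMk (measurable_pi_lambda _ fun i => ?_)
  exact (measurable_rep.comp ((measurable_pi_apply i).comp measurable_snd)).add_const _

lemma kernelE_proj (H : ℝ × (Fin n → ℝ) → ℝ) (x : ℝ) (y : Fin n → ℝ) :
    kernelE H (proj (x, y)) = ∑' j : Fin n → ℤ, ENNReal.ofReal (H (x, fun i => y i + (j i : ℝ))) := by
  have hrep : ∀ t : ℝ, ∃ m : ℤ, rep (t : UnitAddCircle) = t + m := by
    intro t
    refine ⟨-toIcoDiv (zero_lt_one' ℝ) 0 t, ?_⟩
    have h : rep (t : UnitAddCircle) = toIcoMod (zero_lt_one' ℝ) 0 t := rfl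
    rw [h, toIcoMod]
    simp [sub_eq_add_neg]
  choose m hm using hrep
  unfold kernelE proj
  rw [← (Equiv.addLeft (fun i => m (y i))).tsum_eq
    (fun j : Fin n → ℤ => ENNReal.ofReal (H (x, fun i => y i + (j i : ℝ))))]
  refine tsum_congr fun j => ?_
  simp only [hm, Equiv.coe_addLeft, Pi.add_apply, Int.cast_add, add_assoc]

/-- Unfolding: f ∘ `proj` is periodic, so summing H over the lattice and integrating over the torus
is the same as integrating over the cover. In ℝ≥0∞ no convergence has to be known. -/
lemma IsKernel.lintegral_mul_kernelE {H : ℝ × (Fin n → ℝ) → ℝ} (hH : IsKernel H)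
    {f : Cyl n → ℝ≥0∞} (hf : Measurable f) :
    ∫⁻ w, f w * kernelE H w = ∫⁻ z, f (proj z) ∂kerMeas H := by
  have hfp : Measurable fun z : ℝ × (Fin n → ℝ) => f (proj z) := hf.comp measurable_proj
  rw [kerMeas, lintegral_withDensity_eq_lintegral_mul _ hH.measurable.ennreal_ofReal hfp,
    Measure.volume_eq_prod, Measure.volume_eq_prod,
    lintegral_prod (fun w : ℝ × UnitAddTorus (Fin n) => f w * kernelE H w) (hf.mul hH.measurable_kernelE).aemeasurable,
    lintegral_prod _ (hH.measurable.ennreal_ofReal.mul hfp).aemeasurable]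
  refine lintegral_congr fun x => ?_
  have hm : Measurable fun y : Fin n → ℝ => ENNReal.ofReal (H (x, y)) * f (proj (x, y)) :=
    (hH.measurable.ennreal_ofReal.mul hfp).comp (measurable_prodMk_left)
  simp only [Pi.mul_apply]
  rw [lintegral_torus, tsum_lintegral_floor_fiber _ hm, ← lintegral_tsum]
  · refine lintegral_congr fun y => ?_
    have h1 := kernelE_proj H x y
    have h2 : ∀ j : Fin n → ℤ, proj (x, fun i => y i + (j i : ℝ)) = proj (x, y) := by
      intro j
      simp only [proj, Prod.mk.injEq, true_and]
      ext i
      have : (((j i : ℤ) : ℝ) : UnitAddCircle) = 0 := by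
        rw [AddCircle.coe_eq_zero_iff]; exact ⟨j i, by simp⟩
      rw [AddCircle.coe_add, this, add_zero]
    simp only [h2, ENNReal.tsum_mul_right]
    rw [← h1, mul_comm]
    rfl
  · intro j
    exact (hm.comp (by fun_prop)).aemeasurable

/-- A divergent real `tsum` would have the value 0. This is excluded almost everywhere: by unfolding
and the Lévy condition min(1, x²)·`kernelE` has a finite integral, so the series converges at almost
every point with x ≠ 0. -/
lemma IsKernel.kernel_ae {H : ℝ × (Fin n → ℝ) → ℝ} (hH : IsKernel H) :
    ∀ᵐ w : Cyl n, 0 ≤ kernel H w ∧ ENNReal.ofReal (kernel H w) = kernelE H w := by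
  have hx : ∀ᵐ w : Cyl n, w.1 ≠ 0 := by
    have h0 : ∀ᵐ x : ℝ, x ≠ 0 := Measure.ae_ne volume 0
    exact Measure.quasiMeasurePreserving_fst.ae h0
  have hm : Measurable fun w : Cyl n => ENNReal.ofReal (min 1 (w.1 ^ 2)) := by fun_prop
  have hfin : ∫⁻ w : Cyl n, ENNReal.ofReal (min 1 (w.1 ^ 2)) * kernelE H w ≠ ⊤ := by
    rw [hH.lintegral_mul_kernelE hm]
    refine (lt_of_le_of_lt (lintegral_mono fun z => ?_) hH.lintegral_min_lt_top).ne
    refine ENNReal.ofReal_le_ofReal (min_le_min_left _ ?_)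
    rw [← sq_abs]
    exact pow_le_pow_left₀ (abs_nonneg _) (norm_fst_le z) 2
  filter_upwards [hx, ae_lt_top (hm.mul hH.measurable_kernelE) hfin] with w hw hlt
  have hk : kernelE H w ≠ ⊤ := by
    intro h
    simp only [Pi.mul_apply, h] at hlt
    rw [ENNReal.mul_top] at hlt
    · exact lt_irrefl _ hlt
    · simp only [ne_eq, ENNReal.ofReal_eq_zero, not_le]
      positivity
  have hpos : ∀ j : Fin n → ℤ, 0 ≤ H (w.1, fun i => rep (w.2 i) + (j i : ℝ)) :=
    fun j => (hH.pos _ fun h => hw (congrArg Prod.fst h)).le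
  have : kernel H w = (kernelE H w).toReal := by
    rw [kernelE, ENNReal.tsum_toReal_eq fun j => ENNReal.ofReal_ne_top]
    exact tsum_congr fun j => (ENNReal.toReal_ofReal (hpos j)).symm
  rw [this]
  exact ⟨ENNReal.toReal_nonneg, ENNReal.ofReal_toReal hk⟩

lemma IsKernel.cylMeas_eq {H : ℝ × (Fin n → ℝ) → ℝ} (hH : IsKernel H) :
    cylMeas H = volume.withDensity (kernelE H) :=
  withDensity_congr_ae (hH.kernel_ae.mono fun _ h => h.2)

lemma IsKernel.aemeasurable_kernel {H : ℝ × (Fin n → ℝ) → ℝ} (hH : IsKernel H) :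
    AEMeasurable (kernel H) := by
  refine ⟨fun w => (kernelE H w).toReal, hH.measurable_kernelE.ennreal_toReal, ?_⟩
  filter_upwards [hH.kernel_ae] with w hw
  rw [← hw.2, ENNReal.toReal_ofReal hw.1]

lemma IsKernel.map_proj {H : ℝ × (Fin n → ℝ) → ℝ} (hH : IsKernel H) :
    (kerMeas H).map proj = cylMeas H := by
  refine Measure.ext_of_lintegral _ fun f hf => ?_
  rw [lintegral_map hf measurable_proj, ← hH.lintegral_mul_kernelE hf, hH.cylMeas_eq,
    lintegral_withDensity_eq_lintegral_mul _ hH.measurable_kernelE hf]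
  simp [mul_comm]

/-- Substituting y → x•y yields |x|ⁿ and homogeneity yields |x|^{-(n+2)}, together x⁻². Evenness
takes care of negative x. -/
lemma IsKernel.lintegral_slice {H : ℝ × (Fin n → ℝ) → ℝ} (hH : IsKernel H) {x : ℝ} (hx : x ≠ 0) :
    ∫⁻ y, ENNReal.ofReal (H (x, y)) = ENNReal.ofReal (1 / x ^ 2) * ∫⁻ y, ENNReal.ofReal (H (1, y)) := by
  have hm : Measurable fun y : Fin n → ℝ => ENNReal.ofReal (H (x, y)) :=
    (hH.measurable.comp measurable_prodMk_left).ennreal_ofReal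
  have h1 := Measure.map_addHaar_smul (volume : Measure (Fin n → ℝ)) hx
  have h2 : ∫⁻ y, ENNReal.ofReal (H (x, x • y)) =
      ENNReal.ofReal |(x ^ n)⁻¹| * ∫⁻ y, ENNReal.ofReal (H (x, y)) := by
    rw [← lintegral_map (μ := volume) (g := fun y : Fin n → ℝ => x • y) hm (by fun_prop), h1]
    simp
  have h3 : ∀ y, H (x, x • y) = (|x| ^ (n + 2))⁻¹ * H (1, y) := by
    intro y
    have hne : ((1 : ℝ), y) ≠ 0 := fun h => one_ne_zero (congrArg Prod.fst h)
    rw [← hH.homog _ hne _ (abs_pos.2 hx)]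
    rcases abs_choice x with h | h
    · rw [h]; simp
    · rw [h, ← hH.symm]; simp
  simp_rw [h3] at h2
  have h4 : ∀ y, ENNReal.ofReal ((|x| ^ (n + 2))⁻¹ * H (1, y)) =
      ENNReal.ofReal ((|x| ^ (n + 2))⁻¹) * ENNReal.ofReal (H (1, y)) :=
    fun y => ENNReal.ofReal_mul (by positivity)
  simp_rw [h4] at h2
  rw [lintegral_const_mul' _ _ ENNReal.ofReal_ne_top] at h2
  have h5 : ENNReal.ofReal (|x| ^ n) * (ENNReal.ofReal |(x ^ n)⁻¹| * ∫⁻ y, ENNReal.ofReal (H (x, y))) =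
      ∫⁻ y, ENNReal.ofReal (H (x, y)) := by
    rw [← mul_assoc, ← ENNReal.ofReal_mul (by positivity), abs_inv, abs_pow, mul_inv_cancel₀
      (by positivity)]
    simp
  rw [← h5, ← h2, ← mul_assoc, ← ENNReal.ofReal_mul (by positivity)]
  congr 2
  rw [← sq_abs x]
  have : |x| ≠ 0 := abs_ne_zero.2 hx
  field_simp
  ring

/-- If this slice were infinite, then by scaling so would be all slices with x ≠ 0, against the Lévy
condition. -/
lemma IsKernel.lintegral_one_ne_top {H : ℝ × (Fin n → ℝ) → ℝ} (hH : IsKernel H) :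
    ∫⁻ y, ENNReal.ofReal (H (1, y)) ≠ ⊤ := by
  intro htop
  have h := hH.lintegral_min_lt_top
  rw [kerMeas, lintegral_withDensity_eq_lintegral_mul _ hH.measurable.ennreal_ofReal (by fun_prop),
    Measure.volume_eq_prod, lintegral_prod _ (hH.measurable.ennreal_ofReal.mul
      (by fun_prop)).aemeasurable] at h
  have hall : ∀ᵐ x : ℝ, (⊤ : ℝ≥0∞) ≤ ∫⁻ y : Fin n → ℝ, ((fun z => ENNReal.ofReal (H z)) *
      fun z : ℝ × (Fin n → ℝ) => ENNReal.ofReal (min 1 (‖z‖ ^ 2))) (x, y) := by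
    filter_upwards [Measure.ae_ne volume (0 : ℝ)] with x hx
    have : ∫⁻ y : Fin n → ℝ, ENNReal.ofReal (H (x, y)) * ENNReal.ofReal (min 1 (x ^ 2)) = ⊤ := by
      rw [lintegral_mul_const' _ _ ENNReal.ofReal_ne_top, hH.lintegral_slice hx, htop,
        ENNReal.mul_top, ENNReal.top_mul]
      · simp only [ne_eq, ENNReal.ofReal_eq_zero, not_le]; positivity
      · simp only [ne_eq, ENNReal.ofReal_eq_zero, not_le]; positivity
    rw [← this]
    refine lintegral_mono fun y => ?_
    simp only [Pi.mul_apply]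
    refine mul_le_mul_right (ENNReal.ofReal_le_ofReal (min_le_min_left _ ?_)) _
    rw [← sq_abs]
    exact pow_le_pow_left₀ (abs_nonneg _) (norm_fst_le (x, y)) 2
  have h2 := (lintegral_mono_ae hall).trans_lt h
  simp at h2

lemma IsKernel.kerConst_pos {H : ℝ × (Fin n → ℝ) → ℝ} (hH : IsKernel H) : 0 < kerConst H := by
  refine ENNReal.toReal_pos ?_ hH.lintegral_one_ne_top
  have hm : Measurable fun y : Fin n → ℝ => ENNReal.ofReal (H (1, y)) :=
    (hH.measurable.comp measurable_prodMk_left).ennreal_ofReal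
  rw [← pos_iff_ne_zero, lintegral_pos_iff_support hm]
  have : (Function.support fun y : Fin n → ℝ => ENNReal.ofReal (H (1, y))) = Set.univ := by
    ext y
    simp only [Function.mem_support, ne_eq, ENNReal.ofReal_eq_zero, not_le, Set.mem_univ, iff_true]
    exact hH.pos _ fun h => one_ne_zero (congrArg Prod.fst h)
  rw [this]
  exact Measure.measure_univ_pos.2 (NeZero.ne _)

/-- Whatever H is, functions of x alone feel only c/x²: this is what turns the one-dimensional
problem into one for a multiple of the half Laplacian. -/
lemma IsKernel.map_fst {H : ℝ × (Fin n → ℝ) → ℝ} (hH : IsKernel H) :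
    (cylMeas H).map Prod.fst = lineMeas (kerConst H) := by
  refine Measure.ext_of_lintegral _ fun f hf => ?_
  have hf1 : Measurable fun z : ℝ × (Fin n → ℝ) => f z.1 := hf.comp measurable_fst
  have hmc : Measurable fun x : ℝ => ENNReal.ofReal (kerConst H / x ^ 2) := by fun_prop
  rw [← hH.map_proj, Measure.map_map measurable_fst measurable_proj,
    show Prod.fst ∘ (proj : ℝ × (Fin n → ℝ) → Cyl n) = Prod.fst from rfl,
    lintegral_map hf measurable_fst, kerMeas,
    lintegral_withDensity_eq_lintegral_mul _ hH.measurable.ennreal_ofReal hf1,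
    Measure.volume_eq_prod, lintegral_prod _ (hH.measurable.ennreal_ofReal.mul hf1).aemeasurable,
    lineMeas, lintegral_withDensity_eq_lintegral_mul _ hmc hf]
  refine lintegral_congr_ae ?_
  filter_upwards [Measure.ae_ne volume (0 : ℝ)] with x hx
  simp only [Pi.mul_apply]
  have hm : Measurable fun y : Fin n → ℝ => ENNReal.ofReal (H (x, y)) :=
    (hH.measurable.comp measurable_prodMk_left).ennreal_ofReal
  rw [lintegral_mul_const _ hm, hH.lintegral_slice hx]
  congr 1
  rw [kerConst, div_eq_mul_one_div (ENNReal.toReal _) (x ^ 2), mul_comm (ENNReal.toReal _),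
    ENNReal.ofReal_mul (by positivity), ENNReal.ofReal_toReal hH.lintegral_one_ne_top]

lemma IsKernel.lintegral_lineMeas_min_lt_top {H : ℝ × (Fin n → ℝ) → ℝ} (hH : IsKernel H) :
    ∫⁻ x, ENNReal.ofReal (min 1 (x ^ 2)) ∂lineMeas (kerConst H) < ⊤ := by
  rw [← hH.map_fst, lintegral_map (by fun_prop) measurable_fst, ← hH.map_proj,
    lintegral_map (by fun_prop) measurable_proj]
  refine (lintegral_mono fun z => ?_).trans_lt hH.lintegral_min_lt_top
  refine ENNReal.ofReal_le_ofReal (min_le_min_left _ ?_)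
  rw [← sq_abs]
  exact pow_le_pow_left₀ (abs_nonneg _) (norm_fst_le z) 2

lemma measurePreserving_sub_shear :
    MeasurePreserving (fun q : Cyl n × Cyl n => (q.1, q.1 - q.2)) := by
  have h1 : MeasurePreserving (fun q : Cyl n × Cyl n => (q.1, q.2 - q.1))
    (volume.prod volume) (volume.prod volume) := measurePreserving_prod_sub _ _
  have h2 : MeasurePreserving (fun q : Cyl n × Cyl n => (q.1, -q.2))
      (volume.prod volume) (volume.prod volume) :=
    (MeasurePreserving.id volume).prod (Measure.measurePreserving_neg volume)
  have h3 := h2.comp h1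
  have h4 : (fun q : Cyl n × Cyl n => (q.1, -q.2)) ∘ (fun q => (q.1, q.2 - q.1)) =
      fun q : Cyl n × Cyl n => (q.1, q.1 - q.2) := by
    ext1 q; simp
  rw [h4] at h3
  exact h3

/-- The involution `(w, w') ↦ (w, w - w')`. -/
def shear : (Cyl n × Cyl n) ≃ᵐ (Cyl n × Cyl n) :=
  MeasurableEquiv.ofInvolutive (fun q => (q.1, q.1 - q.2)) (fun q => by simp) (by fun_prop)

lemma prod_cylMeas (H : ℝ × (Fin n → ℝ) → ℝ) (hH : IsKernel H) :
    (volume : Measure (Cyl n)).prod (cylMeas H) =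
      (volume : Measure (Cyl n × Cyl n)).withDensity (fun q => kernelE H q.2) := by
  rw [hH.cylMeas_eq, prod_withDensity_right hH.measurable_kernelE]
  rfl

lemma IsKernel.kernel_ae_prod {H : ℝ × (Fin n → ℝ) → ℝ} (hH : IsKernel H) :
    ∀ᵐ q : Cyl n × Cyl n, 0 ≤ kernel H q.2 ∧ ENNReal.ofReal (kernel H q.2) = kernelE H q.2 :=
  Measure.quasiMeasurePreserving_snd.ae hH.kernel_ae

/-- The involution (w, w') ↦ (w, w - w') preserves volume and turns the coupled weight K(w - w')
into a product measure. All interaction integrals below are computed in these variables. -/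
lemma IsKernel.integrable_mul_kernel_iff {H : ℝ × (Fin n → ℝ) → ℝ} (hH : IsKernel H)
    (f : Cyl n × Cyl n → ℝ) :
    Integrable (fun p : Cyl n × Cyl n => f p * kernel H (p.1 - p.2)) ↔
      Integrable (fun q : Cyl n × Cyl n => f (q.1, q.1 - q.2)) (volume.prod (cylMeas H)) := by
  rw [prod_cylMeas H hH, integrable_withDensity_iff_integrable_smul'
    (f := fun q : Cyl n × Cyl n => kernelE H q.2) (hH.measurable_kernelE.comp measurable_snd)
    (hH.kernel_ae_prod.mono fun q hq => by rw [← hq.2]; exact ENNReal.ofReal_lt_top),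
    ← measurePreserving_sub_shear.integrable_comp_emb shear.measurableEmbedding]
  refine integrable_congr ?_
  filter_upwards [hH.kernel_ae_prod] with q hq
  simp only [Function.comp, sub_sub_cancel, smul_eq_mul, ← hq.2, ENNReal.toReal_ofReal hq.1]
  exact mul_comm _ _

lemma IsKernel.integral_mul_kernel {H : ℝ × (Fin n → ℝ) → ℝ} (hH : IsKernel H)
    (f : Cyl n × Cyl n → ℝ) :
    ∫ p : Cyl n × Cyl n, f p * kernel H (p.1 - p.2) =
      ∫ q : Cyl n × Cyl n, f (q.1, q.1 - q.2) ∂(volume.prod (cylMeas H)) := by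
  rw [prod_cylMeas H hH, integral_withDensity_eq_integral_toReal_smul₀
    (f := fun q : Cyl n × Cyl n => kernelE H q.2)
    (hH.measurable_kernelE.comp measurable_snd).aemeasurable
    (hH.kernel_ae_prod.mono fun q hq => by rw [← hq.2]; exact ENNReal.ofReal_lt_top),
    ← measurePreserving_sub_shear.integral_comp shear.measurableEmbedding]
  refine integral_congr_ae ?_
  filter_upwards [hH.kernel_ae_prod] with q hq
  simp only [sub_sub_cancel, smul_eq_mul, ← hq.2, ENNReal.toReal_ofReal hq.1]
  exact mul_comm _ _

end

/-! ### The Fourier transform on L² of the line -/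

section

open scoped SchwartzMap

/-- The `L²` Fourier transform on the line at the level of functions. -/
def ft (f : ℝ → ℂ) : ℝ → ℂ :=
  open Classical in if h : MemLp f 2 volume then ((𝓕 h.toLp : Lp ℂ 2 (volume : Measure ℝ)) : ℝ → ℂ) else 0

lemma ft_of_memLp {f : ℝ → ℂ} (h : MemLp f 2 volume) :
    ft f = ((𝓕 h.toLp : Lp ℂ 2 (volume : Measure ℝ)) : ℝ → ℂ) := dif_pos h

lemma ft_memLp (f : ℝ → ℂ) : MemLp (ft f) 2 volume := by
  unfold ft
  split_ifs
  · exact Lp.memLp _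
  · exact MemLp.zero

lemma ft_congr_ae {f g : ℝ → ℂ} (hf : MemLp f 2 volume) (h : f =ᵐ[volume] g) : ft f = ft g := by
  rw [ft_of_memLp hf, ft_of_memLp ((memLp_congr_ae h).1 hf), MemLp.toLp_congr hf _ h]

lemma ft_sub {f g : ℝ → ℂ} (hf : MemLp f 2 volume) (hg : MemLp g 2 volume) :
    ft (fun x => f x - g x) =ᵐ[volume] fun ξ => ft f ξ - ft g ξ := by
  rw [ft_of_memLp hf, ft_of_memLp hg, ft_of_memLp (f := fun x => f x - g x) (hf.sub hg)]
  have : MemLp.toLp (fun x => f x - g x) (hf.sub hg) = hf.toLp - hg.toLp := MemLp.toLp_sub hf hg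
  have h2 : (𝓕 (hf.toLp - hg.toLp) : Lp ℂ 2 (volume : Measure ℝ)) = 𝓕 hf.toLp - 𝓕 hg.toLp :=
    (Lp.fourierTransformₗᵢ ℝ ℂ).map_sub _ _
  rw [this, h2]
  exact Lp.coeFn_sub _ _

lemma ft_const_mul {f : ℝ → ℂ} (hf : MemLp f 2 volume) (c : ℂ) :
    ft (fun x => c * f x) =ᵐ[volume] fun ξ => c * ft f ξ := by
  rw [ft_of_memLp hf, ft_of_memLp (f := fun x => c * f x) (hf.const_mul c)]
  have : MemLp.toLp (fun x => c * f x) (hf.const_mul c) = c • hf.toLp := MemLp.toLp_const_smul c hf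
  have h2 : (𝓕 (c • hf.toLp) : Lp ℂ 2 (volume : Measure ℝ)) = c • 𝓕 hf.toLp :=
    (Lp.fourierTransformₗᵢ ℝ ℂ).map_smul _ _
  rw [this, h2]
  filter_upwards [Lp.coeFn_smul c (𝓕 hf.toLp : Lp ℂ 2 (volume : Measure ℝ))] with x hx
  simpa using hx

lemma eLpNorm_ft {f : ℝ → ℂ} (hf : MemLp f 2 volume) : eLpNorm (ft f) 2 volume = eLpNorm f 2 volume := by
  have h := Lp.norm_fourier_eq (hf.toLp)
  rw [Lp.norm_def, Lp.norm_toLp, ENNReal.toReal_eq_toReal_iff' (Lp.memLp _).eLpNorm_ne_top hf.eLpNorm_ne_top] at h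
  rw [ft_of_memLp hf, h]

lemma eLpNorm_two_sq {α : Type*} [MeasurableSpace α] {μ : Measure α} {E : Type*} [NormedAddCommGroup E]
    (f : α → E) : eLpNorm f 2 μ ^ 2 = ∫⁻ x, ENNReal.ofReal (‖f x‖ ^ 2) ∂μ := by
  have h := eLpNorm_nnreal_pow_eq_lintegral (p := 2) (f := f) (μ := μ) (by norm_num)
  simp only [NNReal.coe_ofNat, ENNReal.rpow_ofNat, ENNReal.coe_ofNat] at h
  rw [h]
  refine lintegral_congr fun x => ?_
  rw [← ofReal_norm, ENNReal.ofReal_pow (norm_nonneg _)]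

lemma lintegral_ft_sq {f : ℝ → ℂ} (hf : MemLp f 2 volume) :
    ∫⁻ ξ, ENNReal.ofReal (‖ft f ξ‖ ^ 2) = ∫⁻ x, ENNReal.ofReal (‖f x‖ ^ 2) := by
  rw [← eLpNorm_two_sq, ← eLpNorm_two_sq, eLpNorm_ft hf]

lemma integral_conj_ft_mul_ft {f g : ℝ → ℂ} (hf : MemLp f 2 volume) (hg : MemLp g 2 volume) :
    ∫ ξ, starRingEnd ℂ (ft f ξ) * ft g ξ = ∫ x, starRingEnd ℂ (f x) * g x := by
  have h := Lp.inner_fourier_eq hf.toLp hg.toLp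
  rw [L2.inner_def, L2.inner_def] at h
  simp only [RCLike.inner_apply] at h
  rw [ft_of_memLp hf, ft_of_memLp hg]
  simp_rw [mul_comm (starRingEnd ℂ _)]
  rw [h]
  refine integral_congr_ae ?_
  filter_upwards [hf.coeFn_toLp, hg.coeFn_toLp] with x h1 h2
  rw [h1, h2]

lemma ft_schwartz (φ : 𝓢(ℝ, ℂ)) : ft φ =ᵐ[volume] 𝓕 (φ : ℝ → ℂ) := by
  rw [ft_of_memLp (φ.memLp 2)]
  have := SchwartzMap.toLp_fourier_eq φ
  have h2 : (MemLp.toLp φ (φ.memLp 2 volume)) = φ.toLp 2 := rfl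
  rw [h2, this]
  filter_upwards [(𝓕 φ).coeFn_toLp 2 volume] with x hx
  rw [hx, SchwartzMap.fourier_coe]

/-- Multiplication by a unimodular function on `L²`. -/
def unimod (e : ℝ → Circle) (he : Continuous e) (f : Lp ℂ 2 (volume : Measure ℝ)) :
    Lp ℂ 2 (volume : Measure ℝ) :=
  MemLp.toLp (fun x => (e x : ℂ) * f x) (by
    refine (Lp.memLp f).of_le ?_ (Eventually.of_forall fun x => by
      rw [norm_mul, Circle.norm_coe, one_mul])
    exact (by fun_prop : Continuous fun x => (e x : ℂ)).aestronglyMeasurable.mul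
      (Lp.memLp f).aestronglyMeasurable)

lemma isometry_unimod (e : ℝ → Circle) (he : Continuous e) : Isometry (unimod e he) := by
  intro f g
  rw [unimod, unimod, Lp.edist_toLp_toLp, Lp.edist_def]
  refine eLpNorm_congr_norm_ae (Eventually.of_forall fun x => ?_)
  simp only [Pi.sub_apply]
  rw [← mul_sub, norm_mul, Circle.norm_coe, one_mul]

/-- The character `ξ ↦ e^{-2πi h ξ}`. -/
def chr (h ξ : ℝ) : ℂ := (Real.fourierChar (-(h * ξ)) : ℂ)

lemma norm_chr (h ξ : ℝ) : ‖chr h ξ‖ = 1 := Circle.norm_coe _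

lemma continuous_chr (h : ℝ) : Continuous (chr h) := by
  unfold chr
  have := Real.continuous_fourierChar
  fun_prop

lemma memLp_comp_sub {f : ℝ → ℂ} (hf : MemLp f 2 volume) (h : ℝ) :
    MemLp (fun x => f (x - h)) 2 volume :=
  hf.comp_measurePreserving (measurePreserving_sub_right volume h)

/-- For Schwartz functions this is a computation with the Fourier integral. Both sides are
continuous in L², the right one because multiplication by a unimodular function is an isometry, and
Schwartz functions are dense. -/
lemma ft_comp_sub {f : ℝ → ℂ} (hf : MemLp f 2 volume) (h : ℝ) :
    ft (fun x => f (x - h)) =ᵐ[volume] fun ξ => chr h ξ * ft f ξ := by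
  have hmp : MeasurePreserving (fun x : ℝ => x - h) volume volume :=
    measurePreserving_sub_right volume h
  set e : ℝ → Circle := fun ξ => Real.fourierChar (-(h * ξ)) with he_def
  have he : Continuous e := by
    have := Real.continuous_fourierChar
    fun_prop
  have key : ∀ g : Lp ℂ 2 (volume : Measure ℝ),
      𝓕 (Lp.compMeasurePreservingₗᵢ ℂ _ hmp g) = unimod e he (𝓕 g) := by
    intro g
    refine DenseRange.induction_on
      (p := fun g : Lp ℂ 2 (volume : Measure ℝ) => 𝓕 (Lp.compMeasurePreservingₗᵢ ℂ _ hmp g) = unimod e he (𝓕 g))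
      (SchwartzMap.denseRange_toLpCLM (p := 2) ENNReal.ofNat_ne_top) g ?_ ?_
    · refine isClosed_eq ?_ ?_
      · exact (Lp.fourierTransformₗᵢ ℝ ℂ).continuous.comp (Lp.compMeasurePreservingₗᵢ ℂ _ hmp).continuous
      · exact (isometry_unimod e he).continuous.comp (Lp.fourierTransformₗᵢ ℝ ℂ).continuous
    · intro φ
      have h1 : Lp.compMeasurePreservingₗᵢ ℂ _ hmp (φ.toLp 2) = (φ.compSubConstCLM ℂ h).toLp 2 := by
        ext1
        refine (Lp.coeFn_compMeasurePreserving _ hmp).trans ?_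
        have h3 := hmp.quasiMeasurePreserving.ae_eq_comp (φ.coeFn_toLp 2 volume)
        refine h3.trans ?_
        refine EventuallyEq.trans ?_ ((φ.compSubConstCLM ℂ h).coeFn_toLp 2 volume).symm
        exact Eventually.of_forall fun x => rfl
      change 𝓕 (Lp.compMeasurePreservingₗᵢ ℂ _ hmp (φ.toLp 2)) = unimod e he (𝓕 (φ.toLp 2))
      rw [h1, SchwartzMap.toLp_fourier_eq, SchwartzMap.toLp_fourier_eq]
      ext1
      refine (SchwartzMap.coeFn_toLp _ 2 volume).trans ?_
      refine EventuallyEq.trans ?_ (MemLp.coeFn_toLp _).symm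
      filter_upwards [(𝓕 φ).coeFn_toLp 2 volume] with ξ hξ
      rw [hξ, SchwartzMap.fourier_coe, SchwartzMap.fourier_coe]
      have := congrFun (VectorFourier.fourierIntegral_comp_add_right Real.fourierChar volume
        (innerₗ ℝ) (φ : ℝ → ℂ) (-h)) ξ
      simp only [← sub_eq_add_neg] at this
      refine Eq.trans this ?_
      simp only [Circle.smul_def, smul_eq_mul, he_def]
      refine congrArg₂ _ ?_ rfl
      congr 2
      simp [mul_comm]
  have h4 : (memLp_comp_sub hf h).toLp = Lp.compMeasurePreservingₗᵢ ℂ _ hmp hf.toLp := by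
    ext1
    refine (MemLp.coeFn_toLp _).trans ?_
    refine EventuallyEq.trans ?_ (Lp.coeFn_compMeasurePreserving _ hmp).symm
    exact (hmp.quasiMeasurePreserving.ae_eq_comp hf.coeFn_toLp).symm
  rw [ft_of_memLp hf, ft_of_memLp (memLp_comp_sub hf h), h4, key]
  exact MemLp.coeFn_toLp _

/-- The L² transform is defined by extension and has no integral formula; its compatibility with
tempered distributions supplies this dual description. -/
lemma integral_fourierInv_mul_ft {f : ℝ → ℂ} (hf : MemLp f 2 volume) (ψ : 𝓢(ℝ, ℂ)) :
    ∫ ξ, 𝓕⁻ (ψ : ℝ → ℂ) ξ * ft f ξ = ∫ x, ψ x * f x := by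
  have h1 := congrArg (fun T => T ψ) (Lp.fourierInv_toTemperedDistribution_eq (𝓕 hf.toLp))
  simp only [TemperedDistribution.fourierInv_apply, Lp.toTemperedDistribution_apply,
    FourierTransform.fourierInv_fourier_eq, smul_eq_mul] at h1
  rw [ft_of_memLp hf, ← SchwartzMap.fourierInv_coe, h1]
  refine integral_congr_ae ?_
  filter_upwards [hf.coeFn_toLp] with x hx
  rw [hx]

lemma continuous_fourierInv {G : ℝ → ℂ} (hi : Integrable G) : Continuous (𝓕⁻ G) := by
  have : 𝓕⁻ G = fun x => 𝓕 G (-x) := by ext x; exact Real.fourierInv_eq_fourier_neg _ _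
  rw [this]
  exact (VectorFourier.fourierIntegral_continuous Real.continuous_fourierChar
    (by exact continuous_inner) hi).comp continuous_neg

/-- Fubini for the honest Fourier integral. Comparison with `integral_fourierInv_mul_ft` identifies
the L² transform and the integral one wherever both make sense. -/
lemma integral_fourierInv_mul {G : ℝ → ℂ} (hi : Integrable G) (ψ : 𝓢(ℝ, ℂ)) :
    ∫ ξ, 𝓕⁻ (ψ : ℝ → ℂ) ξ * G ξ = ∫ x, ψ x * 𝓕⁻ G x := by
  have h := VectorFourier.integral_fourierIntegral_smul_eq_flip (μ := (volume : Measure ℝ))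
    (ν := (volume : Measure ℝ)) (L := innerₗ ℝ) (f := (ψ : ℝ → ℂ)) (g := fun ξ => G (-ξ))
    Real.continuous_fourierChar (by exact continuous_inner) ψ.integrable hi.comp_neg
  rw [flip_innerₗ] at h
  have h2 : VectorFourier.fourierIntegral Real.fourierChar volume (innerₗ ℝ) (fun ξ => G (-ξ)) = 𝓕⁻ G :=
    (Real.fourierInv_eq_fourier_comp_neg G).symm
  rw [h2] at h
  simp only [smul_eq_mul] at h
  rw [← h, ← integral_neg_eq_self]
  refine integral_congr_ae (Eventually.of_forall fun ξ => ?_)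
  simp only [Real.fourierInv_eq_fourier_neg, neg_neg]
  rfl

lemma ae_eq_of_integral_schwartz {f g : ℝ → ℂ} (hf : LocallyIntegrable f) (hg : LocallyIntegrable g)
    (h : ∀ ψ : ℝ → ℝ, ContDiff ℝ ∞ ψ → HasCompactSupport ψ →
      ∫ x, (ψ x : ℂ) * f x = ∫ x, (ψ x : ℂ) * g x) : f =ᵐ[volume] g := by
  have key : ∀ᵐ x, f x - g x = 0 := by
    refine ae_eq_zero_of_integral_contDiff_smul_eq_zero (hf.sub hg) fun ψ hψ hs => ?_
    have i1 := hf.integrable_smul_left_of_hasCompactSupport hψ.continuous hs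
    have i2 := hg.integrable_smul_left_of_hasCompactSupport hψ.continuous hs
    simp only [smul_sub]
    rw [integral_sub i1 i2, sub_eq_zero]
    simpa using h ψ hψ hs
  filter_upwards [key] with x hx
  exact sub_eq_zero.1 hx

/-- A smooth compactly supported real function as a complex Schwartz function. -/
def toSchwartz (ψ : ℝ → ℝ) (h : ContDiff ℝ ∞ ψ) (hs : HasCompactSupport ψ) : 𝓢(ℝ, ℂ) :=
  HasCompactSupport.toSchwartzMap (f := fun x => (ψ x : ℂ)) (hs.comp_left (g := fun x : ℝ => (x : ℂ)) (by simp))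
    (Complex.ofRealCLM.contDiff.comp h)

lemma toSchwartz_apply (ψ : ℝ → ℝ) (h : ContDiff ℝ ∞ ψ) (hs : HasCompactSupport ψ) (x : ℝ) :
    toSchwartz ψ h hs x = ψ x := rfl

lemma ae_eq_fourierInv_ft {f : ℝ → ℂ} (hf : MemLp f 2 volume) (hi : Integrable (ft f)) :
    f =ᵐ[volume] 𝓕⁻ (ft f) := by
  refine ae_eq_of_integral_schwartz (hf.locallyIntegrable (by norm_num))
    (continuous_fourierInv hi).locallyIntegrable fun ψ hψ hs => ?_
  have h1 := integral_fourierInv_mul_ft hf (toSchwartz ψ hψ hs)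
  have h2 := integral_fourierInv_mul hi (toSchwartz ψ hψ hs)
  simp only [toSchwartz_apply] at h1 h2
  rw [← h1, h2]

lemma ft_fourierInv {G : ℝ → ℂ} (hi : Integrable G) (h2 : MemLp (𝓕⁻ G) 2 volume) :
    ft (𝓕⁻ G) =ᵐ[volume] G := by
  refine ae_eq_of_integral_schwartz ((ft_memLp _).locallyIntegrable (by norm_num))
    hi.locallyIntegrable fun ψ hψ hs => ?_
  set χ := toSchwartz ψ hψ hs
  have h3 := integral_fourierInv_mul_ft h2 (𝓕 χ)
  have h4 := integral_fourierInv_mul hi (𝓕 χ)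
  rw [← SchwartzMap.fourierInv_coe, FourierTransform.fourierInv_fourier_eq] at h3 h4
  exact h3.trans h4.symm

/-! ### Scaling, Gagliardo energy and the symbol of the kernel -/

/-- Dilation by R costs R^{-(n+1)} from the volume and gains R^{n+2} from H; the remaining single
power of R says that the operator has order one. -/
lemma lintegral_scale_kerMeas {n : ℕ} {H : ℝ × (Fin n → ℝ) → ℝ} (hH : IsKernel H) {R : ℝ} (hR : 0 < R)
    {f : ℝ × (Fin n → ℝ) → ℝ≥0∞} (hf : Measurable f) :
    ∫⁻ z, f (R • z) ∂kerMeas H = ENNReal.ofReal R * ∫⁻ z, f z ∂kerMeas H := by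
  have hfR : Measurable fun z => f (R • z) := hf.comp (by fun_prop)
  rw [kerMeas, lintegral_withDensity_eq_lintegral_mul _ hH.measurable.ennreal_ofReal hfR,
    lintegral_withDensity_eq_lintegral_mul _ hH.measurable.ennreal_ofReal hf]
  have h1 := Measure.map_addHaar_smul (volume : Measure (ℝ × (Fin n → ℝ))) hR.ne'
  have hd : Module.finrank ℝ (ℝ × (Fin n → ℝ)) = n + 1 := by simp [add_comm]
  have hm : Measurable fun z => ENNReal.ofReal (H z) * f z := hH.measurable.ennreal_ofReal.mul hf
  have h2 : ∫⁻ z, ENNReal.ofReal (H (R • z)) * f (R • z) =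
      ENNReal.ofReal |(R ^ (n + 1))⁻¹| * ∫⁻ z, ENNReal.ofReal (H z) * f z := by
    rw [← lintegral_map (μ := volume) (g := fun y : ℝ × (Fin n → ℝ) => R • y) hm (by fun_prop), h1, hd]
    simp
  have h0 : ∀ᵐ z : ℝ × (Fin n → ℝ), z ≠ 0 := Measure.ae_ne volume 0
  have h3 : ∫⁻ z, ENNReal.ofReal (H z) * f (R • z) =
      ∫⁻ z, ENNReal.ofReal (R ^ (n + 2)) * (ENNReal.ofReal (H (R • z)) * f (R • z)) := by
    refine lintegral_congr_ae ?_
    filter_upwards [h0] with z hz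
    rw [← mul_assoc, ← ENNReal.ofReal_mul (by positivity), hH.homog z hz R hR, ← mul_assoc,
      mul_inv_cancel₀ (by positivity), one_mul]
  simp only [Pi.mul_apply]
  rw [h3, lintegral_const_mul' _ _ ENNReal.ofReal_ne_top, h2, ← mul_assoc,
    ← ENNReal.ofReal_mul (by positivity), abs_of_pos (by positivity)]
  congr 2
  field_simp
  ring

/-- The squared `L²` norm of the increment `u - u(· - z)`. -/
def shiftSq {G : Type*} [AddGroup G] [MeasureSpace G] (u : G → ℝ) (z : G) : ℝ≥0∞ :=
  ∫⁻ w, ENNReal.ofReal ((u w - u (w - z)) ^ 2)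

/-- The Gagliardo energy of `u` with respect to the interaction measure `μ`. -/
def gag {G : Type*} [AddGroup G] [MeasureSpace G] (μ : Measure G) (u : G → ℝ) : ℝ≥0∞ :=
  ∫⁻ z, shiftSq u z ∂μ

variable {n : ℕ}

lemma parseval_torus {f : UnitAddTorus (Fin n) → ℂ} (hf : MemLp f 2 volume) :
    ∑' k : Fin n → ℤ, ENNReal.ofReal (‖∫ y, UnitAddTorus.mFourier (-k) y * f y‖ ^ 2) =
      ∫⁻ y, ENNReal.ofReal (‖f y‖ ^ 2) := by
  have hv : (volume : Measure UnitAddCircle) = AddCircle.haarAddCircle := by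
    rw [AddCircle.volume_eq_smul_haarAddCircle]; simp
  have hvol : (volume : Measure (UnitAddTorus (Fin n))) =
      Measure.pi fun _ => AddCircle.haarAddCircle :=
    congrArg (fun μ => Measure.pi fun _ : Fin n => μ) hv
  have hi : Integrable (fun y => ‖f y‖ ^ 2) volume := hf.integrable_norm_pow (by norm_num)
  rw [← ofReal_integral_eq_lintegral_ofReal hi (Eventually.of_forall fun y => by positivity)]
  rw [hvol] at hf ⊢
  have h := UnitAddTorus.hasSum_sq_mFourierCoeff (d := Fin n) hf.toLp
  have hc : ∀ k, UnitAddTorus.mFourierCoeff (hf.toLp : UnitAddTorus (Fin n) → ℂ) k =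
      ∫ y, UnitAddTorus.mFourier (-k) y * f y ∂(Measure.pi fun _ => AddCircle.haarAddCircle) := by
    intro k
    refine integral_congr_ae ?_
    filter_upwards [hf.coeFn_toLp] with y hy
    rw [hy, smul_eq_mul]
  have h2 : ∫ y, ‖f y‖ ^ 2 ∂(Measure.pi fun _ => AddCircle.haarAddCircle) =
      ∫ y, ‖(hf.toLp : UnitAddTorus (Fin n) → ℂ) y‖ ^ 2 ∂(Measure.pi fun _ => AddCircle.haarAddCircle) := by
    refine integral_congr_ae ?_
    filter_upwards [hf.coeFn_toLp] with y hy
    rw [hy]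
  refine Eq.trans ?_ (congrArg ENNReal.ofReal (h.tsum_eq.trans h2.symm))
  rw [ENNReal.ofReal_tsum_of_nonneg (fun _ => by positivity) h.summable]
  simp_rw [hc]

lemma norm_one_sub_chr_sq_le (θ : ℝ) : ‖1 - (Real.fourierChar θ : ℂ)‖ ^ 2 ≤ 4 * min 1 ((Real.pi * θ) ^ 2) := by
  have h1 : ‖1 - (Real.fourierChar θ : ℂ)‖ ≤ 2 := by
    refine (norm_sub_le _ _).trans ?_
    rw [norm_one, Circle.norm_coe]; norm_num
  have h2 : ‖1 - (Real.fourierChar θ : ℂ)‖ ≤ |2 * Real.pi * θ| := by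
    rw [norm_sub_rev, Real.fourierChar_apply]
    have := Real.norm_exp_I_mul_ofReal_sub_one_le (x := 2 * Real.pi * θ)
    rw [mul_comm] at this
    simpa using this
  rcases le_total 1 ((Real.pi * θ) ^ 2) with h | h
  · rw [min_eq_left h]
    nlinarith [norm_nonneg (1 - (Real.fourierChar θ : ℂ))]
  · rw [min_eq_right h]
    calc _ ≤ |2 * Real.pi * θ| ^ 2 := pow_le_pow_left₀ (norm_nonneg _) h2 2
      _ = _ := by rw [sq_abs]; ring

lemma mFourier_coe (k : Fin n → ℤ) (y : Fin n → ℝ) :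
    UnitAddTorus.mFourier k (fun i => (y i : UnitAddCircle)) = (Real.fourierChar (∑ i, k i * y i) : ℂ) := by
  simp only [UnitAddTorus.mFourier, ContinuousMap.coe_mk]
  rw [Real.fourierChar_apply]
  simp only [fourier_coe_apply, Complex.ofReal_one, div_one]
  rw [← Complex.exp_sum]
  congr 1
  push_cast
  rw [Finset.mul_sum, Finset.sum_mul]
  refine Finset.sum_congr rfl fun i _ => ?_
  ring

/-- With R = |ν| the integrand is at most a multiple of min(1, (R‖z‖)²). Rescaling z by R extracts
exactly one factor R and leaves the Lévy integral. -/
lemma symbol_bound {H : ℝ × (Fin n → ℝ) → ℝ} (hH : IsKernel H) :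
    ∃ C : ℝ≥0∞, C ≠ ⊤ ∧ ∀ (ξ : ℝ) (k : Fin n → ℤ),
      ∫⁻ w, ENNReal.ofReal (‖1 - UnitAddTorus.mFourier (-k) w.2 * chr w.1 ξ‖ ^ 2) ∂cylMeas H ≤
        C * ENNReal.ofReal ((ξ ^ 2 + ∑ i, (k i : ℝ) ^ 2) ^ (1 / 2 : ℝ)) := by
  -- The norm of z is a maximum, so the phase, a sum of n + 1 products of coordinates, is bounded by
  -- (n + 1)R‖z‖; π comes from the character.
  set b : ℝ := (Real.pi * (n + 1)) ^ 2 with hb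
  have hb1 : 1 ≤ b := by
    rw [hb]
    have : 1 ≤ Real.pi * (n + 1) := by
      have := Real.pi_gt_three
      nlinarith [(Nat.cast_nonneg n : (0:ℝ) ≤ n)]
    nlinarith
  refine ⟨ENNReal.ofReal (4 * b) * ∫⁻ z, ENNReal.ofReal (min 1 (‖z‖ ^ 2)) ∂kerMeas H,
    ENNReal.mul_ne_top ENNReal.ofReal_ne_top hH.lintegral_min_lt_top.ne, fun ξ k => ?_⟩
  set S := ξ ^ 2 + ∑ i, (k i : ℝ) ^ 2 with hS
  have hS0 : 0 ≤ S := by positivity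
  set R := S ^ (1 / 2 : ℝ) with hR
  have hR0 : 0 ≤ R := by positivity
  have hR2 : R ^ 2 = S := by
    rw [hR, ← Real.sqrt_eq_rpow, Real.sq_sqrt hS0]
  have hm : Measurable fun w : Cyl n =>
      ENNReal.ofReal (‖1 - UnitAddTorus.mFourier (-k) w.2 * chr w.1 ξ‖ ^ 2) := by
    have h1 : Measurable fun w : Cyl n => chr w.1 ξ := by
      unfold chr
      have := Real.continuous_fourierChar
      exact (by fun_prop : Continuous fun w : Cyl n => (Real.fourierChar (-(w.1 * ξ)) : ℂ)).measurable
    have h2 : Measurable fun w : Cyl n => UnitAddTorus.mFourier (-k) w.2 :=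
      ((UnitAddTorus.mFourier (-k)).continuous.comp continuous_snd).measurable
    fun_prop
  have hpt : ∀ z : ℝ × (Fin n → ℝ),
      ‖1 - UnitAddTorus.mFourier (-k) (proj z).2 * chr (proj z).1 ξ‖ ^ 2 ≤ 4 * b * min 1 ((R * ‖z‖) ^ 2) := by
    intro z
    have h1 : UnitAddTorus.mFourier (-k) (proj z).2 * chr (proj z).1 ξ =
        (Real.fourierChar (-((∑ i, k i * z.2 i) + z.1 * ξ)) : ℂ) := by
      rw [proj, mFourier_coe, chr, neg_add, AddChar.map_add_eq_mul, Circle.coe_mul]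
      simp
    rw [h1]
    refine (norm_one_sub_chr_sq_le _).trans ?_
    have h2 : |(∑ i, k i * z.2 i) + z.1 * ξ| ≤ (n + 1) * (R * ‖z‖) := by
      have hk : ∀ i, |(k i : ℝ)| ≤ R := fun i => by
        refine abs_le_of_sq_le_sq ?_ hR0
        rw [hR2, hS]
        have := Finset.single_le_sum (f := fun i => (k i : ℝ) ^ 2) (fun i _ => by positivity) (Finset.mem_univ i)
        have h3 := sq_nonneg ξ
        linarith
      have hξ : |ξ| ≤ R := by
        refine abs_le_of_sq_le_sq ?_ hR0
        rw [hR2, hS]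
        have : 0 ≤ ∑ i, (k i : ℝ) ^ 2 := by positivity
        linarith
      have hz1 : |z.1| ≤ ‖z‖ := norm_fst_le z
      have hz2 : ∀ i, |z.2 i| ≤ ‖z‖ := fun i => (norm_le_pi_norm z.2 i).trans (norm_snd_le z)
      calc _ ≤ (∑ i, |k i * z.2 i|) + |z.1 * ξ| :=
            (abs_add_le _ _).trans (by gcongr; exact Finset.abs_sum_le_sum_abs _ _)
        _ ≤ (∑ _i : Fin n, R * ‖z‖) + ‖z‖ * R := by
            gcongr with i
            · rw [abs_mul]; exact mul_le_mul (hk i) (hz2 i) (abs_nonneg _) hR0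
            · rw [abs_mul]; exact mul_le_mul hz1 hξ (abs_nonneg _) (norm_nonneg _)
        _ = _ := by simp; ring
    have h3 : (Real.pi * (-((∑ i, k i * z.2 i) + z.1 * ξ))) ^ 2 ≤ b * (R * ‖z‖) ^ 2 := by
      rw [mul_neg, neg_sq, hb, ← mul_pow, ← sq_abs, abs_mul, abs_of_pos Real.pi_pos, mul_assoc]
      gcongr
    rw [mul_assoc]
    gcongr
    rcases le_total 1 ((R * ‖z‖) ^ 2) with h | h
    · rw [min_eq_left h, mul_one]
      exact (min_le_left _ _).trans hb1
    · rw [min_eq_right h]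
      exact (min_le_right _ _).trans h3
  rw [← hH.map_proj, lintegral_map hm measurable_proj]
  -- Dilation requires R > 0. At zero frequency both sides vanish.
  rcases hR0.eq_or_lt with h0 | h0
  · refine (lintegral_mono fun z => ENNReal.ofReal_le_ofReal (hpt z)).trans ?_
    simp [← h0]
  · have hsc := lintegral_scale_kerMeas hH h0 (f := fun z => ENNReal.ofReal (min 1 (‖z‖ ^ 2))) (by fun_prop)
    calc _ ≤ ∫⁻ z, ENNReal.ofReal (4 * b) * ENNReal.ofReal (min 1 (‖R • z‖ ^ 2)) ∂kerMeas H := by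
          refine lintegral_mono fun z => ?_
          rw [← ENNReal.ofReal_mul (by positivity), norm_smul, Real.norm_of_nonneg hR0]
          exact ENNReal.ofReal_le_ofReal (hpt z)
      _ = _ := by
          rw [lintegral_const_mul' _ _ ENNReal.ofReal_ne_top, hsc]
          ring

end

/-! ### Functions in H^{1/2} have finite Gagliardo energy -/

section

variable {n : ℕ}

lemma memLp_ae_slice {v : Cyl n → ℝ} (hv : MemLp v 2 volume) :
    ∀ᵐ x : ℝ, MemLp (fun y => v (x, y)) 2 volume := by
  have h2 : Integrable (fun w => v w ^ 2) (volume.prod volume) := hv.integrable_sq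
  have hm : AEStronglyMeasurable v (volume.prod volume) := hv.aestronglyMeasurable
  filter_upwards [h2.prod_right_ae, hm.prodMk_left] with x h1 h3
  exact (memLp_two_iff_integrable_sq h3).2 h1

/-- A translation by z moves the k-th mode by z₁ and multiplies it by a character. The restriction
to almost every x is needed because only almost every slice of v is square integrable. -/
lemma fourierMode_shift {v : Cyl n → ℝ} (hv : MemLp v 2 volume) (z : Cyl n) (k : Fin n → ℤ) :
    ∀ᵐ x : ℝ, ∫ y, UnitAddTorus.mFourier (-k) y * ((v (x, y) - v (x - z.1, y - z.2) : ℝ) : ℂ) =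
      fourierMode v k x - UnitAddTorus.mFourier (-k) z.2 * fourierMode v k (x - z.1) := by
  have h1 := memLp_ae_slice hv
  have h2 := (measurePreserving_sub_right volume z.1).quasiMeasurePreserving.ae h1
  filter_upwards [h1, h2] with x hx hx'
  have hint : ∀ g : UnitAddTorus (Fin n) → ℝ, MemLp g 2 volume →
      Integrable (fun y => UnitAddTorus.mFourier (-k) y * (g y : ℂ)) := by
    intro g hg
    have hg1 : Integrable g := hg.integrable (by norm_num)
    refine hg1.ofReal.bdd_mul (c := 1) (UnitAddTorus.mFourier (-k)).continuous.aestronglyMeasurable ?_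
    refine Eventually.of_forall fun y => ?_
    exact ((UnitAddTorus.mFourier (-k)).norm_coe_le_norm y).trans UnitAddTorus.mFourier_norm.le
  have hmp := measurePreserving_sub_right (volume : Measure (UnitAddTorus (Fin n))) z.2
  have hs : MemLp (fun y => v (x - z.1, y - z.2)) 2 volume := hx'.comp_measurePreserving hmp
  simp only [Complex.ofReal_sub, mul_sub]
  rw [integral_sub (hint _ hx) (hint _ hs)]
  congr 1
  have h3 := integral_sub_right_eq_self (μ := (volume : Measure (UnitAddTorus (Fin n))))
    (fun y => UnitAddTorus.mFourier (-k) (y + z.2) * (v (x - z.1, y) : ℂ)) z.2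
  simp only [sub_add_cancel] at h3
  rw [h3, fourierMode, ← integral_const_mul]
  refine integral_congr_ae (Eventually.of_forall fun y => ?_)
  have h4 : UnitAddTorus.mFourier (-k) (y + z.2) =
      UnitAddTorus.mFourier (-k) y * UnitAddTorus.mFourier (-k) z.2 := by
    simp only [UnitAddTorus.mFourier, ContinuousMap.coe_mk, Pi.add_apply, ← Finset.prod_mul_distrib]
    refine Finset.prod_congr rfl fun i _ => ?_
    rw [fourier_apply, fourier_apply, fourier_apply, smul_add, AddCircle.toCircle_add, Circle.coe_mul]
  simp only [h4]
  ring

/-- Parseval on the torus for almost every x, followed by Plancherel on the line for every mode. -/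
lemma shiftSq_eq_tsum {v : Cyl n → ℝ} (hv : MemLp v 2 volume)
    (hk : ∀ k : Fin n → ℤ, MemLp (fourierMode v k) 2 (volume : Measure ℝ)) (z : Cyl n) :
    shiftSq v z = ∑' k : Fin n → ℤ, ∫⁻ ξ, ENNReal.ofReal (‖1 - UnitAddTorus.mFourier (-k) z.2 * chr z.1 ξ‖ ^ 2) *
      ENNReal.ofReal (‖ft (fourierMode v k) ξ‖ ^ 2) := by
  have hs : MemLp (fun w => v w - v (w - z)) 2 volume :=
    hv.sub (hv.comp_measurePreserving (measurePreserving_sub_right volume z))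
  have hsm : AEMeasurable (fun w : ℝ × UnitAddTorus (Fin n) => ENNReal.ofReal ((v w - v (w - z)) ^ 2))
    (volume.prod volume) := (hs.aestronglyMeasurable.aemeasurable.pow_const 2).ennreal_ofReal
  have hmode : ∀ k : Fin n → ℤ,
      MemLp (fun x => fourierMode v k x - UnitAddTorus.mFourier (-k) z.2 * fourierMode v k (x - z.1)) 2 volume :=
    fun k => (hk k).sub ((memLp_comp_sub (hk k) z.1).const_mul _)
  rw [shiftSq, Measure.volume_eq_prod, lintegral_prod _ hsm]
  have h1 : ∀ᵐ x : ℝ, ∫⁻ y, ENNReal.ofReal ((v (x, y) - v ((x, y) - z)) ^ 2) =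
      ∑' k : Fin n → ℤ, ENNReal.ofReal
        (‖fourierMode v k x - UnitAddTorus.mFourier (-k) z.2 * fourierMode v k (x - z.1)‖ ^ 2) := by
    have hae := ae_all_iff.2 (fourierMode_shift hv z)
    filter_upwards [memLp_ae_slice hs, hae] with x hx hx2
    rw [← tsum_congr fun k => congrArg (fun c : ℂ => ENNReal.ofReal (‖c‖ ^ 2)) (hx2 k)]
    rw [parseval_torus (f := fun y => ((v (x, y) - v (x - z.1, y - z.2) : ℝ) : ℂ)) hx.ofReal]
    refine lintegral_congr fun y => ?_
    rw [Complex.norm_real, Real.norm_eq_abs, sq_abs]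
    rfl
  rw [lintegral_congr_ae h1, lintegral_tsum fun k =>
    ((hmode k).aestronglyMeasurable.norm.aemeasurable.pow_const 2).ennreal_ofReal]
  refine tsum_congr fun k => ?_
  rw [← lintegral_ft_sq (hmode k)]
  refine lintegral_congr_ae ?_
  filter_upwards [ft_sub (hk k) ((memLp_comp_sub (hk k) z.1).const_mul (UnitAddTorus.mFourier (-k) z.2)),
    ft_const_mul (memLp_comp_sub (hk k) z.1) (UnitAddTorus.mFourier (-k) z.2), ft_comp_sub (hk k) z.1] with ξ e1 e2 e3
  rw [e1, e2, e3, ← ENNReal.ofReal_mul (by positivity), ← mul_pow, ← norm_mul]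
  congr 3
  ring

/-- Tonelli moves the z-integral inside, where it produces the symbol of K, and the symbol is at
most C|ν|. -/
theorem gag_lt_top_of_memHs {H : ℝ × (Fin n → ℝ) → ℝ} (hH : IsKernel H) {v : Cyl n → ℝ}
    (hv : MemHs (1 / 2) v) : gag (cylMeas H) v < ⊤ := by
  obtain ⟨hv2, hk, hsum⟩ := hv
  obtain ⟨C, hC, hb⟩ := symbol_bound hH
  have hchr : ∀ k : Fin n → ℤ, Measurable fun p : Cyl n × ℝ =>
      ENNReal.ofReal (‖1 - UnitAddTorus.mFourier (-k) p.1.2 * chr p.1.1 p.2‖ ^ 2) := by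
    intro k
    have h1 : Measurable fun p : Cyl n × ℝ => chr p.1.1 p.2 := by
      unfold chr
      have := Real.continuous_fourierChar
      exact (by fun_prop : Continuous fun w : Cyl n × ℝ => (Real.fourierChar (-(w.1.1 * w.2)) : ℂ)).measurable
    have h2 : Measurable fun p : Cyl n × ℝ => UnitAddTorus.mFourier (-k) p.1.2 :=
      ((UnitAddTorus.mFourier (-k)).continuous.comp (by fun_prop)).measurable
    fun_prop
  have hft : ∀ k : Fin n → ℤ, AEMeasurable fun ξ => ENNReal.ofReal (‖ft (fourierMode v k) ξ‖ ^ 2) :=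
    fun k => ((ft_memLp _).aestronglyMeasurable.norm.aemeasurable.pow_const 2).ennreal_ofReal
  have hprod : ∀ k : Fin n → ℤ, AEMeasurable (fun p : Cyl n × ℝ =>
      ENNReal.ofReal (‖1 - UnitAddTorus.mFourier (-k) p.1.2 * chr p.1.1 p.2‖ ^ 2) *
      ENNReal.ofReal (‖ft (fourierMode v k) p.2‖ ^ 2)) ((cylMeas H).prod volume) :=
    fun k => (hchr k).aemeasurable.mul (hft k).comp_snd
  unfold gag
  simp_rw [shiftSq_eq_tsum hv2 hk]
  rw [lintegral_tsum fun k => (hprod k).lintegral_prod_right']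
  refine lt_of_le_of_lt ?_ (ENNReal.mul_lt_top hC.lt_top hsum)
  rw [← ENNReal.tsum_mul_left]
  refine ENNReal.tsum_le_tsum fun k => ?_
  rw [lintegral_lintegral_swap (hprod k), ← lintegral_const_mul' _ _ hC]
  refine lintegral_mono fun ξ => ?_
  simp only
  rw [lintegral_mul_const' _ _ ENNReal.ofReal_ne_top, ft_of_memLp (hk k), ENNReal.ofReal_mul (by positivity),
    ← mul_assoc]
  gcongr
  exact hb ξ k

end

/-! ### Gagliardo calculus and profiles on the line -/

section

set_option linter.unusedSectionVars false

section Gagliardo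

variable {G : Type*} [AddGroup G] [MeasureSpace G] [MeasurableAdd₂ G] [MeasurableNeg G]
  [SFinite (volume : Measure G)] [(volume : Measure G).IsAddRightInvariant]

/-- Null sets pull back to null sets along (w, z) ↦ w - z, whatever the measure in z is, so
increments are meaningful for classes modulo null sets. -/
lemma quasiMeasurePreserving_sub_fst (μ : Measure G) [SFinite μ] :
    Measure.QuasiMeasurePreserving (fun q : G × G => q.1 - q.2) (volume.prod μ) volume :=
  Measure.quasiMeasurePreserving_fst.comp
    (measurePreserving_sub_prod (volume : Measure G) μ).quasiMeasurePreserving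

lemma aestronglyMeasurable_increment (μ : Measure G) [SFinite μ] {u : G → ℝ}
    (hu : AEStronglyMeasurable u) :
    AEStronglyMeasurable (fun q : G × G => u q.1 - u (q.1 - q.2)) (volume.prod μ) :=
  (hu.comp_quasiMeasurePreserving Measure.quasiMeasurePreserving_fst).sub
    (hu.comp_quasiMeasurePreserving (quasiMeasurePreserving_sub_fst μ))

lemma gag_eq_lintegral (μ : Measure G) [SFinite μ] {u : G → ℝ} (hu : AEStronglyMeasurable u) :
    gag μ u = ∫⁻ q, ENNReal.ofReal ((u q.1 - u (q.1 - q.2)) ^ 2) ∂(volume.prod μ) := by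
  rw [lintegral_prod_symm _
    ((aestronglyMeasurable_increment μ hu).aemeasurable.pow_const 2).ennreal_ofReal]
  rfl

lemma integrable_increment_sq (μ : Measure G) [SFinite μ] {u : G → ℝ} (hu : AEStronglyMeasurable u)
    (hg : gag μ u < ⊤) :
    Integrable (fun q : G × G => (u q.1 - u (q.1 - q.2)) ^ 2) (volume.prod μ) := by
  refine ⟨(aestronglyMeasurable_increment μ hu).pow 2, ?_⟩
  rw [hasFiniteIntegral_iff_ofReal (Eventually.of_forall fun q => sq_nonneg _), ← gag_eq_lintegral μ hu]
  exact hg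

lemma integral_increment_sq (μ : Measure G) [SFinite μ] {u : G → ℝ} (hu : AEStronglyMeasurable u) :
    ∫ q : G × G, (u q.1 - u (q.1 - q.2)) ^ 2 ∂(volume.prod μ) = (gag μ u).toReal := by
  rw [integral_eq_lintegral_of_nonneg_ae (Eventually.of_forall fun q => sq_nonneg _)
    ((aestronglyMeasurable_increment μ hu).pow 2), ← gag_eq_lintegral μ hu]

lemma integrable_increment_mul (μ : Measure G) [SFinite μ] {u v : G → ℝ} (hu : AEStronglyMeasurable u)
    (hv : AEStronglyMeasurable v) (hgu : gag μ u < ⊤) (hgv : gag μ v < ⊤) :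
    Integrable (fun q : G × G => (u q.1 - u (q.1 - q.2)) * (v q.1 - v (q.1 - q.2))) (volume.prod μ) := by
  refine ((integrable_increment_sq μ hu hgu).add (integrable_increment_sq μ hv hgv)).mono'
    ((aestronglyMeasurable_increment μ hu).mul (aestronglyMeasurable_increment μ hv))
    (Eventually.of_forall fun q => ?_)
  rw [Real.norm_eq_abs, abs_le]
  simp only [Pi.add_apply]
  constructor <;> nlinarith [sq_nonneg ((u q.1 - u (q.1 - q.2)) - (v q.1 - v (q.1 - q.2))),
    sq_nonneg ((u q.1 - u (q.1 - q.2)) + (v q.1 - v (q.1 - q.2)))]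

lemma shiftSq_le_two_add {u v w : G → ℝ} (hu : AEStronglyMeasurable u) (z : G)
    (h : ∀ x, w x = u x + v x) :
    shiftSq w z ≤ 2 * shiftSq u z + 2 * shiftSq v z := by
  have hm : AEMeasurable (fun x => 2 * ENNReal.ofReal ((u x - u (x - z)) ^ 2)) volume := by
    refine AEMeasurable.const_mul (AEMeasurable.ennreal_ofReal ?_) _
    exact (hu.sub (hu.comp_measurePreserving (measurePreserving_sub_right volume z))).aemeasurable.pow_const 2
  unfold shiftSq
  rw [← lintegral_const_mul' _ _ ENNReal.ofNat_ne_top, ← lintegral_const_mul' _ _ ENNReal.ofNat_ne_top,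
    ← lintegral_add_left' hm]
  refine lintegral_mono fun x => ?_
  simp only
  rw [← ENNReal.ofReal_ofNat, ← ENNReal.ofReal_mul (by norm_num), ← ENNReal.ofReal_mul (by norm_num),
    ← ENNReal.ofReal_add (by positivity) (by positivity), h, h]
  refine ENNReal.ofReal_le_ofReal ?_
  nlinarith [sq_nonneg ((u x - u (x - z)) - (v x - v (x - z)))]

lemma gag_lt_top_add (μ : Measure G) [SFinite μ] {u v : G → ℝ} (hu : AEStronglyMeasurable u)
    (hv : AEStronglyMeasurable v) (hgu : gag μ u < ⊤) (hgv : gag μ v < ⊤) :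
    gag μ (fun x => u x + v x) < ⊤ := by
  rw [gag_eq_lintegral μ (u := fun x => u x + v x) (hu.add hv)]
  have h := ((integrable_increment_sq μ hu hgu).const_mul 2).add ((integrable_increment_sq μ hv hgv).const_mul 2)
  refine lt_of_le_of_lt (lintegral_mono fun q => ENNReal.ofReal_le_ofReal ?_) h.lintegral_lt_top
  simp only [Pi.add_apply]
  nlinarith [sq_nonneg ((u q.1 - u (q.1 - q.2)) - (v q.1 - v (q.1 - q.2)))]

lemma gag_lt_top_const_mul (μ : Measure G) {u : G → ℝ}
    (hgu : gag μ u < ⊤) (t : ℝ) : gag μ (fun x => t * u x) < ⊤ := by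
  have : gag μ (fun x => t * u x) = ENNReal.ofReal (t ^ 2) * gag μ u := by
    unfold gag shiftSq
    simp_rw [← mul_sub, mul_pow, ENNReal.ofReal_mul (sq_nonneg t)]
    simp_rw [lintegral_const_mul' _ _ ENNReal.ofReal_ne_top]
  rw [this]
  exact ENNReal.mul_lt_top ENNReal.ofReal_lt_top hgu

end Gagliardo

lemma lintegral_scale_lineMeas (c : ℝ) {R : ℝ} (hR : 0 < R) {f : ℝ → ℝ≥0∞} (hf : Measurable f) :
    ∫⁻ z, f (R * z) ∂lineMeas c = ENNReal.ofReal R * ∫⁻ z, f z ∂lineMeas c := by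
  have hfR : Measurable fun z => f (R * z) := hf.comp (by fun_prop)
  have hmc : Measurable fun x : ℝ => ENNReal.ofReal (c / x ^ 2) := by fun_prop
  rw [lineMeas, lintegral_withDensity_eq_lintegral_mul _ hmc hfR,
    lintegral_withDensity_eq_lintegral_mul _ hmc hf]
  have hm : Measurable fun z => ENNReal.ofReal (c / z ^ 2) * f z := hmc.mul hf
  have h2 : ∫⁻ z, ENNReal.ofReal (c / (R * z) ^ 2) * f (R * z) =
      ENNReal.ofReal |R⁻¹| * ∫⁻ z, ENNReal.ofReal (c / z ^ 2) * f z := by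
    rw [← lintegral_map (μ := volume) (g := fun y : ℝ => R * y) hm (by fun_prop),
      Real.map_volume_mul_left hR.ne']
    simp
  have h3 : ∫⁻ z, ENNReal.ofReal (c / z ^ 2) * f (R * z) =
      ∫⁻ z, ENNReal.ofReal (R ^ 2) * (ENNReal.ofReal (c / (R * z) ^ 2) * f (R * z)) := by
    refine lintegral_congr fun z => ?_
    rw [← mul_assoc, ← ENNReal.ofReal_mul (by positivity), mul_pow]
    congr 2
    rcases eq_or_ne z 0 with rfl | hz
    · simp
    · field_simp
  simp only [Pi.mul_apply]
  rw [h3, lintegral_const_mul' _ _ ENNReal.ofReal_ne_top, h2, ← mul_assoc,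
    ← ENNReal.ofReal_mul (by positivity), abs_of_pos (by positivity)]
  congr 2
  field_simp

/-- The truncated second moment `∫ min(1, z²) c z⁻² dz`. -/
def moment (c : ℝ) : ℝ := (∫⁻ x, ENNReal.ofReal (min 1 (x ^ 2)) ∂lineMeas c).toReal

/-- The finiteness of the truncated second moment. -/
def FiniteMoment (c : ℝ) : Prop := ∫⁻ x, ENNReal.ofReal (min 1 (x ^ 2)) ∂lineMeas c < ⊤

lemma moment_nonneg (c : ℝ) : 0 ≤ moment c := ENNReal.toReal_nonneg

/-- By scaling, jumps of length at least r have mass at most `moment c`/r. The factor 4 covers both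
ranges: 1 + |x| ≤ 4 for |x| ≤ 3, and 1 + |x| ≤ 4(|x| - 2) for |x| ≥ 3. -/
lemma lintegral_tail_le {c : ℝ} (hc : FiniteMoment c) (x : ℝ) :
    ∫⁻ z in {z | |x| - 2 ≤ |z|}, ENNReal.ofReal (min 1 (z ^ 2)) ∂lineMeas c ≤
      ENNReal.ofReal (4 * moment c * (1 + |x|)⁻¹) := by
  have hI : ∫⁻ x, ENNReal.ofReal (min 1 (x ^ 2)) ∂lineMeas c = ENNReal.ofReal (moment c) :=
    (ENNReal.ofReal_toReal hc.ne).symm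
  have h0 := moment_nonneg c
  rcases le_total |x| 3 with hx | hx
  · refine (setLIntegral_le_lintegral _ _).trans ?_
    rw [hI]
    refine ENNReal.ofReal_le_ofReal ?_
    rw [← div_eq_mul_inv, le_div_iff₀ (by positivity)]
    nlinarith
  · set r := |x| - 2
    have hr : 1 ≤ r := by simp only [r]; linarith
    have hs : MeasurableSet {z : ℝ | r ≤ |z|} := measurableSet_le measurable_const (by fun_prop)
    rw [← lintegral_indicator hs]
    have hm : Measurable ({z : ℝ | 1 ≤ |z|}.indicator fun _ => (1 : ℝ≥0∞)) :=
      measurable_const.indicator (measurableSet_le measurable_const (by fun_prop))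
    have hsc := lintegral_scale_lineMeas c (R := r⁻¹) (by positivity) hm
    have hrpos : 0 < r := by linarith
    calc _ ≤ ∫⁻ z, ({z : ℝ | 1 ≤ |z|}.indicator fun _ => (1 : ℝ≥0∞)) (r⁻¹ * z) ∂lineMeas c := by
          refine lintegral_mono fun z => ?_
          by_cases hz : r ≤ |z|
          · rw [Set.indicator_of_mem (by exact hz), Set.indicator_of_mem]
            · rw [← ENNReal.ofReal_one]
              exact ENNReal.ofReal_le_ofReal (min_le_left _ _)
            · change 1 ≤ |r⁻¹ * z|
              rw [abs_mul, abs_of_pos (by positivity), inv_mul_eq_div, le_div_iff₀ hrpos, one_mul]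
              exact hz
          · rw [Set.indicator_of_notMem (by exact hz)]
            exact zero_le
      _ ≤ ENNReal.ofReal r⁻¹ * ENNReal.ofReal (moment c) := by
          rw [hsc, ← hI]
          gcongr with z
          by_cases hz : 1 ≤ |z|
          · rw [Set.indicator_of_mem (by exact hz), min_eq_left, ENNReal.ofReal_one]
            rw [← sq_abs]; nlinarith
          · rw [Set.indicator_of_notMem (by exact hz)]
            exact zero_le
      _ ≤ _ := by
          rw [← ENNReal.ofReal_mul (by positivity)]
          refine ENNReal.ofReal_le_ofReal ?_
          rw [mul_comm 4, mul_assoc, mul_comm (moment c)]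
          gcongr
          rw [← div_eq_mul_inv, inv_eq_one_div, div_le_div_iff₀ hrpos (by positivity)]
          simp only [r]; linarith

/-- Profiles with bounded first and second differences that are locally constant away from a
bounded interval. -/
structure IsBump (B : ℝ) (ζ : ℝ → ℝ) : Prop where
  meas : Measurable ζ
  first : ∀ x z, |ζ x - ζ (x - z)| ≤ B * min 1 |z|
  second : ∀ x z, |2 * ζ x - ζ (x + z) - ζ (x - z)| ≤ B * min 1 (z ^ 2)
  -- The margin is 2 and not 1 so that the increments η(·+h) - η with |h| ≤ 1, which vanish only for
  -- |x| > 2, are included.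
  far : ∀ x z, |z| < |x| - 2 → ζ x = ζ (x - z)

/-- The one-dimensional nonlocal operator, written with second differences. -/
def Lop (c : ℝ) (ζ : ℝ → ℝ) (x : ℝ) : ℝ :=
  1 / 2 * ∫ z, (2 * ζ x - ζ (x + z) - ζ (x - z)) ∂lineMeas c

namespace IsBump

variable {B c : ℝ} {ζ : ℝ → ℝ}

lemma nonneg (h : IsBump B ζ) : 0 ≤ B := by
  have := (abs_nonneg _).trans (h.first 0 1)
  simpa using this

lemma second_le (h : IsBump B ζ) (x z : ℝ) :
    |2 * ζ x - ζ (x + z) - ζ (x - z)| ≤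
      {z : ℝ | |x| - 2 ≤ |z|}.indicator (fun z => B * min 1 (z ^ 2)) z := by
  by_cases hz : |x| - 2 ≤ |z|
  · rw [Set.indicator_of_mem (by exact hz)]
    exact h.second x z
  · rw [Set.indicator_of_notMem (by exact hz)]
    rw [not_le] at hz
    have h1 := h.far x z hz
    have h2 := h.far x (-z) (by rwa [abs_neg])
    rw [sub_neg_eq_add] at h2
    rw [← h1, ← h2]
    simp [two_mul]

lemma first_le (h : IsBump B ζ) (x z : ℝ) (hz1 : 1 ≤ |z|) :
    |ζ x - ζ (x - z)| ≤ {z : ℝ | |x| - 2 ≤ |z|}.indicator (fun z => B * min 1 (z ^ 2)) z := by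
  by_cases hz : |x| - 2 ≤ |z|
  · rw [Set.indicator_of_mem (by exact hz)]
    refine (h.first x z).trans ?_
    rw [min_eq_left hz1, min_eq_left]
    rw [← sq_abs]; nlinarith
  · rw [Set.indicator_of_notMem (by exact hz)]
    rw [not_le] at hz
    rw [h.far x z hz]; simp

lemma lintegral_indicator_le (h : IsBump B ζ) (hc : FiniteMoment c) (x : ℝ) :
    ∫⁻ z, ENNReal.ofReal ({z : ℝ | |x| - 2 ≤ |z|}.indicator (fun z => B * min 1 (z ^ 2)) z) ∂lineMeas c ≤
      ENNReal.ofReal (4 * B * moment c * (1 + |x|)⁻¹) := by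
  have hs : MeasurableSet {z : ℝ | |x| - 2 ≤ |z|} := measurableSet_le measurable_const (by fun_prop)
  have h1 := lintegral_tail_le hc x
  rw [← lintegral_indicator hs] at h1
  calc _ = ENNReal.ofReal B * _ := ?_
    _ ≤ ENNReal.ofReal B * _ := mul_le_mul_right h1 _
    _ = _ := by
      rw [← ENNReal.ofReal_mul h.nonneg]
      congr 1; ring
  rw [← lintegral_const_mul' _ _ ENNReal.ofReal_ne_top]
  refine lintegral_congr fun z => ?_
  by_cases hz : |x| - 2 ≤ |z|
  · rw [Set.indicator_of_mem (by exact hz), Set.indicator_of_mem (by exact hz), ENNReal.ofReal_mul h.nonneg]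
  · rw [Set.indicator_of_notMem (by exact hz), Set.indicator_of_notMem (by exact hz)]
    simp

/-- Far away only the jumps that reach back to the transition region contribute, and their mass is
O(1/|x|). This decay is what makes `Lop c ζ` square integrable. -/
lemma abs_Lop_le (h : IsBump B ζ) (hc : FiniteMoment c) (x : ℝ) :
    |Lop c ζ x| ≤ 2 * B * moment c * (1 + |x|)⁻¹ := by
  have h0 := h.nonneg
  have h1 := moment_nonneg c
  rw [Lop, abs_mul, abs_of_pos (by norm_num : (0 : ℝ) < 1 / 2)]
  have : |∫ z, (2 * ζ x - ζ (x + z) - ζ (x - z)) ∂lineMeas c| ≤ 4 * B * moment c * (1 + |x|)⁻¹ := by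
    refine (ENNReal.ofReal_le_ofReal_iff (by positivity)).1 ?_
    rw [← Real.norm_eq_abs, ofReal_norm]
    refine (enorm_integral_le_lintegral_enorm _).trans ?_
    refine le_trans (lintegral_mono fun z => ?_) (h.lintegral_indicator_le hc x)
    rw [← ofReal_norm]
    exact ENNReal.ofReal_le_ofReal (h.second_le x z)
  linarith

lemma measurable_second (h : IsBump B ζ) :
    Measurable fun p : ℝ × ℝ => 2 * ζ p.1 - ζ (p.1 + p.2) - ζ (p.1 - p.2) := by
  have := h.meas
  fun_prop

lemma measurable_Lop (h : IsBump B ζ) (c : ℝ) : Measurable (Lop c ζ) := by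
  have := (h.measurable_second.stronglyMeasurable.integral_prod_right' (ν := lineMeas c)).measurable
  exact this.const_mul _

end IsBump

lemma memLp_inv_one_add_abs : MemLp (fun x : ℝ => (1 + |x|)⁻¹) 2 volume := by
  rw [memLp_two_iff_integrable_sq (by fun_prop)]
  have := integrable_one_add_norm (μ := (volume : Measure ℝ)) (r := 2) (by simp)
  refine this.congr (Eventually.of_forall fun x => ?_)
  simp only [Real.norm_eq_abs]
  rw [Real.rpow_neg (by positivity), inv_pow]
  norm_num

lemma IsBump.memLp_Lop {B c : ℝ} {ζ : ℝ → ℝ} (h : IsBump B ζ) (hc : FiniteMoment c) :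
    MemLp (Lop c ζ) 2 volume := by
  refine MemLp.of_le_mul (c := 2 * B * moment c) memLp_inv_one_add_abs
    (h.measurable_Lop c).aestronglyMeasurable (Eventually.of_forall fun x => ?_)
  rw [Real.norm_eq_abs, Real.norm_of_nonneg (by positivity)]
  exact h.abs_Lop_le hc x

variable {n : ℕ}

lemma measurePreserving_fst_cyl : MeasurePreserving (Prod.fst : Cyl n → ℝ) :=
  measurePreserving_fst (μ := (volume : Measure ℝ)) (ν := (volume : Measure (UnitAddTorus (Fin n))))

lemma memLp_lift {f : ℝ → ℝ} (hf : MemLp f 2 volume) : MemLp (fun w : Cyl n => f w.1) 2 volume :=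
  hf.comp_measurePreserving measurePreserving_fst_cyl

lemma memLp_of_bounded_support {f : ℝ → ℝ} (hf : Measurable f) {C R : ℝ} (hC : ∀ x, |f x| ≤ C)
    (hR : ∀ x, R < |x| → f x = 0) : MemLp f 2 volume := by
  have h1 : MemLp ((Set.Icc (-R) R).indicator fun _ => C) 2 (volume : Measure ℝ) :=
    memLp_indicator_const 2 measurableSet_Icc C (Or.inr (by simp))
  refine h1.of_le hf.aestronglyMeasurable (Eventually.of_forall fun x => ?_)
  by_cases hx : |x| ≤ R
  · rw [Set.indicator_of_mem (show x ∈ Set.Icc (-R) R from abs_le.1 hx)]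
    exact (hC x).trans (le_abs_self C)
  · rw [hR x (not_le.1 hx)]
    simp

end

/-! ### Pairing a perturbation with the profile -/

section

variable {n : ℕ} {H : ℝ × (Fin n → ℝ) → ℝ}

lemma IsKernel.finiteMoment (hH : IsKernel H) : FiniteMoment (kerConst H) :=
  hH.lintegral_lineMeas_min_lt_top

lemma IsKernel.lintegral_fst (hH : IsKernel H) {f : ℝ → ℝ≥0∞} (hf : Measurable f) :
    ∫⁻ w, f w.1 ∂cylMeas H = ∫⁻ x, f x ∂lineMeas (kerConst H) := by
  rw [← hH.map_fst, lintegral_map hf measurable_fst]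

lemma IsKernel.integral_fst (hH : IsKernel H) {f : ℝ → ℝ} (hf : Measurable f) :
    ∫ w, f w.1 ∂cylMeas H = ∫ x, f x ∂lineMeas (kerConst H) := by
  rw [← hH.map_fst, integral_map measurable_fst.aemeasurable hf.aestronglyMeasurable]

/-- The weight dominating differences of a profile. -/
def tailWeight (B x z : ℝ) : ℝ := {z : ℝ | |x| - 2 ≤ |z|}.indicator (fun z => B * min 1 (z ^ 2)) z

lemma measurable_tailWeight (B : ℝ) : Measurable fun p : ℝ × ℝ => tailWeight B p.1 p.2 := by
  have : (fun p : ℝ × ℝ => tailWeight B p.1 p.2) =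
      {p : ℝ × ℝ | |p.1| - 2 ≤ |p.2|}.indicator (fun p => B * min 1 (p.2 ^ 2)) := by
    ext p
    simp only [tailWeight, Set.indicator_apply]
    rfl
  rw [this]
  exact Measurable.indicator (by fun_prop) (measurableSet_le (by fun_prop) (by fun_prop))

lemma tailWeight_nonneg {B : ℝ} (hB : 0 ≤ B) (x z : ℝ) : 0 ≤ tailWeight B x z :=
  Set.indicator_nonneg (fun _ _ => by positivity) _

/-- A square integrable function times the tail weight is integrable over all pairs. -/
lemma IsBump.integrable_mul_tailWeight {B : ℝ} {ζ : ℝ → ℝ} (h : IsBump B ζ) (hH : IsKernel H) {v : Cyl n → ℝ}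
    (hv : MemLp v 2 volume) :
    Integrable (fun q : Cyl n × Cyl n => |v q.1| * tailWeight B q.1.1 q.2.1) (volume.prod (cylMeas H)) := by
  have hB := h.nonneg
  have hm := moment_nonneg (kerConst H)
  have hmeas : Measurable fun q : Cyl n × Cyl n => tailWeight B q.1.1 q.2.1 :=
    (measurable_tailWeight B).comp (by fun_prop : Measurable fun q : Cyl n × Cyl n => (q.1.1, q.2.1))
  have hvm : AEMeasurable (fun q : Cyl n × Cyl n => |v q.1|) (volume.prod (cylMeas H)) :=
    (hv.aestronglyMeasurable.aemeasurable.norm).comp_fst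
  refine ⟨(hvm.mul hmeas.aemeasurable).aestronglyMeasurable, ?_⟩
  rw [hasFiniteIntegral_iff_ofReal (Eventually.of_forall fun q =>
    mul_nonneg (abs_nonneg _) (tailWeight_nonneg hB _ _))]
  rw [lintegral_prod (fun q : Cyl n × Cyl n => ENNReal.ofReal (|v q.1| * tailWeight B q.1.1 q.2.1))
    (hvm.mul hmeas.aemeasurable).ennreal_ofReal]
  have hint : Integrable (fun w : Cyl n => |v w| * (4 * B * moment (kerConst H) * (1 + |w.1|)⁻¹)) := by
    have h1 : MemLp (fun w : Cyl n => 4 * B * moment (kerConst H) * (1 + |w.1|)⁻¹) 2 volume :=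
      (memLp_lift memLp_inv_one_add_abs).const_mul _
    exact MemLp.integrable_mul hv.abs h1
  refine lt_of_le_of_lt (lintegral_mono fun w => ?_) hint.lintegral_lt_top
  simp only
  simp_rw [ENNReal.ofReal_mul (abs_nonneg (v w))]
  rw [lintegral_const_mul' _ _ ENNReal.ofReal_ne_top]
  gcongr
  rw [hH.lintegral_fst (f := fun z => ENNReal.ofReal (tailWeight B w.1 z))
    ((measurable_tailWeight B).comp measurable_prodMk_left).ennreal_ofReal]
  exact h.lintegral_indicator_le hH.finiteMoment w.1

/-- Short jumps see a difference of ζ only if |x| ≤ 3, where it is at most B|z|. The restriction to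
short jumps is essential, since a transition between two different limits has infinite Gagliardo
energy through its long jumps. -/
lemma IsBump.integrable_near {B : ℝ} {ζ : ℝ → ℝ} (h : IsBump B ζ) (hH : IsKernel H) :
    Integrable (fun q : Cyl n × Cyl n => {q : Cyl n × Cyl n | |q.2.1| < 1}.indicator
      (fun q => (ζ q.1.1 - ζ (q.1.1 - q.2.1)) ^ 2) q) (volume.prod (cylMeas H)) := by
  have hB := h.nonneg
  have h1 : Integrable (fun q : Cyl n × Cyl n =>
      (Set.Icc (-3 : ℝ) 3).indicator (fun _ => B ^ 2) q.1.1 * min 1 (q.2.1 ^ 2)) (volume.prod (cylMeas H)) := by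
    refine Integrable.mul_prod (f := fun w : Cyl n => (Set.Icc (-3 : ℝ) 3).indicator (fun _ => B ^ 2) w.1)
      (g := fun w : Cyl n => min 1 (w.1 ^ 2)) ?_ ?_
    · have : Integrable ((Set.Icc (-3 : ℝ) 3).indicator fun _ => B ^ 2) :=
        (integrableOn_const (by simp) (by simp)).integrable_indicator measurableSet_Icc
      exact (measurePreserving_fst_cyl.integrable_comp this.aestronglyMeasurable).2 this
    · refine ⟨by fun_prop, ?_⟩
      rw [hasFiniteIntegral_iff_ofReal (Eventually.of_forall fun w => by positivity),
        hH.lintegral_fst (f := fun x => ENNReal.ofReal (min 1 (x ^ 2))) (by fun_prop)]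
      exact hH.finiteMoment
  have hζ := h.meas
  refine h1.mono' ?_ (Eventually.of_forall fun q => ?_)
  · exact (Measurable.indicator (by fun_prop) (measurableSet_lt (by fun_prop) (by fun_prop))).aestronglyMeasurable
  · by_cases hq : |q.2.1| < 1
    · rw [Set.indicator_of_mem (by exact hq), Real.norm_of_nonneg (sq_nonneg _)]
      by_cases hx : |q.1.1| ≤ 3
      · rw [Set.indicator_of_mem (show q.1.1 ∈ Set.Icc (-3 : ℝ) 3 from abs_le.1 hx), min_eq_right
          (by rw [← sq_abs]; nlinarith [abs_nonneg q.2.1]), ← mul_pow, ← sq_abs]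
        have := h.first q.1.1 q.2.1
        rw [min_eq_right hq.le] at this
        rw [← sq_abs (B * q.2.1), abs_mul, abs_of_nonneg hB]
        exact pow_le_pow_left₀ (abs_nonneg _) this 2
      · rw [h.far q.1.1 q.2.1 (by linarith), sub_self]
        have : 0 ≤ (Set.Icc (-3 : ℝ) 3).indicator (fun _ => B ^ 2) q.1.1 :=
          Set.indicator_nonneg (fun _ _ => by positivity) _
        rw [zero_pow two_ne_zero]
        positivity
    · rw [Set.indicator_of_notMem (by exact hq), norm_zero]
      have : 0 ≤ (Set.Icc (-3 : ℝ) 3).indicator (fun _ => B ^ 2) q.1.1 :=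
        Set.indicator_nonneg (fun _ _ => by positivity) _
      positivity

/-- The map `(w, z) ↦ (w - z, -z)`-type bound: increments of a profile, seen from the shifted point. -/
lemma IsBump.first_le' {B : ℝ} {ζ : ℝ → ℝ} (h : IsBump B ζ) (x z : ℝ) (hz1 : 1 ≤ |z|) :
    |ζ x - ζ (x - z)| ≤ tailWeight B (x - z) z := by
  have := h.first_le (x - z) (-z) (by rwa [abs_neg])
  rw [sub_neg_eq_add, sub_add_cancel, abs_sub_comm] at this
  refine this.trans (le_of_eq ?_)
  simp [tailWeight, Set.indicator_apply]

/-- Short jumps: the product is bounded by the two squares. Long jumps: the increment of v is split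
into its two values, each multiplied by the tail weight centred at its own point. -/
lemma IsBump.integrable_increment_mul {B : ℝ} {ζ : ℝ → ℝ} (h : IsBump B ζ) (hH : IsKernel H) {v : Cyl n → ℝ}
    (hv : MemLp v 2 volume) (hg : gag (cylMeas H) v < ⊤) :
    Integrable (fun q : Cyl n × Cyl n => (v q.1 - v (q.1 - q.2)) * (ζ q.1.1 - ζ (q.1.1 - q.2.1)))
      (volume.prod (cylMeas H)) := by
  have hB := h.nonneg
  have hζ := h.meas
  have i1 := integrable_increment_sq (cylMeas H) hv.aestronglyMeasurable hg
  have i2 := h.integrable_near hH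
  have i3 := h.integrable_mul_tailWeight hH hv
  -- The same bound as `i3`, transported by the measure-preserving map (w, z) ↦ (w - z, z).
  have i4 : Integrable (fun q : Cyl n × Cyl n => |v (q.1 - q.2)| * tailWeight B (q.1.1 - q.2.1) q.2.1)
      (volume.prod (cylMeas H)) := by
    have hmp := measurePreserving_sub_prod (volume : Measure (Cyl n)) (cylMeas H)
    exact (hmp.integrable_comp i3.aestronglyMeasurable).2 i3
  refine ((i1.add i2).add (i3.add i4)).mono' ?_ (Eventually.of_forall fun q => ?_)
  · refine (aestronglyMeasurable_increment (cylMeas H) hv.aestronglyMeasurable).mul ?_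
    exact (by fun_prop : Measurable fun q : Cyl n × Cyl n => ζ q.1.1 - ζ (q.1.1 - q.2.1)).aestronglyMeasurable
  · simp only [Pi.add_apply]
    rw [norm_mul, Real.norm_eq_abs, Real.norm_eq_abs]
    have t1 := tailWeight_nonneg hB q.1.1 q.2.1
    have t2 := tailWeight_nonneg hB (q.1.1 - q.2.1) q.2.1
    have t3 := mul_nonneg (abs_nonneg (v q.1)) t1
    have t4 := mul_nonneg (abs_nonneg (v (q.1 - q.2))) t2
    by_cases hq : |q.2.1| < 1
    · rw [Set.indicator_of_mem (by exact hq)]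
      rw [← sq_abs (v q.1 - v (q.1 - q.2)), ← sq_abs (ζ q.1.1 - ζ (q.1.1 - q.2.1))]
      nlinarith [sq_nonneg (|v q.1 - v (q.1 - q.2)| - |ζ q.1.1 - ζ (q.1.1 - q.2.1)|),
        abs_nonneg (v q.1 - v (q.1 - q.2)), abs_nonneg (ζ q.1.1 - ζ (q.1.1 - q.2.1))]
    · rw [Set.indicator_of_notMem (by exact hq)]
      rw [not_lt] at hq
      have b1 : |ζ q.1.1 - ζ (q.1.1 - q.2.1)| ≤ tailWeight B q.1.1 q.2.1 := h.first_le _ _ hq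
      have b2 := h.first_le' q.1.1 q.2.1 hq
      have b3 : |v q.1 - v (q.1 - q.2)| ≤ |v q.1| + |v (q.1 - q.2)| := abs_sub _ _
      calc _ ≤ (|v q.1| + |v (q.1 - q.2)|) * |ζ q.1.1 - ζ (q.1.1 - q.2.1)| := by gcongr
        _ ≤ |v q.1| * tailWeight B q.1.1 q.2.1 + |v (q.1 - q.2)| * tailWeight B (q.1.1 - q.2.1) q.2.1 := by
          rw [add_mul]; gcongr
        _ ≤ _ := by nlinarith [sq_nonneg (v q.1 - v (q.1 - q.2))]

lemma IsBump.memLp_difference {B : ℝ} {ζ : ℝ → ℝ} (h : IsBump B ζ) (z : ℝ) :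
    MemLp (fun w : Cyl n => ζ w.1 - ζ (w.1 - z)) 2 volume := by
  have hζ := h.meas
  refine memLp_lift (f := fun x => ζ x - ζ (x - z)) (memLp_of_bounded_support (C := B * min 1 |z|)
    (R := |z| + 2) (by fun_prop) (fun x => h.first x z) fun x hx => ?_)
  rw [h.far x z (by linarith), sub_self]

/-- Discrete integration by parts: for fixed z, translating the term with v(w - z) moves the
increment onto ζ and leaves a second difference. The factor 2 offsets the 1/2 in `Lop`. -/
lemma IsBump.integral_increment_mul {B : ℝ} {ζ : ℝ → ℝ} (h : IsBump B ζ) (hH : IsKernel H) {v : Cyl n → ℝ}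
    (hv : MemLp v 2 volume) (hg : gag (cylMeas H) v < ⊤) :
    ∫ q : Cyl n × Cyl n, (v q.1 - v (q.1 - q.2)) * (ζ q.1.1 - ζ (q.1.1 - q.2.1)) ∂(volume.prod (cylMeas H)) =
      2 * ∫ w, v w * Lop (kerConst H) ζ w.1 := by
  have hζ := h.meas
  have hB := h.nonneg
  have hvs : ∀ z, MemLp (fun w => v (w - z)) 2 volume :=
    fun z => hv.comp_measurePreserving (measurePreserving_sub_right volume z)
  have hint : Integrable (fun q : Cyl n × Cyl n =>
      v q.1 * (2 * ζ q.1.1 - ζ (q.1.1 + q.2.1) - ζ (q.1.1 - q.2.1))) (volume.prod (cylMeas H)) := by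
    refine (h.integrable_mul_tailWeight hH hv).mono' ?_ (Eventually.of_forall fun q => ?_)
    · refine (hv.aestronglyMeasurable.comp_quasiMeasurePreserving Measure.quasiMeasurePreserving_fst).mul ?_
      exact (h.measurable_second.comp
        (by fun_prop : Measurable fun q : Cyl n × Cyl n => (q.1.1, q.2.1))).aestronglyMeasurable
    · rw [norm_mul]
      exact mul_le_mul_of_nonneg_left (h.second_le _ _) (norm_nonneg _)
  rw [integral_prod_symm _ (h.integrable_increment_mul hH hv hg)]
  have hinner : ∀ z : Cyl n, ∫ w : Cyl n, (v w - v (w - z)) * (ζ w.1 - ζ (w.1 - z.1)) =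
      ∫ w : Cyl n, v w * (2 * ζ w.1 - ζ (w.1 + z.1) - ζ (w.1 - z.1)) := by
    intro z
    have d1 := h.memLp_difference (n := n) z.1
    have d2 := h.memLp_difference (n := n) (-z.1)
    simp only [sub_neg_eq_add] at d2
    have e1 : Integrable fun w : Cyl n => v w * (ζ w.1 - ζ (w.1 - z.1)) := hv.integrable_mul d1
    have e2 : Integrable fun w : Cyl n => v (w - z) * (ζ w.1 - ζ (w.1 - z.1)) := (hvs z).integrable_mul d1
    have e3 : Integrable fun w : Cyl n => v w * (ζ w.1 - ζ (w.1 + z.1)) := hv.integrable_mul d2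
    have e4 := integral_sub_right_eq_self (μ := (volume : Measure (Cyl n)))
      (fun w => v w * (ζ (w.1 + z.1) - ζ w.1)) z
    simp only [Prod.fst_sub, sub_add_cancel] at e4
    simp_rw [sub_mul]
    rw [integral_sub e1 e2, e4, ← integral_sub e1 (by
      refine e3.neg.congr (Eventually.of_forall fun w => ?_)
      simp only [Pi.neg_apply]; ring)]
    refine integral_congr_ae (Eventually.of_forall fun w => ?_)
    simp only
    ring
  simp_rw [hinner]
  rw [← integral_prod_symm _ hint, integral_prod _ hint, ← integral_const_mul]
  refine integral_congr_ae (Eventually.of_forall fun w => ?_)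
  simp only
  rw [integral_const_mul, hH.integral_fst (f := fun z => 2 * ζ w.1 - ζ (w.1 + z) - ζ (w.1 - z)) (by fun_prop), Lop]
  ring

end

/-! ### Profiles and their perturbations of finite energy -/

section

/-- For short jumps the second difference is estimated by the mean value theorem for t ↦ ζ(x+t) +
ζ(x-t), whose derivative is at most 2A|z| for |t| ≤ |z|. For long jumps the bound 4A is the trivial
one. -/
lemma isBump_of_bounds {ζ ζ' ζ'' : ℝ → ℝ} {A : ℝ} (h1 : ∀ x, HasDerivAt ζ (ζ' x) x)
    (h2 : ∀ x, HasDerivAt ζ' (ζ'' x) x) (b0 : ∀ x, |ζ x| ≤ A) (b1 : ∀ x, |ζ' x| ≤ A)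
    (b2 : ∀ x, |ζ'' x| ≤ A) (hs : ∀ x, 2 < |x| → ζ' x = 0) : IsBump (4 * A) ζ := by
  have hA : 0 ≤ A := (abs_nonneg _).trans (b0 0)
  have hd : Differentiable ℝ ζ := fun x => (h1 x).differentiableAt
  have lip : ∀ (f f' : ℝ → ℝ), (∀ x, HasDerivAt f (f' x) x) → (∀ x, |f' x| ≤ A) → ∀ x y, |f x - f y| ≤ A * |x - y| := by
    intro f f' hf hb x y
    have := convex_univ.norm_image_sub_le_of_norm_hasDerivWithin_le (f := f) (f' := f') (C := A)
      (fun x _ => (hf x).hasDerivWithinAt) (fun x _ => hb x) (Set.mem_univ y) (Set.mem_univ x)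
    simpa using this
  refine ⟨hd.continuous.measurable, fun x z => ?_, fun x z => ?_, fun x z hz => ?_⟩
  · rcases le_total 1 |z| with h | h
    · rw [min_eq_left h]
      have := (abs_sub (ζ x) (ζ (x - z))).trans (add_le_add (b0 _) (b0 _))
      linarith
    · rw [min_eq_right h]
      have := lip ζ ζ' h1 b1 x (x - z)
      rw [sub_sub_cancel] at this
      nlinarith [abs_nonneg z]
  · rcases le_total 1 (z ^ 2) with h | h
    · rw [min_eq_left h]
      have e1 := abs_le.1 (b0 x)
      have e2 := abs_le.1 (b0 (x + z))
      have e3 := abs_le.1 (b0 (x - z))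
      rw [abs_le]
      constructor <;> linarith
    · rw [min_eq_right h]
      have hg : ∀ t : ℝ, HasDerivAt (fun t => ζ (x + t) + ζ (x - t)) (ζ' (x + t) - ζ' (x - t)) t := by
        intro t
        have e1 := (h1 (x + t)).comp_const_add x t
        have e2 := (h1 (x - t)).comp_const_sub x t
        have := e1.add e2
        rwa [← sub_eq_add_neg] at this
      have hb : ∀ t ∈ Set.Icc (-|z|) |z|, ‖ζ' (x + t) - ζ' (x - t)‖ ≤ 2 * A * |z| := by
        intro t ht
        have := lip ζ' ζ'' h2 b2 (x + t) (x - t)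
        rw [Real.norm_eq_abs]
        refine this.trans ?_
        have e : |x + t - (x - t)| = 2 * |t| := by
          rw [show x + t - (x - t) = 2 * t by ring, abs_mul]; norm_num
        rw [e]
        have := abs_le.2 ht
        nlinarith
      have := (convex_Icc (-|z|) |z|).norm_image_sub_le_of_norm_hasDerivWithin_le
        (fun t _ => (hg t).hasDerivWithinAt) hb (x := 0) (y := z)
        ⟨by simp, abs_nonneg z⟩ ⟨neg_abs_le z, le_abs_self z⟩
      simp only [add_zero, sub_zero, Real.norm_eq_abs] at this
      have e : 2 * ζ x - ζ (x + z) - ζ (x - z) = -(ζ (x + z) + ζ (x - z) - (ζ x + ζ x)) := by ring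
      rw [e, abs_neg]
      refine this.trans ?_
      rw [mul_assoc, ← sq, sq_abs]
      nlinarith [sq_nonneg z]
  · have hconst : ∀ (s : Set ℝ), Convex ℝ s → (∀ t ∈ s, 2 < |t|) → ∀ a ∈ s, ∀ b ∈ s, ζ a = ζ b := by
      intro s hs' ht a ha b hb
      have := hs'.norm_image_sub_le_of_norm_hasDerivWithin_le (f := ζ) (f' := ζ') (C := 0)
        (fun t _ => (h1 t).hasDerivWithinAt) (fun t h => by rw [hs t (ht t h)]; simp) hb ha
      rw [zero_mul] at this
      exact sub_eq_zero.1 (norm_le_zero_iff.1 this)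
    have hz' := abs_lt.1 hz
    rcases le_total 0 x with hx | hx
    · rw [abs_of_nonneg hx] at hz'
      exact hconst (Set.Ioi 2) (convex_Ioi 2) (fun t ht => lt_of_lt_of_le ht (le_abs_self t)) _
        (by rw [Set.mem_Ioi]; linarith) _ (by rw [Set.mem_Ioi]; linarith)
    · rw [abs_of_nonpos hx] at hz'
      refine hconst (Set.Iio (-2)) (convex_Iio (-2)) (fun t ht => ?_) _
        (by rw [Set.mem_Iio]; linarith) _ (by rw [Set.mem_Iio]; linarith)
      rw [lt_abs]; right; rw [Set.mem_Iio] at ht; linarith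

namespace IsProfile

variable {η : ℝ → ℝ}

lemma hasDerivAt_iterate (hη : IsProfile η) (k : ℕ) (x : ℝ) :
    HasDerivAt (deriv^[k] η) (deriv^[k + 1] η x) x := by
  rw [Function.iterate_succ_apply']
  have : ContDiff ℝ ∞ (deriv^[k] η) := by
    have h : ContDiff ℝ (∞ : WithTop ℕ∞) η := hη.smooth
    exact h.iterate_deriv k
  exact (this.differentiable (by simp) x).hasDerivAt

lemma iterate_eq_zero (hη : IsProfile η) (k : ℕ) {x : ℝ} (hx : 1 < |x|) : deriv^[k + 1] η x = 0 := by
  have h0 : ∀ x : ℝ, 1 < |x| → deriv η x = 0 := by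
    intro x hx
    rcases lt_abs.1 hx with h | h
    · have : η =ᶠ[𝓝 x] fun _ => 1 := by
        filter_upwards [Ioi_mem_nhds h] with y hy using hη.eq_one y (le_of_lt hy)
      rw [this.deriv_eq, deriv_const]
    · have : η =ᶠ[𝓝 x] fun _ => -1 := by
        filter_upwards [Iio_mem_nhds (show x < -1 by linarith)] with y hy using hη.eq_neg_one y (le_of_lt hy)
      rw [this.deriv_eq, deriv_const]
  induction k generalizing x with
  | zero => exact h0 x hx
  | succ k ih =>
    rw [Function.iterate_succ_apply']
    have : deriv^[k + 1] η =ᶠ[𝓝 x] fun _ => 0 := by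
      have : {y : ℝ | 1 < |y|} ∈ 𝓝 x := (isOpen_lt continuous_const continuous_abs).mem_nhds hx
      filter_upwards [this] with y hy using ih hy
    rw [this.deriv_eq, deriv_const]

lemma exists_bound (hη : IsProfile η) (k : ℕ) : ∃ A : ℝ, ∀ x, |deriv^[k] η x| ≤ A := by
  have hc : Continuous (deriv^[k] η) := continuous_iff_continuousAt.2 fun x =>
    (hη.hasDerivAt_iterate k x).continuousAt
  obtain ⟨A, hA⟩ := (isCompact_Icc (a := (-1 : ℝ)) (b := 1)).exists_bound_of_continuousOn hc.continuousOn
  refine ⟨max A 1, fun x => ?_⟩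
  by_cases hx : |x| ≤ 1
  · exact (hA x (abs_le.1 hx)).trans (le_max_left _ _)
  · refine le_trans ?_ (le_max_right _ _)
    rw [not_le] at hx
    cases k with
    | zero =>
      rcases lt_abs.1 hx with h | h
      · simp [hη.eq_one x h.le]
      · simp [hη.eq_neg_one x (by linarith)]
    | succ k => rw [hη.iterate_eq_zero k hx]; simp

/-- A common bound for the derivatives of a profile up to order three. -/
lemma exists_common_bound (hη : IsProfile η) : ∃ A : ℝ, 0 < A ∧ ∀ k ≤ 3, ∀ x, |deriv^[k] η x| ≤ A := by
  choose A hA using hη.exists_bound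
  refine ⟨|A 0| + |A 1| + |A 2| + |A 3| + 1, by positivity, fun k hk x => (hA k x).trans ?_⟩
  have := le_abs_self (A 0)
  have := le_abs_self (A 1)
  have := le_abs_self (A 2)
  have := le_abs_self (A 3)
  have := abs_nonneg (A 0)
  have := abs_nonneg (A 1)
  have := abs_nonneg (A 2)
  have := abs_nonneg (A 3)
  interval_cases k <;> linarith

lemma exists_isBump (hη : IsProfile η) : ∃ B, IsBump B η := by
  obtain ⟨A, -, hA⟩ := hη.exists_common_bound
  exact ⟨4 * A, isBump_of_bounds (hη.hasDerivAt_iterate 0) (hη.hasDerivAt_iterate 1) (hA 0 (by norm_num))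
    (hA 1 (by norm_num)) (hA 2 (by norm_num)) fun x hx => hη.iterate_eq_zero 0 (by linarith)⟩

/-- Increments of a profile are profiles with constants proportional to the increment. -/
lemma exists_isBump_increment (hη : IsProfile η) :
    ∃ B, ∀ h : ℝ, |h| ≤ 1 → IsBump (B * |h|) (fun x => η (x + h) - η x) := by
  obtain ⟨A, hA0, hA⟩ := hη.exists_common_bound
  refine ⟨4 * A, fun h hh => ?_⟩
  have hd : ∀ k x, HasDerivAt (fun x => deriv^[k] η (x + h) - deriv^[k] η x)
      (deriv^[k + 1] η (x + h) - deriv^[k + 1] η x) x := fun k x =>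
    ((hη.hasDerivAt_iterate k (x + h)).comp_add_const x h).sub (hη.hasDerivAt_iterate k x)
  have hb : ∀ k ≤ 2, ∀ x, |deriv^[k] η (x + h) - deriv^[k] η x| ≤ A * |h| := by
    intro k hk x
    have := convex_univ.norm_image_sub_le_of_norm_hasDerivWithin_le (f := deriv^[k] η)
      (f' := deriv^[k + 1] η) (C := A) (fun x _ => (hη.hasDerivAt_iterate k x).hasDerivWithinAt)
      (fun x _ => hA (k + 1) (by omega) x) (Set.mem_univ x) (Set.mem_univ (x + h))
    simpa using this
  rw [mul_assoc]
  refine isBump_of_bounds (hd 0) (hd 1) (hb 0 (by norm_num)) (hb 1 (by norm_num)) (hb 2 (by norm_num))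
    fun x hx => ?_
  have h1 : 1 < |x + h| := by
    have := abs_sub_abs_le_abs_sub x (-h)
    rw [abs_neg, sub_neg_eq_add] at this
    linarith
  rw [hη.iterate_eq_zero 0 h1, hη.iterate_eq_zero 0 (by linarith), sub_zero]

end IsProfile

variable {n : ℕ} {H : ℝ × (Fin n → ℝ) → ℝ} {η : ℝ → ℝ}

/-- The class of finite Gagliardo energy perturbations of the profile. -/
structure GAdm (H : ℝ × (Fin n → ℝ) → ℝ) (η : ℝ → ℝ) (u : Cyl n → ℝ) : Prop where
  memLp : MemLp (fun w => u w - η w.1) 2 volume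
  gag_lt : gag (cylMeas H) (fun w => u w - η w.1) < ⊤

lemma GAdm.of_admissible (hH : IsKernel H) {u : Cyl n → ℝ} (hu : u ∈ admissible (n := n) η) : GAdm H η u :=
  ⟨hu.1, gag_lt_top_of_memHs hH hu⟩

lemma GAdm.aestronglyMeasurable (hη : IsProfile η) {u : Cyl n → ℝ} (hu : GAdm H η u) :
    AEStronglyMeasurable u volume := by
  have h1 : AEStronglyMeasurable (fun w : Cyl n => η w.1) volume :=
    (hη.smooth.continuous.comp continuous_fst).aestronglyMeasurable
  refine (hu.memLp.aestronglyMeasurable.add h1).congr (Eventually.of_forall fun w => ?_)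
  simp

/-- The renormalized density in the variables `(w, w - w')`. -/
def density' (η : ℝ → ℝ) (u : Cyl n → ℝ) (q : Cyl n × Cyl n) : ℝ :=
  (u q.1 - u (q.1 - q.2)) ^ 2 - (η q.1.1 - η (q.1.1 - q.2.1)) ^ 2

lemma integrable_density_iff (hH : IsKernel H) (u : Cyl n → ℝ) :
    Integrable (density H η u) ↔ Integrable (density' η u) (volume.prod (cylMeas H)) :=
  hH.integrable_mul_kernel_iff (fun p => (u p.1 - u p.2) ^ 2 - (η p.1.1 - η p.2.1) ^ 2)

lemma integral_density_eq (hH : IsKernel H) (u : Cyl n → ℝ) :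
    ∫ p, density H η u p = ∫ q, density' η u q ∂(volume.prod (cylMeas H)) :=
  hH.integral_mul_kernel (fun p => (u p.1 - u p.2) ^ 2 - (η p.1.1 - η p.2.1) ^ 2)

/-- (a + e)² - e² = a² + 2ae, with a and e the increments of u - η and of η: the square of the
profile, which is not integrable, disappears. -/
lemma density'_eq (u : Cyl n → ℝ) (q : Cyl n × Cyl n) :
    density' η u q = ((u q.1 - η q.1.1) - (u (q.1 - q.2) - η (q.1 - q.2).1)) ^ 2 +
      2 * (((u q.1 - η q.1.1) - (u (q.1 - q.2) - η (q.1 - q.2).1)) * (η q.1.1 - η (q.1.1 - q.2.1))) := by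
  simp only [density', Prod.fst_sub]
  ring

lemma GAdm.integrable_density' (hH : IsKernel H) (hη : IsProfile η) {u : Cyl n → ℝ} (hu : GAdm H η u) :
    Integrable (density' η u) (volume.prod (cylMeas H)) := by
  obtain ⟨B, hB⟩ := hη.exists_isBump
  have h1 := integrable_increment_sq (cylMeas H) hu.memLp.aestronglyMeasurable hu.gag_lt
  have h2 := (hB.integrable_increment_mul hH hu.memLp hu.gag_lt).const_mul 2
  exact (h1.add h2).congr (Eventually.of_forall fun q => (density'_eq u q).symm)

lemma GAdm.integral_density' (hH : IsKernel H) (hη : IsProfile η) {u : Cyl n → ℝ} (hu : GAdm H η u) :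
    ∫ q, density' η u q ∂(volume.prod (cylMeas H)) =
      (gag (cylMeas H) (fun w => u w - η w.1)).toReal +
        4 * ∫ w, (u w - η w.1) * Lop (kerConst H) η w.1 := by
  obtain ⟨B, hB⟩ := hη.exists_isBump
  have h1 := integrable_increment_sq (cylMeas H) hu.memLp.aestronglyMeasurable hu.gag_lt
  have h2 := (hB.integrable_increment_mul hH hu.memLp hu.gag_lt).const_mul 2
  rw [integral_congr_ae (Eventually.of_forall fun q => density'_eq u q), integral_add h1 h2,
    integral_increment_sq (cylMeas H) hu.memLp.aestronglyMeasurable, integral_const_mul,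
    hB.integral_increment_mul hH hu.memLp hu.gag_lt]
  ring

lemma memLp_profile_increment (hη : IsProfile η) (z : ℝ) :
    MemLp (fun w : Cyl n => η w.1 - η (w.1 - z)) 2 volume := by
  obtain ⟨B, hB⟩ := hη.exists_isBump
  exact hB.memLp_difference z

lemma GAdm.memLp_increment (hη : IsProfile η) {u : Cyl n → ℝ} (hu : GAdm H η u) (z : Cyl n) :
    MemLp (fun w => u w - u (w - z)) 2 volume := by
  have h1 : MemLp (fun w => (u w - η w.1) - (u (w - z) - η (w - z).1)) 2 volume :=
    hu.memLp.sub (hu.memLp.comp_measurePreserving (measurePreserving_sub_right volume z))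
  refine (h1.add (memLp_profile_increment hη z.1)).ae_eq (Eventually.of_forall fun w => ?_)
  simp only [Pi.add_apply, Prod.fst_sub]
  ring

lemma shiftSq_toReal {u : Cyl n → ℝ} {z : Cyl n} (h : MemLp (fun w => u w - u (w - z)) 2 volume) :
    shiftSq u z = ENNReal.ofReal (∫ w, (u w - u (w - z)) ^ 2) := by
  rw [ofReal_integral_eq_lintegral_ofReal h.integrable_sq (Eventually.of_forall fun w => sq_nonneg _)]
  rfl

/-- The profile term cannot be split off globally. For a fixed z all three increments are in L², so
the densities are compared after integration in w and only then integrated in z. -/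
lemma GAdm.integral_density'_le (hH : IsKernel H) (hη : IsProfile η) {u u₁ : Cyl n → ℝ} (hu : GAdm H η u)
    (hu₁ : GAdm H η u₁) (hle : ∀ z, shiftSq u₁ z ≤ shiftSq u z) :
    ∫ q, density' η u₁ q ∂(volume.prod (cylMeas H)) ≤ ∫ q, density' η u q ∂(volume.prod (cylMeas H)) := by
  have i := hu.integrable_density' hH hη
  have i₁ := hu₁.integrable_density' hH hη
  rw [integral_prod_symm _ i, integral_prod_symm _ i₁]
  refine integral_mono i₁.integral_prod_right i.integral_prod_right fun z => ?_
  have e := (hu.memLp_increment hη z)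
  have e₁ := (hu₁.memLp_increment hη z)
  have eη := memLp_profile_increment (n := n) hη z.1
  have := hle z
  rw [shiftSq_toReal e, shiftSq_toReal e₁, ENNReal.ofReal_le_ofReal_iff
    (integral_nonneg fun w => sq_nonneg _)] at this
  simp only [density']
  rw [integral_sub e.integrable_sq eη.integrable_sq, integral_sub e₁.integrable_sq eη.integrable_sq]
  linarith

lemma shiftSq_le_four {v : Cyl n → ℝ} (hv : AEStronglyMeasurable v volume) (z : Cyl n) :
    shiftSq v z ≤ 4 * ∫⁻ w, ENNReal.ofReal (v w ^ 2) := by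
  have hm : AEMeasurable (fun w => 2 * ENNReal.ofReal (v w ^ 2)) volume :=
    (hv.aemeasurable.pow_const 2).ennreal_ofReal.const_mul _
  have h2 : ∫⁻ w, ENNReal.ofReal (v (w - z) ^ 2) = ∫⁻ w, ENNReal.ofReal (v w ^ 2) :=
    lintegral_sub_right_eq_self (fun w => ENNReal.ofReal (v w ^ 2)) z
  calc shiftSq v z ≤ ∫⁻ w, (2 * ENNReal.ofReal (v w ^ 2) + 2 * ENNReal.ofReal (v (w - z) ^ 2)) := by
        refine lintegral_mono fun w => ?_
        simp only
        rw [← ENNReal.ofReal_ofNat, ← ENNReal.ofReal_mul (by norm_num), ← ENNReal.ofReal_mul (by norm_num),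
          ← ENNReal.ofReal_add (by positivity) (by positivity)]
        refine ENNReal.ofReal_le_ofReal ?_
        nlinarith [sq_nonneg (v w + v (w - z))]
    _ = _ := by
        rw [lintegral_add_left' hm, lintegral_const_mul' _ _ ENNReal.ofNat_ne_top,
          lintegral_const_mul' _ _ ENNReal.ofNat_ne_top, h2, ← add_mul]
        norm_num

/-- Short jumps of u₁ - η are controlled by those of u and of η, long ones by the L² norm of u₁ - η
alone. Hence the class is preserved by any operation that does not increase increments and keeps the
distance to η square integrable. -/
lemma GAdm.of_shiftSq_le (hH : IsKernel H) (hη : IsProfile η) {u u₁ : Cyl n → ℝ} (hu : GAdm H η u)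
    (hu₁ : MemLp (fun w => u₁ w - η w.1) 2 volume) (hle : ∀ z, shiftSq u₁ z ≤ shiftSq u z) : GAdm H η u₁ := by
  refine ⟨hu₁, ?_⟩
  obtain ⟨B, hB⟩ := hη.exists_isBump
  set v : Cyl n → ℝ := fun w => u w - η w.1
  set v₁ : Cyl n → ℝ := fun w => u₁ w - η w.1
  set E : Cyl n → ℝ := fun w => η w.1
  set M := ∫⁻ w, ENNReal.ofReal (v₁ w ^ 2)
  have hM : M < ⊤ := hu₁.integrable_sq.lintegral_lt_top
  have hEm : AEStronglyMeasurable E volume :=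
    (hη.smooth.continuous.comp continuous_fst).aestronglyMeasurable
  have hu₁m : AEStronglyMeasurable u₁ volume :=
    (hu₁.aestronglyMeasurable.add hEm).congr (Eventually.of_forall fun w => by simp [v₁, E])
  set S : Set (Cyl n) := {z | |z.1| < 1}
  have hS : MeasurableSet S := measurableSet_lt (by fun_prop) measurable_const
  have hpt : ∀ z, shiftSq v₁ z ≤ 4 * shiftSq v z + (6 * S.indicator (shiftSq E) z +
      4 * M * ENNReal.ofReal (min 1 (z.1 ^ 2))) := by
    intro z
    by_cases hz : z ∈ S
    · rw [Set.indicator_of_mem hz]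
      have e1 : shiftSq v₁ z ≤ 2 * shiftSq u₁ z + 2 * shiftSq (fun w => -E w) z :=
        shiftSq_le_two_add hu₁m z fun w => sub_eq_add_neg _ _
      have e2 : shiftSq (fun w => -E w) z = shiftSq E z :=
        lintegral_congr fun w => by congr 1; ring
      have e3 : shiftSq u z ≤ 2 * shiftSq v z + 2 * shiftSq E z :=
        shiftSq_le_two_add hu.memLp.aestronglyMeasurable z fun w => by simp [E]
      calc shiftSq v₁ z ≤ 2 * (2 * shiftSq v z + 2 * shiftSq E z) + 2 * shiftSq E z := by
            rw [e2] at e1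
            refine e1.trans ?_
            gcongr
            exact (hle z).trans e3
        _ = 4 * shiftSq v z + 6 * shiftSq E z := by ring
        _ ≤ _ := by gcongr; exact le_self_add
    · have h1 : ENNReal.ofReal (min 1 (z.1 ^ 2)) = 1 := by
        rw [min_eq_left, ENNReal.ofReal_one]
        rw [← sq_abs]
        have : 1 ≤ |z.1| := not_lt.1 hz
        nlinarith
      rw [h1, mul_one]
      refine (shiftSq_le_four hu₁.aestronglyMeasurable z).trans ?_
      rw [← add_assoc]
      exact le_add_self
  have hEint : ∫⁻ z, S.indicator (shiftSq E) z ∂cylMeas H < ⊤ := by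
    have h1 := (hB.integrable_near hH).lintegral_lt_top
    have hm : Measurable fun q : Cyl n × Cyl n => ENNReal.ofReal ({q : Cyl n × Cyl n | |q.2.1| < 1}.indicator
      (fun q => (η q.1.1 - η (q.1.1 - q.2.1)) ^ 2) q) := by
      have := hB.meas
      exact (Measurable.indicator (by fun_prop) (measurableSet_lt (by fun_prop) (by fun_prop))).ennreal_ofReal
    rw [lintegral_prod_symm _ hm.aemeasurable] at h1
    refine lt_of_le_of_lt (lintegral_mono fun z => ?_) h1
    by_cases hz : z ∈ S
    · rw [Set.indicator_of_mem hz]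
      refine lintegral_mono fun w => ?_
      simp only
      rw [Set.indicator_of_mem (by exact hz)]
      rfl
    · rw [Set.indicator_of_notMem hz]
      exact zero_le
  have hmin : ∫⁻ z : Cyl n, ENNReal.ofReal (min 1 (z.1 ^ 2)) ∂cylMeas H < ⊤ := by
    rw [hH.lintegral_fst (f := fun x => ENNReal.ofReal (min 1 (x ^ 2))) (by fun_prop)]
    exact hH.finiteMoment
  have hvg := hu.gag_lt
  have hvm : AEMeasurable (fun z => shiftSq v z) (cylMeas H) := by
    have := ((aestronglyMeasurable_increment (cylMeas H)
      hu.memLp.aestronglyMeasurable).aemeasurable.pow_const 2).ennreal_ofReal.prod_swap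
    exact this.lintegral_prod_right'
  refine lt_of_le_of_lt (lintegral_mono hpt) ?_
  rw [lintegral_add_left' (hvm.const_mul _), lintegral_add_right _ (by fun_prop),
    lintegral_const_mul' _ _ ENNReal.ofNat_ne_top, lintegral_const_mul' _ _ ENNReal.ofNat_ne_top,
    lintegral_const_mul' _ _ (ENNReal.mul_ne_top ENNReal.ofNat_ne_top hM.ne)]
  refine ENNReal.add_lt_top.2 ⟨ENNReal.mul_lt_top (by simp) hvg, ENNReal.add_lt_top.2
    ⟨ENNReal.mul_lt_top (by simp) hEint, ENNReal.mul_lt_top (ENNReal.mul_lt_top (by simp) hM) hmin⟩⟩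

end

/-! ### The wells, monotone layers and the layer-cake formula -/

section

/-- Near 1 the second derivative exceeds q/2 while f and f' vanish at 1, so two monotonicity
arguments give q/4·(1-s)². On the rest of [0,1] f has a positive minimum by compactness. -/
lemma quadratic_lower_bound {f : ℝ → ℝ} (hf : ContDiff ℝ 2 f) (h0 : ∀ s, 0 ≤ f s)
    (hpos : ∀ s, 0 ≤ s → s < 1 → 0 < f s) (h1 : f 1 = 0) (h2 : 0 < deriv (deriv f) 1) :
    ∃ c, 0 < c ∧ ∀ s, 0 ≤ s → s ≤ 1 → c * (1 - s) ^ 2 ≤ f s := by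
  have hd1 : ContDiff ℝ 1 (deriv f) := (contDiff_succ_iff_deriv.1 (hf : ContDiff ℝ (1 + 1) f)).2.2
  have hdf : Differentiable ℝ f := hf.differentiable (by norm_num)
  have hdf' : Differentiable ℝ (deriv f) := hd1.differentiable (by norm_num)
  have hc2 : Continuous (deriv (deriv f)) := hd1.continuous_deriv le_rfl
  set q := deriv (deriv f) 1
  have hd0 : deriv f 1 = 0 := by
    refine IsLocalMin.deriv_eq_zero (Eventually.of_forall fun s => ?_)
    rw [h1]; exact h0 s
  obtain ⟨δ, hδ, hball⟩ := Metric.eventually_nhds_iff.1 (hc2.continuousAt.eventually_const_lt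
    (show q / 2 < deriv (deriv f) 1 by simp only [q]; linarith))
  have hnear : ∀ s, 1 - δ < s → s ≤ 1 → q / 4 * (1 - s) ^ 2 ≤ f s := by
    intro s hs hs1
    have hg' : ∀ t, HasDerivAt (fun t => deriv f t + q / 2 * (1 - t)) (deriv (deriv f) t - q / 2) t := by
      intro t
      have := (hdf' t).hasDerivAt.add ((((hasDerivAt_id t).const_sub 1)).const_mul (q / 2))
      convert! this using 1; ring
    have hg : ∀ t, HasDerivAt (fun t => f t - q / 4 * (1 - t) ^ 2) (deriv f t + q / 2 * (1 - t)) t := by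
      intro t
      have := (hdf t).hasDerivAt.sub (((((hasDerivAt_id t).const_sub 1)).pow 2).const_mul (q / 4))
      convert! this using 1; simp; ring
    have hmono : MonotoneOn (fun t => deriv f t + q / 2 * (1 - t)) (Set.Icc s 1) := by
      refine monotoneOn_of_deriv_nonneg (convex_Icc s 1) (fun t _ => (hg' t).continuousAt.continuousWithinAt)
        (fun t _ => (hg' t).differentiableAt.differentiableWithinAt) fun t ht => ?_
      rw [interior_Icc] at ht
      rw [(hg' t).deriv]
      have : q / 2 < deriv (deriv f) t := hball (by
        rw [Real.dist_eq, abs_lt]; constructor <;> linarith [ht.1, ht.2])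
      linarith
    have hanti : AntitoneOn (fun t => f t - q / 4 * (1 - t) ^ 2) (Set.Icc s 1) := by
      refine antitoneOn_of_deriv_nonpos (convex_Icc s 1) (fun t _ => (hg t).continuousAt.continuousWithinAt)
        (fun t _ => (hg t).differentiableAt.differentiableWithinAt) fun t ht => ?_
      rw [interior_Icc] at ht
      rw [(hg t).deriv]
      have := hmono ⟨ht.1.le, ht.2.le⟩ ⟨hs1, le_rfl⟩ ht.2.le
      simp only [hd0] at this
      linarith
    have := hanti ⟨le_rfl, hs1⟩ ⟨hs1, le_rfl⟩ hs1
    simp only [h1] at this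
    linarith
  rcases le_or_gt 1 δ with hδ1 | hδ1
  · refine ⟨q / 4, by linarith, fun s hs hs1 => ?_⟩
    rcases hs1.eq_or_lt with rfl | hlt
    · simp [h1]
    · rcases hs.eq_or_lt with rfl | h
      -- If δ = 1 the point s = 0 lies just outside the open range of `hnear`; the inequality
      -- extends to it by continuity.
      · have hc : Continuous fun s => f s - q / 4 * (1 - s) ^ 2 := by
          have := hdf.continuous; fun_prop
        have hmem : (0 : ℝ) ∈ closure (Set.Ioc 0 1) := by rw [closure_Ioc (by norm_num)]; simp
        have := closure_minimal (s := Set.Ioc (0 : ℝ) 1) (t := {s | 0 ≤ f s - q / 4 * (1 - s) ^ 2})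
          (fun t ht => by
            have := hnear t (by linarith [ht.1]) ht.2
            simp only [Set.mem_ofPred_eq]; linarith) (isClosed_le continuous_const hc) hmem
        simp only [Set.mem_ofPred_eq] at this
        linarith
      · exact hnear s (by linarith) hs1
  · obtain ⟨m, hm, hmin⟩ := (isCompact_Icc (a := (0 : ℝ)) (b := 1 - δ)).exists_isMinOn
      ⟨0, by simp; linarith⟩ hdf.continuous.continuousOn
    have hfm := hpos m hm.1 (by linarith [hm.2])
    refine ⟨min (q / 4) (f m), lt_min (by linarith) hfm, fun s hs hs1 => ?_⟩
    rcases le_or_gt s (1 - δ) with h | h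
    · calc _ ≤ f m * (1 - s) ^ 2 := by gcongr; exact min_le_right _ _
        _ ≤ f m * 1 := by gcongr; nlinarith
        _ ≤ f s := by rw [mul_one]; exact hmin ⟨hs, h⟩
    · exact le_trans (by gcongr; exact min_le_left _ _) (hnear s h hs1)

lemma IsDoubleWell.exists_quadratic {γ : ℝ → ℝ} (hγ : IsDoubleWell γ) :
    ∃ c, 0 < c ∧ (∀ s, 0 ≤ s → s ≤ 1 → c * (s - 1) ^ 2 ≤ γ s) ∧
      (∀ s, -1 ≤ s → s ≤ 0 → c * (s - -1) ^ 2 ≤ γ s) := by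
  obtain ⟨c1, h1, b1⟩ := quadratic_lower_bound hγ.contDiff hγ.nonneg
    (fun s h h' => hγ.pos s (by linarith) h') hγ.zero_one hγ.second_one
  have hd : deriv (fun s => γ (-s)) = fun s => -deriv γ (-s) := funext fun s => deriv_comp_neg γ s
  obtain ⟨c2, h2, b2⟩ := quadratic_lower_bound (f := fun s => γ (-s)) (hγ.contDiff.comp contDiff_neg)
    (fun s => hγ.nonneg _) (fun s h h' => hγ.pos _ (by linarith) (by linarith)) hγ.zero_neg_one (by
      rw [hd]
      have : deriv (fun s => -deriv γ (-s)) 1 = deriv (deriv γ) (-1) := by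
        rw [deriv.fun_neg, deriv_comp_neg, neg_neg]
      rw [this]; exact hγ.second_neg_one)
  refine ⟨min c1 c2, lt_min h1 h2, fun s hs hs' => ?_, fun s hs hs' => ?_⟩
  · refine le_trans ?_ (b1 s hs hs')
    rw [← neg_sq, neg_sub]; gcongr; exact min_le_left _ _
  · have := b2 (-s) (by linarith) (by linarith)
    rw [neg_neg] at this
    refine le_trans ?_ this
    rw [show s - -1 = 1 - -s by ring]; gcongr; exact min_le_right _ _

/-- Increasing layer profiles normalized to change sign at the origin. -/
structure IsLayer (φ : ℝ → ℝ) : Prop where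
  mono : Monotone φ
  ge : ∀ x, -1 ≤ φ x
  le : ∀ x, φ x ≤ 1
  nonneg : ∀ x, 0 < x → 0 ≤ φ x
  nonpos : ∀ x, x < 0 → φ x ≤ 0

lemma IsLayer.measurable {φ : ℝ → ℝ} (h : IsLayer φ) : Measurable φ := h.mono.measurable

/-- The sign normalization assigns one well to each half line: φ lies in [0,1] on the right and in
[-1,0] on the left, and for |x| > 1 the profile equals that well. This is where a loss of
compactness by translation is excluded. -/
lemma exists_layer_bound {γ η : ℝ → ℝ} (hη : IsProfile η) (hγ : IsDoubleWell γ) :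
    ∃ c D, 0 < c ∧ ∀ φ, IsLayer φ → ∀ x, (|x| ≤ 1 → |φ x - η x| ≤ D) ∧
      (1 < |x| → c * (φ x - η x) ^ 2 ≤ γ (φ x)) := by
  obtain ⟨c, hc, b1, b2⟩ := hγ.exists_quadratic
  obtain ⟨A, hA0, hA⟩ := hη.exists_common_bound
  refine ⟨c, 1 + A, hc, fun φ h x => ⟨fun _ => ?_, fun hx => ?_⟩⟩
  · exact (abs_sub _ _).trans (add_le_add (abs_le.2 ⟨h.ge x, h.le x⟩) (hA 0 (by norm_num) x))
  · rcases lt_abs.1 hx with h' | h'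
    · rw [hη.eq_one x h'.le]
      exact b1 _ (h.nonneg x (by linarith)) (h.le x)
    · rw [hη.eq_neg_one x (by linarith)]
      exact b2 _ (h.ge x) (h.nonpos x (by linarith))

lemma lintegral_Ici_ofReal_sub (α β : ℝ) :
    2 * ∫⁻ s in Set.Ici α, ENNReal.ofReal (β - s) = ENNReal.ofReal (max (β - α) 0 ^ 2) := by
  rcases le_total β α with h | h
  · rw [max_eq_right (by linarith)]
    have : ∫⁻ s in Set.Ici α, ENNReal.ofReal (β - s) = 0 := by
      rw [setLIntegral_congr_fun (g := fun _ => 0) measurableSet_Ici (fun s hs => by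
        rw [Set.mem_Ici] at hs
        simp only
        rw [ENNReal.ofReal_eq_zero]; linarith)]
      simp
    rw [this]; simp
  · rw [max_eq_left (by linarith)]
    have h1 : ∫⁻ s in Set.Ici α, ENNReal.ofReal (β - s) = ∫⁻ s in Set.Ioc α β, ENNReal.ofReal (β - s) := by
      rw [← lintegral_indicator measurableSet_Ici, ← lintegral_indicator measurableSet_Ioc]
      refine lintegral_congr_ae ?_
      filter_upwards [Measure.ae_ne volume α] with s hs
      by_cases h2 : s ∈ Set.Ioc α β
      · rw [Set.indicator_of_mem h2, Set.indicator_of_mem (by exact h2.1.le)]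
      · rw [Set.indicator_of_notMem h2]
        by_cases h3 : s ∈ Set.Ici α
        · rw [Set.indicator_of_mem h3, ENNReal.ofReal_eq_zero]
          by_contra h4
          exact h2 ⟨lt_of_le_of_ne h3 (Ne.symm hs), by linarith⟩
        · rw [Set.indicator_of_notMem h3]
    have hi : IntegrableOn (fun s => β - s) (Set.Ioc α β) :=
      (by fun_prop : Continuous fun s : ℝ => β - s).integrableOn_Ioc
    rw [h1, ← ofReal_integral_eq_lintegral_ofReal hi ((ae_restrict_mem measurableSet_Ioc).mono fun s hs => by
      have := hs.2; simp only [Pi.zero_apply]; linarith), ← intervalIntegral.integral_of_le h]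
    rw [intervalIntegral.integral_sub (by simp) (by simp), integral_id, intervalIntegral.integral_const,
      ← ENNReal.ofReal_ofNat, ← ENNReal.ofReal_mul (by norm_num)]
    congr 1
    simp; ring

/-- The square of the positive part of a difference as a double layer-cake integral. -/
def layerCake (α β : ℝ) : ℝ≥0∞ :=
  ∫⁻ p, {p : ℝ × ℝ | α ≤ p.1 ∧ p.1 < p.2 ∧ p.2 < β}.indicator (fun _ => (1 : ℝ≥0∞)) p
    ∂((volume.restrict (Set.Ioo (-1 : ℝ) 1)).prod (volume.restrict (Set.Ioo (-1 : ℝ) 1)))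

lemma measurableSet_layer (α β : ℝ) : MeasurableSet {p : ℝ × ℝ | α ≤ p.1 ∧ p.1 < p.2 ∧ p.2 < β} :=
  (measurableSet_le measurable_const measurable_fst).inter
    ((measurableSet_lt measurable_fst measurable_snd).inter (measurableSet_lt measurable_snd measurable_const))

lemma layerCake_eq (α β : ℝ) :
    layerCake α β = ∫⁻ s in Set.Ioo (-1 : ℝ) 1 ∩ Set.Ici α, ENNReal.ofReal (min β 1 - s) := by
  rw [layerCake, lintegral_prod _ (measurable_const.indicator (measurableSet_layer α β)).aemeasurable,
    ← lintegral_indicator measurableSet_Ioo, ← lintegral_indicator (measurableSet_Ioo.inter measurableSet_Ici)]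
  refine lintegral_congr fun s => ?_
  by_cases hs : s ∈ Set.Ioo (-1 : ℝ) 1
  · rw [Set.indicator_of_mem hs]
    by_cases hα : α ≤ s
    · rw [Set.indicator_of_mem (show s ∈ Set.Ioo (-1 : ℝ) 1 ∩ Set.Ici α from ⟨hs, hα⟩), ← Real.volume_Ioo,
        ← lintegral_indicator measurableSet_Ioo, ← lintegral_indicator_one measurableSet_Ioo]
      refine lintegral_congr fun t => ?_
      simp only [Set.indicator_apply, Set.mem_Ioo, Set.mem_ofPred_eq, Pi.one_apply, lt_min_iff]
      have := hs.1
      grind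
    · rw [Set.indicator_of_notMem (show s ∉ Set.Ioo (-1 : ℝ) 1 ∩ Set.Ici α from fun h => hα h.2)]
      simp [hα]
  · rw [Set.indicator_of_notMem hs, Set.indicator_of_notMem (fun h => hs h.1)]

/-- Only an inequality in general, since the levels are confined to (-1,1) and only upward
differences count. For ordered values in [-1,1] it is an equality, as `two_mul_layerCake_eq` shows;
this asymmetry suits the comparison with a layer. -/
lemma two_mul_layerCake_le (α β : ℝ) : 2 * layerCake α β ≤ ENNReal.ofReal ((β - α) ^ 2) := by
  calc 2 * layerCake α β ≤ 2 * ∫⁻ s in Set.Ici α, ENNReal.ofReal (β - s) := by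
        rw [layerCake_eq]
        gcongr 2 * ?_
        refine (lintegral_mono_set Set.inter_subset_right).trans (lintegral_mono fun s => ?_)
        exact ENNReal.ofReal_le_ofReal (by linarith [min_le_left β 1])
    _ = ENNReal.ofReal (max (β - α) 0 ^ 2) := lintegral_Ici_ofReal_sub α β
    _ ≤ _ := by
        refine ENNReal.ofReal_le_ofReal ?_
        rcases le_total (β - α) 0 with h | h
        · rw [max_eq_right h]; nlinarith
        · rw [max_eq_left h]

lemma two_mul_layerCake_eq {α β : ℝ} (h1 : -1 ≤ α) (h2 : α ≤ β) (h3 : β ≤ 1) :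
    2 * layerCake α β = ENNReal.ofReal ((β - α) ^ 2) := by
  rw [layerCake_eq, min_eq_left h3]
  have : ∫⁻ s in Set.Ioo (-1 : ℝ) 1 ∩ Set.Ici α, ENNReal.ofReal (β - s) =
      ∫⁻ s in Set.Ici α, ENNReal.ofReal (β - s) := by
    rw [← lintegral_indicator (measurableSet_Ioo.inter measurableSet_Ici), ← lintegral_indicator measurableSet_Ici]
    refine lintegral_congr_ae ?_
    filter_upwards [Measure.ae_ne volume α] with s hs
    by_cases h : s ∈ Set.Ici α
    · rw [Set.indicator_of_mem h]
      by_cases h' : s < 1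
      · rw [Set.indicator_of_mem]
        exact ⟨⟨h1.trans_lt (lt_of_le_of_ne h (Ne.symm hs)), h'⟩, h⟩
      · rw [Set.indicator_of_notMem (fun hh => h' hh.1.2)]
        symm
        rw [ENNReal.ofReal_eq_zero]; linarith
    · rw [Set.indicator_of_notMem h, Set.indicator_of_notMem (fun hh => h hh.2)]
  rw [this, lintegral_Ici_ofReal_sub, max_eq_left (by linarith)]

end

/-! ### Sublevel volumes and the increasing rearrangement -/

section

variable {n : ℕ}

/-- A measurable set comparable to the left half cylinder loses at least measure `r` when it is
pushed to the right by `r`. -/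
lemma le_volume_shift_diff {A : Set (Cyl n)} (hA : MeasurableSet A)
    (h1 : volume (A ∩ {w | 0 < w.1}) ≠ ⊤) (h2 : volume (Aᶜ ∩ {w | w.1 ≤ 0}) ≠ ⊤) (z : Cyl n) (hz : 0 < z.1) :
    ENNReal.ofReal z.1 ≤ volume {w | w - z ∈ A ∧ w ∉ A} := by
  set D : Set (Cyl n) := {w | w - z ∈ A ∧ w ∉ A}
  have hsub : Measurable fun w : Cyl n => w - z := by fun_prop
  have hD : MeasurableSet D := (hsub hA).inter hA.compl
  by_cases hDtop : volume D = ⊤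
  · rw [hDtop]; exact le_top
  have hP : MeasurableSet {w : Cyl n | 0 < w.1} := measurableSet_lt measurable_const measurable_fst
  have hN : MeasurableSet {w : Cyl n | w.1 ≤ 0} := measurableSet_le measurable_fst measurable_const
  -- f is the indicator of A minus that of the left half cylinder, written so that integrability is
  -- visible. Its integral is translation invariant, while f(w - z) - f(w) plus the indicator of the
  -- slab 0 < x ≤ z₁ equals 1_A(w - z) - 1_A(w), at most the indicator of D. Integration gives z₁ ≤
  -- |D|.
  set f : Cyl n → ℝ := fun w => (A ∩ {w | 0 < w.1}).indicator 1 w - (Aᶜ ∩ {w | w.1 ≤ 0}).indicator 1 w with hf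
  have hfi : Integrable f :=
    ((integrable_indicator_iff (hA.inter hP)).2 (integrableOn_const h1 (by simp))).sub
      ((integrable_indicator_iff (hA.compl.inter hN)).2 (integrableOn_const h2 (by simp)))
  have hfs : Integrable fun w => f (w - z) := hfi.comp_sub_right z
  set S : Set (Cyl n) := {w | w.1 ∈ Set.Ioc 0 z.1}
  have hSm : MeasurableSet S := measurable_fst measurableSet_Ioc
  have hSv : volume S = ENNReal.ofReal z.1 := by
    have := (measurePreserving_fst_cyl (n := n)).measure_preimage (measurableSet_Ioc (a := 0) (b := z.1)).nullMeasurableSet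
    rw [Real.volume_Ioc, sub_zero] at this
    exact this
  have hSi : Integrable (S.indicator (1 : Cyl n → ℝ)) :=
    (integrable_indicator_iff hSm).2 (integrableOn_const (by rw [hSv]; simp) (by simp))
  have hDi : Integrable (D.indicator (1 : Cyl n → ℝ)) :=
    (integrable_indicator_iff hD).2 (integrableOn_const hDtop (by simp))
  classical
  have hpt : ∀ w, f (w - z) - f w + S.indicator 1 w ≤ D.indicator (1 : Cyl n → ℝ) w := by
    intro w
    have hS : w ∈ S ↔ 0 < w.1 ∧ w.1 ≤ z.1 := Iff.rfl
    have hDw : w ∈ D ↔ w - z ∈ A ∧ w ∉ A := Iff.rfl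
    have hf' : ∀ p, f p = (if p ∈ A then 1 else 0) - (if p.1 ≤ 0 then 1 else 0) := by
      intro p
      simp only [hf, Set.indicator_apply, Set.mem_inter_iff, Set.mem_compl_iff, Set.mem_ofPred_eq, Pi.one_apply]
      by_cases a1 : p ∈ A <;> by_cases a2 : p.1 ≤ 0 <;> simp [a1, a2, not_lt.2, not_le.1]
    have hz' : (w - z).1 ≤ 0 ↔ w.1 ≤ z.1 := by simp
    rw [hf', hf', Set.indicator_apply, Set.indicator_apply]
    simp only [hS, hDw, hz', Pi.one_apply, ← not_le (a := w.1)]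
    have h3 : w.1 ≤ 0 → w.1 ≤ z.1 := fun h => h.trans hz.le
    by_cases a1 : w - z ∈ A <;> by_cases a2 : w ∈ A <;> by_cases a3 : w.1 ≤ 0 <;> by_cases a4 : w.1 ≤ z.1 <;>
      first
        | exact absurd (h3 a3) a4
        | (simp only [a1, a2, a3, a4, if_true, if_false, not_true_eq_false, not_false_eq_true, and_true, and_false, and_self]
           norm_num)
  have hint := integral_mono ((hfs.sub hfi).add hSi) hDi hpt
  have e1 : ∫ w, f (w - z) = ∫ w, f w := integral_sub_right_eq_self f z
  have e2 : ∫ w, S.indicator (1 : Cyl n → ℝ) w = z.1 := by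
    rw [integral_indicator_one hSm, measureReal_def, hSv, ENNReal.toReal_ofReal hz.le]
  have e3 : ∫ w, D.indicator (1 : Cyl n → ℝ) w = (volume D).toReal := by
    rw [integral_indicator_one hD]; rfl
  have e4 : ∫ w, (f (w - z) - f w + S.indicator (1 : Cyl n → ℝ) w) = z.1 := by
    rw [integral_add (f := fun w => f (w - z) - f w) (hfs.sub hfi) hSi, integral_sub hfs hfi, e1, e2, sub_self,
      zero_add]
  have : z.1 ≤ (volume D).toReal := by
    rw [← e3, ← e4]; exact hint
  exact (ENNReal.ofReal_le_iff_le_toReal hDtop).2 this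

/-- The renormalized volume of the sublevel set `{u ≤ s}`. -/
def levelVol (u : Cyl n → ℝ) (s : ℝ) : ℝ :=
  (volume ({w | u w ≤ s} ∩ {w | 0 < w.1})).toReal - (volume ({w | s < u w} ∩ {w | w.1 ≤ 0})).toReal

section Levels

variable {u : Cyl n → ℝ} {η : ℝ → ℝ}

lemma volume_ge_lt_top {v : Cyl n → ℝ} (hv : MemLp v 2 volume) {ε : ℝ} (hε : 0 < ε) :
    volume {w | ε ≤ |v w|} < ⊤ := by
  have := hv.meas_ge_lt_top (by norm_num) (by norm_num) (ε := ε.toNNReal) (by simpa using hε)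
  convert! this using 2
  ext w
  rw [Set.mem_ofPred_eq, Set.mem_ofPred_eq, ← NNReal.coe_le_coe, Real.coe_toNNReal _ hε.le, coe_nnnorm, Real.norm_eq_abs]

lemma volume_slab_lt_top (a b : ℝ) : volume {w : Cyl n | w.1 ∈ Set.Icc a b} < ⊤ := by
  have := (measurePreserving_fst_cyl (n := n)).measure_preimage (measurableSet_Icc (a := a) (b := b)).nullMeasurableSet
  rw [Real.volume_Icc] at this
  exact this.le.trans_lt ENNReal.ofReal_lt_top

lemma volume_sublevel_right (hη : IsProfile η) (hv : MemLp (fun w => u w - η w.1) 2 volume) {s : ℝ} (hs : s < 1) :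
    volume ({w | u w ≤ s} ∩ {w | 0 < w.1}) < ⊤ := by
  refine lt_of_le_of_lt (measure_mono (t := {w | 1 - s ≤ |u w - η w.1|} ∪ {w | w.1 ∈ Set.Icc 0 1}) ?_)
    ((measure_union_le _ _).trans_lt (ENNReal.add_lt_top.2
      ⟨volume_ge_lt_top hv (by linarith), volume_slab_lt_top 0 1⟩))
  rintro w ⟨h1, h2⟩
  simp only [Set.mem_ofPred_eq] at h1 h2
  by_cases h3 : w.1 ≤ 1
  · right; exact ⟨h2.le, h3⟩
  · left
    simp only [Set.mem_ofPred_eq]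
    rw [hη.eq_one w.1 (by linarith), abs_sub_comm]
    exact le_trans (by linarith) (le_abs_self _)

lemma volume_superlevel_left (hη : IsProfile η) (hv : MemLp (fun w => u w - η w.1) 2 volume) {s : ℝ} (hs : -1 < s) :
    volume ({w | s < u w} ∩ {w | w.1 ≤ 0}) < ⊤ := by
  refine lt_of_le_of_lt (measure_mono (t := {w | s + 1 ≤ |u w - η w.1|} ∪ {w | w.1 ∈ Set.Icc (-1) 0}) ?_)
    ((measure_union_le _ _).trans_lt (ENNReal.add_lt_top.2
      ⟨volume_ge_lt_top hv (by linarith), volume_slab_lt_top (-1) 0⟩))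
  rintro w ⟨h1, h2⟩
  simp only [Set.mem_ofPred_eq] at h1 h2
  by_cases h3 : -1 ≤ w.1
  · right; exact ⟨h3, h2⟩
  · left
    simp only [Set.mem_ofPred_eq]
    rw [hη.eq_neg_one w.1 (by linarith)]
    exact le_trans (by linarith) (le_abs_self _)

/-- The sets {u ≤ s} have infinite volume, but their differences do not: the normalization by the
left half cylinder cancels. Both halves are finite because -1 < s and t < 1. -/
lemma levelVol_sub (hu : Measurable u) (hη : IsProfile η) (hv : MemLp (fun w => u w - η w.1) 2 volume)
    {s t : ℝ} (hs : -1 < s) (hst : s ≤ t) (ht : t < 1) :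
    volume {w | s < u w ∧ u w ≤ t} = ENNReal.ofReal (levelVol u t - levelVol u s) ∧
      levelVol u s ≤ levelVol u t := by
  have hP : MeasurableSet {w : Cyl n | 0 < w.1} := measurableSet_lt measurable_const measurable_fst
  have hN : MeasurableSet {w : Cyl n | w.1 ≤ 0} := measurableSet_le measurable_fst measurable_const
  have hle : ∀ s, MeasurableSet {w | u w ≤ s} := fun s => measurableSet_le hu measurable_const
  have hlt : ∀ s, MeasurableSet {w | s < u w} := fun s => measurableSet_lt measurable_const hu
  set M : Set (Cyl n) := {w | s < u w ∧ u w ≤ t}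
  have hM : MeasurableSet M := (hlt s).inter (hle t)
  have p1 : volume ({w | u w ≤ t} ∩ {w | 0 < w.1}) =
      volume ({w | u w ≤ s} ∩ {w | 0 < w.1}) + volume (M ∩ {w | 0 < w.1}) := by
    rw [← measure_union _ (hM.inter hP)]
    · congr 1; ext w
      simp only [Set.mem_inter_iff, Set.mem_ofPred_eq, Set.mem_union, M]
      grind
    · rw [Set.disjoint_left]
      rintro w ⟨h1, -⟩ ⟨⟨h2, -⟩, -⟩
      exact absurd h1 (not_le.2 h2)
  have p2 : volume ({w | s < u w} ∩ {w | w.1 ≤ 0}) =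
      volume ({w | t < u w} ∩ {w | w.1 ≤ 0}) + volume (M ∩ {w | w.1 ≤ 0}) := by
    rw [← measure_union _ (hM.inter hN)]
    · congr 1; ext w
      simp only [Set.mem_inter_iff, Set.mem_ofPred_eq, Set.mem_union, M]
      grind
    · rw [Set.disjoint_left]
      rintro w ⟨h1, -⟩ ⟨⟨-, h2⟩, -⟩
      exact absurd h2 (not_le.2 h1)
  have p3 : volume M = volume (M ∩ {w | 0 < w.1}) + volume (M ∩ {w | w.1 ≤ 0}) := by
    rw [← measure_inter_add_sdiff M hP]
    congr 2
    ext w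
    simp [Set.mem_sdiff]
  have f1 := volume_sublevel_right hη hv ht
  have f2 := volume_superlevel_left hη hv hs
  have f3 := volume_sublevel_right hη hv (hst.trans_lt ht)
  have f4 := volume_superlevel_left hη hv (hs.trans_le hst)
  have g1 : volume (M ∩ {w | 0 < w.1}) ≠ ⊤ := ne_top_of_le_ne_top f1.ne (p1 ▸ le_add_self)
  have g2 : volume (M ∩ {w | w.1 ≤ 0}) ≠ ⊤ := ne_top_of_le_ne_top f2.ne (p2 ▸ le_add_self)
  have key : levelVol u t - levelVol u s =
      (volume (M ∩ {w | 0 < w.1})).toReal + (volume (M ∩ {w | w.1 ≤ 0})).toReal := by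
    unfold levelVol
    rw [p1, p2, ENNReal.toReal_add f3.ne g1, ENNReal.toReal_add f4.ne g2]
    ring
  constructor
  · rw [key, p3, ENNReal.ofReal_add ENNReal.toReal_nonneg ENNReal.toReal_nonneg, ENNReal.ofReal_toReal g1,
      ENNReal.ofReal_toReal g2]
  · have := ENNReal.toReal_nonneg (a := volume (M ∩ {w | 0 < w.1}))
    have := ENNReal.toReal_nonneg (a := volume (M ∩ {w | w.1 ≤ 0}))
    linarith

/-- The sets {s < u ≤ τ} decrease to the empty set as τ decreases to s and have finite volume, so
their volumes tend to 0. -/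
lemma levelVol_right_cont (hu : Measurable u) (hη : IsProfile η) (hv : MemLp (fun w => u w - η w.1) 2 volume)
    {s x : ℝ} (hs : -1 < s) (hs1 : s < 1) (h : ∀ t, s < t → t < 1 → x ≤ levelVol u t) : x ≤ levelVol u s := by
  -- The denominator k + 2 keeps even the first level below 1.
  set τ : ℕ → ℝ := fun k => s + (1 - s) / (k + 2) with hτ
  have hτs : ∀ k, s < τ k := fun k => by
    have : 0 < (1 - s) / ((k : ℝ) + 2) := div_pos (by linarith) (by positivity)
    simp only [hτ]; linarith
  have hτ1 : ∀ k, τ k < 1 := fun k => by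
    have : (1 - s) / ((k : ℝ) + 2) < 1 - s := by
      rw [div_lt_iff₀ (by positivity)]
      nlinarith [(Nat.cast_nonneg k : (0 : ℝ) ≤ k)]
    simp only [hτ]; linarith
  have hτanti : Antitone τ := fun j k hjk => by
    have : (j : ℝ) ≤ k := by exact_mod_cast hjk
    simp only [hτ]
    gcongr
  have hτlim : Tendsto τ atTop (𝓝 s) := by
    have : Tendsto (fun k : ℕ => (1 - s) / ((k : ℝ) + 2)) atTop (𝓝 0) :=
      tendsto_const_nhds.div_atTop (tendsto_atTop_add_const_right _ _ tendsto_natCast_atTop_atTop)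
    simpa using this.const_add s
  have hmeas : ∀ k, MeasurableSet {w | s < u w ∧ u w ≤ τ k} := fun k =>
    (measurableSet_lt measurable_const hu).inter (measurableSet_le hu measurable_const)
  have hlim := tendsto_measure_iInter_atTop (μ := (volume : Measure (Cyl n)))
    (s := fun k => {w | s < u w ∧ u w ≤ τ k}) (fun k => (hmeas k).nullMeasurableSet)
    (fun j k hjk w hw => ⟨hw.1, hw.2.trans (hτanti hjk)⟩)
    ⟨0, by rw [(levelVol_sub hu hη hv hs (hτs 0).le (hτ1 0)).1]; exact ENNReal.ofReal_ne_top⟩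
  have hempty : (⋂ k, {w | s < u w ∧ u w ≤ τ k}) = ∅ := by
    ext w
    simp only [Set.mem_iInter, Set.mem_ofPred_eq, Set.mem_empty_iff_false, iff_false, not_forall]
    by_contra hcon
    push Not at hcon
    exact absurd (ge_of_tendsto' hτlim fun k => (hcon k).2) (not_le.2 (hcon 0).1)
  rw [hempty, measure_empty] at hlim
  have hlim2 := (ENNReal.tendsto_toReal ENNReal.zero_ne_top).comp hlim
  have heq : ∀ k, (ENNReal.toReal ∘ fun k => volume {w | s < u w ∧ u w ≤ τ k}) k =
      levelVol u (τ k) - levelVol u s := fun k => by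
    obtain ⟨e1, e2⟩ := levelVol_sub hu hη hv hs (hτs k).le (hτ1 k)
    simp only [Function.comp]
    rw [e1, ENNReal.toReal_ofReal (by linarith)]
  have := ge_of_tendsto' (hlim2.congr heq) (b := x - levelVol u s) fun k => by
    linarith [h (τ k) (hτs k) (hτ1 k)]
  rw [ENNReal.toReal_zero] at this
  linarith

/-- The increasing rearrangement, normalized to change sign at the origin. -/
def rearr (u : Cyl n → ℝ) (x : ℝ) : ℝ :=
  -- The inserted -1 is the value where no level qualifies; the supremum of the empty set would be
  -- 0.
  sSup (insert (-1) {s | s ∈ Set.Ioo (-1 : ℝ) 1 ∧ levelVol u s - levelVol u 0 < x})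

lemma bddAbove_rearr (u : Cyl n → ℝ) (x : ℝ) :
    BddAbove (insert (-1) {s | s ∈ Set.Ioo (-1 : ℝ) 1 ∧ levelVol u s - levelVol u 0 < x}) := by
  refine ⟨1, ?_⟩
  rintro s (rfl | h)
  · norm_num
  · exact h.1.2.le

/-- Identifies the sublevel sets of the rearrangement as closed half lines. The forward direction
uses right continuity of `levelVol`, the backward one its monotonicity. -/
lemma rearr_le_iff (hu : Measurable u) (hη : IsProfile η) (hv : MemLp (fun w => u w - η w.1) 2 volume)
    {s : ℝ} (hs : s ∈ Set.Ioo (-1 : ℝ) 1) (x : ℝ) :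
    rearr u x ≤ s ↔ x ≤ levelVol u s - levelVol u 0 := by
  constructor
  · intro h
    have : x + levelVol u 0 ≤ levelVol u s := by
      refine levelVol_right_cont hu hη hv hs.1 hs.2 fun t ht ht1 => ?_
      by_contra hcon
      rw [not_le] at hcon
      have h1 : t ≤ rearr u x := le_csSup (bddAbove_rearr u x)
        (Or.inr ⟨⟨hs.1.trans ht, ht1⟩, by linarith⟩)
      linarith
    linarith
  · intro h
    refine csSup_le (Set.insert_nonempty _ _) ?_
    rintro t (rfl | ⟨ht, htx⟩)
    · exact hs.1.le
    · by_contra hcon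
      rw [not_le] at hcon
      have := (levelVol_sub hu hη hv hs.1 hcon.le ht.2).2
      linarith

lemma isLayer_rearr (hu : Measurable u) (hη : IsProfile η) (hv : MemLp (fun w => u w - η w.1) 2 volume) :
    IsLayer (rearr u) := by
  refine ⟨fun x y hxy => ?_, fun x => ?_, fun x => ?_, fun x hx => ?_, fun x hx => ?_⟩
  · refine csSup_le_csSup (bddAbove_rearr u y) (Set.insert_nonempty _ _) (Set.insert_subset_insert ?_)
    exact fun s hs => ⟨hs.1, hs.2.trans_le hxy⟩
  · exact le_csSup (bddAbove_rearr u x) (Set.mem_insert _ _)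
  · refine csSup_le (Set.insert_nonempty _ _) ?_
    rintro s (rfl | h)
    · norm_num
    · exact h.1.2.le
  · refine le_csSup (bddAbove_rearr u x) (Or.inr ⟨by norm_num, ?_⟩)
    simpa using hx
  · rw [rearr_le_iff hu hη hv (by norm_num)]
    simpa using hx.le

end Levels

end

/-! ### The rearrangement does not increase the energy -/

section

variable {n : ℕ}

lemma lintegral_layerCake {X : Type*} [MeasurableSpace X] {μ : Measure X} [SFinite μ] {a b : X → ℝ}
    (ha : Measurable a) (hb : Measurable b) :
    ∫⁻ w, layerCake (a w) (b w) ∂μ =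
      ∫⁻ p, μ {w | a w ≤ p.1 ∧ p.1 < p.2 ∧ p.2 < b w}
        ∂((volume.restrict (Set.Ioo (-1 : ℝ) 1)).prod (volume.restrict (Set.Ioo (-1 : ℝ) 1))) := by
  have hm : MeasurableSet {q : X × (ℝ × ℝ) | a q.1 ≤ q.2.1 ∧ q.2.1 < q.2.2 ∧ q.2.2 < b q.1} :=
    (measurableSet_le (ha.comp measurable_fst) (measurable_fst.comp measurable_snd)).inter
      ((measurableSet_lt (measurable_fst.comp measurable_snd) (measurable_snd.comp measurable_snd)).inter
        (measurableSet_lt (measurable_snd.comp measurable_snd) (hb.comp measurable_fst)))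
  have hmi : Measurable fun q : X × (ℝ × ℝ) =>
      {q : X × (ℝ × ℝ) | a q.1 ≤ q.2.1 ∧ q.2.1 < q.2.2 ∧ q.2.2 < b q.1}.indicator (fun _ => (1 : ℝ≥0∞)) q :=
    measurable_const.indicator hm
  unfold layerCake
  have := lintegral_lintegral_swap (μ := μ)
    (ν := (volume.restrict (Set.Ioo (-1 : ℝ) 1)).prod (volume.restrict (Set.Ioo (-1 : ℝ) 1)))
    (f := fun w p => {q : X × (ℝ × ℝ) | a q.1 ≤ q.2.1 ∧ q.2.1 < q.2.2 ∧ q.2.2 < b q.1}.indicator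
      (fun _ => (1 : ℝ≥0∞)) (w, p)) hmi.aemeasurable
  refine this.trans (lintegral_congr fun p => ?_)
  have hs : MeasurableSet {w | a w ≤ p.1 ∧ p.1 < p.2 ∧ p.2 < b w} :=
    measurable_prodMk_right hm
  rw [← lintegral_indicator_one hs]
  rfl

lemma volume_Ioc_fst (a b : ℝ) : volume {w : Cyl n | a < w.1 ∧ w.1 ≤ b} = ENNReal.ofReal (b - a) := by
  have := (measurePreserving_fst_cyl (n := n)).measure_preimage
    (measurableSet_Ioc (a := a) (b := b)).nullMeasurableSet
  rwa [Real.volume_Ioc] at this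

section

variable {u : Cyl n → ℝ} {η γ : ℝ → ℝ}

lemma shiftSq_neg (u : Cyl n → ℝ) (z : Cyl n) : shiftSq u (-z) = shiftSq u z := by
  unfold shiftSq
  rw [← lintegral_sub_right_eq_self (fun w => ENNReal.ofReal ((u w - u (w - -z)) ^ 2)) z]
  refine lintegral_congr fun w => ?_
  rw [sub_neg_eq_add, sub_add_cancel]
  congr 1; ring

/-- The rearrangement inequality. After the layer-cake formula, fix levels s < t and a shift with z₁
> 0. For the layer the set in question is a slab of volume (z₁ - |{s < u ≤ t}|)₊; for u it is at
least that, since pushing {u ≤ s} by z makes volume z₁ or more leave it, and what leaves either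
passes above t or stays in {s < u ≤ t}. -/
lemma shiftSq_rearr_le (hu : Measurable u) (hη : IsProfile η) (hv : MemLp (fun w => u w - η w.1) 2 volume)
    (z : Cyl n) : shiftSq (fun w => rearr u w.1) z ≤ shiftSq u z := by
  have hL := isLayer_rearr hu hη hv
  wlog hz : 0 < z.1 generalizing z
  -- Negative shifts reduce to positive ones by symmetry of the increment norm, and a shift along
  -- the torus does not move a layer.
  · rcases lt_or_eq_of_le (not_lt.1 hz) with h | h
    · rw [← shiftSq_neg, ← shiftSq_neg u]
      exact this (-z) (by simpa using h)
    · have : shiftSq (fun w : Cyl n => rearr u w.1) z = 0 := by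
        simp [shiftSq, h]
      rw [this]; exact zero_le
  have hsub : Measurable fun w : Cyl n => w - z := by fun_prop
  have m1 : Measurable fun w : Cyl n => rearr u (w - z).1 := hL.measurable.comp (measurable_fst.comp hsub)
  have m2 : Measurable fun w : Cyl n => rearr u w.1 := hL.measurable.comp measurable_fst
  have e1 : shiftSq (fun w => rearr u w.1) z = 2 * ∫⁻ w : Cyl n, layerCake (rearr u (w - z).1) (rearr u w.1) := by
    rw [← lintegral_const_mul' _ _ (by simp)]
    refine lintegral_congr fun w => ?_
    rw [two_mul_layerCake_eq (hL.ge _) (hL.mono (by simpa using hz.le)) (hL.le _)]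
  have e2 : 2 * ∫⁻ w : Cyl n, layerCake (u (w - z)) (u w) ≤ shiftSq u z := by
    rw [← lintegral_const_mul' _ _ (by simp)]
    exact lintegral_mono fun w => two_mul_layerCake_le _ _
  rw [e1]
  refine le_trans ?_ e2
  gcongr 2 * ?_
  rw [lintegral_layerCake m1 m2, lintegral_layerCake (a := fun w => u (w - z)) (hu.comp hsub) hu, Measure.prod_restrict]
  refine setLIntegral_mono' (measurableSet_Ioo.prod measurableSet_Ioo) ?_
  rintro ⟨s, t⟩ ⟨hs, ht⟩
  dsimp only at hs ht ⊢
  by_cases hst : s < t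
  swap
  · simp [hst]
  have A1 : volume {w : Cyl n | rearr u (w - z).1 ≤ s ∧ s < t ∧ t < rearr u w.1} =
      ENNReal.ofReal (z.1 - (levelVol u t - levelVol u s)) := by
    have : {w : Cyl n | rearr u (w - z).1 ≤ s ∧ s < t ∧ t < rearr u w.1} =
        {w : Cyl n | levelVol u t - levelVol u 0 < w.1 ∧ w.1 ≤ levelVol u s - levelVol u 0 + z.1} := by
      ext w
      simp only [Set.mem_ofPred_eq, hst, true_and]
      rw [rearr_le_iff hu hη hv hs, ← not_le, rearr_le_iff hu hη hv ht, Prod.fst_sub, not_le, and_comm,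
        sub_le_iff_le_add]
    rw [this, volume_Ioc_fst]
    congr 1; ring
  have A2 : ENNReal.ofReal z.1 ≤ volume {w | u (w - z) ≤ s ∧ s < t ∧ t < u w} +
      ENNReal.ofReal (levelVol u t - levelVol u s) := by
    rw [← (levelVol_sub hu hη hv hs.1 hst.le ht.2).1]
    refine (le_volume_shift_diff (A := {w | u w ≤ s}) (measurableSet_le hu measurable_const)
      (volume_sublevel_right hη hv hs.2).ne ?_ z hz).trans ((measure_mono ?_).trans (measure_union_le _ _))
    · convert! (volume_superlevel_left hη hv hs.1).ne using 3
      ext w; simp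
    · rintro w ⟨h1, h2⟩
      simp only [Set.mem_ofPred_eq, not_le] at h1 h2
      by_cases h : u w ≤ t
      · right; exact ⟨h2, h⟩
      · left; exact ⟨h1, hst, not_le.1 h⟩
  rw [A1, ENNReal.ofReal_sub _ (by linarith [(levelVol_sub hu hη hv hs.1 hst.le ht.2).2])]
  exact tsub_le_iff_right.2 A2

lemma iUnion_Ioc_eq_Ioo :
    (⋃ m : ℕ, Set.Ioc (-1 + 1 / ((m : ℝ) + 2)) (1 - 1 / ((m : ℝ) + 2))) = Set.Ioo (-1 : ℝ) 1 := by
  ext s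
  simp only [Set.mem_iUnion, Set.mem_Ioc, Set.mem_Ioo]
  constructor
  · rintro ⟨m, h1, h2⟩
    have : 0 < 1 / ((m : ℝ) + 2) := by positivity
    constructor <;> linarith
  · rintro ⟨h1, h2⟩
    obtain ⟨m, hm⟩ := exists_nat_one_div_lt (show 0 < min (s + 1) (1 - s) from lt_min (by linarith) (by linarith))
    have h3 : 1 / ((m : ℝ) + 2) ≤ 1 / ((m : ℝ) + 1) := by gcongr; norm_num
    have := hm.trans_le (min_le_left _ _)
    have := hm.trans_le (min_le_right _ _)
    exact ⟨m, by linarith, by linarith⟩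

/-- Intervals (s, t] inside (-1,1) have equal mass by the description of the sublevel sets. The
exhaustion by compactly contained intervals provides the finiteness needed to pass to measures. -/
lemma map_rearr_restrict (hu : Measurable u) (hη : IsProfile η) (hv : MemLp (fun w => u w - η w.1) 2 volume) :
    (Measure.map (fun w : Cyl n => rearr u w.1) volume).restrict (Set.Ioo (-1) 1) =
      (Measure.map u volume).restrict (Set.Ioo (-1) 1) := by
  have hL := isLayer_rearr hu hη hv
  have m2 : Measurable fun w : Cyl n => rearr u w.1 := hL.measurable.comp measurable_fst
  have key : ∀ s t, -1 < s → t < 1 → Measure.map (fun w : Cyl n => rearr u w.1) volume (Set.Ioc s t) =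
      Measure.map u volume (Set.Ioc s t) := by
    intro s t hs ht
    rcases le_or_gt s t with hst | hst
    swap
    · simp [Set.Ioc_eq_empty (not_lt.2 hst.le)]
    rw [Measure.map_apply m2 measurableSet_Ioc, Measure.map_apply hu measurableSet_Ioc]
    have hs' : s ∈ Set.Ioo (-1 : ℝ) 1 := ⟨hs, hst.trans_lt ht⟩
    have ht' : t ∈ Set.Ioo (-1 : ℝ) 1 := ⟨hs.trans_le hst, ht⟩
    have e : (fun w : Cyl n => rearr u w.1) ⁻¹' Set.Ioc s t =
        {w : Cyl n | levelVol u s - levelVol u 0 < w.1 ∧ w.1 ≤ levelVol u t - levelVol u 0} := by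
      ext w
      simp only [Set.mem_preimage, Set.mem_Ioc, Set.mem_ofPred_eq]
      rw [← not_le, rearr_le_iff hu hη hv hs', rearr_le_iff hu hη hv ht', not_le]
    rw [e, volume_Ioc_fst, sub_sub_sub_cancel_right]
    exact (levelVol_sub hu hη hv hs hst ht).1.symm
  have keytop : ∀ s t, -1 < s → t < 1 → Measure.map u volume (Set.Ioc s t) < ⊤ := by
    intro s t hs ht
    rcases le_or_gt s t with hst | hst
    swap
    · simp [Set.Ioc_eq_empty (not_lt.2 hst.le)]
    rw [Measure.map_apply hu measurableSet_Ioc]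
    exact (levelVol_sub hu hη hv hs hst ht).1.trans_lt ENNReal.ofReal_lt_top
  rw [← iUnion_Ioc_eq_Ioo, Measure.restrict_iUnion_congr]
  intro m
  have hm : (0 : ℝ) < 1 / ((m : ℝ) + 2) := by positivity
  set a : ℝ := -1 + 1 / ((m : ℝ) + 2) with ha
  set b : ℝ := 1 - 1 / ((m : ℝ) + 2) with hb
  have fin : IsFiniteMeasure ((Measure.map (fun w : Cyl n => rearr u w.1) volume).restrict (Set.Ioc a b)) :=
    ⟨by rw [Measure.restrict_apply_univ, key a b (by linarith) (by linarith)]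
        exact keytop a b (by linarith) (by linarith)⟩
  refine Measure.ext_of_Ioc _ _ fun s t hst => ?_
  rw [Measure.restrict_apply measurableSet_Ioc, Measure.restrict_apply measurableSet_Ioc, Set.Ioc_inter_Ioc]
  exact key _ _ (lt_of_lt_of_le (by linarith) (le_max_right s a)) (lt_of_le_of_lt (min_le_right t b) (by linarith))

/-- Inside (-1,1) the distributions agree. Outside, the layer takes only the values ±1, which are
free, while u can only pay more because γ ≥ 0. -/
lemma lintegral_potential_rearr_le (hγ : IsDoubleWell γ) (hu : Measurable u) (hη : IsProfile η)
    (hv : MemLp (fun w => u w - η w.1) 2 volume) :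
    ∫⁻ w : Cyl n, ENNReal.ofReal (γ (rearr u w.1)) ≤ ∫⁻ w, ENNReal.ofReal (γ (u w)) := by
  have hL := isLayer_rearr hu hη hv
  have m2 : Measurable fun w : Cyl n => rearr u w.1 := hL.measurable.comp measurable_fst
  have hγm : Measurable fun s => ENNReal.ofReal (γ s) := hγ.contDiff.continuous.measurable.ennreal_ofReal
  rw [← lintegral_map (f := fun s => ENNReal.ofReal (γ s)) hγm m2, ← lintegral_map hγm hu]
  calc ∫⁻ s, ENNReal.ofReal (γ s) ∂(Measure.map (fun w : Cyl n => rearr u w.1) volume)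
      = ∫⁻ s in Set.Ioo (-1) 1, ENNReal.ofReal (γ s) ∂(Measure.map (fun w : Cyl n => rearr u w.1) volume) := by
        rw [← lintegral_indicator measurableSet_Ioo, lintegral_map hγm m2,
          lintegral_map (hγm.indicator measurableSet_Ioo) m2]
        refine lintegral_congr fun w => ?_
        by_cases h : rearr u w.1 ∈ Set.Ioo (-1 : ℝ) 1
        · rw [Set.indicator_of_mem h]
        · rw [Set.indicator_of_notMem h]
          rcases (hL.ge w.1).lt_or_eq with h1 | h1
          · rcases (hL.le w.1).lt_or_eq with h2 | h2
            · exact absurd ⟨h1, h2⟩ h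
            · rw [h2, hγ.zero_one, ENNReal.ofReal_zero]
          · rw [← h1, hγ.zero_neg_one, ENNReal.ofReal_zero]
    _ = ∫⁻ s in Set.Ioo (-1) 1, ENNReal.ofReal (γ s) ∂(Measure.map u volume) := by
        rw [map_rearr_restrict hu hη hv]
    _ ≤ _ := setLIntegral_le_lintegral _ _

lemma memLp_layer_sub {φ : ℝ → ℝ} (hγ : IsDoubleWell γ) (hη : IsProfile η) (hφ : IsLayer φ)
    (h : ∫⁻ x, ENNReal.ofReal (γ (φ x)) < ⊤) : MemLp (fun x => φ x - η x) 2 volume := by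
  obtain ⟨c, D, hc, hcD⟩ := exists_layer_bound hη hγ
  have hm : Measurable fun x => φ x - η x := hφ.measurable.sub hη.smooth.continuous.measurable
  refine ⟨hm.aestronglyMeasurable, ?_⟩
  refine (ENNReal.pow_lt_top_iff (n := 2)).1 ?_ |>.resolve_right (by norm_num)
  rw [eLpNorm_two_sq]
  have hb : ∀ x, ENNReal.ofReal (‖φ x - η x‖ ^ 2) ≤ (Set.Icc (-1 : ℝ) 1).indicator (fun _ => ENNReal.ofReal (D ^ 2)) x +
      ENNReal.ofReal c⁻¹ * ENNReal.ofReal (γ (φ x)) := by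
    intro x
    rw [Real.norm_eq_abs, sq_abs]
    rcases le_or_gt |x| 1 with hx | hx
    · rw [Set.indicator_of_mem (show x ∈ Set.Icc (-1 : ℝ) 1 from abs_le.1 hx)]
      refine le_add_right (ENNReal.ofReal_le_ofReal ?_)
      rw [← sq_abs]
      exact pow_le_pow_left₀ (abs_nonneg _) ((hcD φ hφ x).1 hx) 2
    · refine le_add_left ?_
      rw [← ENNReal.ofReal_mul (by positivity)]
      refine ENNReal.ofReal_le_ofReal ?_
      rw [inv_mul_eq_div, le_div_iff₀ hc, mul_comm]
      exact (hcD φ hφ x).2 hx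
  refine (lintegral_mono hb).trans_lt ?_
  rw [lintegral_add_left (measurable_const.indicator measurableSet_Icc), lintegral_indicator measurableSet_Icc,
    lintegral_const_mul' _ _ ENNReal.ofReal_ne_top]
  refine ENNReal.add_lt_top.2 ⟨?_, ENNReal.mul_lt_top ENNReal.ofReal_lt_top h⟩
  simp [ENNReal.mul_lt_top_iff]

lemma lintegral_fst_cyl {f : ℝ → ℝ≥0∞} (hf : Measurable f) : ∫⁻ w : Cyl n, f w.1 = ∫⁻ x, f x :=
  (measurePreserving_fst_cyl (n := n)).lintegral_comp hf

/-- Replacing a function by its increasing rearrangement does not increase the energy. -/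
lemma GAdm.exists_layer {H : ℝ × (Fin n → ℝ) → ℝ} (hH : IsKernel H) (hγ : IsDoubleWell γ) (hη : IsProfile η)
    (hu : GAdm H η u) (hpot : ∫⁻ w, ENNReal.ofReal (γ (u w)) < ⊤) :
    ∃ φ, IsLayer φ ∧ GAdm H η (fun w : Cyl n => φ w.1) ∧
      ∫ q, density' η (fun w : Cyl n => φ w.1) q ∂(volume.prod (cylMeas H)) ≤
        ∫ q, density' η u q ∂(volume.prod (cylMeas H)) ∧
      ∫⁻ x, ENNReal.ofReal (γ (φ x)) ≤ ∫⁻ w, ENNReal.ofReal (γ (u w)) := by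
  have hum := hu.aestronglyMeasurable hη
  -- The rearrangement is built from a measurable function; u is only measurable up to a null set,
  -- which none of the quantities notices.
  set U := hum.mk u
  have hUu : u =ᵐ[volume] U := hum.ae_eq_mk
  have hU : Measurable U := hum.stronglyMeasurable_mk.measurable
  have hv : MemLp (fun w => U w - η w.1) 2 volume := hu.memLp.ae_eq (by
    filter_upwards [hUu] with w hw using by rw [hw])
  have hshift : ∀ z, shiftSq U z = shiftSq u z := fun z => by
    refine lintegral_congr_ae ?_
    have := (measurePreserving_sub_right (volume : Measure (Cyl n)) z).quasiMeasurePreserving.ae_eq_comp hUu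
    filter_upwards [hUu, this] with w h1 h2
    simp only [Function.comp] at h2
    rw [h1, h2]
  have hle : ∀ z, shiftSq (fun w => rearr U w.1) z ≤ shiftSq u z := fun z =>
    (shiftSq_rearr_le hU hη hv z).trans (hshift z).le
  have hL := isLayer_rearr hU hη hv
  have hγm : Measurable fun x => ENNReal.ofReal (γ (rearr U x)) :=
    (hγ.contDiff.continuous.measurable.comp hL.measurable).ennreal_ofReal
  have hpotle : ∫⁻ x, ENNReal.ofReal (γ (rearr U x)) ≤ ∫⁻ w, ENNReal.ofReal (γ (u w)) := by
    rw [← lintegral_fst_cyl (n := n) hγm]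
    refine (lintegral_potential_rearr_le hγ hU hη hv).trans_eq (lintegral_congr_ae ?_)
    filter_upwards [hUu] with w hw using by rw [hw]
  have hmem := memLp_layer_sub hγ hη hL (hpotle.trans_lt hpot)
  have hG : GAdm H η (fun w : Cyl n => rearr U w.1) := hu.of_shiftSq_le hH hη (memLp_lift hmem) hle
  exact ⟨rearr U, hL, hG, hu.integral_density'_le hH hη hG hle, hpotle⟩

end

end

/-! ### Compactness of layers and the direct method -/

section

variable {n : ℕ}

lemma liminf_add_liminf_le (a b : ℕ → ℝ≥0∞) :
    liminf a atTop + liminf b atTop ≤ liminf (fun k => a k + b k) atTop := by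
  rw [liminf_eq_iSup_iInf_of_nat, liminf_eq_iSup_iInf_of_nat, liminf_eq_iSup_iInf_of_nat,
    ENNReal.iSup_add_iSup_of_monotone
      (fun i j hij => le_iInf₂ fun k hk => iInf₂_le k (hij.trans hk))
      (fun i j hij => le_iInf₂ fun k hk => iInf₂_le k (hij.trans hk))]
  exact iSup_mono fun k => le_iInf₂ fun i hi => add_le_add (iInf₂_le i hi) (iInf₂_le i hi)

/-- Helly selection for layers. -/
lemma exists_subseq_tendsto_layer {f : ℕ → ℝ → ℝ} (hf : ∀ k, IsLayer (f k)) :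
    ∃ θ : ℕ → ℕ, StrictMono θ ∧ ∃ φ, IsLayer φ ∧ ∃ S : Set ℝ, S.Countable ∧
      ∀ x ∉ S, Tendsto (fun k => f (θ k) x) atTop (𝓝 (φ x)) := by
  -- The diagonal extraction over rational points is sequential compactness of [-1,1]^ℚ.
  have hK : IsCompact (Set.univ.pi fun _ : ℚ => Set.Icc (-1 : ℝ) 1) := isCompact_univ_pi fun _ => isCompact_Icc
  obtain ⟨g, hg, θ, hθ, hlim⟩ := hK.tendsto_subseq (x := fun k (q : ℚ) => f k q)
    fun k q _ => ⟨(hf k).ge q, (hf k).le q⟩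
  have hgq : ∀ q : ℚ, Tendsto (fun k => f (θ k) q) atTop (𝓝 (g q)) := fun q => tendsto_pi_nhds.1 hlim q
  have hg1 : ∀ q, g q ∈ Set.Icc (-1 : ℝ) 1 := fun q => hg q trivial
  -- A supremum over rationals strictly below x gives a monotone limit; at its continuity points it
  -- is squeezed between rational values, so convergence fails at most on a countable set.
  set φ : ℝ → ℝ := fun x => sSup (g '' {q : ℚ | (q : ℝ) < x}) with hφ
  have hbdd : ∀ x, BddAbove (g '' {q : ℚ | (q : ℝ) < x}) := fun x =>
    ⟨1, by rintro _ ⟨q, -, rfl⟩; exact (hg1 q).2⟩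
  have hne : ∀ x, (g '' {q : ℚ | (q : ℝ) < x}).Nonempty := fun x => by
    obtain ⟨q, hq⟩ := exists_rat_lt x
    exact ⟨g q, q, hq, rfl⟩
  have hle : ∀ (x : ℝ) (q : ℚ), (q : ℝ) < x → g q ≤ φ x := fun x q hq => le_csSup (hbdd x) ⟨q, hq, rfl⟩
  have hmono : Monotone φ := fun x y hxy =>
    csSup_le_csSup (hbdd y) (hne x) (Set.image_mono fun q (hq : (q : ℝ) < x) => hq.trans_le hxy)
  have hL : IsLayer φ := by
    refine ⟨hmono, fun x => ?_, fun x => ?_, fun x hx => ?_, fun x hx => ?_⟩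
    · obtain ⟨q, hq⟩ := exists_rat_lt x
      exact (hg1 q).1.trans (hle x q hq)
    · refine csSup_le (hne x) ?_
      rintro _ ⟨q, -, rfl⟩
      exact (hg1 q).2
    · obtain ⟨q, hq0, hq⟩ := exists_rat_btwn hx
      exact (ge_of_tendsto' (hgq q) fun k => (hf (θ k)).nonneg q hq0).trans (hle x q hq)
    · refine csSup_le (hne x) ?_
      rintro _ ⟨q, hq, rfl⟩
      exact le_of_tendsto' (hgq q) fun k => (hf (θ k)).nonpos q (hq.trans hx)
  refine ⟨θ, hθ, φ, hL, {x | ¬ContinuousAt φ x}, hmono.countable_not_continuousAt, fun x hx => ?_⟩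
  have hc : ContinuousAt φ x := by simpa using hx
  rw [tendsto_order]
  constructor
  · intro a ha
    obtain ⟨_, ⟨q, hq, rfl⟩, haq⟩ := exists_lt_of_lt_csSup (hne x) ha
    filter_upwards [(hgq q).eventually_const_lt haq] with k hk
    exact hk.trans_le ((hf (θ k)).mono (le_of_lt hq))
  · intro b hb
    obtain ⟨δ, hδ, hball⟩ := Metric.eventually_nhds_iff.1 (hc.eventually_lt_const hb)
    have hy : φ (x + δ / 2) < b := hball (by rw [Real.dist_eq]; rw [abs_of_pos] <;> linarith)
    obtain ⟨q, hq1, hq2⟩ := exists_rat_btwn (show x < x + δ / 2 by linarith)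
    filter_upwards [(hgq q).eventually_lt_const ((hle _ q hq2).trans_lt hy)] with k hk
    exact ((hf (θ k)).mono hq1.le).trans_lt hk

section

variable {H : ℝ × (Fin n → ℝ) → ℝ} {γ η : ℝ → ℝ}

/-- The local part of the energy of a layer. -/
def localDensity (H : ℝ × (Fin n → ℝ) → ℝ) (γ η φ : ℝ → ℝ) (x : ℝ) : ℝ :=
  (φ x - η x) * Lop (kerConst H) η x + γ (φ x)

/-- With ℓ = Lη, completing the square gives (φ-η)ℓ ≥ -(c/2)(φ-η)² - ℓ²/(2c), and the potential
absorbs the quadratic term. Adding the fixed integrable ρ makes the local density nonnegative, ready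
for Fatou, and still controls both the L² distance and the potential. -/
lemma exists_coercive (hH : IsKernel H) (hγ : IsDoubleWell γ) (hη : IsProfile η) :
    ∃ (ρ : ℝ → ℝ) (c : ℝ), 0 < c ∧ Integrable ρ ∧ Measurable ρ ∧ ∀ φ, IsLayer φ → ∀ x,
      c * (φ x - η x) ^ 2 ≤ localDensity H γ η φ x + ρ x ∧
        γ (φ x) ≤ 2 * (localDensity H γ η φ x + ρ x) := by
  obtain ⟨c, D, hc, hcD⟩ := exists_layer_bound hη hγ
  obtain ⟨B, hB⟩ := hη.exists_isBump
  set ℓ := Lop (kerConst H) η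
  have hℓ : MemLp ℓ 2 volume := hB.memLp_Lop hH.finiteMoment
  have hℓm : Measurable ℓ := hB.measurable_Lop _
  refine ⟨fun x => (2 * c)⁻¹ * ℓ x ^ 2 + (Set.Icc (-1 : ℝ) 1).indicator (fun _ => c * D ^ 2) x, c / 2, by positivity,
    (hℓ.integrable_sq.const_mul _).add ((integrable_indicator_iff measurableSet_Icc).2
      (integrableOn_const (by simp) enorm_ne_top)), by fun_prop (disch := exact measurableSet_Icc), fun φ hφ x => ?_⟩
  have h1 : -(c / 2 * (φ x - η x) ^ 2) - (2 * c)⁻¹ * ℓ x ^ 2 ≤ (φ x - η x) * ℓ x := by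
    have h2 : 0 ≤ (2 * c)⁻¹ * (c * (φ x - η x) + ℓ x) ^ 2 := by positivity
    have h3 : (2 * c)⁻¹ * (c * (φ x - η x) + ℓ x) ^ 2 =
        c / 2 * (φ x - η x) ^ 2 + (φ x - η x) * ℓ x + (2 * c)⁻¹ * ℓ x ^ 2 := by
      field_simp; ring
    linarith
  have h4 : c * (φ x - η x) ^ 2 ≤ γ (φ x) + (Set.Icc (-1 : ℝ) 1).indicator (fun _ => c * D ^ 2) x := by
    rcases le_or_gt |x| 1 with hx | hx
    · rw [Set.indicator_of_mem (show x ∈ Set.Icc (-1 : ℝ) 1 from abs_le.1 hx)]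
      have : (φ x - η x) ^ 2 ≤ D ^ 2 := by
        rw [← sq_abs]
        exact pow_le_pow_left₀ (abs_nonneg _) ((hcD φ hφ x).1 hx) 2
      nlinarith [hγ.nonneg (φ x)]
    · have := (hcD φ hφ x).2 hx
      have h5 : 0 ≤ (Set.Icc (-1 : ℝ) 1).indicator (fun _ => c * D ^ 2) x :=
        Set.indicator_nonneg (fun _ _ => by positivity) x
      linarith
  have h5 : 0 ≤ (Set.Icc (-1 : ℝ) 1).indicator (fun _ => c * D ^ 2) x :=
    Set.indicator_nonneg (fun _ _ => by positivity) x
  have hmain : c / 2 * (φ x - η x) ^ 2 ≤ localDensity H γ η φ x +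
      ((2 * c)⁻¹ * ℓ x ^ 2 + (Set.Icc (-1 : ℝ) 1).indicator (fun _ => c * D ^ 2) x) := by
    unfold localDensity
    linarith
  refine ⟨hmain, ?_⟩
  unfold localDensity at hmain ⊢
  linarith

/-- The coercive form of the energy on layers. -/
def layerEnergy (H : ℝ × (Fin n → ℝ) → ℝ) (γ η ρ φ : ℝ → ℝ) : ℝ≥0∞ :=
  gag (cylMeas H) (fun w : Cyl n => φ w.1 - η w.1) +
    4 * ∫⁻ x, ENNReal.ofReal (localDensity H γ η φ x + ρ x)

/-- Four times the energy of a function of finite potential energy. -/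
def energy' (H : ℝ × (Fin n → ℝ) → ℝ) (γ η : ℝ → ℝ) (u : Cyl n → ℝ) : ℝ :=
  ∫ q, density' η u q ∂(volume.prod (cylMeas H)) + 4 * (∫⁻ w, ENNReal.ofReal (γ (u w))).toReal

lemma measurable_localDensity (hγ : IsDoubleWell γ) (hη : IsProfile η) {φ : ℝ → ℝ} (hφ : Measurable φ) :
    Measurable (localDensity H γ η φ) := by
  obtain ⟨B, hB⟩ := hη.exists_isBump
  have hℓm : Measurable (Lop (kerConst H) η) := hB.measurable_Lop _
  have := hη.smooth.continuous.measurable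
  have := hγ.contDiff.continuous.measurable
  unfold localDensity
  fun_prop

lemma integrable_potential (hγ : IsDoubleWell γ) {X : Type*} [MeasurableSpace X] {μ : Measure X} {f : X → ℝ}
    (hf : AEMeasurable f μ) (h : ∫⁻ x, ENNReal.ofReal (γ (f x)) ∂μ < ⊤) : Integrable (fun x => γ (f x)) μ :=
  (lintegral_ofReal_ne_top_iff_integrable (hγ.contDiff.continuous.measurable.comp_aemeasurable hf).aestronglyMeasurable
    (Eventually.of_forall fun _ => hγ.nonneg _)).1 h.ne

/-- On admissible layers `layerEnergy` is the energy up to the constant 4∫ρ. Having it in ℝ≥0∞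
allows infima and lower limits with no prior finiteness. -/
lemma layerEnergy_eq (hH : IsKernel H) (hγ : IsDoubleWell γ) (hη : IsProfile η) {ρ φ : ℝ → ℝ} (hρ : Integrable ρ)
    (hφ : Measurable φ) (hG : GAdm H η (fun w : Cyl n => φ w.1)) (hpot : ∫⁻ x, ENNReal.ofReal (γ (φ x)) < ⊤)
    (hpos : ∀ x, 0 ≤ localDensity H γ η φ x + ρ x) :
    layerEnergy H γ η ρ φ = ENNReal.ofReal (energy' H γ η (fun w : Cyl n => φ w.1) + 4 * ∫ x, ρ x) ∧
      0 ≤ energy' H γ η (fun w : Cyl n => φ w.1) + 4 * ∫ x, ρ x := by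
  obtain ⟨B, hB⟩ := hη.exists_isBump
  have hℓ : MemLp (Lop (kerConst H) η) 2 volume := hB.memLp_Lop hH.finiteMoment
  have hγm : Measurable fun x => ENNReal.ofReal (γ (φ x)) :=
    (hγ.contDiff.continuous.measurable.comp hφ).ennreal_ofReal
  have hv : MemLp (fun x => φ x - η x) 2 volume := by
    have hm := hG.memLp
    have := (measurePreserving_fst_cyl (n := n))
    refine (memLp_map_measure_iff (f := Prod.fst) (μ := (volume : Measure (Cyl n)))
      (g := fun x => φ x - η x) ?_ this.measurable.aemeasurable).2 hm |> fun h => by rwa [this.map_eq] at h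
    exact (hφ.sub hη.smooth.continuous.measurable).aestronglyMeasurable
  have i1 : Integrable (fun x => (φ x - η x) * Lop (kerConst H) η x) := hv.integrable_mul hℓ
  have i2 : Integrable (fun x => γ (φ x)) := integrable_potential hγ hφ.aemeasurable hpot
  have i3 : Integrable (fun x => localDensity H γ η φ x + ρ x) := (i1.add i2).add hρ
  have e1 : ∫ w : Cyl n, (φ w.1 - η w.1) * Lop (kerConst H) η w.1 = ∫ x, (φ x - η x) * Lop (kerConst H) η x := by
    have := (measurePreserving_fst_cyl (n := n))
    rw [← this.map_eq, integral_map this.measurable.aemeasurable]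
    rw [this.map_eq]
    exact i1.aestronglyMeasurable
  have e2 : (∫⁻ w : Cyl n, ENNReal.ofReal (γ (φ w.1))).toReal = ∫ x, γ (φ x) := by
    rw [lintegral_fst_cyl hγm, integral_eq_lintegral_of_nonneg_ae (Eventually.of_forall fun x => hγ.nonneg _)
      i2.aestronglyMeasurable]
  have e3 : energy' H γ η (fun w : Cyl n => φ w.1) + 4 * ∫ x, ρ x =
      (gag (cylMeas H) (fun w : Cyl n => φ w.1 - η w.1)).toReal + 4 * ∫ x, (localDensity H γ η φ x + ρ x) := by
    rw [energy', hG.integral_density' hH hη, e1, e2]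
    have : ∫ x, (localDensity H γ η φ x + ρ x) =
        (∫ x, (φ x - η x) * Lop (kerConst H) η x) + (∫ x, γ (φ x)) + ∫ x, ρ x := by
      rw [← integral_add i1 i2]
      exact integral_add (i1.add i2) hρ
    rw [this]; ring
  have hnn : 0 ≤ ∫ x, (localDensity H γ η φ x + ρ x) := integral_nonneg hpos
  rw [e3]
  refine ⟨?_, by positivity⟩
  rw [layerEnergy, ENNReal.ofReal_add ENNReal.toReal_nonneg (by positivity), ENNReal.ofReal_toReal hG.gag_lt.ne,
    ENNReal.ofReal_mul (by norm_num), ofReal_integral_eq_lintegral_ofReal i3 (Eventually.of_forall hpos)]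
  simp

/-- Fatou for each of the two terms. The countable exceptional set is null both for w and for w - z.
-/
lemma layerEnergy_le_liminf (hγ : IsDoubleWell γ) (hη : IsProfile η) {ρ : ℝ → ℝ} (hρ : Measurable ρ)
    {f : ℕ → ℝ → ℝ} (hf : ∀ k, Measurable (f k)) {φ : ℝ → ℝ} (hφ : Measurable φ) {S : Set ℝ} (hS : S.Countable)
    (hlim : ∀ x ∉ S, Tendsto (fun k => f k x) atTop (𝓝 (φ x))) :
    layerEnergy H γ η ρ φ ≤ liminf (fun k => layerEnergy H γ η ρ (f k)) atTop := by
  have hηm := hη.smooth.continuous.measurable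
  have hlift : ∀ {g : ℝ → ℝ}, Measurable g → Measurable fun w : Cyl n => g w.1 - η w.1 := fun hg =>
    (hg.comp measurable_fst).sub (hηm.comp measurable_fst)
  have hSc : ∀ᵐ w : Cyl n, w.1 ∉ S := by
    have h0 : ∀ᵐ x : ℝ, x ∉ S := by
      rw [ae_iff]; simpa using hS.measure_zero volume
    exact (measurePreserving_fst_cyl (n := n)).quasiMeasurePreserving.ae h0
  have hq : ∀ᵐ q ∂((volume : Measure (Cyl n)).prod (cylMeas H)), q.1.1 ∉ S ∧ (q.1 - q.2).1 ∉ S :=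
    (Measure.quasiMeasurePreserving_fst.ae hSc).and ((quasiMeasurePreserving_sub_fst (cylMeas H)).ae hSc)
  have h1 : gag (cylMeas H) (fun w : Cyl n => φ w.1 - η w.1) ≤
      liminf (fun k => gag (cylMeas H) (fun w : Cyl n => f k w.1 - η w.1)) atTop := by
    simp_rw [gag_eq_lintegral _ (hlift hφ).aestronglyMeasurable,
      fun k => gag_eq_lintegral (cylMeas H) (hlift (hf k)).aestronglyMeasurable]
    refine (lintegral_mono_ae ?_).trans (lintegral_liminf_le' fun k =>
      ((aestronglyMeasurable_increment _ (hlift (hf k)).aestronglyMeasurable).aemeasurable.pow_const 2).ennreal_ofReal)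
    filter_upwards [hq] with q hq
    refine le_of_eq (Tendsto.liminf_eq ?_).symm
    refine ENNReal.tendsto_ofReal (Tendsto.pow ?_ 2)
    exact ((hlim _ hq.1).sub_const _).sub ((hlim _ hq.2).sub_const _)
  have h2 : ∫⁻ x, ENNReal.ofReal (localDensity H γ η φ x + ρ x) ≤
      liminf (fun k => ∫⁻ x, ENNReal.ofReal (localDensity H γ η (f k) x + ρ x)) atTop := by
    refine (lintegral_mono_ae ?_).trans (lintegral_liminf_le fun k =>
      ((measurable_localDensity hγ hη (hf k)).add hρ).ennreal_ofReal)
    filter_upwards [hS.ae_notMem volume] with x hx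
    refine le_of_eq (Tendsto.liminf_eq ?_).symm
    refine ENNReal.tendsto_ofReal (Tendsto.add_const _ (Tendsto.add (((hlim x hx).sub_const _).mul_const _) ?_))
    exact (hγ.contDiff.continuous.tendsto _).comp (hlim x hx)
  have h3 : 4 * liminf (fun k => ∫⁻ x, ENNReal.ofReal (localDensity H γ η (f k) x + ρ x)) atTop ≤
      liminf (fun k => 4 * ∫⁻ x, ENNReal.ofReal (localDensity H γ η (f k) x + ρ x)) atTop := by
    rw [ENNReal.liminf_const_mul_of_ne_top (by simp)]
  exact (add_le_add h1 ((mul_le_mul_right h2 4).trans h3)).trans (liminf_add_liminf_le _ _)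

lemma gAdm_profile : GAdm H η (fun w : Cyl n => η w.1) := by
  constructor <;> simp [gag, shiftSq]

lemma lintegral_potential_profile_lt_top (hγ : IsDoubleWell γ) (hη : IsProfile η) :
    ∫⁻ w : Cyl n, ENNReal.ofReal (γ (η w.1)) < ⊤ := by
  have hc : Continuous fun x => γ (η x) := hγ.contDiff.continuous.comp hη.smooth.continuous
  rw [lintegral_fst_cyl (f := fun x => ENNReal.ofReal (γ (η x))) hc.measurable.ennreal_ofReal]
  have hcs : HasCompactSupport fun x => γ (η x) := by
    refine HasCompactSupport.intro (isCompact_Icc (a := (-1 : ℝ)) (b := 1)) fun x hx => ?_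
    rcases le_or_gt (-1) x with h | h
    · have : 1 < x := by by_contra hcon; exact hx ⟨h, not_lt.1 hcon⟩
      rw [hη.eq_one x this.le, hγ.zero_one]
    · rw [hη.eq_neg_one x h.le, hγ.zero_neg_one]
  exact ((lintegral_ofReal_ne_top_iff_integrable hc.aestronglyMeasurable
    (Eventually.of_forall fun x => hγ.nonneg _)).2 (hc.integrable_of_hasCompactSupport hcs)).lt_top

/-- Existence of a one-dimensional monotone minimizer. -/
theorem exists_minimizer (hH : IsKernel H) (hγ : IsDoubleWell γ) (hη : IsProfile η) :
    ∃ φ, IsLayer φ ∧ GAdm H η (fun w : Cyl n => φ w.1) ∧ ∫⁻ x, ENNReal.ofReal (γ (φ x)) < ⊤ ∧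
      ∀ u : Cyl n → ℝ, GAdm H η u → ∫⁻ w, ENNReal.ofReal (γ (u w)) < ⊤ →
        energy' H γ η (fun w : Cyl n => φ w.1) ≤ energy' H γ η u := by
  obtain ⟨ρ, c, hc, hρ, hρm, hco⟩ := exists_coercive hH hγ hη
  have hpos : ∀ φ, IsLayer φ → ∀ x, 0 ≤ localDensity H γ η φ x + ρ x := fun φ hφ x =>
    le_trans (by positivity) (hco φ hφ x).1
  -- The infimum runs over all layers, admissible or not: a finite value at the limit by itself
  -- yields the L² and Gagliardo bounds.
  set m : ℝ≥0∞ := sInf (layerEnergy H γ η ρ '' {φ | IsLayer φ}) with hm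
  have hml : ∀ φ, IsLayer φ → m ≤ layerEnergy H γ η ρ φ := fun φ hφ => sInf_le ⟨φ, hφ, rfl⟩
  obtain ⟨φ₀, hφ₀, hG₀, -, hp₀⟩ :=
    (gAdm_profile (H := H) (η := η)).exists_layer hH hγ hη (lintegral_potential_profile_lt_top hγ hη)
  have hp₀' := hp₀.trans_lt (lintegral_potential_profile_lt_top (n := n) hγ hη)
  have hmtop : m < ⊤ := (hml φ₀ hφ₀).trans_lt (by
    rw [(layerEnergy_eq hH hγ hη hρ hφ₀.measurable hG₀ hp₀' (hpos φ₀ hφ₀)).1]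
    exact ENNReal.ofReal_lt_top)
  obtain ⟨e, -, he, hmem⟩ := exists_seq_tendsto_sInf (S := layerEnergy H γ η ρ '' {φ | IsLayer φ})
    ⟨_, φ₀, hφ₀, rfl⟩ (OrderBot.bddBelow _)
  choose f hf hfe using hmem
  obtain ⟨θ, hθ, φ, hφ, S, hS, hlim⟩ := exists_subseq_tendsto_layer hf
  have hJ : layerEnergy H γ η ρ φ ≤ m := by
    refine (layerEnergy_le_liminf hγ hη hρm (fun k => (hf (θ k)).measurable) hφ.measurable hS hlim).trans ?_
    simp_rw [hfe]
    exact (he.comp hθ.tendsto_atTop).liminf_eq.le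
  have hJtop := hJ.trans_lt hmtop
  have hint : ∫⁻ x, ENNReal.ofReal (localDensity H γ η φ x + ρ x) < ⊤ := by
    have := (ENNReal.add_lt_top.1 hJtop).2
    by_contra hcon
    rw [not_lt, top_le_iff] at hcon
    rw [hcon] at this
    simp at this
  have hpot : ∫⁻ x, ENNReal.ofReal (γ (φ x)) < ⊤ := by
    calc ∫⁻ x, ENNReal.ofReal (γ (φ x)) ≤ ∫⁻ x, 2 * ENNReal.ofReal (localDensity H γ η φ x + ρ x) := by
          refine lintegral_mono fun x => ?_
          rw [← ENNReal.ofReal_ofNat 2, ← ENNReal.ofReal_mul (by norm_num)]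
          exact ENNReal.ofReal_le_ofReal (hco φ hφ x).2
      _ = 2 * ∫⁻ x, ENNReal.ofReal (localDensity H γ η φ x + ρ x) := lintegral_const_mul' _ _ (by simp)
      _ < ⊤ := ENNReal.mul_lt_top (by simp) hint
  have hG : GAdm H η (fun w : Cyl n => φ w.1) :=
    ⟨memLp_lift (memLp_layer_sub hγ hη hφ hpot), (ENNReal.add_lt_top.1 hJtop).1⟩
  refine ⟨φ, hφ, hG, hpot, fun u hu hup => ?_⟩
  -- An arbitrary competitor is replaced by its rearrangement, which is a layer and therefore has
  -- already been compared.
  obtain ⟨ψ, hψ, hGψ, hdens, hpψ⟩ := hu.exists_layer hH hγ hη hup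
  have hpψ' := hpψ.trans_lt hup
  have key := hJ.trans (hml ψ hψ)
  have e1 := layerEnergy_eq hH hγ hη hρ hφ.measurable hG hpot (hpos φ hφ)
  have e2 := layerEnergy_eq hH hγ hη hρ hψ.measurable hGψ hpψ' (hpos ψ hψ)
  rw [e1.1, e2.1, ENNReal.ofReal_le_ofReal_iff e2.2] at key
  have hγm : Measurable fun x => ENNReal.ofReal (γ (ψ x)) :=
    (hγ.contDiff.continuous.measurable.comp hψ.measurable).ennreal_ofReal
  have h3 : energy' H γ η (fun w : Cyl n => ψ w.1) ≤ energy' H γ η u := by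
    unfold energy'
    rw [lintegral_fst_cyl hγm]
    have := ENNReal.toReal_mono hup.ne hpψ
    linarith
  linarith

end

end

/-! ### The first variation -/

section

variable {n : ℕ} {H : ℝ × (Fin n → ℝ) → ℝ} {γ η : ℝ → ℝ}

lemma IsDoubleWell.exists_taylor (hγ : IsDoubleWell γ) (R : ℝ) :
    ∃ M, 0 ≤ M ∧ ∀ a ∈ Set.Icc (-R) R, ∀ b ∈ Set.Icc (-R) R,
      |deriv γ b - deriv γ a| ≤ M * |b - a| ∧ |γ b - γ a - deriv γ a * (b - a)| ≤ M * (b - a) ^ 2 := by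
  have hd : Differentiable ℝ γ := hγ.contDiff.differentiable (by norm_num)
  have hd1 : ContDiff ℝ 1 (deriv γ) := by
    have := hγ.contDiff
    rw [show (2 : WithTop ℕ∞) = 1 + 1 by norm_num, contDiff_succ_iff_deriv] at this
    exact this.2.2
  have hc2 : Continuous (deriv (deriv γ)) := hd1.continuous_deriv le_rfl
  obtain ⟨M, hM⟩ := (isCompact_Icc (a := -R) (b := R)).exists_bound_of_continuousOn hc2.continuousOn
  have hlip : ∀ a ∈ Set.Icc (-R) R, ∀ b ∈ Set.Icc (-R) R, |deriv γ b - deriv γ a| ≤ max M 0 * |b - a| := by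
    intro a ha b hb
    exact (convex_Icc (-R) R).norm_image_sub_le_of_norm_deriv_le
      (fun x _ => (hd1.differentiable (by norm_num)).differentiableAt)
      (fun x hx => (hM x hx).trans (le_max_left _ _)) ha hb
  refine ⟨max M 0, le_max_right _ _, fun a ha b hb => ⟨hlip a ha b hb, ?_⟩⟩
  have key := (convex_uIcc a b).norm_image_sub_le_of_norm_deriv_le (f := fun s => γ s - deriv γ a * s)
    (C := max M 0 * |b - a|) (fun x _ => by fun_prop) (fun x hx => ?_) Set.left_mem_uIcc Set.right_mem_uIcc
  · rw [Real.norm_eq_abs, Real.norm_eq_abs, mul_assoc, ← sq, sq_abs] at key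
    convert key using 2; ring
  · have hxm : x ∈ Set.Icc (-R) R := (convex_Icc (-R) R).ordConnected.uIcc_subset ha hb hx
    have hderiv : deriv (fun s => γ s - deriv γ a * s) x = deriv γ x - deriv γ a := by
      have : HasDerivAt (fun s => γ s - deriv γ a * s) (deriv γ x - deriv γ a * 1) x :=
        (hd x).hasDerivAt.sub ((hasDerivAt_id x).const_mul (deriv γ a))
      rw [this.deriv, mul_one]
    rw [hderiv]
    refine (hlip a ha x hxm).trans ?_
    exact mul_le_mul_of_nonneg_left (Set.abs_sub_left_of_mem_uIcc hx) (le_max_right _ _)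

lemma IsDoubleWell.deriv_one (hγ : IsDoubleWell γ) : deriv γ 1 = 0 :=
  IsLocalMin.deriv_eq_zero (Eventually.of_forall fun s => by rw [hγ.zero_one]; exact hγ.nonneg s)

lemma IsDoubleWell.deriv_neg_one (hγ : IsDoubleWell γ) : deriv γ (-1) = 0 :=
  IsLocalMin.deriv_eq_zero (Eventually.of_forall fun s => by rw [hγ.zero_neg_one]; exact hγ.nonneg s)

lemma IsDoubleWell.continuous_deriv (hγ : IsDoubleWell γ) : Continuous (deriv γ) :=
  hγ.contDiff.continuous_deriv (by norm_num)

lemma IsLayer.abs_le {φ : ℝ → ℝ} (h : IsLayer φ) (x : ℝ) : |φ x| ≤ 1 := _root_.abs_le.2 ⟨h.ge x, h.le x⟩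

/-- The wells are minima, so γ'(±1) = 0, and γ' is Lipschitz on [-1,1]; hence |γ'(φ)| ≤ M|φ - η|
wherever η is at a well. -/
lemma memLp_deriv_layer {φ : ℝ → ℝ} (hγ : IsDoubleWell γ) (hη : IsProfile η) (hφ : IsLayer φ)
    (hv : MemLp (fun x => φ x - η x) 2 volume) : MemLp (fun x => deriv γ (φ x)) 2 volume := by
  obtain ⟨M, hM, hT⟩ := hγ.exists_taylor 1
  have hmem : ∀ x, φ x ∈ Set.Icc (-1 : ℝ) 1 := fun x => ⟨hφ.ge x, hφ.le x⟩
  have h1 : MemLp ((Set.Icc (-1 : ℝ) 1).indicator fun _ : ℝ => 2 * M) 2 volume :=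
    memLp_indicator_const _ measurableSet_Icc _ (Or.inr (by simp))
  have hm : Measurable fun x => deriv γ (φ x) := hγ.continuous_deriv.measurable.comp hφ.measurable
  refine ((hv.norm.const_mul M).add h1).mono hm.aestronglyMeasurable (Eventually.of_forall fun x => ?_)
  have b1 := (hT 1 (by norm_num) (φ x) (hmem x)).1
  have b2 := (hT (-1) (by norm_num) (φ x) (hmem x)).1
  rw [hγ.deriv_one, sub_zero] at b1
  rw [hγ.deriv_neg_one, sub_zero] at b2
  simp only [Pi.add_apply, Real.norm_eq_abs]
  refine le_trans ?_ (le_abs_self _)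
  have hi : 0 ≤ (Set.Icc (-1 : ℝ) 1).indicator (fun _ : ℝ => 2 * M) x :=
    Set.indicator_nonneg (fun _ _ => by positivity) x
  by_cases h2 : 1 ≤ x
  · rw [hη.eq_one x h2]; linarith
  · by_cases h3 : x ≤ -1
    · rw [hη.eq_neg_one x h3]; linarith
    · rw [Set.indicator_of_mem (show x ∈ Set.Icc (-1 : ℝ) 1 from ⟨by linarith, by linarith⟩)]
      have : |φ x - 1| ≤ 2 := _root_.abs_le.2 ⟨by linarith [hφ.ge x], by linarith [hφ.le x]⟩
      have h4 := mul_le_mul_of_nonneg_left this hM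
      have : 0 ≤ M * |φ x - η x| := by positivity
      linarith

/-- Bounded perturbations of finite Gagliardo energy. -/
structure IsPerturbation (H : ℝ × (Fin n → ℝ) → ℝ) (ψ : Cyl n → ℝ) : Prop where
  bounded : ∃ C, ∀ w, |ψ w| ≤ C
  memLp : MemLp ψ 2 volume
  gag_lt : gag (cylMeas H) ψ < ⊤

lemma eq_zero_of_forall_nonneg {a b : ℝ} (h : ∀ t : ℝ, |t| ≤ 1 → 0 ≤ t * a + t ^ 2 * b) : a = 0 := by
  have hb : 0 ≤ b := by
    have h1 := h 1 (by simp)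
    have h2 := h (-1) (by simp)
    linarith
  -- Short enough for |t| ≤ 1, and of the size for which the linear term beats the quadratic one
  -- unless a = 0.
  set t : ℝ := -a / (1 + b + |a|) with ht
  have hpos : 0 < 1 + b + |a| := by positivity
  have h1 : |t| ≤ 1 := by
    rw [ht, abs_div, abs_neg, abs_of_pos hpos, div_le_one hpos]
    linarith
  have h2 := h t h1
  have h3 : t * a + t ^ 2 * b = -(a ^ 2 * (1 + |a|)) / (1 + b + |a|) ^ 2 := by
    rw [ht]; field_simp; ring
  rw [h3] at h2
  have h4 : 0 ≤ -(a ^ 2 * (1 + |a|)) := by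
    by_contra hcon
    exact absurd h2 (not_le.2 (div_neg_of_neg_of_pos (not_le.1 hcon) (by positivity)))
  have h5 : a ^ 2 ≤ 0 := by nlinarith [abs_nonneg a, sq_nonneg a]
  exact pow_eq_zero_iff (two_ne_zero) |>.1 (le_antisymm h5 (sq_nonneg a))

lemma integral_add_add {X : Type*} [MeasurableSpace X] {μ : Measure X} {f g h : X → ℝ} (hf : Integrable f μ)
    (hg : Integrable g μ) (hh : Integrable h μ) :
    ∫ x, (f x + g x + h x) ∂μ = ∫ x, f x ∂μ + ∫ x, g x ∂μ + ∫ x, h x ∂μ := by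
  rw [← integral_add hf hg]
  exact integral_add (hf.add hg) hh

lemma energy'_eq (hH : IsKernel H) (hγ : IsDoubleWell γ) (hη : IsProfile η) {u : Cyl n → ℝ} (hu : GAdm H η u)
    (hpot : ∫⁻ w, ENNReal.ofReal (γ (u w)) < ⊤) :
    energy' H γ η u = ∫ q, ((u q.1 - η q.1.1) - (u (q.1 - q.2) - η (q.1 - q.2).1)) ^ 2 ∂(volume.prod (cylMeas H)) +
      4 * (∫ w, (u w - η w.1) * Lop (kerConst H) η w.1) + 4 * ∫ w, γ (u w) := by
  have hi := integrable_potential hγ (hu.aestronglyMeasurable hη).aemeasurable hpot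
  rw [energy', hu.integral_density' hH hη,
    integral_increment_sq (cylMeas H) hu.memLp.aestronglyMeasurable]
  rw [integral_eq_lintegral_of_nonneg_ae (f := fun w => γ (u w)) (Eventually.of_forall fun x => hγ.nonneg _)
      hi.aestronglyMeasurable]

/-- The Euler–Lagrange equation of a bounded minimizer. -/
theorem euler_lagrange (hH : IsKernel H) (hγ : IsDoubleWell γ) (hη : IsProfile η) {u : Cyl n → ℝ}
    (hu : GAdm H η u) (hu1 : ∀ w, |u w| ≤ 1) (hpot : ∫⁻ w, ENNReal.ofReal (γ (u w)) < ⊤)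
    (hd : MemLp (fun w => deriv γ (u w)) 2 volume)
    (hmin : ∀ u' : Cyl n → ℝ, GAdm H η u' → ∫⁻ w, ENNReal.ofReal (γ (u' w)) < ⊤ →
      energy' H γ η u ≤ energy' H γ η u') {ψ : Cyl n → ℝ} (hψ : IsPerturbation H ψ) :
    1 / 2 * (∫ q : Cyl n × Cyl n, ((u q.1 - η q.1.1) - (u (q.1 - q.2) - η (q.1 - q.2).1)) * (ψ q.1 - ψ (q.1 - q.2))
        ∂(volume.prod (cylMeas H))) +
      (∫ w, ψ w * Lop (kerConst H) η w.1) + ∫ w, deriv γ (u w) * ψ w = 0 := by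
  obtain ⟨C, hC⟩ := hψ.bounded
  -- Since |u| ≤ 1 and |tψ| ≤ C, all values stay in a fixed interval, so no growth condition on γ is
  -- needed.
  obtain ⟨M, hM, hT⟩ := hγ.exists_taylor (1 + C)
  obtain ⟨B, hB⟩ := hη.exists_isBump
  have hC0 : 0 ≤ C := (abs_nonneg _).trans (hC 0)
  have hℓ : MemLp (fun w : Cyl n => Lop (kerConst H) η w.1) 2 volume := memLp_lift (hB.memLp_Lop hH.finiteMoment)
  have hum := (hu.aestronglyMeasurable hη)
  set v : Cyl n → ℝ := fun w => u w - η w.1 with hv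
  have iγ := integrable_potential hγ hum.aemeasurable hpot
  have idψ : Integrable fun w => deriv γ (u w) * ψ w := hd.integrable_mul hψ.memLp
  have iψ2 : Integrable fun w => ψ w ^ 2 := hψ.memLp.integrable_sq
  have iψℓ : Integrable fun w => ψ w * Lop (kerConst H) η w.1 := hψ.memLp.integrable_mul hℓ
  have ivℓ : Integrable fun w => v w * Lop (kerConst H) η w.1 := hu.memLp.integrable_mul hℓ
  have iv := integrable_increment_sq (cylMeas H) hu.memLp.aestronglyMeasurable hu.gag_lt
  have iψ := integrable_increment_sq (cylMeas H) hψ.memLp.aestronglyMeasurable hψ.gag_lt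
  have ivψ := integrable_increment_mul (cylMeas H) hu.memLp.aestronglyMeasurable hψ.memLp.aestronglyMeasurable
    hu.gag_lt hψ.gag_lt
  set I := ∫ q : Cyl n × Cyl n, (v q.1 - v (q.1 - q.2)) * (ψ q.1 - ψ (q.1 - q.2)) ∂(volume.prod (cylMeas H)) with hI
  set J := ∫ q : Cyl n × Cyl n, (ψ q.1 - ψ (q.1 - q.2)) ^ 2 ∂(volume.prod (cylMeas H)) with hJ
  -- Four times the energy increment is at most t times a linear functional of ψ plus t² times a
  -- constant; the Taylor remainder of γ goes into the constant.
  have key : ∀ t : ℝ, |t| ≤ 1 → 0 ≤ t * (2 * I + 4 * (∫ w, ψ w * Lop (kerConst H) η w.1) +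
      4 * ∫ w, deriv γ (u w) * ψ w) + t ^ 2 * (J + 4 * (M * ∫ w, ψ w ^ 2)) := by
    intro t ht
    set ut : Cyl n → ℝ := fun w => u w + t * ψ w with hut
    have htψ : ∀ w, |t * ψ w| ≤ C := fun w => by
      rw [abs_mul]
      calc |t| * |ψ w| ≤ 1 * C := by gcongr; exact hC w
        _ = C := one_mul C
    have hvt : ∀ w, ut w - η w.1 = v w + t * ψ w := fun w => by simp only [hut, hv]; ring
    have hut_adm : GAdm H η ut := by
      constructor
      · simp_rw [hvt]
        exact hu.memLp.add (hψ.memLp.const_mul t)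
      · simp_rw [hvt]
        exact gag_lt_top_add _ hu.memLp.aestronglyMeasurable (hψ.memLp.const_mul t).aestronglyMeasurable
          hu.gag_lt (gag_lt_top_const_mul _ hψ.gag_lt t)
    have htay : ∀ w, |γ (ut w) - γ (u w) - deriv γ (u w) * (t * ψ w)| ≤ M * (t * ψ w) ^ 2 := by
      intro w
      have h1 := abs_le.1 (hu1 w)
      have h2 := abs_le.1 (htψ w)
      have := (hT (u w) ⟨by linarith, by linarith⟩ (ut w) ⟨by simp only [hut]; linarith, by simp only [hut]; linarith⟩).2
      simpa [hut] using this
    have ibound : Integrable fun w => γ (u w) + t * (deriv γ (u w) * ψ w) + t ^ 2 * (M * ψ w ^ 2) :=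
      (iγ.add (idψ.const_mul t)).add ((iψ2.const_mul M).const_mul (t ^ 2))
    have hle : ∀ w, γ (ut w) ≤ γ (u w) + t * (deriv γ (u w) * ψ w) + t ^ 2 * (M * ψ w ^ 2) := fun w => by
      have := (abs_le.1 (htay w)).2
      nlinarith
    have hpott : ∫⁻ w, ENNReal.ofReal (γ (ut w)) < ⊤ :=
      (lintegral_mono fun w => ENNReal.ofReal_le_ofReal (hle w)).trans_lt ibound.lintegral_lt_top
    have iγt := integrable_potential hγ (hut_adm.aestronglyMeasurable hη).aemeasurable hpott
    have e := hmin ut hut_adm hpott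
    rw [energy'_eq hH hγ hη hu hpot, energy'_eq hH hγ hη hut_adm hpott] at e
    have e1 : ∫ q, ((ut q.1 - η q.1.1) - (ut (q.1 - q.2) - η (q.1 - q.2).1)) ^ 2 ∂(volume.prod (cylMeas H)) =
        ∫ q, (v q.1 - v (q.1 - q.2)) ^ 2 ∂(volume.prod (cylMeas H)) + t * (2 * I) + t ^ 2 * J := by
      rw [hI, hJ, ← integral_const_mul, ← integral_const_mul, ← integral_const_mul,
        ← integral_add_add iv ((ivψ.const_mul 2).const_mul t) (iψ.const_mul _)]
      refine integral_congr_ae (Eventually.of_forall fun q => ?_)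
      simp only [hvt]
      ring
    have e2 : ∫ w, (ut w - η w.1) * Lop (kerConst H) η w.1 =
        (∫ w, v w * Lop (kerConst H) η w.1) + t * ∫ w, ψ w * Lop (kerConst H) η w.1 := by
      rw [← integral_const_mul, ← integral_add ivℓ (iψℓ.const_mul t)]
      refine integral_congr_ae (Eventually.of_forall fun q => ?_)
      simp only [hvt]
      ring
    have e3 : ∫ w, γ (ut w) ≤ (∫ w, γ (u w)) + t * (∫ w, deriv γ (u w) * ψ w) + t ^ 2 * (M * ∫ w, ψ w ^ 2) := by
      refine (integral_mono iγt ibound hle).trans_eq ?_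
      rw [← integral_const_mul, ← integral_const_mul, ← integral_const_mul]
      exact integral_add_add iγ (idψ.const_mul t) ((iψ2.const_mul M).const_mul (t ^ 2))
    rw [e1, e2] at e
    linarith
  have := eq_zero_of_forall_nonneg key
  linarith

/-- The full interaction form splits into the form of the perturbation and the action of the profile. -/
lemma integral_interaction_eq (hH : IsKernel H) (hη : IsProfile η) {u ψ : Cyl n → ℝ} (hu : GAdm H η u)
    (hψ : IsPerturbation H ψ) :
    Integrable (fun q : Cyl n × Cyl n => (u q.1 - u (q.1 - q.2)) * (ψ q.1 - ψ (q.1 - q.2))) (volume.prod (cylMeas H)) ∧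
    1 / 2 * (∫ q : Cyl n × Cyl n, (u q.1 - u (q.1 - q.2)) * (ψ q.1 - ψ (q.1 - q.2)) ∂(volume.prod (cylMeas H))) =
    1 / 2 * (∫ q : Cyl n × Cyl n, ((u q.1 - η q.1.1) - (u (q.1 - q.2) - η (q.1 - q.2).1)) * (ψ q.1 - ψ (q.1 - q.2))
        ∂(volume.prod (cylMeas H))) +
      ∫ w, ψ w * Lop (kerConst H) η w.1 := by
  obtain ⟨B, hB⟩ := hη.exists_isBump
  have i1 := integrable_increment_mul (cylMeas H) hu.memLp.aestronglyMeasurable hψ.memLp.aestronglyMeasurable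
    hu.gag_lt hψ.gag_lt
  have i2 := hB.integrable_increment_mul hH hψ.memLp hψ.gag_lt
  have e : (fun q : Cyl n × Cyl n => (u q.1 - u (q.1 - q.2)) * (ψ q.1 - ψ (q.1 - q.2))) = fun q =>
      ((u q.1 - η q.1.1) - (u (q.1 - q.2) - η (q.1 - q.2).1)) * (ψ q.1 - ψ (q.1 - q.2)) +
        (ψ q.1 - ψ (q.1 - q.2)) * (η q.1.1 - η (q.1.1 - q.2.1)) := by
    funext q
    rw [Prod.fst_sub]
    ring
  rw [e]
  refine ⟨i1.add i2, ?_⟩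
  rw [integral_add i1 i2, hB.integral_increment_mul hH hψ.memLp hψ.gag_lt]
  ring

end

/-! ### Test functions as admissible variations -/

section

variable {n : ℕ} {H : ℝ × (Fin n → ℝ) → ℝ} {γ η : ℝ → ℝ}

lemma exists_proj_eq (w : Cyl n) : ∃ p : ℝ × (Fin n → ℝ), proj p = w ∧ p.1 = w.1 ∧ ∀ i, |p.2 i| ≤ 1 := by
  refine ⟨(w.1, fun i => rep (w.2 i)), Prod.ext rfl (funext fun i => coe_rep _), rfl, fun i => ?_⟩
  obtain ⟨h1, h2⟩ := (AddCircle.equivIco (1 : ℝ) 0 (w.2 i)).2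
  have e : (AddCircle.equivIco (1 : ℝ) 0 (w.2 i) : ℝ) = rep (w.2 i) := rfl
  rw [e] at h1 h2
  exact abs_le.2 ⟨by linarith, by linarith⟩

lemma proj_sub (p q : ℝ × (Fin n → ℝ)) : proj (p - q) = proj p - proj q := by
  refine Prod.ext rfl (funext fun i => ?_)
  simp [proj]

namespace IsTest

variable {φ : Cyl n → ℝ}

lemma exists_support (h : IsTest φ) : ∃ R, 0 < R ∧ ∀ w, R < |w.1| → φ w = 0 := by
  obtain ⟨R, hR⟩ := (h.compact.image continuous_fst).isBounded.exists_norm_le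
  refine ⟨max R 1, by positivity, fun w hw => ?_⟩
  by_contra hcon
  have := hR w.1 ⟨w, subset_tsupport φ hcon, rfl⟩
  exact absurd (hw.trans_le (this.trans (le_max_left _ _))) (lt_irrefl _)

lemma measurable (h : IsTest φ) : Measurable φ := by
  have h1 : Measurable fun w : Cyl n => (w.1, fun i => rep (w.2 i)) :=
    measurable_fst.prodMk (measurable_pi_lambda _ fun i =>
      measurable_rep.comp ((measurable_pi_apply i).comp measurable_snd))
  have h2 := h.smooth.continuous.measurable.comp h1
  convert! h2 using 1
  funext w
  simp [Function.comp, coe_rep]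

/-- Lifts are chosen with torus coordinates of size at most 1. The ball of radius R + 3 then
contains every lift with |x| ≤ R + 1 together with its translates by ‖z‖ ≤ 1, and the gradient is
bounded there. Beyond R + 1 both values vanish. -/
lemma exists_lipschitz (h : IsTest φ) :
    ∃ C R, 0 ≤ C ∧ 0 < R ∧ (∀ w, |φ w| ≤ C) ∧ (∀ w, R < |w.1| → φ w = 0) ∧
      ∀ w (z : ℝ × (Fin n → ℝ)), ‖z‖ ≤ 1 → |φ w - φ (w - proj z)| ≤ C * ‖z‖ ∧
        (R < |w.1| → φ w - φ (w - proj z) = 0) := by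
  obtain ⟨R, hR, hsupp⟩ := h.exists_support
  set Φ : ℝ × (Fin n → ℝ) → ℝ := fun p => φ (proj p) with hΦ
  have hs : ContDiff ℝ ∞ Φ := h.smooth
  have hK := isCompact_closedBall (0 : ℝ × (Fin n → ℝ)) (R + 3)
  obtain ⟨C₁, hC₁⟩ := hK.exists_bound_of_continuousOn hs.continuous.continuousOn
  obtain ⟨C₂, hC₂⟩ := hK.exists_bound_of_continuousOn (hs.continuous_fderiv (by simp)).continuousOn
  have hball : ∀ p : ℝ × (Fin n → ℝ), |p.1| ≤ R + 3 → (∀ i, |p.2 i| ≤ 2) → p ∈ Metric.closedBall 0 (R + 3) := by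
    intro p h1 h2
    rw [mem_closedBall_zero_iff, Prod.norm_def]
    exact max_le h1 ((pi_norm_le_iff_of_nonneg (by linarith)).2 fun i => (h2 i).trans (by linarith))
  refine ⟨max (max C₁ C₂) 0, R + 1, le_max_right _ _, by linarith, fun w => ?_, fun w hw => hsupp w (by linarith),
    fun w z hz => ⟨?_, fun hw => ?_⟩⟩
  · by_cases hw : R < |w.1|
    · rw [hsupp w hw, abs_zero]; exact le_max_right _ _
    · obtain ⟨p, rfl, hp1, hp2⟩ := exists_proj_eq w
      refine (hC₁ p (hball p ?_ fun i => (hp2 i).trans (by norm_num))).trans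
        ((le_max_left _ _).trans (le_max_left _ _))
      rw [hp1]; linarith [not_lt.1 hw]
  · obtain ⟨p, rfl, hp1, hp2⟩ := exists_proj_eq w
    have hz1 : |z.1| ≤ 1 := (norm_fst_le z).trans hz
    have hz2 : ∀ i, |z.2 i| ≤ 1 := fun i => (norm_le_pi_norm z.2 i).trans ((norm_snd_le z).trans hz)
    rw [← proj_sub]
    by_cases hw : |p.1| ≤ R + 1
    · have hp : p ∈ Metric.closedBall (0 : ℝ × (Fin n → ℝ)) (R + 3) :=
        hball p (by linarith) fun i => (hp2 i).trans (by norm_num)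
      have hpz : p - z ∈ Metric.closedBall (0 : ℝ × (Fin n → ℝ)) (R + 3) := by
        refine hball _ ((abs_sub _ _).trans (by linarith)) fun i => (abs_sub _ _).trans ?_
        linarith [hp2 i, hz2 i]
      have := (convex_closedBall (0 : ℝ × (Fin n → ℝ)) (R + 3)).norm_image_sub_le_of_norm_fderiv_le
        (f := Φ) (𝕜 := ℝ) (fun x _ => (hs.differentiable (by simp)).differentiableAt) hC₂ hpz hp
      rw [sub_sub_cancel] at this
      refine this.trans ?_
      gcongr
      exact (le_max_right _ _).trans (le_max_left _ _)
    · rw [not_le] at hw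
      have h1 : φ (proj p) = 0 := hsupp _ (by show R < |p.1|; linarith)
      have h2 : φ (proj (p - z)) = 0 := hsupp _ (by
        show R < |p.1 - z.1|
        have := abs_sub_abs_le_abs_sub p.1 z.1
        linarith)
      rw [h1, h2, sub_zero, abs_zero]
      positivity
  · have hz1 : |z.1| ≤ 1 := (norm_fst_le z).trans hz
    rw [hsupp w (by linarith), hsupp (w - proj z), sub_zero]
    show R < |w.1 - z.1|
    have := abs_sub_abs_le_abs_sub w.1 z.1
    linarith

lemma memLp (h : IsTest φ) : MemLp φ 2 volume := by
  obtain ⟨C, R, hC, hR, hb, hs, -⟩ := h.exists_lipschitz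
  have hm : MeasurableSet {w : Cyl n | w.1 ∈ Set.Icc (-R) R} := measurable_fst measurableSet_Icc
  have h1 : MemLp ({w : Cyl n | w.1 ∈ Set.Icc (-R) R}.indicator fun _ => C) 2 volume :=
    memLp_indicator_const _ hm _ (Or.inr (volume_slab_lt_top _ _).ne)
  refine h1.mono h.measurable.aestronglyMeasurable (Eventually.of_forall fun w => ?_)
  by_cases hw : |w.1| ≤ R
  · rw [Set.indicator_of_mem (show w ∈ {w : Cyl n | w.1 ∈ Set.Icc (-R) R} from abs_le.1 hw)]
    exact (hb w).trans (le_abs_self C)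
  · rw [hs w (not_le.1 hw), norm_zero]; exact norm_nonneg _

/-- The squared increment is O(‖z‖²) for short jumps, by the Lipschitz bound on a slab of finite
volume, and bounded for long ones. The Lévy condition finishes. -/
lemma isPerturbation (h : IsTest φ) (hH : IsKernel H) : IsPerturbation H φ := by
  obtain ⟨C, R, hC, hR, hb, hs, hl⟩ := h.exists_lipschitz
  refine ⟨⟨C, hb⟩, h.memLp, ?_⟩
  set E : ℝ≥0∞ := 4 * ∫⁻ w, ENNReal.ofReal (φ w ^ 2) with hE
  have hEtop : E < ⊤ := ENNReal.mul_lt_top (by simp) h.memLp.integrable_sq.lintegral_lt_top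
  set V : ℝ≥0∞ := volume {w : Cyl n | w.1 ∈ Set.Icc (-R) R}
  have hVtop : V < ⊤ := volume_slab_lt_top _ _
  set D : ℝ≥0∞ := E + ENNReal.ofReal (C ^ 2) * V
  have hDtop : D < ⊤ := ENNReal.add_lt_top.2 ⟨hEtop, ENNReal.mul_lt_top ENNReal.ofReal_lt_top hVtop⟩
  have hm : Measurable (shiftSq φ) := by
    have : Measurable fun q : Cyl n × Cyl n => ENNReal.ofReal ((φ q.2 - φ (q.2 - q.1)) ^ 2) :=
      (((h.measurable.comp measurable_snd).sub (h.measurable.comp (measurable_snd.sub measurable_fst))).pow_const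
        2).ennreal_ofReal
    exact this.lintegral_prod_right'
  rw [gag, ← hH.map_proj, lintegral_map hm measurable_proj]
  have hbound : ∀ z : ℝ × (Fin n → ℝ), shiftSq φ (proj z) ≤ D * ENNReal.ofReal (min 1 (‖z‖ ^ 2)) := by
    intro z
    rcases le_or_gt ‖z‖ 1 with hz | hz
    · have hz2 : ‖z‖ ^ 2 ≤ 1 := pow_le_one₀ (norm_nonneg _) hz
      rw [min_eq_right hz2]
      calc shiftSq φ (proj z) ≤ ∫⁻ w, {w : Cyl n | w.1 ∈ Set.Icc (-R) R}.indicator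
            (fun _ => ENNReal.ofReal (C ^ 2) * ENNReal.ofReal (‖z‖ ^ 2)) w := by
            refine lintegral_mono fun w => ?_
            by_cases hw : |w.1| ≤ R
            · rw [Set.indicator_of_mem (show w ∈ {w : Cyl n | w.1 ∈ Set.Icc (-R) R} from abs_le.1 hw),
                ← ENNReal.ofReal_mul (by positivity), ← mul_pow, ← sq_abs (φ w - _)]
              exact ENNReal.ofReal_le_ofReal (pow_le_pow_left₀ (abs_nonneg _) (hl w z hz).1 2)
            · rw [(hl w z hz).2 (not_le.1 hw)]
              simp
        _ = ENNReal.ofReal (C ^ 2) * V * ENNReal.ofReal (‖z‖ ^ 2) := by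
            have hS : MeasurableSet {w : Cyl n | w.1 ∈ Set.Icc (-R) R} := measurable_fst measurableSet_Icc
            rw [lintegral_indicator hS, setLIntegral_const]
            ring
        _ ≤ _ := by gcongr; exact le_add_self
    · rw [min_eq_left (one_le_pow₀ hz.le), ENNReal.ofReal_one, mul_one]
      exact (shiftSq_le_four h.measurable.aestronglyMeasurable _).trans le_self_add
  refine (lintegral_mono hbound).trans_lt ?_
  rw [lintegral_const_mul' _ _ hDtop.ne]
  exact ENNReal.mul_lt_top hDtop hH.lintegral_min_lt_top

end IsTest

/-- Bounded minimizers are weak solutions. -/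
theorem isWeakSolution_of_minimizer (hH : IsKernel H) (hγ : IsDoubleWell γ) (hη : IsProfile η) {u : Cyl n → ℝ}
    (hu : GAdm H η u) (hu1 : ∀ w, |u w| ≤ 1) (hpot : ∫⁻ w, ENNReal.ofReal (γ (u w)) < ⊤)
    (hd : MemLp (fun w => deriv γ (u w)) 2 volume)
    (hmin : ∀ u' : Cyl n → ℝ, GAdm H η u' → ∫⁻ w, ENNReal.ofReal (γ (u' w)) < ⊤ →
      energy' H γ η u ≤ energy' H γ η u') : IsWeakSolution H γ u := by
  intro ψ hψ
  have hp := hψ.isPerturbation hH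
  obtain ⟨h1, h2⟩ := integral_interaction_eq hH hη hu hp
  refine ⟨(hH.integrable_mul_kernel_iff fun p => (u p.1 - u p.2) * (ψ p.1 - ψ p.2)).2 h1,
    hd.integrable_mul hp.memLp, ?_⟩
  rw [hH.integral_mul_kernel fun p => (u p.1 - u p.2) * (ψ p.1 - ψ p.2)]
  rw [h2]
  exact euler_lagrange hH hγ hη hu hu1 hpot hd hmin hp

end

/-! ### The symbol of the one-dimensional operator -/

section

open scoped ComplexConjugate SchwartzMap

lemma measurable_ft (f : ℝ → ℂ) : Measurable (ft f) := by
  unfold ft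
  split_ifs
  · exact (Lp.stronglyMeasurable _).measurable
  · exact measurable_const

lemma continuous_chr_uncurry : Continuous fun p : ℝ × ℝ => chr p.1 p.2 := by
  unfold chr
  have := Real.continuous_fourierChar
  fun_prop

lemma chr_neg (z ξ : ℝ) : chr z (-ξ) = conj (chr z ξ) := by
  unfold chr
  rw [← Circle.coe_inv_eq_conj, ← AddChar.map_neg_eq_inv]
  congr 2; ring

lemma norm_one_sub_chr_neg (z ξ : ℝ) : ‖1 - chr z (-ξ)‖ = ‖1 - chr z ξ‖ := by
  rw [chr_neg, ← Complex.norm_conj (1 - chr z ξ), map_sub, map_one]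

/-- The constant `λ` such that `λ|ξ|` is the Fourier symbol of the one-dimensional operator. -/
def symb (c : ℝ) : ℝ := 1 / 2 * (∫⁻ z, ENNReal.ofReal (‖1 - chr z 1‖ ^ 2) ∂lineMeas c).toReal

lemma symb_nonneg (c : ℝ) : 0 ≤ symb c := by unfold symb; positivity

lemma measurable_norm_one_sub_chr : Measurable fun p : ℝ × ℝ => ENNReal.ofReal (‖1 - chr p.1 p.2‖ ^ 2) := by
  have := continuous_chr_uncurry.measurable
  fun_prop

lemma continuous_norm_one_sub_chr_left (ξ : ℝ) : Continuous fun z => ‖1 - chr z ξ‖ ^ 2 := by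
  have : Continuous fun z => chr z ξ :=
    continuous_chr_uncurry.comp (continuous_id.prodMk (continuous_const (y := ξ)))
  exact ((continuous_const.sub this).norm).pow 2

lemma measurable_norm_one_sub_chr_left (ξ : ℝ) : Measurable fun z => ENNReal.ofReal (‖1 - chr z ξ‖ ^ 2) :=
  (continuous_norm_one_sub_chr_left ξ).measurable.ennreal_ofReal

lemma lintegral_chr_one_lt_top {c : ℝ} (hc : FiniteMoment c) :
    ∫⁻ z, ENNReal.ofReal (‖1 - chr z 1‖ ^ 2) ∂lineMeas c < ⊤ := by
  calc _ ≤ ∫⁻ z, ENNReal.ofReal (4 * Real.pi ^ 2) * ENNReal.ofReal (min 1 (z ^ 2)) ∂lineMeas c := by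
        refine lintegral_mono fun z => ?_
        rw [← ENNReal.ofReal_mul (by positivity)]
        refine ENNReal.ofReal_le_ofReal ((norm_one_sub_chr_sq_le _).trans ?_)
        have hpi : 1 ≤ Real.pi ^ 2 := one_le_pow₀ (by linarith [Real.pi_gt_three])
        have h1 : min 1 ((Real.pi * -(z * 1)) ^ 2) ≤ Real.pi ^ 2 * min 1 (z ^ 2) := by
          rw [mul_min_of_nonneg _ _ (by positivity)]
          refine min_le_min (by linarith) (le_of_eq (by ring))
        linarith
    _ < ⊤ := by
        rw [lintegral_const_mul' _ _ ENNReal.ofReal_ne_top]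
        exact ENNReal.mul_lt_top ENNReal.ofReal_lt_top hc

/-- The character depends only on the product zξ, so rescaling c/z² by |ξ| extracts one power of
|ξ|. -/
lemma lintegral_chr {c : ℝ} (hc : FiniteMoment c) (ξ : ℝ) :
    ∫⁻ z, ENNReal.ofReal (‖1 - chr z ξ‖ ^ 2) ∂lineMeas c = ENNReal.ofReal (2 * symb c * |ξ|) := by
  have e1 : ∫⁻ z, ENNReal.ofReal (‖1 - chr z ξ‖ ^ 2) ∂lineMeas c =
      ∫⁻ z, ENNReal.ofReal (‖1 - chr z |ξ|‖ ^ 2) ∂lineMeas c := by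
    rcases abs_choice ξ with h | h
    · rw [h]
    · rw [h]; simp_rw [norm_one_sub_chr_neg]
  rw [e1]
  have e2 : 2 * symb c = (∫⁻ z, ENNReal.ofReal (‖1 - chr z 1‖ ^ 2) ∂lineMeas c).toReal := by
    rw [symb, ← mul_assoc, mul_one_div_cancel two_ne_zero, one_mul]
  rcases (abs_nonneg ξ).eq_or_lt with h | h
  · rw [← h]; simp [chr]
  · have := lintegral_scale_lineMeas c h (f := fun z => ENNReal.ofReal (‖1 - chr z 1‖ ^ 2))
      (measurable_norm_one_sub_chr_left 1)
    rw [mul_comm (2 * symb c), ENNReal.ofReal_mul h.le, e2, ENNReal.ofReal_toReal (lintegral_chr_one_lt_top hc).ne,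
      ← this]
    refine lintegral_congr fun z => ?_
    have e3 : chr z |ξ| = chr (|ξ| * z) 1 := by
      unfold chr
      rw [mul_one, mul_comm]
    rw [e3]

lemma integrable_chr {c : ℝ} (hc : FiniteMoment c) (ξ : ℝ) :
    Integrable (fun z => ‖1 - chr z ξ‖ ^ 2) (lineMeas c) := by
  refine (lintegral_ofReal_ne_top_iff_integrable (continuous_norm_one_sub_chr_left ξ).aestronglyMeasurable
    (Eventually.of_forall fun z => by positivity)).1 ?_
  rw [lintegral_chr hc]
  exact ENNReal.ofReal_ne_top

lemma integral_chr {c : ℝ} (hc : FiniteMoment c) (ξ : ℝ) :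
    ∫ z, ‖1 - chr z ξ‖ ^ 2 ∂lineMeas c = 2 * symb c * |ξ| := by
  rw [integral_eq_lintegral_of_nonneg_ae (Eventually.of_forall fun z => by positivity)
    (integrable_chr hc ξ).aestronglyMeasurable, lintegral_chr hc, ENNReal.toReal_ofReal]
  have := symb_nonneg c
  positivity

/-- The integrand vanishes only at integers z, whereas the measure charges (0,1). -/
lemma symb_pos {c : ℝ} (hc0 : 0 < c) (hc : FiniteMoment c) : 0 < symb c := by
  refine (symb_nonneg c).lt_of_ne fun h => ?_
  have h0 := lintegral_chr hc 1
  have hm := measurable_norm_one_sub_chr_left 1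
  have hmc : Measurable fun x : ℝ => ENNReal.ofReal (c / x ^ 2) := by fun_prop
  rw [← h, mul_zero, zero_mul, ENNReal.ofReal_zero, lineMeas] at h0
  have e0 := lintegral_withDensity_eq_lintegral_mul volume hmc hm
  rw [h0] at e0
  replace h0 := (lintegral_eq_zero_iff (hmc.mul hm)).1 e0.symm
  have h1 : ∀ᵐ z : ℝ, z ∉ Set.Ioo (0 : ℝ) 1 := by
    filter_upwards [h0] with z hz hz1
    simp only [Pi.mul_apply, Pi.zero_apply, mul_eq_zero, ENNReal.ofReal_eq_zero] at hz
    rcases hz with hz | hz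
    · have : 0 < c / z ^ 2 := div_pos hc0 (pow_pos hz1.1 2)
      linarith
    · have h2 : chr z 1 = 1 := by
        have : ‖1 - chr z 1‖ = 0 := pow_eq_zero_iff two_ne_zero |>.1 (le_antisymm hz (by positivity))
        exact (sub_eq_zero.1 (norm_eq_zero.1 this)).symm
      rw [chr, Real.fourierChar_apply, Complex.exp_eq_one_iff] at h2
      obtain ⟨k, hk⟩ := h2
      have h3 : (-z : ℝ) = k := by
        have h4 : ((2 * Real.pi * Complex.I) : ℂ) ≠ 0 := by
          simp [Real.pi_ne_zero]
        have h5 : ((-z : ℝ) : ℂ) = (k : ℂ) := by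
          apply mul_right_cancel₀ h4
          rw [← hk]; push_cast; ring
        exact_mod_cast h5
      have h6 : (-1 : ℝ) < k := by rw [← h3]; linarith [hz1.2]
      have h7 : (k : ℝ) < 0 := by rw [← h3]; linarith [hz1.1]
      have h8 : (-1 : ℤ) < k := by exact_mod_cast h6
      have h9 : k < 0 := by exact_mod_cast h7
      omega
  rw [ae_iff, show {z : ℝ | ¬z ∉ Set.Ioo (0 : ℝ) 1} = Set.Ioo 0 1 by ext; simp, Real.volume_Ioo] at h1
  norm_num at h1

lemma ft_increment {f : ℝ → ℂ} (hf : MemLp f 2 volume) (z : ℝ) :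
    ft (fun x => f x - f (x - z)) =ᵐ[volume] fun ξ => (1 - chr z ξ) * ft f ξ := by
  filter_upwards [ft_sub hf (memLp_comp_sub hf z), ft_comp_sub hf z] with ξ h1 h2
  rw [h1, h2]; ring

lemma lintegral_increment_sq {f : ℝ → ℂ} (hf : MemLp f 2 volume) (z : ℝ) :
    ∫⁻ x, ENNReal.ofReal (‖f x - f (x - z)‖ ^ 2) =
      ∫⁻ ξ, ENNReal.ofReal (‖1 - chr z ξ‖ ^ 2) * ENNReal.ofReal (‖ft f ξ‖ ^ 2) := by
  rw [← lintegral_ft_sq (f := fun x => f x - f (x - z)) (hf.sub (memLp_comp_sub hf z))]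
  refine lintegral_congr_ae ?_
  filter_upwards [ft_increment hf z] with ξ h
  rw [h, norm_mul, mul_pow, ENNReal.ofReal_mul (by positivity)]

lemma lintegral_lintegral_increment_sq {c : ℝ} (hc : FiniteMoment c) {f : ℝ → ℂ} (hf : MemLp f 2 volume) :
    ∫⁻ z, ∫⁻ x, ENNReal.ofReal (‖f x - f (x - z)‖ ^ 2) ∂volume ∂lineMeas c =
      ∫⁻ ξ, ENNReal.ofReal (2 * symb c * |ξ|) * ENNReal.ofReal (‖ft f ξ‖ ^ 2) := by
  have hm := measurable_ft f
  simp_rw [lintegral_increment_sq hf]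
  rw [lintegral_lintegral_swap]
  · refine lintegral_congr fun ξ => ?_
    rw [lintegral_mul_const' _ _ ENNReal.ofReal_ne_top, lintegral_chr hc]
  · exact (measurable_norm_one_sub_chr.mul (by fun_prop)).aemeasurable

end

/-! ### From the weak equation to the Fourier side -/

section

open scoped ComplexConjugate SchwartzMap

lemma lintegral_weight_lt_top {a : ℝ} (ha : 0 ≤ a) {F G : ℝ → ℂ} (hF : MemLp F 2 volume) {χ : ℝ → ℝ}
    (hχ : Continuous χ) (hs : HasCompactSupport χ) (hGχ : G =ᵐ[volume] fun ξ => (χ ξ : ℂ)) :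
    ∫⁻ ξ, ENNReal.ofReal (a * |ξ|) * ENNReal.ofReal (‖F ξ‖ * ‖G ξ‖) < ⊤ := by
  have h1 : MemLp (fun ξ => (a * |ξ|) * χ ξ) 2 volume := by
    have hcont : Continuous fun ξ => (a * |ξ|) * χ ξ := by fun_prop
    exact hcont.memLp_of_hasCompactSupport hs.mul_left
  have h2 : Integrable fun ξ => ‖F ξ‖ * ‖(a * |ξ|) * χ ξ‖ := hF.norm.integrable_mul h1.norm
  refine lt_of_le_of_lt (lintegral_mono_ae ?_) h2.lintegral_lt_top
  filter_upwards [hGχ] with ξ h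
  rw [← ENNReal.ofReal_mul (by positivity), h, norm_mul, Complex.norm_real,
    Real.norm_of_nonneg (show 0 ≤ a * |ξ| by positivity)]
  refine ENNReal.ofReal_le_ofReal (le_of_eq (by ring))

/-- A weak solution `f ∈ L²` of finite Gagliardo energy of `𝓛 f = g` satisfies `λ|ξ| f̂ = ĝ`. -/
theorem symb_mul_ft_eq {c : ℝ} (hc : FiniteMoment c) {f g : ℝ → ℝ} (hf : MemLp f 2 volume) (hg : MemLp g 2 volume)
    (hgag : gag (lineMeas c) f < ⊤)
    (hw : ∀ ψ : ℝ → ℝ, Continuous ψ → (∃ C, ∀ x, |ψ x| ≤ C) → MemLp ψ 2 volume → gag (lineMeas c) ψ < ⊤ →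
      1 / 2 * ∫ q : ℝ × ℝ, (f q.1 - f (q.1 - q.2)) * (ψ q.1 - ψ (q.1 - q.2)) ∂(volume.prod (lineMeas c)) =
        ∫ x, g x * ψ x) :
    (fun ξ => ((symb c * |ξ| : ℝ) : ℂ) * ft (fun x => (f x : ℂ)) ξ) =ᵐ[volume] ft (fun x => (g x : ℂ)) := by
  set F : ℝ → ℂ := ft (fun x => (f x : ℂ)) with hFdef
  have hfC : MemLp (fun x => (f x : ℂ)) 2 volume := hf.ofReal
  have hgC : MemLp (fun x => (g x : ℂ)) 2 volume := hg.ofReal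
  have hF : MemLp F 2 volume := ft_memLp _
  have hFm : Measurable F := measurable_ft _
  have hs0 := symb_nonneg c
  -- The L² pairing is conjugate linear in its first argument, so the identity is proved for the
  -- conjugates and conjugated back.
  suffices h : (fun ξ => ((symb c * |ξ| : ℝ) : ℂ) * conj (F ξ)) =ᵐ[volume]
      fun ξ => conj (ft (fun x => (g x : ℂ)) ξ) by
    filter_upwards [h] with ξ hξ
    have := congrArg conj hξ
    rw [map_mul, Complex.conj_ofReal, Complex.conj_conj, Complex.conj_conj] at this
    exact this
  have hFl : LocallyIntegrable fun ξ => conj (F ξ) := (hF.star).locallyIntegrable (by norm_num)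
  refine ae_eq_of_integral_schwartz ?_ ((ft_memLp _).star.locallyIntegrable (by norm_num)) fun χ hχ hs => ?_
  · rw [locallyIntegrable_iff]
    intro k hk
    exact (hFl.integrableOn_isCompact hk).continuousOn_mul (by fun_prop) hk
  -- The variation is prescribed by its Fourier transform χ. It is complex valued, so the weak
  -- equation is applied to its real and imaginary parts and recombined in `iD2`.
  set Ψ : 𝓢(ℝ, ℂ) := 𝓕⁻ (toSchwartz χ hχ hs) with hΨ
  have hΨft : ft Ψ =ᵐ[volume] fun ξ => (χ ξ : ℂ) := by
    filter_upwards [ft_schwartz Ψ] with ξ h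
    rw [h, ← SchwartzMap.fourier_coe, hΨ, FourierTransform.fourier_fourierInv_eq, toSchwartz_apply]
  have hΨ2 : MemLp Ψ 2 volume := Ψ.memLp 2
  set X : ℝ → ℂ := ft Ψ with hX
  have hX2 : MemLp X 2 volume := ft_memLp _
  have hXm : Measurable X := measurable_ft _
  obtain ⟨C, hC⟩ : ∃ C, ∀ x, ‖Ψ x‖ ≤ C :=
    ⟨_, fun x => Ψ.toBoundedContinuousFunction.norm_coe_le_norm x⟩
  have hgagΨ : ∫⁻ z, ∫⁻ x, ENNReal.ofReal (‖Ψ x - Ψ (x - z)‖ ^ 2) ∂volume ∂lineMeas c < ⊤ := by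
    rw [lintegral_lintegral_increment_sq hc hΨ2]
    have := lintegral_weight_lt_top (a := 2 * symb c) (by positivity) hX2 hχ.continuous hs hΨft
    simpa only [← sq] using this
  have hre : ∀ p : ℂ → ℝ, (∀ a b, p (a - b) = p a - p b) → (∀ a, |p a| ≤ ‖a‖) → (MemLp (fun x => p (Ψ x)) 2 volume) →
      gag (lineMeas c) (fun x => p (Ψ x)) < ⊤ := by
    intro p hp hpn _
    refine (lintegral_mono fun z => lintegral_mono fun x => ?_).trans_lt hgagΨ
    rw [← hp]
    refine ENNReal.ofReal_le_ofReal ?_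
    rw [← sq_abs]
    exact pow_le_pow_left₀ (abs_nonneg _) (hpn _) 2
  have m1 : MemLp (fun x => (Ψ x).re) 2 volume := hΨ2.re
  have m2 : MemLp (fun x => (Ψ x).im) 2 volume := hΨ2.im
  have g1 := hre Complex.re (fun a b => Complex.sub_re a b) Complex.abs_re_le_norm m1
  have g2 := hre Complex.im (fun a b => Complex.sub_im a b) Complex.abs_im_le_norm m2
  have w1 := hw (fun x => (Ψ x).re) (Complex.continuous_re.comp Ψ.continuous) ⟨C, fun x => (Complex.abs_re_le_norm _).trans (hC x)⟩ m1 g1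
  have w2 := hw (fun x => (Ψ x).im) (Complex.continuous_im.comp Ψ.continuous) ⟨C, fun x => (Complex.abs_im_le_norm _).trans (hC x)⟩ m2 g2
  have i1 := integrable_increment_mul (lineMeas c) hf.aestronglyMeasurable m1.aestronglyMeasurable hgag g1
  have i2 := integrable_increment_mul (lineMeas c) hf.aestronglyMeasurable m2.aestronglyMeasurable hgag g2
  set D : ℝ × ℝ → ℂ := fun q => ((f q.1 - f (q.1 - q.2) : ℝ) : ℂ) * (Ψ q.1 - Ψ (q.1 - q.2)) with hD
  have hDeq : D = fun q => (((f q.1 - f (q.1 - q.2)) * ((Ψ q.1).re - (Ψ (q.1 - q.2)).re) : ℝ) : ℂ) +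
      (((f q.1 - f (q.1 - q.2)) * ((Ψ q.1).im - (Ψ (q.1 - q.2)).im) : ℝ) : ℂ) * Complex.I := by
    funext q
    apply Complex.ext <;> simp [hD]
  have iD : Integrable D (volume.prod (lineMeas c)) := by
    rw [hDeq]
    exact i1.ofReal.add (i2.ofReal.mul_const _)
  have iD2 : ∫ q, D q ∂(volume.prod (lineMeas c)) = 2 * ∫ x, (g x : ℂ) * Ψ x := by
    have e1 : ∫ x, (g x : ℂ) * Ψ x = ((∫ x, g x * (Ψ x).re : ℝ) : ℂ) + ((∫ x, g x * (Ψ x).im : ℝ) : ℂ) * Complex.I := by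
      rw [← integral_complex_ofReal, ← integral_complex_ofReal, ← integral_mul_const, ← integral_add
        (hg.integrable_mul m1).ofReal ((hg.integrable_mul m2).ofReal.mul_const _)]
      refine integral_congr_ae (Eventually.of_forall fun x => ?_)
      apply Complex.ext <;> simp
    have e2 : ∫ q, D q ∂(volume.prod (lineMeas c)) =
        ((∫ q : ℝ × ℝ, (f q.1 - f (q.1 - q.2)) * ((Ψ q.1).re - (Ψ (q.1 - q.2)).re) ∂(volume.prod (lineMeas c)) : ℝ) : ℂ) +
        ((∫ q : ℝ × ℝ, (f q.1 - f (q.1 - q.2)) * ((Ψ q.1).im - (Ψ (q.1 - q.2)).im) ∂(volume.prod (lineMeas c)) : ℝ) : ℂ) *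
          Complex.I := by
      rw [hDeq, ← integral_complex_ofReal, ← integral_complex_ofReal, ← integral_mul_const]
      exact integral_add i1.ofReal (i2.ofReal.mul_const _)
    rw [e1, ← w1, ← w2, e2]
    push_cast
    ring
  -- Fubini is permitted because χ has compact support, which tames the unbounded weight |ξ|.
  have hint : Integrable (fun p : ℝ × ℝ => ((‖1 - chr p.1 p.2‖ ^ 2 : ℝ) : ℂ) * (conj (F p.2) * X p.2))
      ((lineMeas c).prod volume) := by
    have hcm := continuous_chr_uncurry.measurable
    have hm1 : Measurable fun p : ℝ × ℝ => (((‖1 - chr p.1 p.2‖ ^ 2 : ℝ) : ℂ)) :=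
      Complex.measurable_ofReal.comp ((measurable_const.sub hcm).norm.pow_const 2)
    have hm2 : Measurable fun p : ℝ × ℝ => conj (F p.2) * X p.2 :=
      (Complex.continuous_conj.measurable.comp (hFm.comp measurable_snd)).mul (hXm.comp measurable_snd)
    have hm3 : Measurable fun p : ℝ × ℝ =>
        ENNReal.ofReal (‖1 - chr p.1 p.2‖ ^ 2) * ENNReal.ofReal (‖F p.2‖ * ‖X p.2‖) :=
      measurable_norm_one_sub_chr.mul (by fun_prop)
    refine ⟨(hm1.mul hm2).aestronglyMeasurable, ?_⟩
    rw [HasFiniteIntegral]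
    have e : ∀ p : ℝ × ℝ, ‖((‖1 - chr p.1 p.2‖ ^ 2 : ℝ) : ℂ) * (conj (F p.2) * X p.2)‖ₑ =
        ENNReal.ofReal (‖1 - chr p.1 p.2‖ ^ 2) * ENNReal.ofReal (‖F p.2‖ * ‖X p.2‖) := by
      intro p
      rw [← ofReal_norm, norm_mul, norm_mul, RCLike.norm_conj, Complex.norm_real,
        Real.norm_of_nonneg (by positivity), ENNReal.ofReal_mul (by positivity)]
    simp_rw [e]
    rw [lintegral_prod_symm _ hm3.aemeasurable]
    refine lt_of_eq_of_lt (lintegral_congr fun ξ => ?_)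
      (lintegral_weight_lt_top (a := 2 * symb c) (by positivity) hF hχ.continuous hs hΨft)
    dsimp only
    rw [lintegral_mul_const' _ _ ENNReal.ofReal_ne_top, lintegral_chr hc]
  have hinner : ∀ z, ∫ x, D (x, z) = ∫ ξ, ((‖1 - chr z ξ‖ ^ 2 : ℝ) : ℂ) * (conj (F ξ) * X ξ) := by
    intro z
    have a1 : MemLp (fun x => (f x : ℂ) - f (x - z)) 2 volume := hfC.sub (memLp_comp_sub hfC z)
    have a2 : MemLp (fun x => Ψ x - Ψ (x - z)) 2 volume := hΨ2.sub (memLp_comp_sub hΨ2 z)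
    have := integral_conj_ft_mul_ft a1 a2
    have e : ∫ x, D (x, z) = ∫ x, conj ((f x : ℂ) - f (x - z)) * (Ψ x - Ψ (x - z)) := by
      refine integral_congr_ae (Eventually.of_forall fun x => ?_)
      simp [hD]
    rw [e, ← this]
    refine integral_congr_ae ?_
    filter_upwards [ft_increment hfC z, ft_increment hΨ2 z] with ξ b1 b2
    have b3 : ((‖1 - chr z ξ‖ ^ 2 : ℝ) : ℂ) = conj (1 - chr z ξ) * (1 - chr z ξ) := by
      rw [Complex.conj_mul']; push_cast; rfl
    rw [b1, b2, b3, map_mul]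
    simp only [hFdef, hX]
    ring
  have hfinal : ∫ q, D q ∂(volume.prod (lineMeas c)) = ∫ ξ, ((2 * symb c * |ξ| : ℝ) : ℂ) * (conj (F ξ) * X ξ) := by
    rw [integral_prod_symm _ iD]
    simp_rw [hinner]
    rw [integral_integral_swap hint]
    refine integral_congr_ae (Eventually.of_forall fun ξ => ?_)
    simp only
    rw [integral_mul_const, integral_complex_ofReal, integral_chr hc]
  have hR : ∫ x, (g x : ℂ) * Ψ x = ∫ ξ, conj (ft (fun x => (g x : ℂ)) ξ) * X ξ := by
    rw [hX, integral_conj_ft_mul_ft hgC hΨ2]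
    simp
  have hL : ∫ ξ, ((2 * symb c * |ξ| : ℝ) : ℂ) * (conj (F ξ) * X ξ) =
      2 * ∫ ξ, ((symb c * |ξ| : ℝ) : ℂ) * (conj (F ξ) * X ξ) := by
    rw [← integral_const_mul]
    refine integral_congr_ae (Eventually.of_forall fun ξ => ?_)
    push_cast; ring
  rw [hfinal, hL, hR] at iD2
  have key := mul_left_cancel₀ (two_ne_zero (α := ℂ)) iD2
  rw [integral_congr_ae (g := fun ξ => ((symb c * |ξ| : ℝ) : ℂ) * (conj (F ξ) * X ξ)), key]
  · refine integral_congr_ae ?_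
    filter_upwards [hΨft] with ξ h
    rw [h]; ring
  · filter_upwards [hΨft] with ξ h
    rw [h]; ring

end

/-! ### The equation for minimizing layers on the line -/

section

open scoped ComplexConjugate SchwartzMap

section Lift

variable {n : ℕ} {H : ℝ × (Fin n → ℝ) → ℝ} {γ η : ℝ → ℝ}

lemma shiftSq_lift {f : ℝ → ℝ} (hf : Measurable f) (z : Cyl n) :
    shiftSq (fun w : Cyl n => f w.1) z = shiftSq f z.1 :=
  lintegral_fst_cyl (f := fun x => ENNReal.ofReal ((f x - f (x - z.1)) ^ 2)) (by fun_prop)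

/-- The increments do not depend on the torus part of z, so only the marginal c/x² of the kernel is
left. -/
lemma gag_lift (hH : IsKernel H) {f : ℝ → ℝ} (hf : Measurable f) :
    gag (cylMeas H) (fun w : Cyl n => f w.1) = gag (lineMeas (kerConst H)) f := by
  have hm : Measurable (shiftSq f) := by
    have : Measurable fun q : ℝ × ℝ => ENNReal.ofReal ((f q.2 - f (q.2 - q.1)) ^ 2) := by fun_prop
    exact this.lintegral_prod_right'
  unfold gag
  simp_rw [shiftSq_lift hf]
  exact hH.lintegral_fst hm

lemma integral_lift (hH : IsKernel H) {F : ℝ × ℝ → ℝ} (hF : Measurable F) :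
    ∫ q : Cyl n × Cyl n, F (q.1.1, q.2.1) ∂(volume.prod (cylMeas H)) =
      ∫ q, F q ∂(volume.prod (lineMeas (kerConst H))) := by
  have h := Measure.map_prod_map (volume : Measure (Cyl n)) (cylMeas H) measurable_fst measurable_fst
  rw [hH.map_fst, (measurePreserving_fst_cyl (n := n)).map_eq] at h
  rw [h, integral_map (measurable_fst.prodMap measurable_fst).aemeasurable hF.aestronglyMeasurable]
  rfl

lemma integral_fst_cyl {f : ℝ → ℝ} (hf : Measurable f) : ∫ w : Cyl n, f w.1 = ∫ x, f x := by
  rw [← (measurePreserving_fst_cyl (n := n)).map_eq, integral_map measurable_fst.aemeasurable]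
  exact hf.aestronglyMeasurable

lemma memLp_of_lift {f : ℝ → ℝ} (hf : Measurable f) (h : MemLp (fun w : Cyl n => f w.1) 2 volume) :
    MemLp f 2 volume := by
  have := measurePreserving_fst_cyl (n := n)
  have h2 := (memLp_map_measure_iff (f := Prod.fst) (μ := (volume : Measure (Cyl n))) (g := f)
    hf.aestronglyMeasurable this.measurable.aemeasurable).2 h
  rwa [this.map_eq] at h2

/-- One-dimensional minimizing layers. -/
structure IsMinimizer (H : ℝ × (Fin n → ℝ) → ℝ) (γ η φ : ℝ → ℝ) : Prop where
  layer : IsLayer φ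
  adm : GAdm H η (fun w : Cyl n => φ w.1)
  pot : ∫⁻ x, ENNReal.ofReal (γ (φ x)) < ⊤
  le : ∀ u : Cyl n → ℝ, GAdm H η u → ∫⁻ w, ENNReal.ofReal (γ (u w)) < ⊤ →
    energy' H γ η (fun w : Cyl n => φ w.1) ≤ energy' H γ η u

variable {φ : ℝ → ℝ}

lemma IsMinimizer.memLp (h : IsMinimizer H γ η φ) (hη : IsProfile η) : MemLp (fun x => φ x - η x) 2 volume :=
  memLp_of_lift (h.layer.measurable.sub hη.smooth.continuous.measurable) h.adm.memLp

lemma IsMinimizer.memLp_deriv (h : IsMinimizer H γ η φ) (hγ : IsDoubleWell γ) (hη : IsProfile η) :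
    MemLp (fun x => deriv γ (φ x)) 2 volume :=
  memLp_deriv_layer hγ hη h.layer (h.memLp hη)

lemma IsMinimizer.pot_lift (h : IsMinimizer H γ η φ) (hγ : IsDoubleWell γ) :
    ∫⁻ w : Cyl n, ENNReal.ofReal (γ (φ w.1)) < ⊤ := by
  rw [lintegral_fst_cyl (f := fun x => ENNReal.ofReal (γ (φ x)))
    (hγ.contDiff.continuous.measurable.comp h.layer.measurable).ennreal_ofReal]
  exact h.pot

lemma memLp_Lop_profile (hH : IsKernel H) (hη : IsProfile η) : MemLp (Lop (kerConst H) η) 2 volume := by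
  obtain ⟨B, hB⟩ := hη.exists_isBump
  exact hB.memLp_Lop hH.finiteMoment

/-- The right-hand side of the one-dimensional equation for `φ - η`. -/
def source (H : ℝ × (Fin n → ℝ) → ℝ) (γ η φ : ℝ → ℝ) (x : ℝ) : ℝ :=
  -(deriv γ (φ x) + Lop (kerConst H) η x)

lemma IsMinimizer.memLp_source (h : IsMinimizer H γ η φ) (hH : IsKernel H) (hγ : IsDoubleWell γ) (hη : IsProfile η) :
    MemLp (source H γ η φ) 2 volume :=
  ((h.memLp_deriv hγ hη).add (memLp_Lop_profile hH hη)).neg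

/-- The equation satisfied by a minimizing layer on the Fourier side. -/
theorem IsMinimizer.symb_mul_ft (h : IsMinimizer H γ η φ) (hH : IsKernel H) (hγ : IsDoubleWell γ) (hη : IsProfile η) :
    (fun ξ => ((symb (kerConst H) * |ξ| : ℝ) : ℂ) * ft (fun x => ((φ x - η x : ℝ) : ℂ)) ξ) =ᵐ[volume]
      ft (fun x => (source H γ η φ x : ℂ)) := by
  have hφ := h.layer.measurable
  have hηm := hη.smooth.continuous.measurable
  have hv : Measurable fun x => φ x - η x := hφ.sub hηm
  refine symb_mul_ft_eq hH.finiteMoment (h.memLp hη) (h.memLp_source hH hγ hη) ?_ fun ψ hψ hb hψ2 hψg => ?_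
  · rw [← gag_lift hH hv]
    exact h.adm.gag_lt
  have hψm := hψ.measurable
  have hp : IsPerturbation H (fun w : Cyl n => ψ w.1) := by
    obtain ⟨C, hC⟩ := hb
    exact ⟨⟨C, fun w => hC _⟩, memLp_lift hψ2, by rwa [gag_lift hH hψm]⟩
  have key := euler_lagrange hH hγ hη h.adm (fun w => h.layer.abs_le _) (h.pot_lift hγ)
    (memLp_lift (h.memLp_deriv hγ hη)) h.le hp
  have e1 := integral_lift hH (n := n) (F := fun q => ((φ q.1 - η q.1) - (φ (q.1 - q.2) - η (q.1 - q.2))) *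
    (ψ q.1 - ψ (q.1 - q.2))) (by fun_prop)
  obtain ⟨B, hB⟩ := hη.exists_isBump
  have hℓm : Measurable (Lop (kerConst H) η) := hB.measurable_Lop _
  have hγm : Measurable (deriv γ) := hγ.continuous_deriv.measurable
  have e2 := integral_fst_cyl (n := n) (f := fun x => ψ x * Lop (kerConst H) η x) (by fun_prop)
  have e3 := integral_fst_cyl (n := n) (f := fun x => deriv γ (φ x) * ψ x) (by fun_prop)
  have e4 : ∫ x, source H γ η φ x * ψ x =
      -((∫ x, ψ x * Lop (kerConst H) η x) + ∫ x, deriv γ (φ x) * ψ x) := by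
    have i1 : Integrable fun x => ψ x * Lop (kerConst H) η x := hψ2.integrable_mul (memLp_Lop_profile hH hη)
    have i2 : Integrable fun x => deriv γ (φ x) * ψ x := (h.memLp_deriv hγ hη).integrable_mul hψ2
    rw [← integral_add i1 i2, ← integral_neg]
    refine integral_congr_ae (Eventually.of_forall fun x => ?_)
    simp only [source]
    ring
  rw [e4, ← e2, ← e3, ← e1]
  simp only [Prod.fst_sub] at key
  linarith

end Lift

/-! ### Increments of the profile -/

section Increments

variable {η : ℝ → ℝ} {B h : ℝ}

lemma IsProfile.increment_eq_zero (hη : IsProfile η) (hh : |h| ≤ 1) {x : ℝ} (hx : 2 < |x|) : η (x + h) - η x = 0 := by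
  obtain ⟨h1, h2⟩ := abs_le.1 hh
  rcases lt_abs.1 hx with h3 | h3
  · rw [hη.eq_one _ (by linarith), hη.eq_one _ (by linarith), sub_self]
  · rw [hη.eq_neg_one _ (by linarith), hη.eq_neg_one _ (by linarith), sub_self]

lemma IsBump.abs_le {ζ : ℝ → ℝ} (hb : IsBump B ζ) (hz : ∀ x, 2 < |x| → ζ x = 0) (x : ℝ) : |ζ x| ≤ B := by
  have h1 := hb.first x (x - (|x| + 3))
  rw [sub_sub_cancel, hz (|x| + 3) (by rw [abs_of_pos (by positivity)]; linarith [abs_nonneg x]), sub_zero] at h1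
  exact h1.trans (mul_le_of_le_one_right hb.nonneg (min_le_left _ _))

lemma IsBump.integrable_second {c : ℝ} {ζ : ℝ → ℝ} (hb : IsBump B ζ) (hc : FiniteMoment c) (x : ℝ) :
    Integrable (fun z => 2 * ζ x - ζ (x + z) - ζ (x - z)) (lineMeas c) := by
  have hm := hb.meas
  have h1 : Integrable (fun z : ℝ => min 1 (z ^ 2)) (lineMeas c) :=
    (lintegral_ofReal_ne_top_iff_integrable (by fun_prop : Measurable fun z : ℝ => min 1 (z ^ 2)).aestronglyMeasurable
      (Eventually.of_forall fun z => by positivity)).1 hc.ne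
  exact (h1.const_mul B).mono' (by fun_prop : Measurable fun z => 2 * ζ x - ζ (x + z) - ζ (x - z)).aestronglyMeasurable
    (Eventually.of_forall fun z => hb.second x z)

lemma Lop_increment {c : ℝ} (hc : FiniteMoment c) (hη : IsProfile η) (h x : ℝ) :
    Lop c (fun x => η (x + h) - η x) x = Lop c η (x + h) - Lop c η x := by
  obtain ⟨B, hB⟩ := hη.exists_isBump
  unfold Lop
  rw [← mul_sub, ← integral_sub (hB.integrable_second hc _) (hB.integrable_second hc _)]
  congr 2
  funext z
  dsimp only
  rw [show x + z + h = x + h + z by ring, show x - z + h = x + h - z by ring]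
  ring

lemma isTest_increment {n : ℕ} (hη : IsProfile η) (hh : |h| ≤ 1) : IsTest (fun w : Cyl n => η (w.1 + h) - η w.1) := by
  constructor
  · have := hη.smooth
    exact (this.comp (contDiff_fst.add contDiff_const)).sub (this.comp contDiff_fst)
  · refine HasCompactSupport.intro ((isCompact_Icc (a := (-2 : ℝ)) (b := 2)).prod
      (isCompact_univ (X := UnitAddTorus (Fin n)))) fun w hw => hη.increment_eq_zero hh ?_
    by_contra hcon
    exact hw ⟨_root_.abs_le.1 (not_lt.1 hcon), trivial⟩

lemma memLp_increment_profile (hη : IsProfile η) (hh : |h| ≤ 1) : MemLp (fun x => η (x + h) - η x) 2 volume := by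
  obtain ⟨B, hB⟩ := hη.exists_isBump_increment
  exact memLp_of_bounded_support (hB h hh).meas ((hB h hh).abs_le fun x hx => hη.increment_eq_zero hh hx)
    fun x hx => hη.increment_eq_zero hh hx

/-- The profile is not in L² and has no transform here, but its increments are. Their integration by
parts formula is precisely the weak equation required by `symb_mul_ft_eq`. -/
lemma symb_mul_ft_increment {n : ℕ} {H : ℝ × (Fin n → ℝ) → ℝ} (hH : IsKernel H) (hη : IsProfile η) (hh : |h| ≤ 1) :
    (fun ξ => ((symb (kerConst H) * |ξ| : ℝ) : ℂ) * ft (fun x => ((η (x + h) - η x : ℝ) : ℂ)) ξ) =ᵐ[volume]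
      ft (fun x => ((Lop (kerConst H) η (x + h) - Lop (kerConst H) η x : ℝ) : ℂ)) := by
  obtain ⟨B, hB⟩ := hη.exists_isBump_increment
  have hb := hB h hh
  have hm := hb.meas
  have e : (fun x => ((Lop (kerConst H) η (x + h) - Lop (kerConst H) η x : ℝ) : ℂ)) =
      fun x => (Lop (kerConst H) (fun x => η (x + h) - η x) x : ℂ) := by
    funext x; rw [Lop_increment hH.finiteMoment hη]
  rw [e]
  refine symb_mul_ft_eq hH.finiteMoment (memLp_increment_profile hη hh) (hb.memLp_Lop hH.finiteMoment) ?_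
    fun ψ hψ _ hψ2 hψg => ?_
  · rw [← gag_lift hH hm]
    exact ((isTest_increment hη hh).isPerturbation hH).gag_lt
  have hψm := hψ.measurable
  have key := hb.integral_increment_mul hH (memLp_lift hψ2) (by rwa [gag_lift hH hψm])
  have e1 := integral_lift hH (n := n) (F := fun q => (ψ q.1 - ψ (q.1 - q.2)) *
    ((η (q.1 + h) - η q.1) - (η (q.1 - q.2 + h) - η (q.1 - q.2)))) (by
      have := hη.smooth.continuous.measurable
      fun_prop)
  have hLm : Measurable (Lop (kerConst H) (fun x => η (x + h) - η x)) := hb.measurable_Lop _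
  have e2 := integral_fst_cyl (n := n) (f := fun x => ψ x * Lop (kerConst H) (fun x => η (x + h) - η x) x) (by fun_prop)
  simp only [Prod.fst_sub] at key
  rw [e1, e2] at key
  rw [show (fun q : ℝ × ℝ => (η (q.1 + h) - η q.1 - (η (q.1 - q.2 + h) - η (q.1 - q.2))) * (ψ q.1 - ψ (q.1 - q.2))) =
    fun q => (ψ q.1 - ψ (q.1 - q.2)) * ((η (q.1 + h) - η q.1) - (η (q.1 - q.2 + h) - η (q.1 - q.2))) by
      funext q; ring, key]
  rw [← mul_assoc, one_div_mul_cancel two_ne_zero, one_mul]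
  refine integral_congr_ae (Eventually.of_forall fun x => ?_)
  ring

end Increments

end

/-! ### H² regularity -/

section

open scoped ComplexConjugate SchwartzMap

lemma norm_one_sub_chr_sq_le_mul (h ξ : ℝ) : ‖1 - chr h ξ‖ ^ 2 ≤ 4 * Real.pi ^ 2 * h ^ 2 * ξ ^ 2 := by
  refine (norm_one_sub_chr_sq_le _).trans ?_
  have := min_le_right 1 ((Real.pi * -(h * ξ)) ^ 2)
  nlinarith

lemma tendsto_norm_one_sub_chr (ξ : ℝ) {h : ℕ → ℝ} (h0 : ∀ k, h k ≠ 0) (hl : Tendsto h atTop (𝓝 0)) :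
    Tendsto (fun k => ‖1 - chr (h k) ξ‖ ^ 2 / h k ^ 2) atTop (𝓝 (4 * Real.pi ^ 2 * ξ ^ 2)) := by
  have hd : HasDerivAt (fun t : ℝ => chr t ξ) (-(2 * Real.pi * ξ : ℝ) * Complex.I) 0 := by
    have h1 : HasDerivAt (fun t : ℝ => Complex.exp (((-(2 * Real.pi * ξ) : ℝ) : ℂ) * Complex.I * t))
        (Complex.exp (((-(2 * Real.pi * ξ) : ℝ) : ℂ) * Complex.I * (0 : ℝ)) *
          ((((-(2 * Real.pi * ξ) : ℝ) : ℂ) * Complex.I) * (1 : ℝ))) 0 :=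
      ((HasDerivAt.ofReal_comp (hasDerivAt_id 0)).const_mul _).cexp
    convert! h1 using 1
    · funext t
      rw [chr, Real.fourierChar_apply]
      congr 1; push_cast; ring
    · simp
  have h2 := (hasDerivAt_iff_tendsto_slope_zero.1 hd).comp
    (tendsto_nhdsWithin_iff.2 ⟨hl, Eventually.of_forall h0⟩)
  have h3 := (h2.norm).pow 2
  have e1 : ‖(-(2 * Real.pi * ξ : ℝ) * Complex.I : ℂ)‖ ^ 2 = 4 * Real.pi ^ 2 * ξ ^ 2 := by
    rw [norm_mul, Complex.norm_I, mul_one, norm_neg, Complex.norm_real, Real.norm_eq_abs, sq_abs]; ring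
  rw [e1] at h3
  refine h3.congr fun k => ?_
  simp only [Function.comp, zero_add]
  have e2 : chr 0 ξ = 1 := by simp [chr]
  rw [e2, norm_smul, mul_pow, norm_inv, Real.norm_eq_abs, inv_pow, sq_abs, norm_sub_rev]
  ring

/-- Square integrable functions whose increments are `O(h)` in `L²` have a square integrable derivative. -/
lemma lintegral_sq_mul_ft_lt_top {g : ℝ → ℂ} (hg : MemLp g 2 volume) {C : ℝ≥0∞} (hC : C < ⊤)
    (hinc : ∀ h : ℝ, 0 < h → h ≤ 1 → ∫⁻ x, ENNReal.ofReal (‖g x - g (x - h)‖ ^ 2) ≤ C * ENNReal.ofReal (h ^ 2)) :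
    ∫⁻ ξ, ENNReal.ofReal (ξ ^ 2) * ENNReal.ofReal (‖ft g ξ‖ ^ 2) < ⊤ := by
  set h : ℕ → ℝ := fun k => 1 / ((k : ℝ) + 1) with hh
  have hpos : ∀ k, 0 < h k := fun k => by simp only [hh]; positivity
  have hle : ∀ k, h k ≤ 1 := fun k => by
    simp only [hh]
    rw [div_le_one (by positivity)]
    linarith [(Nat.cast_nonneg k : (0 : ℝ) ≤ k)]
  have hlim : Tendsto h atTop (𝓝 0) := tendsto_one_div_add_atTop_nhds_zero_nat
  have hm := measurable_ft g
  have hmc : ∀ k, Measurable fun ξ => ENNReal.ofReal (‖1 - chr (h k) ξ‖ ^ 2 / h k ^ 2) := fun k => by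
    have := (continuous_chr (h k)).measurable
    fun_prop
  -- Fatou along h = 1/(k+1): the difference quotients of the character converge to its derivative,
  -- of square 4π²ξ².
  have key : ∫⁻ ξ, ENNReal.ofReal (4 * Real.pi ^ 2 * ξ ^ 2) * ENNReal.ofReal (‖ft g ξ‖ ^ 2) ≤ C := by
    calc _ = ∫⁻ ξ, liminf (fun k => ENNReal.ofReal (‖1 - chr (h k) ξ‖ ^ 2 / h k ^ 2) *
          ENNReal.ofReal (‖ft g ξ‖ ^ 2)) atTop := by
          refine lintegral_congr fun ξ => (Tendsto.liminf_eq ?_).symm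
          refine ENNReal.Tendsto.mul_const ?_ (Or.inr ENNReal.ofReal_ne_top)
          exact ENNReal.tendsto_ofReal (tendsto_norm_one_sub_chr ξ (fun k => (hpos k).ne') hlim)
      _ ≤ liminf (fun k => ∫⁻ ξ, ENNReal.ofReal (‖1 - chr (h k) ξ‖ ^ 2 / h k ^ 2) *
          ENNReal.ofReal (‖ft g ξ‖ ^ 2)) atTop := lintegral_liminf_le fun k => (hmc k).mul (by fun_prop)
      _ ≤ liminf (fun _ : ℕ => C) atTop := by
          refine liminf_le_liminf (Eventually.of_forall fun k => ?_)
          have h1 := hinc (h k) (hpos k) (hle k)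
          rw [lintegral_increment_sq hg] at h1
          have h2 : ∀ ξ, ENNReal.ofReal (‖1 - chr (h k) ξ‖ ^ 2 / h k ^ 2) * ENNReal.ofReal (‖ft g ξ‖ ^ 2) =
              ENNReal.ofReal ((h k ^ 2)⁻¹) *
                (ENNReal.ofReal (‖1 - chr (h k) ξ‖ ^ 2) * ENNReal.ofReal (‖ft g ξ‖ ^ 2)) := fun ξ => by
            rw [← mul_assoc, ← ENNReal.ofReal_mul (inv_nonneg.2 (sq_nonneg (h k))), div_eq_inv_mul]
          simp_rw [h2]
          rw [lintegral_const_mul' _ _ ENNReal.ofReal_ne_top]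
          calc _ ≤ ENNReal.ofReal ((h k ^ 2)⁻¹) * (C * ENNReal.ofReal (h k ^ 2)) := by gcongr
            _ = C * ENNReal.ofReal ((h k ^ 2)⁻¹ * h k ^ 2) := by
                rw [ENNReal.ofReal_mul (by have := hpos k; positivity)]; ring
            _ = C := by
                rw [inv_mul_cancel₀ (by have := hpos k; positivity), ENNReal.ofReal_one, mul_one]
      _ = C := by simp
  refine lt_of_le_of_lt (lintegral_mono fun ξ => ?_) (key.trans_lt hC)
  gcongr
  have : 1 ≤ Real.pi ^ 2 := one_le_pow₀ (by linarith [Real.pi_gt_three])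
  nlinarith [sq_nonneg ξ]

lemma lintegral_increment_le {g : ℝ → ℂ} (hg : MemLp g 2 volume) (h : ℝ) :
    ∫⁻ x, ENNReal.ofReal (‖g x - g (x - h)‖ ^ 2) ≤
      ENNReal.ofReal (4 * Real.pi ^ 2) * (∫⁻ ξ, ENNReal.ofReal (ξ ^ 2) * ENNReal.ofReal (‖ft g ξ‖ ^ 2)) *
        ENNReal.ofReal (h ^ 2) := by
  rw [lintegral_increment_sq hg, mul_right_comm, ← ENNReal.ofReal_mul (by positivity),
    ← lintegral_const_mul' _ _ ENNReal.ofReal_ne_top]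
  refine lintegral_mono fun ξ => ?_
  rw [← mul_assoc, ← ENNReal.ofReal_mul (p := 4 * Real.pi ^ 2 * h ^ 2) (by positivity)]
  gcongr
  exact norm_one_sub_chr_sq_le_mul h ξ

/-- An `L²` bound `O(h)` for increments. -/
def LipL2 (g : ℝ → ℝ) : Prop :=
  ∃ C : ℝ≥0∞, C < ⊤ ∧ ∀ h : ℝ, 0 < h → h ≤ 1 →
    ∫⁻ x, ENNReal.ofReal ((g x - g (x - h)) ^ 2) ≤ C * ENNReal.ofReal (h ^ 2)

lemma LipL2.lintegral_lt_top {g : ℝ → ℝ} (h : LipL2 g) (hg : MemLp g 2 volume) :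
    ∫⁻ ξ, ENNReal.ofReal (ξ ^ 2) * ENNReal.ofReal (‖ft (fun x => (g x : ℂ)) ξ‖ ^ 2) < ⊤ := by
  obtain ⟨C, hC, hh⟩ := h
  refine lintegral_sq_mul_ft_lt_top (g := fun x => (g x : ℂ)) hg.ofReal hC fun t ht ht1 => ?_
  refine le_trans (le_of_eq (lintegral_congr fun x => ?_)) (hh t ht ht1)
  rw [← Complex.ofReal_sub, Complex.norm_real, Real.norm_eq_abs, sq_abs]

lemma LipL2.of_lintegral {g : ℝ → ℝ} (hg : MemLp g 2 volume)
    (h : ∫⁻ ξ, ENNReal.ofReal (ξ ^ 2) * ENNReal.ofReal (‖ft (fun x => (g x : ℂ)) ξ‖ ^ 2) < ⊤) : LipL2 g := by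
  refine ⟨_, ENNReal.mul_lt_top (ENNReal.ofReal_lt_top (r := 4 * Real.pi ^ 2)) h, fun t _ _ => ?_⟩
  refine le_trans (le_of_eq (lintegral_congr fun x => ?_)) (lintegral_increment_le (g := fun x => (g x : ℂ)) hg.ofReal t)
  rw [← Complex.ofReal_sub, Complex.norm_real, Real.norm_eq_abs, sq_abs]

lemma LipL2.add {f g : ℝ → ℝ} (hf : LipL2 f) (hg : LipL2 g) (hfm : Measurable f) : LipL2 fun x => f x + g x := by
  obtain ⟨C, hC, h1⟩ := hf
  obtain ⟨D, hD, h2⟩ := hg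
  refine ⟨2 * C + 2 * D, ENNReal.add_lt_top.2 ⟨ENNReal.mul_lt_top (by simp) hC, ENNReal.mul_lt_top (by simp) hD⟩,
    fun h hh hh1 => ?_⟩
  refine (shiftSq_le_two_add hfm.aestronglyMeasurable h fun _ => rfl).trans ?_
  rw [add_mul, mul_assoc, mul_assoc]
  exact add_le_add (mul_le_mul_right (h1 h hh hh1) 2) (mul_le_mul_right (h2 h hh hh1) 2)

/-- Lipschitz superposition acts on increments directly. Measuring regularity in this way avoids a
chain rule for weak derivatives. -/
lemma LipL2.of_le {f g : ℝ → ℝ} (hf : LipL2 f) {M : ℝ} (hle : ∀ x y, |g x - g y| ≤ M * |f x - f y|) : LipL2 g := by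
  obtain ⟨C, hC, h1⟩ := hf
  refine ⟨ENNReal.ofReal (M ^ 2) * C, ENNReal.mul_lt_top ENNReal.ofReal_lt_top hC, fun h hh hh1 => ?_⟩
  rw [mul_assoc]
  calc _ ≤ ∫⁻ x, ENNReal.ofReal (M ^ 2) * ENNReal.ofReal ((f x - f (x - h)) ^ 2) := by
        refine lintegral_mono fun x => ?_
        rw [← ENNReal.ofReal_mul (by positivity), ← mul_pow, ← sq_abs (g x - _)]
        refine ENNReal.ofReal_le_ofReal ?_
        rw [← sq_abs (M * _), abs_mul]
        refine pow_le_pow_left₀ (abs_nonneg _) ((hle _ _).trans ?_) 2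
        gcongr
        exact le_abs_self M
    _ ≤ _ := by
        rw [lintegral_const_mul' _ _ ENNReal.ofReal_ne_top]
        gcongr
        exact h1 h hh hh1

/-- A pointwise bound for increments by `h` times a fixed square integrable function. -/
lemma LipL2.of_dominated {g k : ℝ → ℝ} (hk : MemLp k 2 volume)
    (h : ∀ t : ℝ, 0 < t → t ≤ 1 → ∀ x, |g x - g (x - t)| ≤ t * k x) : LipL2 g := by
  refine ⟨∫⁻ x, ENNReal.ofReal (k x ^ 2), hk.integrable_sq.lintegral_lt_top, fun t ht ht1 => ?_⟩
  rw [← lintegral_mul_const' _ _ ENNReal.ofReal_ne_top]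
  refine lintegral_mono fun x => ?_
  rw [← ENNReal.ofReal_mul (by positivity), ← sq_abs, ← mul_pow, mul_comm (k x)]
  exact ENNReal.ofReal_le_ofReal (pow_le_pow_left₀ (abs_nonneg _) (h t ht ht1 x) 2)

variable {n : ℕ} {H : ℝ × (Fin n → ℝ) → ℝ} {γ η φ : ℝ → ℝ}

lemma lipL2_profile (hη : IsProfile η) : LipL2 η := by
  obtain ⟨B, hB⟩ := hη.exists_isBump_increment
  have h1 : MemLp ((Set.Icc (-2 : ℝ) 2).indicator fun _ : ℝ => B) 2 volume :=
    memLp_indicator_const _ measurableSet_Icc _ (Or.inr (by simp))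
  refine LipL2.of_dominated h1 fun t ht ht1 x => ?_
  have ht' : |-t| ≤ 1 := by rwa [abs_neg, abs_of_pos ht]
  have hb := hB (-t) ht'
  have e : |η x - η (x - t)| = |η (x + -t) - η x| := by rw [abs_sub_comm, ← sub_eq_add_neg x t]
  rw [e]
  by_cases hx : |x| ≤ 2
  · rw [Set.indicator_of_mem (show x ∈ Set.Icc (-2 : ℝ) 2 from _root_.abs_le.1 hx), mul_comm]
    have := hb.abs_le (fun x hx => hη.increment_eq_zero ht' hx) x
    rwa [abs_neg, abs_of_pos ht] at this
  · rw [hη.increment_eq_zero ht' (not_le.1 hx), abs_zero]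
    rw [Set.indicator_of_notMem (s := Set.Icc (-2 : ℝ) 2) (fun hcon => hx (_root_.abs_le.2 hcon)), mul_zero]

lemma lipL2_Lop (hH : IsKernel H) (hη : IsProfile η) : LipL2 (Lop (kerConst H) η) := by
  obtain ⟨B, hB⟩ := hη.exists_isBump_increment
  refine LipL2.of_dominated (memLp_inv_one_add_abs.const_mul (2 * B * moment (kerConst H))) fun t ht ht1 x => ?_
  have ht' : |-t| ≤ 1 := by rwa [abs_neg, abs_of_pos ht]
  have := (hB (-t) ht').abs_Lop_le hH.finiteMoment x
  rw [Lop_increment hH.finiteMoment hη, abs_neg, abs_of_pos ht, ← sub_eq_add_neg, abs_sub_comm] at this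
  refine this.trans (le_of_eq ?_)
  ring

/-- The quantitative form of `φ - η ∈ H²(ℝ)`. -/
theorem IsMinimizer.lintegral_ft_lt_top (h : IsMinimizer H γ η φ) (hH : IsKernel H) (hγ : IsDoubleWell γ)
    (hη : IsProfile η) :
    ∫⁻ ξ, ENNReal.ofReal ((1 + ξ ^ 2) ^ 2) * ENNReal.ofReal (‖ft (fun x => ((φ x - η x : ℝ) : ℂ)) ξ‖ ^ 2) < ⊤ := by
  have hv := h.memLp hη
  have hg := h.memLp_source hH hγ hη
  set V : ℝ → ℂ := ft (fun x => ((φ x - η x : ℝ) : ℂ)) with hV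
  set G : ℝ → ℂ := ft (fun x => (source H γ η φ x : ℂ)) with hG
  have hs : 0 < symb (kerConst H) := symb_pos hH.kerConst_pos hH.finiteMoment
  have heq := h.symb_mul_ft hH hγ hη
  -- First use of the equation: |ξ||V| = |G|/λ, so G in L² gives one derivative of φ - η.
  have hVG : ∀ᵐ ξ, ENNReal.ofReal (ξ ^ 2) * ENNReal.ofReal (‖V ξ‖ ^ 2) =
      ENNReal.ofReal ((symb (kerConst H) ^ 2)⁻¹) * ENNReal.ofReal (‖G ξ‖ ^ 2) := by
    filter_upwards [heq] with ξ hξ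
    rw [hG, ← hξ, norm_mul, Complex.norm_real, Real.norm_of_nonneg (by positivity), mul_pow, mul_pow, sq_abs,
      ← ENNReal.ofReal_mul (by positivity), ← ENNReal.ofReal_mul (by positivity)]
    congr 1
    rw [← hV]
    field_simp
  have hV0 : ∫⁻ ξ, ENNReal.ofReal (‖V ξ‖ ^ 2) < ⊤ := by
    rw [← eLpNorm_two_sq]; exact ENNReal.pow_lt_top (ft_memLp _).eLpNorm_lt_top
  have hG0 : ∫⁻ ξ, ENNReal.ofReal (‖G ξ‖ ^ 2) < ⊤ := by
    rw [← eLpNorm_two_sq]; exact ENNReal.pow_lt_top (ft_memLp _).eLpNorm_lt_top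
  have hV1 : ∫⁻ ξ, ENNReal.ofReal (ξ ^ 2) * ENNReal.ofReal (‖V ξ‖ ^ 2) < ⊤ := by
    rw [lintegral_congr_ae hVG, lintegral_const_mul' _ _ ENNReal.ofReal_ne_top]
    exact ENNReal.mul_lt_top ENNReal.ofReal_lt_top hG0
  have hφL : LipL2 φ := by
    have h1 := (LipL2.of_lintegral hv hV1).add (lipL2_profile hη)
      (h.layer.measurable.sub hη.smooth.continuous.measurable)
    simpa using h1
  obtain ⟨M, hM, hT⟩ := hγ.exists_taylor 1
  -- One derivative of φ passes to γ'(φ), because γ' is Lipschitz on the range [-1,1]; then the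
  -- source also has one, and the equation is used a second time in `hV2`.
  have hdL : LipL2 fun x => deriv γ (φ x) := hφL.of_le (M := M) fun x y =>
    (hT (φ y) ⟨h.layer.ge y, h.layer.le y⟩ (φ x) ⟨h.layer.ge x, h.layer.le x⟩).1
  have hgL : LipL2 (source H γ η φ) := by
    refine (hdL.add (lipL2_Lop hH hη) (hγ.continuous_deriv.measurable.comp h.layer.measurable)).of_le
      (M := 1) fun x y => ?_
    rw [one_mul, source, source, neg_sub_neg, abs_sub_comm]
  have hG1 := hgL.lintegral_lt_top hg
  have hV2 : ∫⁻ ξ, ENNReal.ofReal (ξ ^ 2) * (ENNReal.ofReal (ξ ^ 2) * ENNReal.ofReal (‖V ξ‖ ^ 2)) < ⊤ := by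
    have : ∀ᵐ ξ, ENNReal.ofReal (ξ ^ 2) * (ENNReal.ofReal (ξ ^ 2) * ENNReal.ofReal (‖V ξ‖ ^ 2)) =
        ENNReal.ofReal ((symb (kerConst H) ^ 2)⁻¹) * (ENNReal.ofReal (ξ ^ 2) * ENNReal.ofReal (‖G ξ‖ ^ 2)) := by
      filter_upwards [hVG] with ξ hξ
      rw [hξ]; ring
    rw [lintegral_congr_ae this, lintegral_const_mul' _ _ ENNReal.ofReal_ne_top]
    exact ENNReal.mul_lt_top ENNReal.ofReal_lt_top hG1
  have hVm := measurable_ft (fun x => ((φ x - η x : ℝ) : ℂ))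
  calc _ ≤ ∫⁻ ξ, (2 * ENNReal.ofReal (‖V ξ‖ ^ 2) +
        2 * (ENNReal.ofReal (ξ ^ 2) * (ENNReal.ofReal (ξ ^ 2) * ENNReal.ofReal (‖V ξ‖ ^ 2)))) := by
        refine lintegral_mono fun ξ => ?_
        rw [← ENNReal.ofReal_ofNat 2, ← ENNReal.ofReal_mul (by positivity), ← ENNReal.ofReal_mul (by positivity),
          ← ENNReal.ofReal_mul (by positivity), ← ENNReal.ofReal_mul (by positivity),
          ← ENNReal.ofReal_mul (by positivity), ← ENNReal.ofReal_add (by positivity) (by positivity)]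
        refine ENNReal.ofReal_le_ofReal ?_
        nlinarith [mul_nonneg (sq_nonneg (1 - ξ ^ 2)) (sq_nonneg ‖V ξ‖)]
    _ < ⊤ := by
        rw [lintegral_add_left (by fun_prop), lintegral_const_mul' _ _ (by simp), lintegral_const_mul' _ _ (by simp)]
        exact ENNReal.add_lt_top.2 ⟨ENNReal.mul_lt_top (by simp) hV0, ENNReal.mul_lt_top (by simp) hV2⟩

end

/-! ### Fourier inversion and the differentiable representative -/

section

open scoped ComplexConjugate SchwartzMap

lemma fourierInv_apply (G : ℝ → ℂ) (x : ℝ) : 𝓕⁻ G x = ∫ ξ, chr (-x) ξ * G ξ := by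
  rw [Real.fourierInv_eq]
  refine integral_congr_ae (Eventually.of_forall fun ξ => ?_)
  simp [chr, Circle.smul_def, mul_comm]

/-- Cauchy–Schwarz: 1 + |ξ| ≤ 2(1 + ξ²)(1 + |ξ|)⁻¹ and the last factor is square integrable. Thus
two derivatives in L² make the inverse transform differentiable. -/
lemma integrable_one_add_abs_mul {G : ℝ → ℂ} (hG : AEStronglyMeasurable G)
    (h : ∫⁻ ξ, ENNReal.ofReal ((1 + ξ ^ 2) ^ 2) * ENNReal.ofReal (‖G ξ‖ ^ 2) < ⊤) :
    Integrable fun ξ => (1 + |ξ|) * ‖G ξ‖ := by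
  have h1 : MemLp (fun ξ => (1 + ξ ^ 2) * ‖G ξ‖) 2 volume := by
    have hm : AEStronglyMeasurable fun ξ : ℝ => (1 + ξ ^ 2) * ‖G ξ‖ :=
      (by fun_prop : Continuous fun ξ : ℝ => 1 + ξ ^ 2).aestronglyMeasurable.mul hG.norm
    refine ⟨hm, ?_⟩
    refine (ENNReal.pow_lt_top_iff (n := 2)).1 ?_ |>.resolve_right (by norm_num)
    rw [eLpNorm_two_sq]
    refine lt_of_le_of_lt (le_of_eq (lintegral_congr fun ξ => ?_)) h
    rw [← ENNReal.ofReal_mul (by positivity), ← mul_pow, Real.norm_eq_abs, sq_abs]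
  refine ((h1.const_mul 2).integrable_mul memLp_inv_one_add_abs).mono'
    ((by fun_prop : Continuous fun ξ : ℝ => 1 + |ξ|).aestronglyMeasurable.mul hG.norm)
    (Eventually.of_forall fun ξ => ?_)
  have h2 : 0 < 1 + |ξ| := by positivity
  have h3 : 1 + |ξ| ≤ 2 * (1 + ξ ^ 2) * (1 + |ξ|)⁻¹ := by
    rw [le_mul_inv_iff₀ h2]
    nlinarith [sq_nonneg (|ξ| - 1), sq_abs ξ]
  rw [Real.norm_eq_abs, abs_of_nonneg (by positivity)]
  calc (1 + |ξ|) * ‖G ξ‖ ≤ 2 * (1 + ξ ^ 2) * (1 + |ξ|)⁻¹ * ‖G ξ‖ := by gcongr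
    _ = _ := by simp only [Pi.mul_apply]; ring

lemma integrable_of_one_add_abs_mul {G : ℝ → ℂ} (hG : AEStronglyMeasurable G)
    (h : Integrable fun ξ => (1 + |ξ|) * ‖G ξ‖) : Integrable G := by
  refine h.mono' hG (Eventually.of_forall fun ξ => ?_)
  nlinarith [abs_nonneg ξ, norm_nonneg (G ξ)]

lemma integrable_abs_mul {G : ℝ → ℂ} (hG : AEStronglyMeasurable G)
    (h : Integrable fun ξ => (1 + |ξ|) * ‖G ξ‖) : Integrable fun ξ => ((|ξ| : ℝ) : ℂ) * G ξ := by
  refine h.mono' ((by fun_prop : Continuous fun ξ : ℝ => ((|ξ| : ℝ) : ℂ)).aestronglyMeasurable.mul hG)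
    (Eventually.of_forall fun ξ => ?_)
  rw [norm_mul, Complex.norm_real, Real.norm_eq_abs, abs_abs]
  nlinarith [abs_nonneg ξ, norm_nonneg (G ξ)]

lemma differentiable_fourierInv {G : ℝ → ℂ} (hG : AEStronglyMeasurable G)
    (h : Integrable fun ξ => (1 + |ξ|) * ‖G ξ‖) : Differentiable ℝ (𝓕⁻ G) := by
  have e : 𝓕⁻ G = fun x => 𝓕 G (-x) := by ext x; exact Real.fourierInv_eq_fourier_neg _ _
  have h1 : Integrable fun ξ : ℝ => ξ • G ξ := by
    refine h.mono' (continuous_id.aestronglyMeasurable.smul hG) (Eventually.of_forall fun ξ => ?_)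
    rw [norm_smul, Real.norm_eq_abs]
    nlinarith [abs_nonneg ξ, norm_nonneg (G ξ)]
  have h2 : Differentiable ℝ (𝓕 G) := fun w =>
    (Real.hasDerivAt_fourier (integrable_of_one_add_abs_mul hG h) h1 w).differentiableAt
  rw [e]
  exact h2.comp differentiable_neg

lemma tendsto_fourierInv (G : ℝ → ℂ) : Tendsto (𝓕⁻ G) (cocompact ℝ) (𝓝 0) := by
  have e : 𝓕⁻ G = 𝓕 G ∘ Neg.neg := by ext x; exact Real.fourierInv_eq_fourier_neg _ _
  rw [e]
  exact (Real.zero_at_infty_fourier G).comp (Homeomorph.neg ℝ).isClosedEmbedding.tendsto_cocompact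

/-- The two functions agree on a dense set, and the continuity of ψ carries each closed condition to
all points. -/
lemma IsLayer.congr_ae {φ ψ : ℝ → ℝ} (h : IsLayer φ) (he : φ =ᵐ[volume] ψ) (hψ : Continuous ψ) : IsLayer ψ := by
  have hd : Dense {x | φ x = ψ x} := Measure.dense_of_ae he
  have hle : ∀ x y, x < y → ψ x ≤ ψ y := by
    intro x y hxy
    have key : ∀ a b, φ a = ψ a → φ b = ψ b → a < b → ψ a ≤ ψ b := fun a b ha hb hab => by
      rw [← ha, ← hb]; exact h.mono hab.le
    have hx : ∀ a, φ a = ψ a → a < y → ψ a ≤ ψ y := by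
      intro a ha hay
      by_contra hcon
      have ho : IsOpen ({b | ψ b < ψ a} ∩ Set.Ioi a) :=
        (isOpen_lt hψ continuous_const).inter isOpen_Ioi
      obtain ⟨b, ⟨hb1, hb2⟩, hb3⟩ := hd.inter_open_nonempty _ ho ⟨y, not_le.1 hcon, hay⟩
      exact absurd (key a b ha hb3 hb2) (not_le.2 hb1)
    by_contra hcon
    have ho : IsOpen ({a | ψ y < ψ a} ∩ Set.Iio y) := (isOpen_lt continuous_const hψ).inter isOpen_Iio
    obtain ⟨a, ⟨ha1, ha2⟩, ha3⟩ := hd.inter_open_nonempty _ ho ⟨x, not_le.1 hcon, hxy⟩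
    exact absurd (hx a ha3 ha2) (not_le.2 ha1)
  have hcl : ∀ (p : Set ℝ), IsOpen p → ∀ (q : ℝ → Prop), IsClosed {x | q (ψ x)} →
      (∀ x ∈ p, q (φ x)) → ∀ x ∈ p, q (ψ x) := by
    intro p hp q hq hall x hx
    by_contra hcon
    obtain ⟨a, ⟨ha1, ha2⟩, ha3⟩ := hd.inter_open_nonempty _ (hq.isOpen_compl.inter hp) ⟨x, hcon, hx⟩
    exact ha1 (by show q (ψ a); rw [← ha3]; exact hall a ha2)
  refine ⟨fun x y hxy => ?_, fun x => ?_, fun x => ?_, fun x hx => ?_, fun x hx => ?_⟩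
  · rcases hxy.lt_or_eq with h1 | h1
    · exact hle x y h1
    · rw [h1]
  · exact hcl Set.univ isOpen_univ (fun t => -1 ≤ t) (isClosed_le continuous_const hψ) (fun x _ => h.ge x) x trivial
  · exact hcl Set.univ isOpen_univ (fun t => t ≤ 1) (isClosed_le hψ continuous_const) (fun x _ => h.le x) x trivial
  · exact hcl (Set.Ioi 0) isOpen_Ioi (fun t => 0 ≤ t) (isClosed_le continuous_const hψ) (fun x hx => h.nonneg x hx) x hx
  · exact hcl (Set.Iio 0) isOpen_Iio (fun t => t ≤ 0) (isClosed_le hψ continuous_const) (fun x hx => h.nonpos x hx) x hx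

variable {n : ℕ} {H : ℝ × (Fin n → ℝ) → ℝ} {γ η φ ψ : ℝ → ℝ}

lemma gag_congr_ae {μ : Measure (Cyl n)} {u v : Cyl n → ℝ} (h : u =ᵐ[volume] v) : gag μ u = gag μ v := by
  refine lintegral_congr fun z => lintegral_congr_ae ?_
  filter_upwards [h, (measurePreserving_sub_right (volume : Measure (Cyl n)) z).quasiMeasurePreserving.ae_eq_comp h]
    with w h1 h2
  simp only [Function.comp] at h2
  rw [h1, h2]

lemma IsMinimizer.congr_ae (h : IsMinimizer H γ η φ) (hH : IsKernel H) (he : φ =ᵐ[volume] ψ) (hψ : Continuous ψ) :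
    IsMinimizer H γ η ψ := by
  have hl : (fun w : Cyl n => φ w.1) =ᵐ[volume] fun w => ψ w.1 :=
    (measurePreserving_fst_cyl (n := n)).quasiMeasurePreserving.ae_eq_comp he
  have hs : (fun w : Cyl n => φ w.1 - η w.1) =ᵐ[volume] fun w => ψ w.1 - η w.1 := by
    filter_upwards [hl] with w hw; rw [hw]
  refine ⟨h.layer.congr_ae he hψ, ⟨(memLp_congr_ae hs).1 h.adm.memLp, ?_⟩, ?_, fun u hu hp => ?_⟩
  · rw [← gag_congr_ae hs]; exact h.adm.gag_lt
  · rw [lintegral_congr_ae (g := fun x => ENNReal.ofReal (γ (φ x)))]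
    · exact h.pot
    · filter_upwards [he] with x hx; rw [hx]
  · refine le_trans (le_of_eq ?_) (h.le u hu hp)
    unfold energy'
    rw [← integral_density_eq hH, ← integral_density_eq hH]
    congr 1
    · refine integral_congr_ae ?_
      filter_upwards [Measure.quasiMeasurePreserving_fst.ae_eq_comp hl,
        Measure.quasiMeasurePreserving_snd.ae_eq_comp hl] with p h1 h2
      simp only [Function.comp] at h1 h2
      simp only [density, h1, h2]
    · congr 2
      refine lintegral_congr_ae ?_
      filter_upwards [hl] with w hw; rw [hw]

/-- A minimizing layer has a continuous representative given by Fourier inversion. -/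
theorem IsMinimizer.exists_representative (h : IsMinimizer H γ η φ) (hH : IsKernel H) (hγ : IsDoubleWell γ)
    (hη : IsProfile η) :
    ∃ ψ, IsMinimizer H γ η ψ ∧
      ∀ x, ((ψ x - η x : ℝ) : ℂ) = 𝓕⁻ (ft fun x => ((ψ x - η x : ℝ) : ℂ)) x := by
  have hvC : MemLp (fun x => ((φ x - η x : ℝ) : ℂ)) 2 volume := (h.memLp hη).ofReal
  have hV := integrable_one_add_abs_mul (measurable_ft _).aestronglyMeasurable (h.lintegral_ft_lt_top hH hγ hη)
  have hVi := integrable_of_one_add_abs_mul (measurable_ft _).aestronglyMeasurable hV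
  set V := ft fun x => ((φ x - η x : ℝ) : ℂ) with hVd
  have hc := continuous_fourierInv hVi
  have hae := ae_eq_fourierInv_ft hvC hVi
  -- The inverse transform agrees almost everywhere with a real function; being real is a closed
  -- condition on a continuous function.
  have hreal : ∀ x, ((𝓕⁻ V x).re : ℂ) = 𝓕⁻ V x := by
    have hcl : IsClosed {x | ((𝓕⁻ V x).re : ℂ) = 𝓕⁻ V x} :=
      isClosed_eq (Complex.continuous_ofReal.comp (Complex.continuous_re.comp hc)) hc
    have hd : Dense {x | ((φ x - η x : ℝ) : ℂ) = 𝓕⁻ V x} := Measure.dense_of_ae hae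
    intro x
    have := hcl.closure_subset_iff.2 (fun y (hy : ((φ y - η y : ℝ) : ℂ) = 𝓕⁻ V y) => by
      show ((𝓕⁻ V y).re : ℂ) = 𝓕⁻ V y
      rw [← hy, Complex.ofReal_re]) (hd x)
    exact this
  have he : φ =ᵐ[volume] fun x => η x + (𝓕⁻ V x).re := by
    filter_upwards [hae] with x hx
    rw [← hx, Complex.ofReal_re]; ring
  have hψc : Continuous fun x => η x + (𝓕⁻ V x).re := hη.smooth.continuous.add (Complex.continuous_re.comp hc)
  refine ⟨_, h.congr_ae hH he hψc, fun x => ?_⟩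
  have e2 : ft (fun x => ((η x + (𝓕⁻ V x).re - η x : ℝ) : ℂ)) = V := by
    refine (ft_congr_ae hvC ?_).symm
    filter_upwards [hae] with x hx
    rw [hx, add_sub_cancel_left, hreal]
  rw [e2, add_sub_cancel_left, hreal]

lemma integral_mFourier_neg (k : Fin n → ℤ) (hk : k ≠ 0) :
    ∫ y : UnitAddTorus (Fin n), UnitAddTorus.mFourier (-k) y = 0 := by
  -- In Parseval's identity for the constant 1 the zero mode already exhausts the norm, so the
  -- others vanish.
  have hp := parseval_torus (n := n) (f := fun _ => 1) (memLp_const 1)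
  simp only [norm_one, one_pow, ENNReal.ofReal_one, lintegral_const, measure_univ, mul_one] at hp
  rw [ENNReal.tsum_eq_add_tsum_ite 0] at hp
  have h0 : ∫ y : UnitAddTorus (Fin n), UnitAddTorus.mFourier (-0) y = 1 := by
    simp [UnitAddTorus.mFourier_zero]
  rw [h0, norm_one, one_pow, ENNReal.ofReal_one] at hp
  have h1 : ∑' k : Fin n → ℤ, (if k = 0 then 0 else
      ENNReal.ofReal (‖∫ y : UnitAddTorus (Fin n), UnitAddTorus.mFourier (-k) y‖ ^ 2)) = 0 :=
    (ENNReal.add_right_inj ENNReal.one_ne_top).1 (by rw [add_zero]; convert hp)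
  have h2 := ENNReal.tsum_eq_zero.1 h1 k
  rw [if_neg hk, ENNReal.ofReal_eq_zero] at h2
  have h3 : ‖∫ y : UnitAddTorus (Fin n), UnitAddTorus.mFourier (-k) y‖ = 0 := by
    nlinarith [norm_nonneg (∫ y : UnitAddTorus (Fin n), UnitAddTorus.mFourier (-k) y)]
  exact norm_eq_zero.1 h3

/-- A function of x alone has only the zero mode, and the weight |ξ|^{2s} is at most (1 + ξ²)² when
s ≤ 2. -/
lemma memHs_lift {s : ℝ} (hs0 : 0 < s) (hs : s ≤ 2) {v : ℝ → ℝ} (hv : MemLp v 2 volume)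
    (h : ∫⁻ ξ, ENNReal.ofReal ((1 + ξ ^ 2) ^ 2) * ENNReal.ofReal (‖ft (fun x => (v x : ℂ)) ξ‖ ^ 2) < ⊤) :
    MemHs s (fun w : Cyl n => v w.1) := by
  have hvC : MemLp (fun x => (v x : ℂ)) 2 volume := hv.ofReal
  have hm : ∀ k : Fin n → ℤ, fourierMode (fun w : Cyl n => v w.1) k =
      if k = 0 then fun x => (v x : ℂ) else 0 := by
    intro k
    funext x
    simp only [fourierMode]
    rw [integral_mul_const]
    split_ifs with hk
    · simp [hk, UnitAddTorus.mFourier_zero]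
    · rw [integral_mFourier_neg k hk, zero_mul]; rfl
  have hmem : ∀ k : Fin n → ℤ, MemLp (fourierMode (fun w : Cyl n => v w.1) k) 2 volume := by
    intro k
    rw [hm k]
    split_ifs
    · exact hvC
    · exact MemLp.zero
  refine ⟨memLp_lift hv, hmem, ?_⟩
  simp_rw [← ft_of_memLp (hmem _)]
  rw [tsum_eq_single 0]
  · rw [hm 0, if_pos rfl]
    refine lt_of_le_of_lt (lintegral_mono fun ξ => ?_) h
    rw [← ENNReal.ofReal_mul (by positivity)]
    refine ENNReal.ofReal_le_ofReal (mul_le_mul_of_nonneg_right ?_ (by positivity))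
    simp only [Pi.zero_apply, Int.cast_zero, ne_eq, OfNat.ofNat_ne_zero, not_false_eq_true, zero_pow,
      Finset.sum_const_zero, add_zero]
    calc (ξ ^ 2) ^ s ≤ (1 + ξ ^ 2) ^ s := Real.rpow_le_rpow (by positivity) (by linarith) hs0.le
      _ ≤ (1 + ξ ^ 2) ^ (2 : ℝ) := Real.rpow_le_rpow_of_exponent_le (by nlinarith [sq_nonneg ξ]) hs
      _ = _ := by norm_num
  · intro k hk
    rw [hm k, if_neg hk]
    have h0 : ft (0 : ℝ → ℂ) =ᵐ[volume] 0 := by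
      have := ft_sub hvC hvC
      simpa using! this
    rw [← lintegral_zero]
    refine lintegral_congr_ae ?_
    filter_upwards [h0] with ξ hξ
    rw [hξ]; simp

end

/-! ### The Poisson semigroup and supersolutions -/

section

open scoped ComplexConjugate SchwartzMap

/-- The Poisson kernel of the half plane at height `a / (2π)`. -/
def poisson (a x : ℝ) : ℝ := 2 * a / (a ^ 2 + (2 * Real.pi * x) ^ 2)

lemma continuous_poisson {a : ℝ} (ha : 0 < a) : Continuous (poisson a) := by
  unfold poisson
  exact continuous_const.div (by fun_prop) fun x => by positivity

lemma poisson_pos {a : ℝ} (ha : 0 < a) (x : ℝ) : 0 < poisson a x := by unfold poisson; positivity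

lemma integrable_exp_neg_abs {a : ℝ} (ha : 0 < a) : Integrable fun ξ : ℝ => Real.exp (-(a * |ξ|)) := by
  rw [← integrableOn_univ, ← Set.Iic_union_Ioi (a := (0 : ℝ))]
  refine IntegrableOn.union ?_ ?_
  · refine (integrableOn_exp_mul_Iic ha 0).congr_fun (fun ξ hξ => ?_) measurableSet_Iic
    dsimp only
    rw [abs_of_nonpos hξ, mul_neg, neg_neg]
  · refine (integrableOn_exp_mul_Ioi (neg_lt_zero.2 ha) 0).congr_fun (fun ξ hξ => ?_) measurableSet_Ioi
    dsimp only
    rw [abs_of_pos hξ, neg_mul]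

lemma fourierInv_exp_neg_abs {a : ℝ} (ha : 0 < a) (x : ℝ) :
    ∫ ξ, chr (-x) ξ * (Real.exp (-(a * |ξ|)) : ℂ) = poisson a x := by
  set b : ℂ := 2 * Real.pi * x * Complex.I with hb
  have hbre : b.re = 0 := by simp [hb]
  have hchr : ∀ ξ : ℝ, chr (-x) ξ = Complex.exp (b * ξ) := fun ξ => by
    rw [chr, Real.fourierChar_apply, hb]
    congr 1; push_cast; ring
  have hi : Integrable fun ξ : ℝ => chr (-x) ξ * (Real.exp (-(a * |ξ|)) : ℂ) := by
    refine (integrable_exp_neg_abs ha).mono' ((continuous_chr _).mul (by fun_prop)).aestronglyMeasurable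
      (Eventually.of_forall fun ξ => ?_)
    rw [norm_mul, norm_chr, one_mul, Complex.norm_real, Real.norm_eq_abs, abs_of_pos (Real.exp_pos _)]
  have h1 : 0 < (b + a).re := by simp [hbre, ha]
  have h2 : (b - a).re < 0 := by simp [hbre, ha]
  have h1' : b + a ≠ 0 := fun h => by rw [h] at h1; simp at h1
  have h2' : b - a ≠ 0 := fun h => by rw [h] at h2; simp at h2
  rw [← intervalIntegral.integral_Iic_add_Ioi (b := 0) hi.integrableOn hi.integrableOn,
    setIntegral_congr_fun (g := fun ξ : ℝ => Complex.exp ((b + a) * ξ)) measurableSet_Iic fun ξ hξ => ?_,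
    setIntegral_congr_fun (g := fun ξ : ℝ => Complex.exp ((b - a) * ξ)) measurableSet_Ioi fun ξ hξ => ?_,
    integral_exp_mul_complex_Iic h1, integral_exp_mul_complex_Ioi h2, poisson]
  · have h3 : (a : ℂ) ^ 2 + (2 * Real.pi * x) ^ 2 ≠ 0 := by
      have : 0 < a ^ 2 + (2 * Real.pi * x) ^ 2 := by positivity
      exact_mod_cast this.ne'
    have h4 : (b + a) * (b - a) = -((a : ℂ) ^ 2 + (2 * Real.pi * x) ^ 2) := by
      rw [hb]; linear_combination (2 * Real.pi * x : ℂ) ^ 2 * Complex.I_sq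
    simp only [Complex.ofReal_zero, mul_zero, Complex.exp_zero]
    rw [div_add_div _ _ h1' h2', h4]
    push_cast
    rw [div_neg, ← neg_div]
    congr 1; ring
  · dsimp only
    rw [hchr, abs_of_pos hξ, Complex.ofReal_exp, ← Complex.exp_add]
    congr 1; push_cast; ring
  · dsimp only
    rw [hchr, abs_of_nonpos hξ, Complex.ofReal_exp, ← Complex.exp_add]
    congr 1; push_cast; ring

lemma memLp_poisson {a : ℝ} (ha : 0 < a) (x : ℝ) : MemLp (fun y => poisson a (y - x)) 2 volume := by
  refine MemLp.comp_measurePreserving (g := poisson a) ?_ (measurePreserving_sub_right volume x)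
  refine memLp_inv_one_add_abs.of_le_mul (c := 4 / a + 2 * a) (continuous_poisson ha).aestronglyMeasurable
    (Eventually.of_forall fun y => ?_)
  rw [Real.norm_eq_abs, Real.norm_eq_abs, abs_of_pos (poisson_pos ha y), abs_of_pos (by positivity), poisson,
    ← div_eq_mul_inv, div_le_div_iff₀ (by positivity) (by positivity)]
  have h1 : 2 * a * (1 + |y|) ≤ 2 * a * (2 + y ^ 2) := by
    have : |y| ≤ 1 + y ^ 2 := by nlinarith [sq_nonneg (|y| - 1), sq_abs y, abs_nonneg y]
    exact mul_le_mul_of_nonneg_left (by linarith) (by positivity)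
  have h2 : y ^ 2 ≤ (2 * Real.pi * y) ^ 2 := by
    rw [mul_pow]
    exact le_mul_of_one_le_left (sq_nonneg y) (one_le_pow₀ (by linarith [Real.pi_gt_three]))
  calc _ ≤ 2 * a * (2 + y ^ 2) := h1
    _ = 4 / a * a ^ 2 + 2 * a * y ^ 2 := by field_simp; ring
    _ ≤ (4 / a + 2 * a) * a ^ 2 + (4 / a + 2 * a) * (2 * Real.pi * y) ^ 2 := by
        gcongr ?_ * _ + ?_ * ?_
        · linarith [ha]
        · have : 0 < 4 / a := by positivity
          linarith
    _ = _ := by ring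

/-- The Poisson semigroup on the Fourier side. -/
lemma integral_exp_mul_ft {f : ℝ → ℝ} (hf : MemLp f 2 volume) {a : ℝ} (ha : 0 < a) (x : ℝ) :
    ∫ ξ, chr (-x) ξ * (Real.exp (-(a * |ξ|)) : ℂ) * ft (fun y => (f y : ℂ)) ξ =
      ((∫ y, poisson a (y - x) * f y : ℝ) : ℂ) := by
  set G : ℝ → ℂ := fun ξ => chr x ξ * (Real.exp (-(a * |ξ|)) : ℂ) with hG
  have hGi : Integrable G := by
    refine (integrable_exp_neg_abs ha).mono' ?_ (Eventually.of_forall fun ξ => ?_)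
    · exact ((continuous_chr x).mul (by fun_prop)).aestronglyMeasurable
    · simp only [hG]
      rw [norm_mul, norm_chr, one_mul, Complex.norm_real, Real.norm_eq_abs, abs_of_pos (Real.exp_pos _)]
  have hinv : 𝓕⁻ G = fun y => (poisson a (y - x) : ℂ) := by
    funext y
    rw [fourierInv_apply, ← fourierInv_exp_neg_abs ha]
    refine integral_congr_ae (Eventually.of_forall fun ξ => ?_)
    simp only [hG]
    rw [← mul_assoc]
    congr 1
    simp only [chr, ← Circle.coe_mul, ← AddChar.map_add_eq_mul]
    congr 2
    ring
  have hP : MemLp (𝓕⁻ G) 2 volume := by rw [hinv]; exact (memLp_poisson ha x).ofReal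
  have hft := ft_fourierInv hGi hP
  have hfC : MemLp (fun y => (f y : ℂ)) 2 volume := hf.ofReal
  have key := integral_conj_ft_mul_ft hP hfC
  rw [← integral_complex_ofReal]
  calc _ = ∫ ξ, starRingEnd ℂ (ft (𝓕⁻ G) ξ) * ft (fun y => (f y : ℂ)) ξ := by
        refine integral_congr_ae ?_
        filter_upwards [hft] with ξ hξ
        rw [hξ]
        simp only [hG, map_mul, Complex.conj_ofReal]
        congr 2
        rw [chr, chr, ← Circle.coe_inv_eq_conj, ← AddChar.map_neg_eq_inv]
        congr 2
        ring
    _ = _ := by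
        rw [key, hinv]
        refine integral_congr_ae (Eventually.of_forall fun y => ?_)
        simp only [Complex.conj_ofReal]
        push_cast; rfl

/-- Supersolutions of `M + L` dominate their Poisson averages. -/
theorem poisson_le_of_supersolution {δ f : ℝ → ℝ} {M c : ℝ} (hM : 0 ≤ M) (hc : 0 < c)
    (hδ : MemLp δ 2 volume) (hf : MemLp f 2 volume) (hf0 : ∀ x, 0 ≤ f x)
    (hint : Integrable fun ξ => (1 + |ξ|) * ‖ft (fun x => (δ x : ℂ)) ξ‖)
    (heq : (fun ξ => ((M + c * |ξ| : ℝ) : ℂ) * ft (fun x => (δ x : ℂ)) ξ) =ᵐ[volume] ft fun x => (f x : ℂ))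
    (hinv : ∀ x, (δ x : ℂ) = 𝓕⁻ (ft fun x => (δ x : ℂ)) x) (x : ℝ) :
    Real.exp (-M) * ∫ y, poisson c (y - x) * δ y ≤ δ x := by
  set D : ℝ → ℂ := ft fun x => (δ x : ℂ) with hD
  set F : ℝ → ℂ := ft fun x => (f x : ℂ) with hF
  have hDm : AEStronglyMeasurable D volume := (measurable_ft _).aestronglyMeasurable
  have hFm : AEStronglyMeasurable F volume := (measurable_ft _).aestronglyMeasurable
  have hDi : Integrable D := integrable_of_one_add_abs_mul hDm hint
  have hFi : Integrable F := by
    refine Integrable.congr ?_ heq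
    refine ((hDi.const_mul (M : ℂ)).add ((integrable_abs_mul hDm hint).const_mul (c : ℂ))).congr
      (Eventually.of_forall fun ξ => ?_)
    simp only [Pi.add_apply]
    push_cast; ring
  have hcm := (continuous_chr (-x))
  -- the time integral of the semigroup applied to `f`
  have hprod : Integrable (fun p : ℝ × ℝ => chr (-x) p.2 * (Real.exp (-((M + c * |p.2|) * p.1)) : ℂ) * F p.2)
      ((volume.restrict (Set.Ioc 0 1)).prod volume) := by
    have h1 : Integrable (fun p : ℝ × ℝ => (1 : ℝ) * ‖F p.2‖) ((volume.restrict (Set.Ioc (0 : ℝ) 1)).prod volume) :=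
      Integrable.mul_prod (integrable_const _) hFi.norm
    refine h1.mono' ?_ ?_
    · refine AEStronglyMeasurable.mul ?_ ((measurable_ft _).comp measurable_snd).aestronglyMeasurable
      exact Continuous.aestronglyMeasurable ((hcm.comp continuous_snd).mul (by fun_prop))
    · have h2 : ∀ᵐ p : ℝ × ℝ ∂((volume.restrict (Set.Ioc (0 : ℝ) 1)).prod volume), p.1 ∈ Set.Ioc (0 : ℝ) 1 :=
        Measure.quasiMeasurePreserving_fst.ae (ae_restrict_mem measurableSet_Ioc)
      filter_upwards [h2] with p hp
      rw [norm_mul, norm_mul, norm_chr, Complex.norm_real, Real.norm_eq_abs, abs_of_pos (Real.exp_pos _), one_mul]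
      refine mul_le_mul_of_nonneg_right (Real.exp_le_one_iff.2 ?_) (norm_nonneg _)
      have := hp.1
      rw [neg_nonpos]; positivity
  have hsw := integral_integral_swap (μ := volume.restrict (Set.Ioc (0 : ℝ) 1)) (ν := volume)
    (f := fun t ξ => chr (-x) ξ * (Real.exp (-((M + c * |ξ|) * t)) : ℂ) * F ξ) hprod
  have hin : ∀ ξ : ℝ, ∫ t in Set.Ioc (0 : ℝ) 1, chr (-x) ξ * (Real.exp (-((M + c * |ξ|) * t)) : ℂ) * F ξ =
      chr (-x) ξ * ((∫ t in Set.Ioc (0 : ℝ) 1, Real.exp (-((M + c * |ξ|) * t)) : ℝ) : ℂ) * F ξ := by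
    intro ξ
    rw [integral_mul_const, integral_const_mul, integral_complex_ofReal]
  -- Stated without dividing by b, so the case b = 0 needs no separate treatment.
  have hexp : ∀ b : ℝ, b * ∫ t in Set.Ioc (0 : ℝ) 1, Real.exp (-(b * t)) = 1 - Real.exp (-b) := by
    intro b
    have hd : ∀ t : ℝ, HasDerivAt (fun t => -Real.exp (-(b * t))) (b * Real.exp (-(b * t))) t := fun t => by
      convert! ((((hasDerivAt_id t).const_mul b).neg).exp).neg using 1
      simp; ring
    rw [← integral_const_mul, ← intervalIntegral.integral_of_le zero_le_one,
      intervalIntegral.integral_eq_sub_of_hasDerivAt (fun t _ => hd t)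
        ((by fun_prop : Continuous fun t => b * Real.exp (-(b * t))).intervalIntegrable _ _)]
    simp; ring
  -- Duhamel on the Fourier side: with b = M + c|ξ| and F = bD, the time integral of e^{-bt}F is D -
  -- e^{-b}D, that is, δ minus its damped Poisson average.
  have hright : ∫ ξ, ∫ t in Set.Ioc (0 : ℝ) 1, chr (-x) ξ * (Real.exp (-((M + c * |ξ|) * t)) : ℂ) * F ξ =
      (δ x : ℂ) - ((Real.exp (-M) * ∫ y, poisson c (y - x) * δ y : ℝ) : ℂ) := by
    have h1 : ∫ ξ, ∫ t in Set.Ioc (0 : ℝ) 1, chr (-x) ξ * (Real.exp (-((M + c * |ξ|) * t)) : ℂ) * F ξ =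
        ∫ ξ, (chr (-x) ξ * D ξ - (Real.exp (-M) : ℂ) * (chr (-x) ξ * (Real.exp (-(c * |ξ|)) : ℂ) * D ξ)) := by
      refine integral_congr_ae ?_
      filter_upwards [heq] with ξ hξ
      rw [hin, ← hξ]
      have h2 : (((M + c * |ξ|) : ℝ) : ℂ) * ((∫ t in Set.Ioc (0 : ℝ) 1, Real.exp (-((M + c * |ξ|) * t)) : ℝ) : ℂ) =
          1 - (Real.exp (-M) : ℂ) * (Real.exp (-(c * |ξ|)) : ℂ) := by
        rw [← Complex.ofReal_mul, hexp, neg_add, Real.exp_add]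
        push_cast; ring
      linear_combination (chr (-x) ξ * D ξ) * h2
    have i1 : Integrable fun ξ => chr (-x) ξ * D ξ :=
      hDi.norm.mono' (hcm.aestronglyMeasurable.mul hDm) (Eventually.of_forall fun ξ => by
        rw [norm_mul, norm_chr, one_mul])
    have i2 : Integrable fun ξ => chr (-x) ξ * (Real.exp (-(c * |ξ|)) : ℂ) * D ξ :=
      hDi.norm.mono' (Continuous.aestronglyMeasurable (hcm.mul (by fun_prop)) |>.mul hDm) (Eventually.of_forall fun ξ => by
        rw [norm_mul, norm_mul, norm_chr, one_mul, Complex.norm_real, Real.norm_eq_abs, abs_of_pos (Real.exp_pos _)]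
        exact mul_le_of_le_one_left (norm_nonneg _) (Real.exp_le_one_iff.2 (by rw [neg_nonpos]; positivity)))
    rw [h1, integral_sub i1 (i2.const_mul _), integral_const_mul, integral_exp_mul_ft hδ hc, hinv x, fourierInv_apply]
    push_cast; rfl
  -- In physical space the same double integral superposes Poisson averages of f, nonnegative since
  -- the kernel and f are.
  have hleft : 0 ≤ (∫ t in Set.Ioc (0 : ℝ) 1, ∫ ξ, chr (-x) ξ * (Real.exp (-((M + c * |ξ|) * t)) : ℂ) * F ξ).re := by
    have h1 : ∫ t in Set.Ioc (0 : ℝ) 1, ∫ ξ, chr (-x) ξ * (Real.exp (-((M + c * |ξ|) * t)) : ℂ) * F ξ =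
        ((∫ t in Set.Ioc (0 : ℝ) 1, Real.exp (-(M * t)) * ∫ y, poisson (c * t) (y - x) * f y : ℝ) : ℂ) := by
      rw [← integral_complex_ofReal]
      refine setIntegral_congr_fun measurableSet_Ioc fun t ht => ?_
      rw [Complex.ofReal_mul, ← integral_exp_mul_ft hf (mul_pos hc ht.1), ← integral_const_mul]
      refine integral_congr_ae (Eventually.of_forall fun ξ => ?_)
      beta_reduce
      rw [show -((M + c * |ξ|) * t) = -(M * t) + -(c * t * |ξ|) by ring, Real.exp_add]
      push_cast; ring
    rw [h1, Complex.ofReal_re]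
    refine setIntegral_nonneg measurableSet_Ioc fun t ht => mul_nonneg (Real.exp_pos _).le
      (integral_nonneg fun y => mul_nonneg (poisson_pos (mul_pos hc ht.1) _).le (hf0 y))
  rw [hsw, hright, ← Complex.ofReal_sub, Complex.ofReal_re] at hleft
  linarith

end

/-! ### Strict monotonicity -/

section

open scoped ComplexConjugate SchwartzMap

lemma ft_add {f g : ℝ → ℂ} (hf : MemLp f 2 volume) (hg : MemLp g 2 volume) :
    ft (fun x => f x + g x) =ᵐ[volume] fun ξ => ft f ξ + ft g ξ := by
  have h := ft_sub hf (hg.const_mul (-1))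
  filter_upwards [h, ft_const_mul hg (-1)] with ξ h1 h2
  have e : (fun x => f x + g x) = fun x => f x - -1 * g x := by funext x; ring
  rw [e, h1, h2]; ring

lemma integrable_ft_smooth {ζ : ℝ → ℝ} (hζ : ContDiff ℝ ∞ ζ) (hs : HasCompactSupport ζ) :
    Integrable fun ξ => (1 + |ξ|) * ‖ft (fun x => (ζ x : ℂ)) ξ‖ := by
  set S := toSchwartz ζ hζ hs
  have h1 := ft_schwartz S
  have h2 : Integrable fun ξ : ℝ => ‖(𝓕 S) ξ‖ + ‖ξ‖ ^ 1 * ‖(𝓕 S) ξ‖ :=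
    (𝓕 S).integrable.norm.add ((𝓕 S).integrable_pow_mul volume 1)
  refine h2.congr ?_
  filter_upwards [h1] with ξ hξ
  have h3 : ft (fun x => (ζ x : ℂ)) ξ = (𝓕 S) ξ := by
    rw [SchwartzMap.fourier_coe, ← hξ]; rfl
  rw [h3, pow_one, Real.norm_eq_abs]; ring

variable {n : ℕ} {H : ℝ × (Fin n → ℝ) → ℝ} {γ η φ : ℝ → ℝ}

/-- The equation for the increments of a minimizing layer. -/
lemma IsMinimizer.symb_mul_ft_increment (h : IsMinimizer H γ η φ) (hH : IsKernel H) (hγ : IsDoubleWell γ)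
    (hη : IsProfile η) {t : ℝ} (ht : |t| ≤ 1) :
    MemLp (fun x => φ (x + t) - φ x) 2 volume ∧
    MemLp (fun x => deriv γ (φ (x + t)) - deriv γ (φ x)) 2 volume ∧
    (Integrable fun ξ => (1 + |ξ|) * ‖ft (fun x => ((φ (x + t) - φ x : ℝ) : ℂ)) ξ‖) ∧
    (fun ξ => ((symb (kerConst H) * |ξ| : ℝ) : ℂ) * ft (fun x => ((φ (x + t) - φ x : ℝ) : ℂ)) ξ) =ᵐ[volume]
      ft fun x => ((-(deriv γ (φ (x + t)) - deriv γ (φ x)) : ℝ) : ℂ) := by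
  have hmp := measurePreserving_add_right (volume : Measure ℝ) t
  have hv := h.memLp hη
  have hvt : MemLp (fun x => φ (x + t) - η (x + t)) 2 volume := hv.comp_measurePreserving hmp
  have hd := memLp_increment_profile hη ht
  have hs := h.memLp_source hH hγ hη
  have hst : MemLp (fun x => source H γ η φ (x + t)) 2 volume := hs.comp_measurePreserving hmp
  have hL := memLp_Lop_profile hH hη
  have hLt : MemLp (fun x => Lop (kerConst H) η (x + t)) 2 volume := hL.comp_measurePreserving hmp
  have hg := h.memLp_deriv hγ hη
  have hgt : MemLp (fun x => deriv γ (φ (x + t))) 2 volume := hg.comp_measurePreserving hmp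
  have hvC : MemLp (fun x => ((φ x - η x : ℝ) : ℂ)) 2 volume := hv.ofReal
  have hvtC : MemLp (fun x => ((φ (x + t) - η (x + t) : ℝ) : ℂ)) 2 volume := hvt.ofReal
  have hdC : MemLp (fun x => ((η (x + t) - η x : ℝ) : ℂ)) 2 volume := hd.ofReal
  have hsC : MemLp (fun x => (source H γ η φ x : ℂ)) 2 volume := hs.ofReal
  have hstC : MemLp (fun x => (source H γ η φ (x + t) : ℂ)) 2 volume := hst.ofReal
  have hLC : MemLp (fun x => ((Lop (kerConst H) η (x + t) - Lop (kerConst H) η x : ℝ) : ℂ)) 2 volume :=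
    (hLt.sub hL).ofReal
  -- φ has no L² transform, so its increment is written as that of φ - η plus that of η, each of
  -- which satisfies its own equation.
  have e1 : (fun x => ((φ (x + t) - φ x : ℝ) : ℂ)) = fun x => (((φ (x + t) - η (x + t) : ℝ) : ℂ) -
      ((φ x - η x : ℝ) : ℂ)) + ((η (x + t) - η x : ℝ) : ℂ) := by
    funext x; push_cast; ring
  have hdec : ft (fun x => ((φ (x + t) - φ x : ℝ) : ℂ)) =ᵐ[volume] fun ξ =>
      chr (-t) ξ * ft (fun x => ((φ x - η x : ℝ) : ℂ)) ξ - ft (fun x => ((φ x - η x : ℝ) : ℂ)) ξ +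
        ft (fun x => ((η (x + t) - η x : ℝ) : ℂ)) ξ := by
    have h3 := ft_comp_sub hvC (-t)
    simp only [sub_neg_eq_add] at h3
    rw [e1]
    filter_upwards [ft_add (f := fun x => ((φ (x + t) - η (x + t) : ℝ) : ℂ) - ((φ x - η x : ℝ) : ℂ)) (hvtC.sub hvC) hdC, ft_sub hvtC hvC, h3] with ξ h4 h5 h6
    rw [h4, h5, h6]
  refine ⟨?_, hgt.sub hg, ?_, ?_⟩
  · refine ((hvt.sub hv).add hd).ae_eq (Eventually.of_forall fun x => ?_)
    simp only [Pi.add_apply, Pi.sub_apply]; ring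
  · have i1 := integrable_one_add_abs_mul (measurable_ft _).aestronglyMeasurable (h.lintegral_ft_lt_top hH hγ hη)
    have hE : Integrable fun ξ => (1 + |ξ|) * ‖ft (fun x => ((η (x + t) - η x : ℝ) : ℂ)) ξ‖ := by
      have hη' := hη.smooth
      refine integrable_ft_smooth (by fun_prop) (HasCompactSupport.intro (isCompact_Icc (a := (-2 : ℝ)) (b := 2))
        fun x hx => hη.increment_eq_zero ht ?_)
      by_contra hcon
      exact hx (_root_.abs_le.1 (not_lt.1 hcon))
    refine ((i1.const_mul 2).add hE).mono' ?_ ?_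
    · exact (by fun_prop : Continuous fun ξ : ℝ => 1 + |ξ|).aestronglyMeasurable.mul
        (measurable_ft _).aestronglyMeasurable.norm
    · filter_upwards [hdec] with ξ hξ
      rw [Real.norm_eq_abs, abs_of_nonneg (by positivity), hξ]
      simp only [Pi.add_apply]
      have h7 := norm_add_le (chr (-t) ξ * ft (fun x => ((φ x - η x : ℝ) : ℂ)) ξ - ft (fun x => ((φ x - η x : ℝ) : ℂ)) ξ)
        (ft (fun x => ((η (x + t) - η x : ℝ) : ℂ)) ξ)
      have h8 := norm_sub_le (chr (-t) ξ * ft (fun x => ((φ x - η x : ℝ) : ℂ)) ξ) (ft (fun x => ((φ x - η x : ℝ) : ℂ)) ξ)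
      rw [norm_mul, norm_chr, one_mul] at h8
      calc _ ≤ (1 + |ξ|) * (2 * ‖ft (fun x => ((φ x - η x : ℝ) : ℂ)) ξ‖ +
            ‖ft (fun x => ((η (x + t) - η x : ℝ) : ℂ)) ξ‖) := by gcongr; linarith
        _ = _ := by ring
  · have e2 : (fun x => ((-(deriv γ (φ (x + t)) - deriv γ (φ x)) : ℝ) : ℂ)) = fun x =>
        ((source H γ η φ (x + t) : ℂ) - (source H γ η φ x : ℂ)) +
          ((Lop (kerConst H) η (x + t) - Lop (kerConst H) η x : ℝ) : ℂ) := by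
      funext x
      simp only [source]
      push_cast; ring
    have h3 := ft_comp_sub hsC (-t)
    simp only [sub_neg_eq_add] at h3
    rw [e2]
    filter_upwards [hdec, ft_add (f := fun x => (source H γ η φ (x + t) : ℂ) - (source H γ η φ x : ℂ)) (hstC.sub hsC) hLC, ft_sub hstC hsC, h3, h.symb_mul_ft hH hγ hη,
      PeierlsNabarro.symb_mul_ft_increment hH hη ht] with ξ h4 h5 h6 h7 h8 h9
    rw [h5, h6, h7, ← h8, ← h9, h4]
    ring

lemma IsMinimizer.differentiable (h : IsMinimizer H γ η φ) (hH : IsKernel H) (hγ : IsDoubleWell γ) (hη : IsProfile η)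
    (hinv : ∀ x, ((φ x - η x : ℝ) : ℂ) = 𝓕⁻ (ft fun x => ((φ x - η x : ℝ) : ℂ)) x) : Differentiable ℝ φ := by
  have h1 := differentiable_fourierInv (measurable_ft _).aestronglyMeasurable
    (integrable_one_add_abs_mul (measurable_ft _).aestronglyMeasurable (h.lintegral_ft_lt_top hH hγ hη))
  have h2 : φ = fun x => η x + Complex.reCLM (𝓕⁻ (ft fun x => ((φ x - η x : ℝ) : ℂ)) x) := by
    funext x
    rw [← hinv x, Complex.reCLM_apply, Complex.ofReal_re]; ring
  rw [h2]
  exact (hη.smooth.differentiable (by simp)).add (Complex.reCLM.differentiable.comp h1)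

lemma tendsto_sub_profile
    (hinv : ∀ x, ((φ x - η x : ℝ) : ℂ) = 𝓕⁻ (ft fun x => ((φ x - η x : ℝ) : ℂ)) x) :
    Tendsto (fun x => φ x - η x) (cocompact ℝ) (𝓝 0) := by
  have h1 := tendsto_fourierInv (ft fun x => ((φ x - η x : ℝ) : ℂ))
  have h2 := (Complex.continuous_re.tendsto 0).comp h1
  refine h2.congr fun x => ?_
  simp only [Function.comp]
  rw [← hinv x, Complex.ofReal_re]

lemma tendsto_layer_atTop (hη : IsProfile η)
    (hinv : ∀ x, ((φ x - η x : ℝ) : ℂ) = 𝓕⁻ (ft fun x => ((φ x - η x : ℝ) : ℂ)) x) :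
    Tendsto φ atTop (𝓝 1) := by
  have h1 := ((tendsto_sub_profile hinv).mono_left atTop_le_cocompact).add_const 1
  rw [zero_add] at h1
  refine h1.congr' ?_
  filter_upwards [eventually_ge_atTop 1] with x hx
  rw [hη.eq_one x hx]; ring

lemma tendsto_layer_atBot (hη : IsProfile η)
    (hinv : ∀ x, ((φ x - η x : ℝ) : ℂ) = 𝓕⁻ (ft fun x => ((φ x - η x : ℝ) : ℂ)) x) :
    Tendsto φ atBot (𝓝 (-1)) := by
  have h1 := ((tendsto_sub_profile hinv).mono_left atBot_le_cocompact).add_const (-1)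
  rw [zero_add] at h1
  refine h1.congr' ?_
  filter_upwards [eventually_le_atBot (-1)] with x hx
  rw [hη.eq_neg_one x hx]; ring

/-- The integral telescopes to that of φ over [A, A+t] minus that over [-A, -A+t]; monotonicity
bounds each. -/
lemma IsLayer.mul_le_integral_increment (h : IsLayer φ) {A t : ℝ} (hA : 0 ≤ A) (ht : 0 ≤ t) :
    t * (φ A - φ (-A + t)) ≤ ∫ y in Set.Icc (-A) A, (φ (y + t) - φ y) := by
  have hi : ∀ a b, IntervalIntegrable φ volume a b := fun a b => h.mono.intervalIntegrable
  have hmt : Monotone fun y => φ (y + t) := fun a b hab => h.mono (by linarith)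
  rw [integral_Icc_eq_integral_Ioc, ← intervalIntegral.integral_of_le (by linarith),
    intervalIntegral.integral_sub hmt.intervalIntegrable (hi _ _), intervalIntegral.integral_comp_add_right,
    intervalIntegral.integral_interval_sub_interval_comm' (hi _ _) (hi _ _) (hi _ _)]
  have h1 : t * φ A ≤ ∫ x in A..(A + t), φ x := by
    have := intervalIntegral.integral_mono_on (a := A) (b := A + t) (f := fun _ => φ A) (g := φ) (by linarith)
      intervalIntegrable_const (hi _ _) fun x hx => h.mono hx.1
    rwa [intervalIntegral.integral_const, add_sub_cancel_left, smul_eq_mul] at this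
  have h2 : ∫ x in (-A)..(-A + t), φ x ≤ t * φ (-A + t) := by
    have := intervalIntegral.integral_mono_on (a := -A) (b := -A + t) (f := φ) (g := fun _ => φ (-A + t)) (by linarith)
      (hi _ _) intervalIntegrable_const fun x hx => h.mono hx.2
    rwa [intervalIntegral.integral_const, add_sub_cancel_left, smul_eq_mul] at this
  linarith

/-- The minimizing layer is strictly increasing, with positive derivative. -/
theorem IsMinimizer.deriv_pos (h : IsMinimizer H γ η φ) (hH : IsKernel H) (hγ : IsDoubleWell γ) (hη : IsProfile η)
    (hinv : ∀ x, ((φ x - η x : ℝ) : ℂ) = 𝓕⁻ (ft fun x => ((φ x - η x : ℝ) : ℂ)) x) (x : ℝ) :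
    0 < deriv φ x := by
  have hdiff := h.differentiable hH hγ hη hinv
  have hc : 0 < symb (kerConst H) := symb_pos hH.kerConst_pos hH.finiteMoment
  set c := symb (kerConst H)
  obtain ⟨M, hM, hMt⟩ := hγ.exists_taylor 1
  -- The limits ±1 provide a window across which φ rises by at least 1/2, for all steps t ≤ 1
  -- simultaneously.
  obtain ⟨A, hA0, hA1, hA2⟩ : ∃ A : ℝ, 0 ≤ A ∧ 1 / 2 < φ A ∧ φ (-A + 1) < 0 := by
    have h1 := (tendsto_layer_atTop hη hinv).eventually (lt_mem_nhds (by norm_num : (1 / 2 : ℝ) < 1))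
    have h2 : Tendsto (fun A : ℝ => φ (-A + 1)) atTop (𝓝 (-1)) :=
      (tendsto_layer_atBot hη hinv).comp (tendsto_atBot_add_const_right _ _ tendsto_neg_atTop_atBot)
    obtain ⟨A, hA⟩ := ((eventually_ge_atTop (0 : ℝ)).and
      (h1.and (h2.eventually (gt_mem_nhds (by norm_num : (-1 : ℝ) < 0))))).exists
    exact ⟨A, hA.1, hA.2.1, hA.2.2⟩
  obtain ⟨y₀, -, hy₀⟩ := (isCompact_Icc (a := -A) (b := A)).exists_isMinOn ⟨0, by constructor <;> linarith⟩
    (f := fun y => poisson c (y - x)) ((continuous_poisson hc).comp (by fun_prop)).continuousOn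
  set m := poisson c (y₀ - x)
  have hm : 0 < m := poisson_pos hc _
  have hbound : ∀ t : ℝ, 0 < t → t ≤ 1 → Real.exp (-M) * (m * (t * (1 / 2))) ≤ φ (x + t) - φ x := by
    intro t ht ht1
    obtain ⟨hδ, hγδ, hint, heq⟩ := h.symb_mul_ft_increment hH hγ hη (t := t) (by rwa [abs_of_pos ht])
    have hδ0 : ∀ y, 0 ≤ φ (y + t) - φ y := fun y => sub_nonneg.2 (h.layer.mono (by linarith))
    have hδC : MemLp (fun y => ((φ (y + t) - φ y : ℝ) : ℂ)) 2 volume := hδ.ofReal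
    have hf : MemLp (fun y => M * (φ (y + t) - φ y) + -(deriv γ (φ (y + t)) - deriv γ (φ y))) 2 volume :=
      (hδ.const_mul M).add hγδ.neg
    have hgC : MemLp (fun y => ((-(deriv γ (φ (y + t)) - deriv γ (φ y)) : ℝ) : ℂ)) 2 volume := hγδ.neg.ofReal
    -- The right-hand side Mδ - (γ'(φ(·+t)) - γ'(φ)) is nonnegative because M is a Lipschitz
    -- constant of γ' on [-1,1] and δ ≥ 0.
    have hsup := poisson_le_of_supersolution (δ := fun y => φ (y + t) - φ y) hM hc hδ hf (fun y => ?_) hint ?_ ?_ x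
    · refine le_trans ?_ hsup
      refine mul_le_mul_of_nonneg_left ?_ (Real.exp_pos _).le
      have hPi : Integrable fun y => poisson c (y - x) * (φ (y + t) - φ y) := (memLp_poisson hc x).integrable_mul hδ
      have hδi : IntegrableOn (fun y => φ (y + t) - φ y) (Set.Icc (-A) A) :=
        (hδ.locallyIntegrable (by norm_num)).integrableOn_isCompact isCompact_Icc
      calc m * (t * (1 / 2)) ≤ m * (t * (φ A - φ (-A + t))) := by
            have : φ (-A + t) ≤ φ (-A + 1) := h.layer.mono (by linarith)
            gcongr; linarith
        _ ≤ m * ∫ y in Set.Icc (-A) A, (φ (y + t) - φ y) := by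
            gcongr; exact h.layer.mul_le_integral_increment hA0 ht.le
        _ = ∫ y in Set.Icc (-A) A, m * (φ (y + t) - φ y) := (integral_const_mul _ _).symm
        _ ≤ ∫ y in Set.Icc (-A) A, poisson c (y - x) * (φ (y + t) - φ y) :=
            setIntegral_mono_on (hδi.const_mul m) hPi.integrableOn measurableSet_Icc fun y hy =>
              mul_le_mul_of_nonneg_right (hy₀ hy) (hδ0 y)
        _ ≤ _ := setIntegral_le_integral hPi (Eventually.of_forall fun y => mul_nonneg (poisson_pos hc _).le (hδ0 y))
    · have h1 := (hMt (φ y) ⟨h.layer.ge y, h.layer.le y⟩ (φ (y + t)) ⟨h.layer.ge _, h.layer.le _⟩).1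
      rw [abs_of_nonneg (hδ0 y)] at h1
      linarith [le_abs_self (deriv γ (φ (y + t)) - deriv γ (φ y))]
    · have e : (fun y => ((M * (φ (y + t) - φ y) + -(deriv γ (φ (y + t)) - deriv γ (φ y)) : ℝ) : ℂ)) =
          fun y => (M : ℂ) * ((φ (y + t) - φ y : ℝ) : ℂ) + ((-(deriv γ (φ (y + t)) - deriv γ (φ y)) : ℝ) : ℂ) := by
        funext y; push_cast; ring
      rw [e]
      filter_upwards [heq, ft_add (hδC.const_mul (M : ℂ)) hgC, ft_const_mul hδC (M : ℂ)] with ξ h1 h2 h3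
      rw [h2, h3, ← h1]
      push_cast; ring
    · have hDi := integrable_of_one_add_abs_mul (measurable_ft _).aestronglyMeasurable hint
      have hφc := hdiff.continuous
      have hcont : Continuous fun y => ((φ (y + t) - φ y : ℝ) : ℂ) := by fun_prop
      exact congrFun (((continuous_fourierInv hDi).ae_eq_iff_eq volume hcont).1 (ae_eq_fourierInv_ft hδC hDi).symm).symm
  have hslope := (hasDerivAt_iff_tendsto_slope_zero.1 (hdiff x).hasDerivAt).mono_left
    (nhdsWithin_mono 0 (fun t (ht : 0 < t) => ht.ne') : 𝓝[>] (0 : ℝ) ≤ 𝓝[≠] 0)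
  -- The bound is linear in t with a constant independent of t, so it survives division by t in the
  -- limit.
  have hκ : 0 < Real.exp (-M) * (m * (1 / 2)) := by positivity
  refine lt_of_lt_of_le hκ (ge_of_tendsto hslope ?_)
  filter_upwards [Ioc_mem_nhdsGT (zero_lt_one' ℝ)] with t ht
  rw [smul_eq_mul, inv_mul_eq_div, le_div_iff₀ ht.1]
  refine le_trans (le_of_eq ?_) (hbound t ht.1 ht.2)
  ring

end

/-! ### Principal values and the pointwise equation -/

section

open scoped ComplexConjugate SchwartzMap

section PrincipalValue

variable {n : ℕ} {H : ℝ × (Fin n → ℝ) → ℝ}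

lemma isNegInvariant_cylMeas (hH : IsKernel H) : (cylMeas H).IsNegInvariant := by
  refine ⟨Measure.ext_of_lintegral _ fun f hf => ?_⟩
  have hk := hH.aemeasurable_kernel.ennreal_ofReal
  have hfn : Measurable fun w => f (-w) := hf.comp measurable_neg
  rw [Measure.neg_def, lintegral_map hf measurable_neg, cylMeas,
    lintegral_withDensity_eq_lintegral_mul₀ hk hfn.aemeasurable,
    lintegral_withDensity_eq_lintegral_mul₀ hk hf.aemeasurable,
    ← (Measure.measurePreserving_neg (volume : Measure (Cyl n))).lintegral_comp_emb
      (MeasurableEquiv.neg (Cyl n)).measurableEmbedding]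
  refine lintegral_congr fun w => ?_
  simp only [Pi.mul_apply, hH.kernel_neg, neg_neg]

lemma restrict_cylMeas (hH : IsKernel H) {T : Set (Cyl n)} (hT : MeasurableSet T) :
    (cylMeas H).restrict T = (volume.restrict T).withDensity (kernelE H) := by
  rw [hH.cylMeas_eq, restrict_withDensity hT]

lemma integrableOn_mul_kernel_iff (hH : IsKernel H) (g : Cyl n → ℝ) {T : Set (Cyl n)} (hT : MeasurableSet T) :
    IntegrableOn (fun z => g z * kernel H z) T ↔ IntegrableOn g T (cylMeas H) := by
  have hk : ∀ᵐ z ∂(volume : Measure (Cyl n)).restrict T, 0 ≤ kernel H z ∧ ENNReal.ofReal (kernel H z) = kernelE H z :=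
    ae_restrict_of_ae hH.kernel_ae
  rw [IntegrableOn, IntegrableOn, restrict_cylMeas hH hT,
    integrable_withDensity_iff_integrable_smul' hH.measurable_kernelE
      (hk.mono fun z hz => by rw [← hz.2]; exact ENNReal.ofReal_lt_top)]
  refine integrable_congr ?_
  filter_upwards [hk] with z hz
  rw [smul_eq_mul, ← hz.2, ENNReal.toReal_ofReal hz.1, mul_comm]

lemma setIntegral_mul_kernel (hH : IsKernel H) (g : Cyl n → ℝ) {T : Set (Cyl n)} (hT : MeasurableSet T) :
    ∫ z in T, g z * kernel H z = ∫ z in T, g z ∂cylMeas H := by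
  have hk : ∀ᵐ z ∂(volume : Measure (Cyl n)).restrict T, 0 ≤ kernel H z ∧ ENNReal.ofReal (kernel H z) = kernelE H z :=
    ae_restrict_of_ae hH.kernel_ae
  rw [restrict_cylMeas hH hT, integral_withDensity_eq_integral_toReal_smul₀ hH.measurable_kernelE.aemeasurable
      (hk.mono fun z hz => by rw [← hz.2]; exact ENNReal.ofReal_lt_top)]
  refine integral_congr_ae ?_
  filter_upwards [hk] with z hz
  rw [smul_eq_mul, ← hz.2, ENNReal.toReal_ofReal hz.1, mul_comm]

lemma sqDist_sub (w w' : Cyl n) : sqDist (w - w') 0 = sqDist w w' := by simp [sqDist]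

lemma sqDist_neg (z : Cyl n) : sqDist (-z) 0 = sqDist z 0 := by simp [sqDist]

lemma measurable_sqDist_zero : Measurable fun z : Cyl n => sqDist z 0 := by
  unfold sqDist
  fun_prop

lemma sqDist_proj_le (z : ℝ × (Fin n → ℝ)) : sqDist (proj z) 0 ≤ (n + 1) * ‖z‖ ^ 2 := by
  have h1 : z.1 ^ 2 ≤ ‖z‖ ^ 2 := by
    rw [← sq_abs z.1, ← Real.norm_eq_abs]
    exact pow_le_pow_left₀ (norm_nonneg _) (norm_fst_le z) 2
  have h2 : ∀ i ∈ Finset.univ, ‖(z.2 i : UnitAddCircle)‖ ^ 2 ≤ ‖z‖ ^ 2 := fun i _ => by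
    refine pow_le_pow_left₀ (norm_nonneg _) ?_ 2
    refine (QuotientAddGroup.norm_mk_le_norm (S := AddSubgroup.zmultiples (1 : ℝ)) (m := z.2 i)).trans ?_
    exact (norm_le_pi_norm z.2 i).trans (norm_snd_le z)
  have h3 := Finset.sum_le_card_nsmul _ _ _ h2
  simp only [Finset.card_univ, Fintype.card_fin, nsmul_eq_mul] at h3
  simp only [sqDist, proj, Prod.fst_zero, Prod.snd_zero, sub_zero, Pi.zero_apply]
  linarith

/-- Markov's inequality for min(1, ‖z‖²): outside a neighbourhood of the origin of the cylinder
every lift z has norm bounded below. -/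
lemma cylMeas_lt_top (hH : IsKernel H) {ε : ℝ} (hε : 0 < ε) : cylMeas H {z | ε ^ 2 < sqDist z 0} < ⊤ := by
  have hT : MeasurableSet {z : Cyl n | ε ^ 2 < sqDist z 0} := measurableSet_lt measurable_const measurable_sqDist_zero
  set m : ℝ := min 1 (ε ^ 2 / (n + 1)) with hm
  have hm0 : 0 < m := by rw [hm]; positivity
  rw [← hH.map_proj, Measure.map_apply measurable_proj hT]
  have hsub : proj ⁻¹' {z : Cyl n | ε ^ 2 < sqDist z 0} ⊆
      {z : ℝ × (Fin n → ℝ) | ENNReal.ofReal m ≤ ENNReal.ofReal (min 1 (‖z‖ ^ 2))} := by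
    intro z hz
    refine ENNReal.ofReal_le_ofReal (min_le_min le_rfl ?_)
    rw [div_le_iff₀ (by positivity), mul_comm]
    exact (le_of_lt hz).trans (sqDist_proj_le z)
  refine (measure_mono hsub).trans_lt ?_
  refine (meas_ge_le_lintegral_div (by fun_prop) (by simpa using hm0) ENNReal.ofReal_ne_top).trans_lt ?_
  exact ENNReal.div_lt_top hH.lintegral_min_lt_top.ne (by simpa using hm0)

/-- Principal values of functions of the first variable are integrals of second differences. -/
theorem hasPVAt_lift (hH : IsKernel H) {φ : ℝ → ℝ} (hφ : Measurable φ) (hb : ∀ x, |φ x| ≤ 1) (w : Cyl n)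
    (hi : Integrable (fun z => 2 * φ w.1 - φ (w.1 + z) - φ (w.1 - z)) (lineMeas (kerConst H))) :
    HasPVAt H (fun w' => φ w'.1) w
      (1 / 2 * ∫ z, (2 * φ w.1 - φ (w.1 + z) - φ (w.1 - z)) ∂lineMeas (kerConst H)) := by
  have := isNegInvariant_cylMeas hH
  set g : Cyl n → ℝ := fun z => φ w.1 - φ (w.1 - z.1) with hg
  set G : Cyl n → ℝ := fun z => 2 * φ w.1 - φ (w.1 + z.1) - φ (w.1 - z.1) with hG
  have hgm : Measurable g := by fun_prop
  have hT : ∀ ε : ℝ, MeasurableSet {z : Cyl n | ε ^ 2 < sqDist z 0} := fun ε =>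
    measurableSet_lt measurable_const measurable_sqDist_zero
  have hmp := Measure.measurePreserving_sub_left (volume : Measure (Cyl n)) w
  have hpre : ∀ ε : ℝ, {w' | ε ^ 2 < sqDist w w'} = (fun w' => w - w') ⁻¹' {z | ε ^ 2 < sqDist z 0} := fun ε => by
    ext w'
    rw [Set.mem_preimage, Set.mem_ofPred_eq, Set.mem_ofPred_eq, sqDist_sub]
  have hfun : (fun w' : Cyl n => (φ w.1 - φ w'.1) * kernel H (w - w')) =
      (fun z => g z * kernel H z) ∘ fun w' => w - w' := by
    funext w'
    simp [hg]
  have hgi : ∀ ε : ℝ, 0 < ε → IntegrableOn g {z | ε ^ 2 < sqDist z 0} (cylMeas H) := fun ε hε => by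
    refine IntegrableOn.of_bound (cylMeas_lt_top hH hε) hgm.aestronglyMeasurable 2 (Eventually.of_forall fun z => ?_)
    rw [Real.norm_eq_abs]
    have h1 := abs_sub (φ w.1) (φ (w.1 - z.1))
    linarith [hb w.1, hb (w.1 - z.1)]
  have hGi : Integrable G (cylMeas H) := by
    rw [← hH.map_fst] at hi
    exact hi.comp_measurable measurable_fst
  -- The kernel and the truncation are even, so averaging over z and -z replaces first differences
  -- by second ones, which are integrable up to the singularity.
  have hsym : ∀ ε : ℝ, 0 < ε → ∫ z in {z | ε ^ 2 < sqDist z 0}, g z ∂cylMeas H =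
      1 / 2 * ∫ z in {z | ε ^ 2 < sqDist z 0}, G z ∂cylMeas H := by
    intro ε hε
    have hneg : (Neg.neg : Cyl n → Cyl n) ⁻¹' {z | ε ^ 2 < sqDist z 0} = {z | ε ^ 2 < sqDist z 0} := by
      ext z
      rw [Set.mem_preimage, Set.mem_ofPred_eq, Set.mem_ofPred_eq, sqDist_neg]
    have hmn := Measure.measurePreserving_neg (cylMeas H)
    have h1 := hmn.setIntegral_preimage_emb (MeasurableEquiv.neg (Cyl n)).measurableEmbedding g
      {z | ε ^ 2 < sqDist z 0}
    rw [hneg] at h1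
    have h2 : IntegrableOn (fun z => g (-z)) {z | ε ^ 2 < sqDist z 0} (cylMeas H) := by
      have := (hmn.integrableOn_comp_preimage (MeasurableEquiv.neg (Cyl n)).measurableEmbedding).2 (hgi ε hε)
      rwa [hneg] at this
    have h3 : ∫ z in {z | ε ^ 2 < sqDist z 0}, G z ∂cylMeas H =
        (∫ z in {z | ε ^ 2 < sqDist z 0}, g z ∂cylMeas H) + ∫ z in {z | ε ^ 2 < sqDist z 0}, g (-z) ∂cylMeas H := by
      rw [← integral_add (hgi ε hε) h2]
      refine integral_congr_ae (Eventually.of_forall fun z => ?_)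
      simp only [hG, hg, Prod.fst_neg, sub_neg_eq_add]
      ring
    rw [h3, h1]; ring
  refine ⟨fun ε hε => ?_, ?_⟩
  · rw [hpre, hfun, hmp.integrableOn_comp_preimage (MeasurableEquiv.subLeft w).measurableEmbedding,
      integrableOn_mul_kernel_iff hH g (hT ε)]
    exact hgi ε hε
  · have hGm : Measurable fun z : ℝ => 2 * φ w.1 - φ (w.1 + z) - φ (w.1 - z) := by fun_prop
    rw [← hH.integral_fst hGm]
    -- Dominated convergence: a point with z₁ ≠ 0 lies outside the excised ball as soon as ε < |z₁|.
    have hlim : Tendsto (fun ε : ℝ => ∫ z in {z | ε ^ 2 < sqDist z 0}, G z ∂cylMeas H) (𝓝[>] 0)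
        (𝓝 (∫ z, G z ∂cylMeas H)) := by
      simp_rw [← fun ε => integral_indicator (μ := cylMeas H) (f := G) (hT ε)]
      refine tendsto_integral_filter_of_dominated_convergence (fun z => ‖G z‖)
        (Eventually.of_forall fun ε => hGi.aestronglyMeasurable.indicator (hT ε))
        (Eventually.of_forall fun ε => Eventually.of_forall fun z => norm_indicator_le_norm_self _ _) hGi.norm ?_
      have h0 : ∀ᵐ z ∂cylMeas H, z.1 ≠ 0 :=
        (withDensity_absolutelyContinuous _ _).ae_le (Measure.quasiMeasurePreserving_fst.ae (Measure.ae_ne volume 0))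
      filter_upwards [h0] with z hz
      refine tendsto_const_nhds.congr' ?_
      filter_upwards [Ioo_mem_nhdsGT (abs_pos.2 hz)] with ε hε
      rw [Set.indicator_of_mem]
      have h1 : ε ^ 2 < z.1 ^ 2 := by
        rw [← sq_abs z.1]
        exact pow_lt_pow_left₀ hε.2 hε.1.le two_ne_zero
      refine h1.trans_le ?_
      simp only [sqDist, Prod.fst_zero, sub_zero]
      have : 0 ≤ ∑ i, ‖z.2 i - (0 : Cyl n).2 i‖ ^ 2 := Finset.sum_nonneg fun i _ => by positivity
      linarith
    refine (hlim.const_mul (1 / 2)).congr' ?_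
    filter_upwards [self_mem_nhdsWithin] with ε hε
    rw [← hsym ε hε, ← setIntegral_mul_kernel hH g (hT ε), hpre, hfun]
    exact (hmp.setIntegral_preimage_emb (MeasurableEquiv.subLeft w).measurableEmbedding _ _).symm

end PrincipalValue

/-- Second differences of a function whose Fourier transform has an integrable first moment. -/
lemma integral_second_difference {c : ℝ} (hc : FiniteMoment c) {V : ℝ → ℂ} (hm : Measurable V)
    (hV : Integrable fun ξ => (1 + |ξ|) * ‖V ξ‖) (x : ℝ) :
    Integrable (fun z => 2 * 𝓕⁻ V x - 𝓕⁻ V (x + z) - 𝓕⁻ V (x - z)) (lineMeas c) ∧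
    ∫ z, (2 * 𝓕⁻ V x - 𝓕⁻ V (x + z) - 𝓕⁻ V (x - z)) ∂lineMeas c =
      2 * 𝓕⁻ (fun ξ => ((symb c * |ξ| : ℝ) : ℂ) * V ξ) x := by
  have hVi := integrable_of_one_add_abs_mul hm.aestronglyMeasurable hV
  have hVa := integrable_abs_mul hm.aestronglyMeasurable hV
  have hchr : ∀ y, Integrable fun ξ => chr y ξ * V ξ := fun y =>
    hVi.norm.mono' ((continuous_chr y).aestronglyMeasurable.mul hm.aestronglyMeasurable)
      (Eventually.of_forall fun ξ => by rw [norm_mul, norm_chr, one_mul])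
  have hadd : ∀ a b ξ, chr (a + b) ξ = chr a ξ * chr b ξ := fun a b ξ => by
    simp only [chr, ← Circle.coe_mul, ← AddChar.map_add_eq_mul]
    congr 2; ring
  have hsq : ∀ z ξ, ((‖1 - chr z ξ‖ ^ 2 : ℝ) : ℂ) = 2 - chr (-z) ξ - chr z ξ := fun z ξ => by
    have h1 : chr (-z) ξ = conj (chr z ξ) := by
      rw [chr, chr, ← Circle.coe_inv_eq_conj, ← AddChar.map_neg_eq_inv]
      congr 2; ring
    have h2 : chr z ξ * conj (chr z ξ) = 1 := by
      rw [Complex.mul_conj, Complex.normSq_eq_norm_sq, norm_chr]; simp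
    rw [← Complex.normSq_eq_norm_sq, ← Complex.mul_conj, map_sub, map_one, h1]
    linear_combination h2
  -- A second difference multiplies the transform by 2 - e^{iθ} - e^{-iθ} = |1 - e^{iθ}|², the
  -- integrand that defines the symbol.
  have hF : ∀ z, 2 * 𝓕⁻ V x - 𝓕⁻ V (x + z) - 𝓕⁻ V (x - z) =
      ∫ ξ, ((‖1 - chr z ξ‖ ^ 2 : ℝ) : ℂ) * (chr (-x) ξ * V ξ) := fun z => by
    rw [fourierInv_apply, fourierInv_apply, fourierInv_apply, ← integral_const_mul,
      ← integral_sub ((hchr _).const_mul 2) (hchr _),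
      ← integral_sub (f := fun ξ => 2 * (chr (-x) ξ * V ξ) - chr (-(x + z)) ξ * V ξ)
        (((hchr _).const_mul 2).sub (hchr _)) (hchr _)]
    refine integral_congr_ae (Eventually.of_forall fun ξ => ?_)
    dsimp only
    rw [hsq, show -(x + z) = -x + -z by ring, show -(x - z) = -x + z by ring, hadd, hadd]
    ring
  have hcm := continuous_chr_uncurry.measurable
  have hm1 : Measurable fun p : ℝ × ℝ => ((‖1 - chr p.1 p.2‖ ^ 2 : ℝ) : ℂ) :=
    Complex.measurable_ofReal.comp ((measurable_const.sub hcm).norm.pow_const 2)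
  have hm2 : Measurable fun p : ℝ × ℝ => chr (-x) p.2 * V p.2 :=
    ((continuous_chr (-x)).measurable.comp measurable_snd).mul (hm.comp measurable_snd)
  have hprod : Integrable (fun p : ℝ × ℝ => ((‖1 - chr p.1 p.2‖ ^ 2 : ℝ) : ℂ) * (chr (-x) p.2 * V p.2))
      ((lineMeas c).prod volume) := by
    have hm3 : Measurable fun p : ℝ × ℝ => ((‖1 - chr p.1 p.2‖ ^ 2 : ℝ) : ℂ) * (chr (-x) p.2 * V p.2) := hm1.mul hm2
    refine (integrable_prod_iff' hm3.aestronglyMeasurable).2 ⟨Eventually.of_forall fun ξ => ?_, ?_⟩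
    · have h1 : Integrable (fun z => ((‖1 - chr z ξ‖ ^ 2 : ℝ) : ℂ)) (lineMeas c) := (integrable_chr hc ξ).ofReal
      exact h1.mul_const (chr (-x) ξ * V ξ)
    refine ((hVa.norm).const_mul (2 * symb c)).congr (Eventually.of_forall fun ξ => ?_)
    dsimp only
    have e : ∀ z, ‖((‖1 - chr z ξ‖ ^ 2 : ℝ) : ℂ) * (chr (-x) ξ * V ξ)‖ = ‖1 - chr z ξ‖ ^ 2 * ‖V ξ‖ := fun z => by
      rw [norm_mul, norm_mul, norm_chr, one_mul, Complex.norm_real, Real.norm_of_nonneg (by positivity)]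
    simp_rw [e]
    rw [integral_mul_const, integral_chr hc, norm_mul, Complex.norm_real, Real.norm_eq_abs, abs_abs]
    ring
  simp_rw [hF]
  refine ⟨hprod.integral_prod_left, ?_⟩
  rw [integral_integral_swap (f := fun z ξ => ((‖1 - chr z ξ‖ ^ 2 : ℝ) : ℂ) * (chr (-x) ξ * V ξ)) hprod,
    fourierInv_apply, ← integral_const_mul]
  refine integral_congr_ae (Eventually.of_forall fun ξ => ?_)
  dsimp only
  rw [integral_mul_const, integral_complex_ofReal, integral_chr hc]
  push_cast; ring

variable {n : ℕ} {H : ℝ × (Fin n → ℝ) → ℝ} {γ η φ : ℝ → ℝ}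

/-- The minimizing layer solves the one-dimensional equation almost everywhere. -/
theorem IsMinimizer.ae_integral_second_difference (h : IsMinimizer H γ η φ) (hH : IsKernel H) (hγ : IsDoubleWell γ)
    (hη : IsProfile η) (hinv : ∀ x, ((φ x - η x : ℝ) : ℂ) = 𝓕⁻ (ft fun x => ((φ x - η x : ℝ) : ℂ)) x) :
    ∀ᵐ x, Integrable (fun z => 2 * φ x - φ (x + z) - φ (x - z)) (lineMeas (kerConst H)) ∧
      1 / 2 * ∫ z, (2 * φ x - φ (x + z) - φ (x - z)) ∂lineMeas (kerConst H) = -deriv γ (φ x) := by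
  have hV := integrable_one_add_abs_mul (measurable_ft _).aestronglyMeasurable (h.lintegral_ft_lt_top hH hγ hη)
  have hsC : MemLp (fun x => (source H γ η φ x : ℂ)) 2 volume := (h.memLp_source hH hγ hη).ofReal
  have heq := h.symb_mul_ft hH hγ hη
  have hSi : Integrable (ft fun x => (source H γ η φ x : ℂ)) := by
    refine Integrable.congr ?_ heq
    refine ((integrable_abs_mul (measurable_ft _).aestronglyMeasurable hV).const_mul (symb (kerConst H) : ℂ)).congr
      (Eventually.of_forall fun ξ => ?_)
    push_cast; ring
  obtain ⟨B, hB⟩ := hη.exists_isBump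
  filter_upwards [ae_eq_fourierInv_ft hsC hSi] with x hx
  obtain ⟨h1, h2⟩ := integral_second_difference hH.finiteMoment (measurable_ft _) hV x
  have hsrc : 𝓕⁻ (fun ξ => ((symb (kerConst H) * |ξ| : ℝ) : ℂ) * ft (fun x => ((φ x - η x : ℝ) : ℂ)) ξ) x =
      (source H γ η φ x : ℂ) := by
    rw [hx, fourierInv_apply, fourierInv_apply]
    refine integral_congr_ae ?_
    filter_upwards [heq] with ξ hξ
    rw [hξ]
  have e : ∀ z, 2 * 𝓕⁻ (ft fun x => ((φ x - η x : ℝ) : ℂ)) x - 𝓕⁻ (ft fun x => ((φ x - η x : ℝ) : ℂ)) (x + z) -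
      𝓕⁻ (ft fun x => ((φ x - η x : ℝ) : ℂ)) (x - z) =
      (((2 * φ x - φ (x + z) - φ (x - z)) - (2 * η x - η (x + z) - η (x - z)) : ℝ) : ℂ) := fun z => by
    rw [← hinv, ← hinv, ← hinv]; push_cast; ring
  simp_rw [e] at h1 h2
  rw [hsrc, integral_complex_ofReal] at h2
  have h1r : Integrable (fun z => (2 * φ x - φ (x + z) - φ (x - z)) - (2 * η x - η (x + z) - η (x - z)))
      (lineMeas (kerConst H)) := by
    have := h1.re
    exact this
  have hηi := hB.integrable_second hH.finiteMoment x
  have hφi : Integrable (fun z => 2 * φ x - φ (x + z) - φ (x - z)) (lineMeas (kerConst H)) :=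
    (h1r.add hηi).congr (Eventually.of_forall fun z => by simp only [Pi.add_apply]; ring)
  refine ⟨hφi, ?_⟩
  rw [integral_sub hφi hηi] at h2
  have h3 : (∫ z, (2 * φ x - φ (x + z) - φ (x - z)) ∂lineMeas (kerConst H)) -
      ∫ z, (2 * η x - η (x + z) - η (x - z)) ∂lineMeas (kerConst H) = 2 * source H γ η φ x := by
    exact_mod_cast h2
  simp only [source, Lop] at h3
  linarith

end

/-! ### Energy comparison and the solution on the cylinder -/

section

open scoped ComplexConjugate SchwartzMap

variable {n : ℕ} {H : ℝ × (Fin n → ℝ) → ℝ} {γ η φ : ℝ → ℝ}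

lemma energy_eq (hH : IsKernel H) {u : Cyl n → ℝ} (hp : ∫⁻ w, ENNReal.ofReal (γ (u w)) < ⊤) :
    energy H γ η u = ((1 / 4 * energy' H γ η u : ℝ) : EReal) := by
  rw [energy, energy', integral_density_eq hH, mul_add, EReal.coe_add]
  congr 1
  rw [← mul_assoc, one_div_mul_cancel (by norm_num), one_mul]
  conv_lhs => rw [← ENNReal.ofReal_toReal hp.ne]
  rw [EReal.coe_ennreal_ofReal, max_eq_left ENNReal.toReal_nonneg]

lemma IsMinimizer.energy_le (h : IsMinimizer H γ η φ) (hH : IsKernel H) (hγ : IsDoubleWell γ) {u : Cyl n → ℝ}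
    (hu : GAdm H η u) : energy H γ η (fun w : Cyl n => φ w.1) ≤ energy H γ η u := by
  rcases lt_or_eq_of_le (le_top : ∫⁻ w, ENNReal.ofReal (γ (u w)) ≤ ⊤) with hp | hp
  · rw [energy_eq hH hp, energy_eq hH (h.pot_lift hγ)]
    exact EReal.coe_le_coe_iff.2 (mul_le_mul_of_nonneg_left (h.le u hu hp) (by norm_num))
  -- A competitor of infinite potential energy has energy +∞, its interaction term being a real
  -- number.
  · have : energy H γ η u = ⊤ := by
      rw [energy, hp, EReal.coe_ennreal_top, EReal.coe_add_top]
    rw [this]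
    exact le_top

lemma IsMinimizer.isL2Solution (h : IsMinimizer H γ η φ) (hH : IsKernel H) (hγ : IsDoubleWell γ)
    (hη : IsProfile η) (hinv : ∀ x, ((φ x - η x : ℝ) : ℂ) = 𝓕⁻ (ft fun x => ((φ x - η x : ℝ) : ℂ)) x) :
    IsL2Solution H γ (fun w : Cyl n => φ w.1) := by
  refine ⟨memLp_lift (h.memLp_deriv hγ hη), ?_⟩
  have hae := (measurePreserving_fst_cyl (n := n)).quasiMeasurePreserving.ae
    (h.ae_integral_second_difference hH hγ hη hinv)
  filter_upwards [hae] with w hw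
  rw [← hw.2]
  exact hasPVAt_lift hH h.layer.measurable (fun x => h.layer.abs_le x) w hw.1

lemma tendstoUniformly_lift {ι : Type*} {l : Filter ℝ} {a : ℝ} (h : Tendsto φ l (𝓝 a)) :
    TendstoUniformly (fun (x : ℝ) (_ : ι) => φ x) (fun _ => a) l := by
  rw [Metric.tendstoUniformly_iff]
  intro ε hε
  filter_upwards [Metric.tendsto_nhds.1 h ε hε] with x hx y
  rwa [dist_comm]

end

end PeierlsNabarro

end

theorem mainTheorem1 (n : ℕ) (H : ℝ × (Fin n → ℝ) → ℝ) (hH : PeierlsNabarro.IsKernel H)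
    (γ : ℝ → ℝ) (hγ : PeierlsNabarro.IsDoubleWell γ)
    (η : ℝ → ℝ) (hη : PeierlsNabarro.IsProfile η) :
    (∀ u ∈ PeierlsNabarro.admissible (n := n) η, Integrable (PeierlsNabarro.density H η u)) ∧
    ∃ u ∈ PeierlsNabarro.admissible (n := n) η,
      -- existence
      (∀ v ∈ PeierlsNabarro.admissible (n := n) η,
        PeierlsNabarro.energy H γ η u ≤ PeierlsNabarro.energy H γ η v) ∧
      PeierlsNabarro.IsWeakSolution H γ u ∧
      -- regularity
      PeierlsNabarro.MemHs 2 (fun w => u w - η w.1) ∧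
      PeierlsNabarro.IsL2Solution H γ u ∧
      TendstoUniformly (fun (x : ℝ) (y : UnitAddTorus (Fin n)) => u (x, y)) (fun _ => 1) atTop ∧
      TendstoUniformly (fun (x : ℝ) (y : UnitAddTorus (Fin n)) => u (x, y)) (fun _ => -1) atBot ∧
      -- strict monotonicity
      (∀ (x : ℝ) (y : UnitAddTorus (Fin n)), 0 < deriv (fun t => u (t, y)) x) ∧
      -- one-dimensional symmetry
      (∃ φ : ℝ → ℝ, ∀ (x : ℝ) (y : UnitAddTorus (Fin n)), u (x, y) = φ x) := by
  open PeierlsNabarro in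
  obtain ⟨φ₀, hl, ha, hp, hle⟩ := exists_minimizer hH hγ hη
  obtain ⟨φ, h, hinv⟩ := (IsMinimizer.mk hl ha hp hle).exists_representative hH hγ hη
  have hft := h.lintegral_ft_lt_top hH hγ hη
  refine ⟨fun u hu => (integrable_density_iff hH u).2 ((GAdm.of_admissible hH hu).integrable_density' hH hη),
    -- The H² bound at s = 1/2 places the minimizer, found in the larger Gagliardo class, back in 𝒜.
    fun w => φ w.1, memHs_lift (by norm_num) (by norm_num) (h.memLp hη) hft,
    fun v hv => h.energy_le hH hγ (GAdm.of_admissible hH hv),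
    isWeakSolution_of_minimizer hH hγ hη h.adm (fun w => h.layer.abs_le _) (h.pot_lift hγ)
      (memLp_lift (h.memLp_deriv hγ hη)) h.le,
    memHs_lift (by norm_num) le_rfl (h.memLp hη) hft, h.isL2Solution hH hγ hη hinv, tendstoUniformly_lift (tendsto_layer_atTop hη hinv),
    tendstoUniformly_lift (tendsto_layer_atBot hη hinv),
    fun x _ => h.deriv_pos hH hγ hη hinv x, φ, fun _ _ => rfl⟩
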